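/- Let $V$ be a closed oriented smooth 3-manifold; contact structures are smooth, cooriented and positive. Let $\mathcal B$ be a branched surface, possibly with boundary, with branch locus $L$ and set $Q$ of double points of $L$, and let $N(\mathcal B)\subset V$ be a branched surface neighborhood: a closed subset with a quotient map $\pi:N(\mathcal B)\to\mathcal B$ whose fibers are arcs, such that in suitable smooth charts of $V$ near each fiber the pair $(N(\mathcal B),\pi)$ has the standard form (product over a disk; a point of $L$ where two sheets merge into one; a transverse double point of $L$; or, at the boundary, a half disk or a point where $L$ meets $\partial\mathcal B$ transversally). Let $\zeta$ be a contact structure on $V\setminus N(\mathcal B)$. A contact structure $\xi$ on $V$ is *generated by* $(\mathcal B,\zeta)$ if the fibers of $\pi$ are Legendrian for $\xi$ and $\xi=\zeta$ on $V\setminus N(\mathcal B)$. Fix a contact structure $\xi_0$ generated by $(\mathcal B,\zeta)$. For $\xi$ generated by $(\mathcal B,\zeta)$ let $$w_\xi(p)=t(\pi^{-1}(p),\xi_0)-t(\pi^{-1}(p),\xi),\qquad p\in\mathcal B\setminus L,$$ where $t(\delta,\cdot)$ is the twisting number of the Legendrian arc $\delta$, i.e. the signed number of full turns, with respect to a fixed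 framing of $\delta$ and the orientation of $V$ (the difference does not depend on the framing). A *weight function* on $\mathcal B$ is a locally constant function $w:\mathcal B\setminus L\to\mathbb Z$ such that $w(B_1)+w(B_2)=w(B_3)$ whenever, along a component of $L\setminus Q$, the two sheets of the components $B_1,B_2$ of $\mathcal B\setminus L$ merge into a sheet of the component $B_3$. Let $w:\mathcal B\setminus L\to\mathbb Z$ be a nonnegative weight function. Then: 1. (Existence) If $w=0$ on $\partial\mathcal B\setminus L$ (no condition if $\partial\mathcal B=\emptyset$), there is a contact structure $\xi$ generated by $(\mathcal B,\zeta)$ with $w_\xi=w$. 2. (Uniqueness) If $\xi,\xi'$ are contact structures generated by $(\mathcal B,\zeta)$ with $w_\xi=w_{\xi'}=w$, then $\xi$ and $\xi'$ are isotopic rel $V\setminus N(\mathcal B)$: there is a smooth isotopy $(\varphi_s)_{s\in[0,1]}$ of $V$ with $\varphi_0=\mathrm{id}$, with $\varphi_s=\mathrm{id}$ on $V\setminus N(\mathcal B)$ for all $s$, and with $(\varphi_1)_*\xi=\xi'$ as cooriented plane fields. -/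

import Mathlib

open Set Topology
open scoped Manifold ContDiff

noncomputable section

/-- The model space `ℝ³`; its coordinates are written `x 0`, `x 1` (horizontal) and `x 2`
(vertical). -/
abbrev R3 : Type := EuclideanSpace ℝ (Fin 3)

section Contact

variable {V : Type*} [TopologicalSpace V] [ChartedSpace R3 V]

/-- An orientation of a smooth 3-manifold, given by an oriented atlas: smooth charts covering `V`
whose transition maps have positive Jacobian determinant. -/
structure OrientedAtlas (V : Type*) [TopologicalSpace V] [ChartedSpace R3 V] where
  charts : Set (OpenPartialHomeomorph V R3)
  smooth : charts ⊆ IsManifold.maximalAtlas (𝓡 3) ∞ V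
  cover : ∀ p : V, ∃ e ∈ charts, p ∈ e.source
  compatible : ∀ e ∈ charts, ∀ e' ∈ charts, ∀ x ∈ e.target, e.symm x ∈ e'.source →
    0 < (fderiv ℝ (fun y => e' (e.symm y)) x).det

/-- A chart is positive if its transition maps to the charts of the oriented atlas have positive
Jacobian determinant. -/
def OrientedAtlas.IsPositive (o : OrientedAtlas V) (e : OpenPartialHomeomorph V R3) : Prop :=
  ∀ e' ∈ o.charts, ∀ x ∈ e.target, e.symm x ∈ e'.source →
    0 < (fderiv ℝ (fun y => e' (e.symm y)) x).det

/-- Covectors at the point `p`. -/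
abbrev Covector (p : V) : Type := TangentSpace (𝓡 3) p →L[ℝ] ℝ

/-- A cooriented plane field: at each point a ray of nonzero covectors. The plane is the common
kernel of the covectors of the ray, the coorientation is the side where they are positive. -/
abbrev PlaneField (V : Type*) [TopologicalSpace V] [ChartedSpace R3 V] : Type _ :=
  ∀ p : V, Module.Ray ℝ (Covector p)

/-- The covector `β` is nonzero and spans the ray `r`. -/
def Spans {p : V} (β : Covector p) (r : Module.Ray ℝ (Covector p)) : Prop :=
  ∃ h : β ≠ 0, r = rayOfNeZero ℝ β h

/-- The plane (without coorientation) defined by a ray of covectors. -/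
def planeOf {p : V} (r : Module.Ray ℝ (Covector p)) : Submodule ℝ (TangentSpace (𝓡 3) p) :=
  LinearMap.ker (ContinuousLinearMap.toLinearMap (r.someVector : Covector p))

/-- The differential of the chart `e` at `p`. -/
def chartDeriv (e : OpenPartialHomeomorph V R3) (p : V) : TangentSpace (𝓡 3) p →L[ℝ] R3 :=
  mfderiv (𝓡 3) (𝓡 3) e p

/-- The pull back to `p` of a covector of `ℝ³` by the chart `e`. -/
def pullCovector (e : OpenPartialHomeomorph V R3) (p : V) (β : R3 →L[ℝ] ℝ) : Covector p :=
  β.comp (chartDeriv e p)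

/-- The exterior derivative `dα (u, v)` at `x` of a 1-form `α` on `ℝ³`. -/
def dOneForm (α : R3 → R3 →L[ℝ] ℝ) (x u v : R3) : ℝ :=
  fderiv ℝ α x u v - fderiv ℝ α x v u

/-- The `i`-th standard basis vector of `ℝ³`. -/
def stdVec (i : Fin 3) : R3 := EuclideanSpace.single i 1

/-- The coefficient of `α ∧ dα` with respect to the standard volume form of `ℝ³`. -/
def contactCoeff (α : R3 → R3 →L[ℝ] ℝ) (x : R3) : ℝ :=
  α x (stdVec 0) * dOneForm α x (stdVec 1) (stdVec 2)
    + α x (stdVec 1) * dOneForm α x (stdVec 2) (stdVec 0)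
    + α x (stdVec 2) * dOneForm α x (stdVec 0) (stdVec 1)

/-- On the open set `U`, the cooriented plane field `ξ` is a smooth positive contact structure:
near each point of `U`, in a chart of the oriented atlas, `ξ` is the cooriented kernel of a smooth
1-form `α` with `α ∧ dα > 0`. Values of `ξ` outside `U` are irrelevant. -/
def IsContactOn (o : OrientedAtlas V) (ξ : PlaneField V) (U : Set V) : Prop :=
  ∀ p ∈ U, ∃ e ∈ o.charts, p ∈ e.source ∧ ∃ W : Set R3, IsOpen W ∧ e p ∈ W ∧ W ⊆ e.target ∧
    ∃ α : R3 → R3 →L[ℝ] ℝ, ContDiffOn ℝ ∞ α W ∧ ∀ x ∈ W, 0 < contactCoeff α x ∧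
      Spans (pullCovector e (e.symm x) (α x)) (ξ (e.symm x))

/-- `ξ` and `ξ'` are isotopic relative to `A`: there is a smooth isotopy of `V`, starting at the
identity and fixing `A` pointwise at all times, whose final diffeomorphism maps `ξ` to `ξ'` (as
cooriented plane fields). -/
def IsotopicRel (A : Set V) (ξ ξ' : PlaneField V) : Prop :=
  ∃ Φ : ℝ → V → V,
    ContMDiffOn (𝓘(ℝ, ℝ).prod (𝓡 3)) (𝓡 3) ∞ (fun z : ℝ × V => Φ z.1 z.2)
      (Icc (0 : ℝ) 1 ×ˢ univ) ∧
    (∀ s ∈ Icc (0 : ℝ) 1, ∃ ψ : V ≃ₘ^∞⟮𝓡 3, 𝓡 3⟯ V, ∀ p, ψ p = Φ s p) ∧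
    (∀ p, Φ 0 p = p) ∧
    (∀ s ∈ Icc (0 : ℝ) 1, ∀ p ∈ A, Φ s p = p) ∧
    ∀ (p : V) (β : Covector (Φ 1 p)), Spans β (ξ' (Φ 1 p)) →
      Spans (p := p) (β.comp (mfderiv (𝓡 3) (𝓡 3) (Φ 1) p)) (ξ p)

end Contact

section BranchedSurface

/-- The local models of a branched surface: a disk, an arc of the branch locus, a transverse double
point of the branch locus, a boundary arc, and a point where the branch locus meets the boundary. -/
inductive LocalModel
  | disk
  | branch
  | double
  | bdryDisk
  | bdryBranch

/-- The box in `ℝ³` in which the local models live. -/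
def modelBox : Set R3 := {x | |x 0| < 1 ∧ |x 1| < 1 ∧ -1 < x 2 ∧ x 2 < 6}

/-- The slab `0 ≤ x 2 ≤ 5`. -/
def slab : Set R3 := {x | 0 ≤ x 2 ∧ x 2 ≤ 5}

/-- The first slit: it separates two sheets over `x 0 < 0`, which merge along `x 0 = 0`. -/
def slitA : Set R3 := {x | x 0 < 0 ∧ 1 < x 2 ∧ x 2 < 2}

/-- The second slit: it separates two sheets over `x 1 < 0`, which merge along `x 1 = 0`. -/
def slitB : Set R3 := {x | x 1 < 0 ∧ 3 < x 2 ∧ x 2 < 4}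

/-- The fibered neighborhoods of the local models; the fibers are the maximal vertical segments.
The branching direction along `x 0 = 0` (resp. `x 1 = 0`) is the direction in which `x 0`
(resp. `x 1`) increases. -/
def LocalModel.region : LocalModel → Set R3
  | .disk => slab
  | .branch => slab \ slitA
  | .double => (slab \ slitA) \ slitB
  | .bdryDisk => slab ∩ {x | 0 ≤ x 1}
  | .bdryBranch => (slab \ slitA) ∩ {x | 0 ≤ x 1}

/-- Two points of a region lie on the same vertical segment contained in the region. -/
def SameVertical (R : Set R3) (x y : R3) : Prop :=
  x 0 = y 0 ∧ x 1 = y 1 ∧ segment ℝ x y ⊆ R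

/-- The point of height `t` over the origin. -/
def centerPt (t : ℝ) : R3 := !₂[0, 0, t]

variable {V : Type*} [TopologicalSpace V] [ChartedSpace R3 V]
  {B : Type*} [TopologicalSpace B]

/-- `e` is a smooth chart of `V` around the fiber over `b` of the projection `π : N → B`. It
identifies `N` with the local model `k`, the fibers of `π` with the vertical segments of the model,
and the fiber over `b` with the central one `{(0, 0)} × [0, 5]`. -/
structure IsModelChart (N : Set V) (π : N → B) (k : LocalModel)
    (e : OpenPartialHomeomorph V R3) (b : B) : Prop where
  smooth : e ∈ IsManifold.maximalAtlas (𝓡 3) ∞ V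
  target_eq : e.target = modelBox
  mem_iff : ∀ p ∈ e.source, p ∈ N ↔ e p ∈ k.region
  fiber_iff : ∀ p q : N, (p : V) ∈ e.source →
    (π p = π q ↔ (q : V) ∈ e.source ∧ SameVertical k.region (e p) (e q))
  center : ∀ p : N, (p : V) ∈ e.source → e p = centerPt 0 → π p = b

/-- A branched surface neighborhood `N = N(B)` in `V` with its projection onto the branched surface
`B` (possibly with boundary): every fiber has a neighborhood of one of the standard forms, and `B`
is the quotient of `N` by the fibers. -/
structure BranchedNbhd (V : Type*) [TopologicalSpace V] [ChartedSpace R3 V]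
    (B : Type*) [TopologicalSpace B] where
  carrier : Set V
  isClosed : IsClosed carrier
  proj : carrier → B
  isQuotientMap : IsQuotientMap proj
  exists_chart : ∀ b : B, ∃ k e, IsModelChart carrier proj k e b

namespace BranchedNbhd

variable (N : BranchedNbhd V B)

/-- `e` is a chart of `V` that puts the neighborhood of the fiber over `b` in the form `k`. -/
def IsChart (k : LocalModel) (e : OpenPartialHomeomorph V R3) (b : B) : Prop :=
  IsModelChart N.carrier N.proj k e b

/-- The branch locus `L`: the points near which `B` is neither a disk nor a half disk. -/
def branchLocus : Set B := {b | ¬ ∃ e, N.IsChart .disk e b ∨ N.IsChart .bdryDisk e b}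

/-- The boundary of the branched surface. -/
def boundary : Set B := {b | ∃ e, N.IsChart .bdryDisk e b ∨ N.IsChart .bdryBranch e b}

/-- The points of `B \ L`; the connected components of this space are the sectors. -/
abbrev Regular : Type _ := {b : B // b ∉ N.branchLocus}

/-- A weight function: a locally constant integer valued function on `B \ L` that satisfies the
branch equations. At a point of `L` that is not a double point, `b₁` and `b₂` lie on the two sheets
that merge (the branching direction is outward) and `b₃` lies on the merged sheet (the branching
direction is inward). -/
structure IsWeight (w : N.Regular → ℤ) : Prop where
  locConst : IsLocallyConstant w
  branchEq : ∀ (c : B) (e : OpenPartialHomeomorph V R3), N.IsChart .branch e c →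
    ∀ (b₁ b₂ b₃ : N.Regular) (p₁ p₂ p₃ : N.carrier),
      N.proj p₁ = b₁ → N.proj p₂ = b₂ → N.proj p₃ = b₃ →
      (p₁ : V) ∈ e.source → (p₂ : V) ∈ e.source → (p₃ : V) ∈ e.source →
      e p₁ 0 < 0 → e p₁ 2 ≤ 1 → e p₂ 0 < 0 → 2 ≤ e p₂ 2 → 0 < e p₃ 0 →
      w b₁ + w b₂ = w b₃

/-- The fibers of `N → B` are Legendrian: their tangent lines lie in `ξ`. -/
def FibersLegendrian (ξ : PlaneField V) : Prop :=
  ∀ (b : B) (k : LocalModel) (e : OpenPartialHomeomorph V R3), N.IsChart k e b →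
    ∀ t ∈ Icc (0 : ℝ) 5, ∀ u : TangentSpace (𝓡 3) (e.symm (centerPt t)),
      chartDeriv e (e.symm (centerPt t)) u = stdVec 2 →
        u ∈ planeOf (ξ (e.symm (centerPt t)))

/-- The contact structure `ξ` on `V` is generated by `(B, ζ)`. -/
structure Generates (o : OrientedAtlas V) (ζ ξ : PlaneField V) : Prop where
  contact : IsContactOn o ξ univ
  legendrian : N.FibersLegendrian ξ
  agree : ∀ p, p ∉ N.carrier → ξ p = ζ p

end BranchedNbhd

/-- In the chart `e`, along the vertical segment `{(0, 0)} × [0, 5]`, the cooriented plane field `ξ`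
is defined by `cos θ dx₀ + sin θ dx₁` with `θ` continuous, and it makes `τ` full turns. If `e` is
positive, `τ` is the twisting number of `ξ` along this Legendrian arc, with respect to the framing
given by `e`. -/
def HasTwisting (e : OpenPartialHomeomorph V R3) (ξ : PlaneField V) (τ : ℝ) : Prop :=
  ∃ θ : ℝ → ℝ, ContinuousOn θ (Icc 0 5) ∧
    (∀ t ∈ Icc (0 : ℝ) 5,
      Spans (pullCovector e (e.symm (centerPt t))
        (Real.cos (θ t) • (EuclideanSpace.proj 0 : R3 →L[ℝ] ℝ)
          + Real.sin (θ t) • (EuclideanSpace.proj 1 : R3 →L[ℝ] ℝ)))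
        (ξ (e.symm (centerPt t)))) ∧
    τ = (θ 5 - θ 0) / (2 * Real.pi)

/-- `w` is the weight function of `ξ` relative to `ξ₀`: at each point of `B \ L` it is the difference
of the twisting numbers of `ξ₀` and of `ξ` along the fiber, computed in any positive chart. -/
def BranchedNbhd.HasWeight (N : BranchedNbhd V B) (o : OrientedAtlas V) (ξ₀ ξ : PlaneField V)
    (w : N.Regular → ℤ) : Prop :=
  ∀ (b : N.Regular) (e : OpenPartialHomeomorph V R3),
    (N.IsChart .disk e b ∨ N.IsChart .bdryDisk e b) → o.IsPositive e →
    ∃ τ₀ τ : ℝ, HasTwisting e ξ₀ τ₀ ∧ HasTwisting e ξ τ ∧ (w b : ℝ) = τ₀ - τ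

end BranchedSurface

end

/-! In a model chart a cooriented plane field is the orthogonal of a unit vector field `v`, its
`rep`. Over the neighborhood the fibers are Legendrian exactly when `v` is horizontal there. Then
`v` may be seen as a unit complex number, and `α ∧ dα` reduces to the speed at which this number
turns along the fiber (`IsSaturated.helicity_eq_rate`). So over `N` a positive contact structure
with Legendrian fibers is a field that turns along every fiber, always in the same direction, with
`rate` positive; the twisting number of a fiber is the integral of `-rate / (2π)`
(`IsLocalField.angle_sub`). Positivity of the speed is a convex condition, and this makes everything
flexible.

Take two such structures that agree off `N` and have the same twisting on every fiber. The angle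
from the first to the second, measured from the bottom of the fiber, vanishes at both ends of each
fiber. Hence, extended by zero, it is a smooth function `angleDiff`, even where fibers split at the
branch locus (`IsFieldPair.angleDiff_eventuallyEq`). Rotate the first field by `ρ * angleDiff`, with
`ρ` a cutoff constant on vertical lines: the speed becomes a convex combination of the two speeds,
so the result is contact, equals the second structure where `ρ = 1` and the first where `ρ = 0`
(`IsFieldPair.isLocalField_rotField`). It is moreover isotopic to the first one: slide the points
along the fibers until the angles match (`IsFieldPair.exists_isotopy`). `exists_interpolation`
transfers this to `V`.

Uniqueness: finitely many charts have central columns that cover `N`. Replace `ξ` by `ξ'` over these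
columns one after another; an agreement already obtained is never destroyed, and each replacement is
an isotopy.

Existence: in one chart, rotate `ξ₀` by `-2π g`, where `g` is a nondecreasing function of the
height, integer valued off `N`, whose increase along each fiber is the prescribed weight
(`exists_local_solution`). Nonnegativity of `w` is what allows `g` to be monotone, so that the speed
only increases; the branch equations are what allows one `g` to serve all the sheets of a chart
(`exists_heights`). In charts that meet the boundary the weight is zero and `g = 0`. The local
solutions are glued by the same interpolation over a growing union of columns. That the weights seen
in one chart are those seen in any other is `hasTwisting_rot`. -/

noncomputable section

/-! ### Changes of charts, and cooriented planes as rays of covectors. -/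

section Transition

variable {V : Type*} [TopologicalSpace V] [ChartedSpace R3 V]
  {e e' e'' : OpenPartialHomeomorph V R3}

/-- The differential at `x` of the transition map from the chart `e` to the chart `e'`. -/
def jac {V : Type*} [TopologicalSpace V] (e e' : OpenPartialHomeomorph V R3) (x : R3) : R3 →L[ℝ] R3 :=
  fderiv ℝ (fun y => e' (e.symm y)) x

theorem contDiffAt_transition (he : e ∈ IsManifold.maximalAtlas (𝓡 3) ∞ V)
    (he' : e' ∈ IsManifold.maximalAtlas (𝓡 3) ∞ V) {x : R3} (hx : x ∈ e.target)
    (hx' : e.symm x ∈ e'.source) : ContDiffAt ℝ ∞ (fun y => e' (e.symm y)) x := by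
  rw [← contMDiffAt_iff_contDiffAt]
  exact (contMDiffAt_of_mem_maximalAtlas he' hx').comp x
    (contMDiffAt_symm_of_mem_maximalAtlas he hx)

theorem chartDeriv_eq_jac_comp (he : e ∈ IsManifold.maximalAtlas (𝓡 3) ∞ V)
    (he' : e' ∈ IsManifold.maximalAtlas (𝓡 3) ∞ V) {p : V} (hp : p ∈ e.source)
    (hp' : p ∈ e'.source) : chartDeriv e' p = (jac e e' (e p)).comp (chartDeriv e p) := by
  have h1 : MDifferentiableAt (𝓡 3) (𝓡 3) e p :=
    (contMDiffAt_of_mem_maximalAtlas he hp).mdifferentiableAt (by simp)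
  have h2 : ContDiffAt ℝ ∞ (fun y => e' (e.symm y)) (e p) :=
    contDiffAt_transition he he' (e.map_source hp) (by rwa [e.left_inv hp])
  have h3 : MDifferentiableAt (𝓡 3) (𝓡 3) (fun y => e' (e.symm y)) (e p) :=
    (contMDiffAt_iff_contDiffAt.2 h2).mdifferentiableAt (by simp)
  have h4 := mfderiv_comp p h3 h1
  have h5 : (fun y => e' (e.symm y)) ∘ e =ᶠ[𝓝 p] e' := by
    filter_upwards [e.open_source.mem_nhds hp] with q hq
    simp [e.left_inv hq]
  rw [h5.mfderiv_eq] at h4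
  unfold chartDeriv jac
  rw [h4, mfderiv_eq_fderiv]
  rfl

theorem jac_comp (he : e ∈ IsManifold.maximalAtlas (𝓡 3) ∞ V)
    (he' : e' ∈ IsManifold.maximalAtlas (𝓡 3) ∞ V)
    (he'' : e'' ∈ IsManifold.maximalAtlas (𝓡 3) ∞ V) {x : R3} (hx : x ∈ e.target)
    (hx' : e.symm x ∈ e'.source) (hx'' : e.symm x ∈ e''.source) :
    jac e e'' x = (jac e' e'' (e' (e.symm x))).comp (jac e e' x) := by
  have h1 := (contDiffAt_transition he he' hx hx').differentiableAt (by simp)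
  have h2 := (contDiffAt_transition he' he'' (e'.map_source hx')
    (by rwa [e'.left_inv hx'])).differentiableAt (by simp)
  have h3 := fderiv_comp x h2 h1
  have h5 : (fun y => e'' (e'.symm y)) ∘ (fun y => e' (e.symm y)) =ᶠ[𝓝 x]
      fun y => e'' (e.symm y) := by
    have : ∀ᶠ y in 𝓝 x, e.symm y ∈ e'.source :=
      (e.continuousAt_symm hx).eventually (e'.open_source.mem_nhds hx')
    filter_upwards [this] with y hy
    simp [e'.left_inv hy]
  rw [h5.fderiv_eq] at h3
  exact h3

theorem jac_self {V : Type*} [TopologicalSpace V] {e : OpenPartialHomeomorph V R3} {x : R3} (hx : x ∈ e.target) : jac e e x = ContinuousLinearMap.id ℝ R3 := by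
  have : (fun y => e (e.symm y)) =ᶠ[𝓝 x] id := by
    filter_upwards [e.open_target.mem_nhds hx] with y hy
    simp [e.right_inv hy]
  rw [jac, this.fderiv_eq, fderiv_id]

theorem jac_comp_jac (he : e ∈ IsManifold.maximalAtlas (𝓡 3) ∞ V)
    (he' : e' ∈ IsManifold.maximalAtlas (𝓡 3) ∞ V) {x : R3} (hx : x ∈ e.target)
    (hx' : e.symm x ∈ e'.source) :
    (jac e' e (e' (e.symm x))).comp (jac e e' x) = ContinuousLinearMap.id ℝ R3 := by
  rw [← jac_comp he he' he hx hx' (e.map_target hx), jac_self hx]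

theorem jac_det_ne_zero (he : e ∈ IsManifold.maximalAtlas (𝓡 3) ∞ V)
    (he' : e' ∈ IsManifold.maximalAtlas (𝓡 3) ∞ V) {x : R3} (hx : x ∈ e.target)
    (hx' : e.symm x ∈ e'.source) : (jac e e' x).det ≠ 0 := by
  intro h
  have h1 := congrArg ContinuousLinearMap.det (jac_comp_jac he he' hx hx')
  have h2 : ((jac e' e (e' (e.symm x))).comp (jac e e' x)).det =
      (jac e' e (e' (e.symm x))).det * (jac e e' x).det := by
    simp [ContinuousLinearMap.det, LinearMap.det_comp]
  rw [h2, h, mul_zero] at h1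
  simp [ContinuousLinearMap.det] at h1

theorem chartDeriv_bijective (he : e ∈ IsManifold.maximalAtlas (𝓡 3) ∞ V) {p : V}
    (hp : p ∈ e.source) : Function.Bijective (chartDeriv e p) := by
  have h : e.MDifferentiable (𝓡 3) (𝓡 3) :=
    ⟨(contMDiffOn_of_mem_maximalAtlas he).mdifferentiableOn (by simp),
      (contMDiffOn_symm_of_mem_maximalAtlas he).mdifferentiableOn (by simp)⟩
  exact h.mfderiv_bijective hp

theorem pullCovector_change (he : e ∈ IsManifold.maximalAtlas (𝓡 3) ∞ V)
    (he' : e' ∈ IsManifold.maximalAtlas (𝓡 3) ∞ V) {p : V} (hp : p ∈ e.source)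
    (hp' : p ∈ e'.source) (β : R3 →L[ℝ] ℝ) :
    pullCovector e' p β = pullCovector e p (β.comp (jac e e' (e p))) := by
  unfold pullCovector
  rw [chartDeriv_eq_jac_comp he he' hp hp']
  rfl

theorem pullCovector_injective (he : e ∈ IsManifold.maximalAtlas (𝓡 3) ∞ V) {p : V}
    (hp : p ∈ e.source) : Function.Injective (pullCovector e p) := by
  intro β β' h
  ext u
  obtain ⟨v, rfl⟩ := (chartDeriv_bijective he hp).2 u
  exact DFunLike.congr_fun h v

theorem pullCovector_surjective (he : e ∈ IsManifold.maximalAtlas (𝓡 3) ∞ V) {p : V}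
    (hp : p ∈ e.source) : Function.Surjective (pullCovector e p) := by
  intro γ
  let L : TangentSpace (𝓡 3) p ≃ₗ[ℝ] R3 :=
    LinearEquiv.ofBijective (chartDeriv e p).toLinearMap (chartDeriv_bijective he hp)
  refine ⟨LinearMap.toContinuousLinearMap ((γ : TangentSpace (𝓡 3) p →ₗ[ℝ] ℝ) ∘ₗ
    (L.symm : R3 →ₗ[ℝ] TangentSpace (𝓡 3) p)), ?_⟩
  ext u
  have : L.symm (chartDeriv e p u) = u := L.symm_apply_apply u
  simp [pullCovector, this]

@[simp] theorem pullCovector_smul (e : OpenPartialHomeomorph V R3) (p : V) (c : ℝ)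
    (β : R3 →L[ℝ] ℝ) : pullCovector e p (c • β) = c • pullCovector e p β := rfl

theorem Spans.exists_pos {p : V} {β β' : Covector p} {r : Module.Ray ℝ (Covector p)}
    (h : Spans β r) (h' : Spans β' r) : ∃ c : ℝ, 0 < c ∧ β' = c • β := by
  obtain ⟨h0, h1⟩ := h
  obtain ⟨h0', h1'⟩ := h'
  have h2 : SameRay ℝ β β' := (ray_eq_iff h0 h0').1 (h1.symm.trans h1')
  obtain ⟨c, hc, h3⟩ := h2.exists_pos_left h0 h0'
  exact ⟨c, hc, h3.symm⟩

theorem Spans.smul {p : V} {β : Covector p} {r : Module.Ray ℝ (Covector p)}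
    (h : Spans β r) {c : ℝ} (hc : 0 < c) : Spans (c • β) r := by
  obtain ⟨h0, h1⟩ := h
  exact ⟨smul_ne_zero hc.ne' h0, h1.trans ((ray_eq_iff h0 _).2
    (SameRay.sameRay_pos_smul_right β hc))⟩

theorem Spans.unique {p : V} {β : Covector p} {r r' : Module.Ray ℝ (Covector p)}
    (h : Spans β r) (h' : Spans β r') : r = r' := h.2.trans h'.2.symm

theorem spans_someVector {p : V} (r : Module.Ray ℝ (Covector p)) : Spans r.someVector r :=
  ⟨r.someVector_ne_zero, r.someVector_ray.symm⟩

theorem Spans.mem_planeOf_iff {p : V} {β : Covector p} {r : Module.Ray ℝ (Covector p)}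
    (h : Spans β r) (u : TangentSpace (𝓡 3) p) : u ∈ planeOf r ↔ β u = 0 := by
  obtain ⟨c, hc, h1⟩ := (spans_someVector r).exists_pos h
  rw [h1]
  change r.someVector u = 0 ↔ c * r.someVector u = 0
  simp [hc.ne']

end Transition

/-! ### The contact condition in coordinates. -/

section ContactCoeff

/-- Naturality of `α ∧ dα` under pullback. In `d(g^*α)` the terms with second derivatives of `g`
cancel by symmetry, so `d(g^*α) = g^*(dα)`; the pullback of a 3-form is then multiplied by the
Jacobian determinant. -/
theorem contactCoeff_comp {α : R3 → R3 →L[ℝ] ℝ} {g : R3 → R3} {x : R3}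
    (hα : DifferentiableAt ℝ α (g x)) (hg : ContDiffAt ℝ ∞ g x) :
    contactCoeff (fun y => (α (g y)).comp (fderiv ℝ g y)) x =
      (fderiv ℝ g x).det * contactCoeff α (g x) := by
  have hg1 : DifferentiableAt ℝ g x := hg.differentiableAt (by simp)
  have hg2 : DifferentiableAt ℝ (fderiv ℝ g) x :=
    (hg.fderiv_right (m := 1) (by norm_cast)).differentiableAt (by simp)
  have hsymm : ∀ u v, fderiv ℝ (fderiv ℝ g) x u v = fderiv ℝ (fderiv ℝ g) x v u := by
    have := hg.isSymmSndFDerivAt (by simp only [minSmoothness_of_isRCLikeNormedField]; exact WithTop.coe_le_coe.2 (le_top : (2 : ℕ∞) ≤ ⊤))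
    exact fun u v => this u v
  have hd : HasFDerivAt (fun y => α (g y)) ((fderiv ℝ α (g x)).comp (fderiv ℝ g x)) x :=
    hα.hasFDerivAt.comp x hg1.hasFDerivAt
  have hD := hd.clm_comp hg2.hasFDerivAt
  have hone : ∀ u v, dOneForm (fun y => (α (g y)).comp (fderiv ℝ g y)) x u v =
      dOneForm α (g x) (fderiv ℝ g x u) (fderiv ℝ g x v) := by
    intro u v
    simp only [dOneForm]
    rw [hD.fderiv]
    simp only [add_apply, ContinuousLinearMap.comp_apply,
      ContinuousLinearMap.compL_apply, ContinuousLinearMap.flip_apply]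
    rw [hsymm u v]
    ring
  set L := fderiv ℝ g x with hL
  have hexp : ∀ i, L (stdVec i) = L (stdVec i) 0 • stdVec 0 + L (stdVec i) 1 • stdVec 1
      + L (stdVec i) 2 • stdVec 2 := by
    intro i
    ext j
    fin_cases j <;> simp [stdVec]
  have hdet : L.det = Matrix.det (Matrix.of fun i j : Fin 3 => L (stdVec j) i) := by
    rw [ContinuousLinearMap.det,
      ← LinearMap.det_toMatrix (EuclideanSpace.basisFun (Fin 3) ℝ).toBasis]
    congr 1
  have key : ∀ i j, dOneForm α (g x) (L (stdVec i)) (L (stdVec j)) =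
      (L (stdVec i) 0 * L (stdVec j) 1 - L (stdVec i) 1 * L (stdVec j) 0) *
        dOneForm α (g x) (stdVec 0) (stdVec 1) +
      (L (stdVec i) 1 * L (stdVec j) 2 - L (stdVec i) 2 * L (stdVec j) 1) *
        dOneForm α (g x) (stdVec 1) (stdVec 2) +
      (L (stdVec i) 2 * L (stdVec j) 0 - L (stdVec i) 0 * L (stdVec j) 2) *
        dOneForm α (g x) (stdVec 2) (stdVec 0) := by
    intro i j
    conv_lhs => rw [hexp i, hexp j]
    simp only [dOneForm, map_add, map_smul, add_apply, smul_eq_mul,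
      smul_apply]
    ring
  have key2 : ∀ i, α (g x) (L (stdVec i)) = L (stdVec i) 0 * α (g x) (stdVec 0) +
      L (stdVec i) 1 * α (g x) (stdVec 1) + L (stdVec i) 2 * α (g x) (stdVec 2) := by
    intro i
    conv_lhs => rw [hexp i]
    simp only [map_add, map_smul, smul_eq_mul]
  unfold contactCoeff
  rw [hone, hone, hone, key, key, key]
  simp only [ContinuousLinearMap.comp_apply, ← hL]
  rw [key2, key2, key2, hdet, Matrix.det_fin_three]
  simp only [Matrix.of_apply]
  ring

/-- The 1-form on `ℝ³` dual to a vector field. -/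
def dualForm (v : R3 → R3) (x : R3) : R3 →L[ℝ] ℝ := innerSL ℝ (v x)

/-- The coefficient of `α ∧ dα` for the 1-form `α` dual to a vector field. -/
def helicity (v : R3 → R3) (x : R3) : ℝ := contactCoeff (dualForm v) x

theorem dOneForm_dualForm {v : R3 → R3} {x : R3} (hv : DifferentiableAt ℝ v x) (a b : R3) :
    dOneForm (dualForm v) x a b =
      inner ℝ (fderiv ℝ v x a) b - inner ℝ (fderiv ℝ v x b) a := by
  have h : HasFDerivAt (dualForm v) ((innerSL ℝ : R3 →L[ℝ] R3 →L[ℝ] ℝ).comp (fderiv ℝ v x)) x :=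
    (innerSL ℝ : R3 →L[ℝ] R3 →L[ℝ] ℝ).hasFDerivAt.comp x hv.hasFDerivAt
  simp [dOneForm, h.fderiv]

theorem inner_stdVec (a : R3) (i : Fin 3) : inner ℝ a (stdVec i) = a i := by
  simp [stdVec, EuclideanSpace.inner_single_right]

/-- The right side is the scalar product of `v` with its curl. -/
theorem helicity_eq {v : R3 → R3} {x : R3} (hv : DifferentiableAt ℝ v x) :
    helicity v x =
      v x 0 * (fderiv ℝ v x (stdVec 1) 2 - fderiv ℝ v x (stdVec 2) 1) +
      v x 1 * (fderiv ℝ v x (stdVec 2) 0 - fderiv ℝ v x (stdVec 0) 2) +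
      v x 2 * (fderiv ℝ v x (stdVec 0) 1 - fderiv ℝ v x (stdVec 1) 0) := by
  unfold helicity contactCoeff
  rw [dOneForm_dualForm hv, dOneForm_dualForm hv, dOneForm_dualForm hv]
  simp only [inner_stdVec, dualForm, innerSL_apply_apply]

/-- The term `df ∧ α` of `d(fα)` is killed by the wedge product with `α`. The factor is a square, so
normalizing a defining vector does not change the sign. -/
theorem helicity_smul {v : R3 → R3} {f : R3 → ℝ} {x : R3} (hv : DifferentiableAt ℝ v x)
    (hf : DifferentiableAt ℝ f x) : helicity (fun y => f y • v y) x = f x ^ 2 * helicity v x := by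
  rw [helicity_eq hv, helicity_eq (v := fun y => f y • v y) (hf.smul hv)]
  have h : fderiv ℝ (fun y => f y • v y) x = f x • fderiv ℝ v x +
      (fderiv ℝ f x).smulRight (v x) := (hf.hasFDerivAt.smul hv.hasFDerivAt).fderiv
  rw [h]
  simp
  ring

theorem helicity_congr {v v' : R3 → R3} {x : R3} (h : v =ᶠ[𝓝 x] v') :
    helicity v x = helicity v' x := by
  have h1 : dualForm v =ᶠ[𝓝 x] dualForm v' := by
    filter_upwards [h] with y hy
    simp [dualForm, hy]
  unfold helicity contactCoeff dOneForm
  rw [h1.fderiv_eq, h1.eq_of_nhds]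

theorem exists_dualForm_eq (α : R3 → R3 →L[ℝ] ℝ) : ∃ v : R3 → R3, α = dualForm v ∧
    ∀ x, ContDiffAt ℝ ∞ α x → ContDiffAt ℝ ∞ v x := by
  refine ⟨fun x => (InnerProductSpace.toDual ℝ R3).symm (α x), ?_, ?_⟩
  · funext x
    ext u
    simp [dualForm]
  · intro x hx
    exact ((InnerProductSpace.toDual ℝ R3).symm.contDiff.contDiffAt).comp x hx

theorem contDiffAt_dualForm {v : R3 → R3} {x : R3} (hv : ContDiffAt ℝ ∞ v x) :
    ContDiffAt ℝ ∞ (dualForm v) x :=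
  ((innerSL ℝ : R3 →L[ℝ] R3 →L[ℝ] ℝ).contDiff.contDiffAt).comp x hv

end ContactCoeff

end

noncomputable section

/-! ### The unit vector that represents a plane field in a chart, and the sign of a chart. -/

section Rep

variable {V : Type*} [TopologicalSpace V] [ChartedSpace R3 V]
  {e e' : OpenPartialHomeomorph V R3} {ξ ξ' : PlaneField V}

/-- In the chart `e`, the vector `v` is dual to a covector that defines `ξ` at the point of
coordinates `x`. -/
def SpansAt (e : OpenPartialHomeomorph V R3) (ξ : PlaneField V) (x v : R3) : Prop :=
  Spans (pullCovector e (e.symm x) (innerSL ℝ v)) (ξ (e.symm x))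

/-- The unit vector dual to a covector that defines `ξ`, in the chart `e`. -/
def rep (e : OpenPartialHomeomorph V R3) (ξ : PlaneField V) (x : R3) : R3 :=
  Classical.epsilon fun v => ‖v‖ = 1 ∧ SpansAt e ξ x v

theorem SpansAt.exists_pos (he : e ∈ IsManifold.maximalAtlas (𝓡 3) ∞ V) {x v v' : R3}
    (hx : x ∈ e.target) (h : SpansAt e ξ x v) (h' : SpansAt e ξ x v') :
    ∃ c : ℝ, 0 < c ∧ v' = c • v := by
  obtain ⟨c, hc, h1⟩ := Spans.exists_pos h h'
  refine ⟨c, hc, ?_⟩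
  rw [← pullCovector_smul] at h1
  have h2 := pullCovector_injective he (e.map_target hx) h1
  rw [← map_smul] at h2
  apply (InnerProductSpace.toDual ℝ R3).injective
  exact h2

theorem SpansAt.smul {x v : R3} (h : SpansAt e ξ x v) {c : ℝ} (hc : 0 < c) :
    SpansAt e ξ x (c • v) := by
  have := Spans.smul h hc
  unfold SpansAt
  rwa [map_smul, pullCovector_smul]

theorem SpansAt.ne_zero {x v : R3} (h : SpansAt e ξ x v) : v ≠ 0 := by
  rintro rfl
  apply h.1
  rw [map_zero]
  rfl

theorem exists_spansAt (he : e ∈ IsManifold.maximalAtlas (𝓡 3) ∞ V) {x : R3}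
    (hx : x ∈ e.target) : ∃ v, SpansAt e ξ x v := by
  obtain ⟨β, hβ⟩ := pullCovector_surjective he (e.map_target hx) (ξ (e.symm x)).someVector
  refine ⟨(InnerProductSpace.toDual ℝ R3).symm β, ?_⟩
  have : innerSL ℝ ((InnerProductSpace.toDual ℝ R3).symm β) = β := by
    ext u; simp
  unfold SpansAt
  rw [this, hβ]
  exact spans_someVector _

theorem rep_spec (he : e ∈ IsManifold.maximalAtlas (𝓡 3) ∞ V) {x : R3} (hx : x ∈ e.target) :
    ‖rep e ξ x‖ = 1 ∧ SpansAt e ξ x (rep e ξ x) := by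
  apply Classical.epsilon_spec (p := fun v => ‖v‖ = 1 ∧ SpansAt e ξ x v)
  obtain ⟨v, hv⟩ := exists_spansAt (ξ := ξ) he hx
  have := hv.ne_zero
  exact ⟨‖v‖⁻¹ • v, by simp [norm_smul, this], hv.smul (by positivity)⟩

theorem norm_rep (he : e ∈ IsManifold.maximalAtlas (𝓡 3) ∞ V) {x : R3} (hx : x ∈ e.target) :
    ‖rep e ξ x‖ = 1 := (rep_spec he hx).1

theorem spansAt_rep (he : e ∈ IsManifold.maximalAtlas (𝓡 3) ∞ V) {x : R3} (hx : x ∈ e.target) :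
    SpansAt e ξ x (rep e ξ x) := (rep_spec he hx).2

theorem SpansAt.rep_eq (he : e ∈ IsManifold.maximalAtlas (𝓡 3) ∞ V) {x v : R3}
    (hx : x ∈ e.target) (h : SpansAt e ξ x v) : rep e ξ x = ‖v‖⁻¹ • v := by
  obtain ⟨c, hc, h1⟩ := h.exists_pos he hx (spansAt_rep he hx)
  have h2 := norm_rep (ξ := ξ) he hx
  rw [h1, norm_smul, Real.norm_of_nonneg hc.le] at h2
  rw [h1, eq_inv_of_mul_eq_one_left h2]

theorem SpansAt.rep_eq_of_norm (he : e ∈ IsManifold.maximalAtlas (𝓡 3) ∞ V) {x v : R3}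
    (hx : x ∈ e.target) (h : SpansAt e ξ x v) (hv : ‖v‖ = 1) : rep e ξ x = v := by
  rw [h.rep_eq he hx, hv, inv_one, one_smul]

theorem rep_eq_iff (he : e ∈ IsManifold.maximalAtlas (𝓡 3) ∞ V) {x : R3} (hx : x ∈ e.target) :
    rep e ξ x = rep e ξ' x ↔ ξ (e.symm x) = ξ' (e.symm x) := by
  constructor
  · intro h
    have h1 := spansAt_rep (ξ := ξ) he hx
    rw [h] at h1
    exact h1.unique (spansAt_rep he hx)
  · intro h
    have h1 := spansAt_rep (ξ := ξ) he hx
    unfold SpansAt at h1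
    rw [h] at h1
    exact (SpansAt.rep_eq_of_norm (ξ := ξ') he hx h1 (norm_rep he hx)).symm

theorem SpansAt.mem_planeOf_iff {x v : R3} (h : SpansAt e ξ x v)
    (u : TangentSpace (𝓡 3) (e.symm x)) :
    u ∈ planeOf (ξ (e.symm x)) ↔ inner ℝ v (chartDeriv e (e.symm x) u) = 0 :=
  Spans.mem_planeOf_iff h u

open scoped Classical in
/-- The cooriented plane at `p` defined by a nonzero vector `v` in a chart (the default value `r` is
used if `v` is zero). -/
def rayAt (e : OpenPartialHomeomorph V R3) (p : V) (r : Module.Ray ℝ (Covector p)) (v : R3) :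
    Module.Ray ℝ (Covector p) :=
  if h : pullCovector e p (innerSL ℝ v) ≠ 0 then rayOfNeZero ℝ _ h else r

theorem spans_rayAt (he : e ∈ IsManifold.maximalAtlas (𝓡 3) ∞ V) {p : V} (hp : p ∈ e.source)
    (r : Module.Ray ℝ (Covector p)) {v : R3} (hv : v ≠ 0) :
    Spans (pullCovector e p (innerSL ℝ v)) (rayAt e p r v) := by
  have h : pullCovector e p (innerSL ℝ v) ≠ 0 := by
    intro h0
    have h1 : innerSL ℝ v = 0 := pullCovector_injective he hp (h0.trans (by rfl))
    apply hv
    apply (InnerProductSpace.toDual ℝ R3).injective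
    rw [map_zero]
    exact h1
  refine ⟨h, ?_⟩
  unfold rayAt
  rw [dif_pos h]

/-- Near the point `p`, the plane field `ξ` is a positive contact structure. -/
def ContactAt (o : OrientedAtlas V) (ξ : PlaneField V) (p : V) : Prop :=
  ∃ e ∈ o.charts, p ∈ e.source ∧ ∃ W : Set R3, IsOpen W ∧ e p ∈ W ∧ W ⊆ e.target ∧
    ∃ α : R3 → R3 →L[ℝ] ℝ, ContDiffOn ℝ ∞ α W ∧ ∀ x ∈ W, 0 < contactCoeff α x ∧
      Spans (pullCovector e (e.symm x) (α x)) (ξ (e.symm x))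

theorem isContactOn_iff {o : OrientedAtlas V} {U : Set V} :
    IsContactOn o ξ U ↔ ∀ p ∈ U, ContactAt o ξ p := Iff.rfl

theorem ContactAt.congr {o : OrientedAtlas V} {p : V} (h : ContactAt o ξ p)
    (h' : ∀ᶠ q in 𝓝 p, ξ q = ξ' q) : ContactAt o ξ' p := by
  obtain ⟨e, he, hp, W, hW, hpW, hWe, α, hα, h1⟩ := h
  obtain ⟨U, hU, hUo, hpU⟩ := eventually_nhds_iff.1 h'
  refine ⟨e, he, hp, W ∩ (e.target ∩ e.symm ⁻¹' U), ?_, ⟨hpW, e.map_source hp, ?_⟩, ?_, α,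
    hα.mono inter_subset_left, ?_⟩
  · exact hW.inter (e.isOpen_inter_preimage_symm hUo)
  · simpa [e.left_inv hp] using hpU
  · exact fun x hx => hx.2.1
  · intro x hx
    rw [← hU _ hx.2.2]
    exact h1 x hx.1

/-- The chart `e` is positive if `ε = 1`, negative if `ε = -1`. -/
def ChartSign (o : OrientedAtlas V) (e : OpenPartialHomeomorph V R3) (ε : ℝ) : Prop :=
  ∀ e' ∈ o.charts, ∀ x ∈ e.target, e.symm x ∈ e'.source → 0 < ε * (jac e e' x).det

theorem chartSign_one_iff {o : OrientedAtlas V} : ChartSign o e 1 ↔ o.IsPositive e := by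
  simp [ChartSign, OrientedAtlas.IsPositive, jac]

theorem chartSign_of_mem {o : OrientedAtlas V} (he : e ∈ o.charts) : ChartSign o e 1 := by
  intro e' he' x hx hx'
  rw [one_mul]
  exact o.compatible e he e' he' x hx hx'

theorem det_comp_R3 (f g : R3 →L[ℝ] R3) : (f.comp g).det = f.det * g.det := by
  simp [ContinuousLinearMap.det, LinearMap.det_comp]

theorem ChartSign.jac_pos {o : OrientedAtlas V} {ε ε' : ℝ}
    (he : e ∈ IsManifold.maximalAtlas (𝓡 3) ∞ V) (he' : e' ∈ IsManifold.maximalAtlas (𝓡 3) ∞ V)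
    (h : ChartSign o e ε) (h' : ChartSign o e' ε') {x : R3} (hx : x ∈ e.target)
    (hx' : e.symm x ∈ e'.source) : 0 < ε * ε' * (jac e e' x).det := by
  obtain ⟨f, hf, hxf⟩ := o.cover (e.symm x)
  have h1 := h f hf x hx hxf
  have h2 := h' f hf (e' (e.symm x)) (e'.map_source hx') (by rwa [e'.left_inv hx'])
  rw [jac_comp he he' (o.smooth hf) hx hx' hxf, det_comp_R3] at h1
  set a := (jac e' f (e' (e.symm x))).det
  set b := (jac e e' x).det
  have h4 : 0 < (ε * (a * b)) * (ε' * a) := mul_pos h1 h2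
  have h5 : (ε * (a * b)) * (ε' * a) = (ε * ε' * b) * a ^ 2 := by ring
  rw [h5] at h4
  exact pos_of_mul_pos_left h4 (sq_nonneg a)

/-- The sign of the Jacobian towards the oriented atlas is defined at every point of the target and
is locally constant. Two disjoint open sets of opposite signs cannot both meet a preconnected
target. -/
theorem exists_chartSign (o : OrientedAtlas V) (he : e ∈ IsManifold.maximalAtlas (𝓡 3) ∞ V)
    (hc : IsPreconnected e.target) : ∃ ε : ℝ, (ε = 1 ∨ ε = -1) ∧ ChartSign o e ε := by
  let P : ℝ → Set R3 := fun ε => {x | x ∈ e.target ∧ ∃ f ∈ o.charts, e.symm x ∈ f.source ∧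
    0 < ε * (jac e f x).det}
  have hP : ∀ ε, IsOpen (P ε) := by
    intro ε
    rw [isOpen_iff_mem_nhds]
    rintro x ⟨hx, f, hf, hxf, h⟩
    have h1 : ContDiffAt ℝ ∞ (fun y => f (e.symm y)) x :=
      contDiffAt_transition he (o.smooth hf) hx hxf
    have h2 : ContinuousAt (jac e f) x := (h1.fderiv_right (m := 0) (by simp)).continuousAt
    have h3 : ContinuousAt (fun y => ε * (jac e f y).det) x :=
      continuousAt_const.mul (ContinuousLinearMap.continuous_det.continuousAt.comp h2)
    have h4 : ∀ᶠ y in 𝓝 x, e.symm y ∈ f.source :=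
      (e.continuousAt_symm hx).eventually (f.open_source.mem_nhds hxf)
    filter_upwards [e.open_target.mem_nhds hx, h4, h3.eventually (lt_mem_nhds h)] with y a b c
    exact ⟨a, f, hf, b, c⟩
  have hcompat : ∀ x ∈ e.target, ∀ f ∈ o.charts, ∀ g ∈ o.charts, e.symm x ∈ f.source →
      e.symm x ∈ g.source → 0 < (jac e f x).det * (jac e g x).det := by
    intro x hx f hf g hg hxf hxg
    have h1 := o.compatible f hf g hg (f (e.symm x)) (f.map_source hxf)
      (by rwa [f.left_inv hxf])
    have h2 := jac_det_ne_zero he (o.smooth hf) hx hxf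
    rw [jac_comp he (o.smooth hf) (o.smooth hg) hx hxf hxg, det_comp_R3]
    have h3 : 0 < (jac f g (f (e.symm x))).det := h1
    have : 0 < (jac e f x).det ^ 2 := by positivity
    nlinarith [mul_pos h3 this]
  have hcov : e.target ⊆ P 1 ∪ P (-1) := by
    intro x hx
    obtain ⟨f, hf, hxf⟩ := o.cover (e.symm x)
    rcases (jac_det_ne_zero he (o.smooth hf) hx hxf).lt_or_gt with h | h
    · exact Or.inr ⟨hx, f, hf, hxf, by linarith⟩
    · exact Or.inl ⟨hx, f, hf, hxf, by linarith⟩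
  have hfin : ∀ ε : ℝ, ε = 1 ∨ ε = -1 → e.target ⊆ P ε → ChartSign o e ε := by
    intro ε hε h f hf x hx hxf
    obtain ⟨-, g, hg, hxg, h1⟩ := h hx
    have h2 := hcompat x hx f hf g hg hxf hxg
    rcases hε with rfl | rfl
    · nlinarith
    · nlinarith
  by_cases h1 : (e.target ∩ P 1).Nonempty
  · by_cases h2 : (e.target ∩ P (-1)).Nonempty
    · obtain ⟨x, hx, ⟨-, f, hf, hxf, h3⟩, ⟨-, g, hg, hxg, h4⟩⟩ :=
        hc _ _ (hP 1) (hP (-1)) hcov h1 h2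
      have := hcompat x hx f hf g hg hxf hxg
      nlinarith
    · refine ⟨1, Or.inl rfl, hfin 1 (Or.inl rfl) fun x hx => (hcov hx).resolve_right fun h => ?_⟩
      exact h2 ⟨x, hx, h⟩
  · refine ⟨-1, Or.inr rfl, hfin (-1) (Or.inr rfl) fun x hx =>
      (hcov hx).resolve_left fun h => h1 ⟨x, hx, h⟩⟩

/-- A 1-form that defines `ξ` in a chart is pulled back to a 1-form that defines `ξ` in another
chart. -/
theorem contact_change {ε : ℝ} {α : R3 → R3 →L[ℝ] ℝ}
    (he : e ∈ IsManifold.maximalAtlas (𝓡 3) ∞ V) (he' : e' ∈ IsManifold.maximalAtlas (𝓡 3) ∞ V)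
    {x : R3} (hx : x ∈ e'.target) (hx' : e'.symm x ∈ e.source)
    (hα : ContDiffAt ℝ ∞ α (e (e'.symm x))) (hc : 0 < ε * contactCoeff α (e (e'.symm x)))
    (hs : Spans (pullCovector e (e'.symm x) (α (e (e'.symm x)))) (ξ (e'.symm x))) :
    ContDiffAt ℝ ∞ (fun y => (α (e (e'.symm y))).comp (jac e' e y)) x ∧
    0 < ε * (jac e' e x).det * contactCoeff (fun y => (α (e (e'.symm y))).comp (jac e' e y)) x ∧
    Spans (pullCovector e' (e'.symm x) ((α (e (e'.symm x))).comp (jac e' e x)))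
      (ξ (e'.symm x)) := by
  have h1 := contDiffAt_transition he' he hx hx'
  refine ⟨?_, ?_, ?_⟩
  · exact (hα.comp x h1).clm_comp (h1.fderiv_right (m := ∞) (by simp))
  · have h2 := contactCoeff_comp (g := fun y => e (e'.symm y)) (hα.differentiableAt (by simp)) h1
    unfold jac
    rw [h2]
    have h3 : 0 < ((jac e' e x).det) ^ 2 := by
      have := jac_det_ne_zero he' he hx hx'
      positivity
    have := mul_pos hc h3
    unfold jac at this
    nlinarith
  · rw [pullCovector_change he' he (e'.map_target hx) hx', e'.right_inv hx] at hs
    exact hs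

theorem contDiffAt_normalize {v : R3 → R3} {x : R3} (hv : ContDiffAt ℝ ∞ v x) (h0 : v x ≠ 0) :
    ContDiffAt ℝ ∞ (fun y => ‖v y‖⁻¹) x :=
  (hv.norm ℝ h0).inv (by simpa using h0)

/-- The contact condition can be tested in any smooth chart of known sign and on the canonical unit
representative: normalization multiplies the coefficient by a positive square, and the change of
charts by a determinant whose sign is `ε`. -/
theorem contactAt_iff {o : OrientedAtlas V} {ε : ℝ} (hε : ε = 1 ∨ ε = -1)
    (he : e ∈ IsManifold.maximalAtlas (𝓡 3) ∞ V) (hs : ChartSign o e ε) {p : V}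
    (hp : p ∈ e.source) : ContactAt o ξ p ↔
      ∀ᶠ x in 𝓝 (e p), ContDiffAt ℝ ∞ (rep e ξ) x ∧ 0 < ε * helicity (rep e ξ) x := by
  have hε2 : ε * ε = 1 := by rcases hε with rfl | rfl <;> norm_num
  constructor
  · rintro ⟨f, hf, hpf, W, hW, hpW, hWf, α, hα, h1⟩
    have hf' := o.smooth hf
    set U : Set R3 := e.target ∩ e.symm ⁻¹' (f.source ∩ f ⁻¹' W) with hU
    have hUo : IsOpen U := e.isOpen_inter_preimage_symm (f.isOpen_inter_preimage hW)
    have hpU : e p ∈ U := ⟨e.map_source hp, by simp [e.left_inv hp, hpf, hpW]⟩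
    set β : R3 → R3 →L[ℝ] ℝ := fun y => (α (f (e.symm y))).comp (jac e f y) with hβ
    have hch : ∀ x ∈ U, ContDiffAt ℝ ∞ β x ∧ 0 < 1 * (jac e f x).det * contactCoeff β x ∧
        Spans (pullCovector e (e.symm x) (β x)) (ξ (e.symm x)) := by
      intro x hx
      obtain ⟨h2, h3⟩ := h1 _ hx.2.2
      refine contact_change hf' he hx.1 hx.2.1 (hα.contDiffAt (hW.mem_nhds hx.2.2))
        (by rwa [one_mul]) ?_
      rwa [f.left_inv hx.2.1] at h3
    obtain ⟨v, hv, hv1⟩ := exists_dualForm_eq β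
    rw [hv] at hch hv1
    have hrep : ∀ x ∈ U, rep e ξ x = ‖v x‖⁻¹ • v x := fun x hx =>
      SpansAt.rep_eq he hx.1 (hch x hx).2.2
    filter_upwards [hUo.mem_nhds hpU] with x hx
    have hev : rep e ξ =ᶠ[𝓝 x] fun y => ‖v y‖⁻¹ • v y := by
      filter_upwards [hUo.mem_nhds hx] with y hy using hrep y hy
    have h0 : v x ≠ 0 := SpansAt.ne_zero (hch x hx).2.2
    have hvx := hv1 x (hch x hx).1
    have hn := contDiffAt_normalize hvx h0
    refine ⟨(hn.smul hvx).congr_of_eventuallyEq hev, ?_⟩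
    rw [helicity_congr hev, helicity_smul (hvx.differentiableAt (by simp))
      (hn.differentiableAt (by simp))]
    have h4 : 0 < ‖v x‖⁻¹ ^ 2 := by positivity
    have h5 : 0 < (jac e f x).det * helicity v x := by simpa [helicity] using (hch x hx).2.1
    have h6 := hs f hf x hx.1 hx.2.1
    have h7 : 0 < ε * helicity v x := by
      rcases hε with rfl | rfl
      · nlinarith
      · nlinarith
    nlinarith [mul_pos h4 h7]
  · intro h
    obtain ⟨f, hf, hpf⟩ := o.cover p
    have hf' := o.smooth hf
    obtain ⟨U, hU, hUo, hpU⟩ := eventually_nhds_iff.1 h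
    set W : Set R3 := f.target ∩ f.symm ⁻¹' (e.source ∩ e ⁻¹' U) with hW
    have hch : ∀ x ∈ W, _ := fun x hx => contact_change (ξ := ξ) (ε := ε)
        (α := dualForm (rep e ξ)) he hf' hx.1 hx.2.1 (contDiffAt_dualForm (hU _ hx.2.2).1)
        (hU _ hx.2.2).2 (by
          have := spansAt_rep (ξ := ξ) he (e.map_source hx.2.1)
          unfold SpansAt at this
          rwa [e.left_inv hx.2.1] at this)
    refine ⟨f, hf, hpf, W, f.isOpen_inter_preimage_symm (e.isOpen_inter_preimage hUo),
      ⟨f.map_source hpf, by simp [f.left_inv hpf, hp, hpU]⟩, inter_subset_left, _,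
      fun x hx => (hch x hx).1.contDiffWithinAt, fun x hx => ⟨?_, (hch x hx).2.2⟩⟩
    have h1 := ChartSign.jac_pos hf' he (chartSign_of_mem hf) hs hx.1 hx.2.1
    have h2 := (hch x hx).2.1
    rw [one_mul] at h1
    exact pos_of_mul_pos_right h2 h1.le

end Rep

end

noncomputable section

/-! ### Vertical segments and membership in the model regions. -/

section Region

/-- The point of height `t` on the vertical line through `x`. -/
def atHeight (x : R3) (t : ℝ) : R3 := !₂[x 0, x 1, t]

@[simp] theorem atHeight_zero (x : R3) (t : ℝ) : atHeight x t 0 = x 0 := rfl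
@[simp] theorem atHeight_one (x : R3) (t : ℝ) : atHeight x t 1 = x 1 := rfl
@[simp] theorem atHeight_two (x : R3) (t : ℝ) : atHeight x t 2 = t := rfl
@[simp] theorem centerPt_zero (t : ℝ) : centerPt t 0 = 0 := rfl
@[simp] theorem centerPt_one (t : ℝ) : centerPt t 1 = 0 := rfl
@[simp] theorem centerPt_two (t : ℝ) : centerPt t 2 = t := rfl

theorem R3_ext {x y : R3} (h0 : x 0 = y 0) (h1 : x 1 = y 1) (h2 : x 2 = y 2) : x = y := by
  ext i; fin_cases i <;> assumption

@[simp] theorem atHeight_self (x : R3) : atHeight x (x 2) = x := R3_ext rfl rfl rfl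

@[simp] theorem atHeight_atHeight (x : R3) (s t : ℝ) :
    atHeight (atHeight x s) t = atHeight x t := rfl

theorem atHeight_eq_add (x : R3) (t : ℝ) : atHeight x t = x + (t - x 2) • stdVec 2 := by
  apply R3_ext <;> simp [stdVec]

theorem centerPt_eq_atHeight {x : R3} (h0 : x 0 = 0) (h1 : x 1 = 0) (t : ℝ) :
    centerPt t = atHeight x t := R3_ext h0.symm h1.symm rfl

theorem sameVertical_iff {R : Set R3} {x y : R3} : SameVertical R x y ↔
    x 0 = y 0 ∧ x 1 = y 1 ∧ ∀ t ∈ uIcc (x 2) (y 2), atHeight x t ∈ R := by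
  unfold SameVertical
  refine and_congr_right fun h0 => and_congr_right fun h1 => ?_
  constructor
  · intro h t ht
    apply h
    rw [← segment_eq_uIcc] at ht
    obtain ⟨a, b, ha, hb, hab, rfl⟩ := ht
    refine ⟨a, b, ha, hb, hab, ?_⟩
    apply R3_ext
    · simp [← h0, ← add_mul, hab]
    · simp [← h1, ← add_mul, hab]
    · simp
  · rintro h _ ⟨a, b, ha, hb, hab, rfl⟩
    have : a • x + b • y = atHeight x (a * x 2 + b * y 2) := by
      apply R3_ext
      · simp [← h0, ← add_mul, hab]
      · simp [← h1, ← add_mul, hab]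
      · simp
    rw [this]
    apply h
    rw [← segment_eq_uIcc]
    exact ⟨a, b, ha, hb, hab, rfl⟩

theorem mem_modelBox {x : R3} : x ∈ modelBox ↔ |x 0| < 1 ∧ |x 1| < 1 ∧ -1 < x 2 ∧ x 2 < 6 :=
  Iff.rfl

theorem isOpen_modelBox : IsOpen modelBox := by
  have h : ∀ i : Fin 3, Continuous fun x : R3 => x i := fun i => by fun_prop
  exact (isOpen_lt (h 0).abs continuous_const).inter ((isOpen_lt (h 1).abs continuous_const).inter
    ((isOpen_lt continuous_const (h 2)).inter (isOpen_lt (h 2) continuous_const)))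

theorem convex_modelBox : Convex ℝ modelBox := by
  rintro x ⟨hx0, hx1, hx2, hx3⟩ y ⟨hy0, hy1, hy2, hy3⟩ a b ha hb hab
  rw [abs_lt] at hx0 hx1 hy0 hy1
  have key : ∀ l u c d : ℝ, l < c → l < d → c < u → d < u → l < a * c + b * d ∧
      a * c + b * d < u := by
    intro l u c d h1 h2 h3 h4
    exact convex_Ioo l u ⟨h1, h3⟩ ⟨h2, h4⟩ ha hb hab
  refine ⟨abs_lt.2 ?_, abs_lt.2 ?_, ?_⟩
  · simpa using key (-1) 1 _ _ hx0.1 hy0.1 hx0.2 hy0.2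
  · simpa using key (-1) 1 _ _ hx1.1 hy1.1 hx1.2 hy1.2
  · simpa using key (-1) 6 _ _ hx2 hy2 hx3 hy3

theorem atHeight_mem_modelBox {x : R3} (hx : x ∈ modelBox) {t : ℝ} (h : -1 < t) (h' : t < 6) :
    atHeight x t ∈ modelBox := ⟨hx.1, hx.2.1, h, h'⟩

/-- A description common to the five models, so that most later arguments need no distinction of
cases. -/
theorem mem_region_iff (k : LocalModel) (x : R3) : x ∈ k.region ↔ 0 ≤ x 2 ∧ x 2 ≤ 5 ∧
    ((k = .branch ∨ k = .double ∨ k = .bdryBranch) → x 0 < 0 → x 2 ≤ 1 ∨ 2 ≤ x 2) ∧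
    (k = .double → x 1 < 0 → x 2 ≤ 3 ∨ 4 ≤ x 2) ∧
    ((k = .bdryDisk ∨ k = .bdryBranch) → 0 ≤ x 1) := by
  cases k <;> simp [LocalModel.region, slab, slitA, slitB] <;> grind

theorem region_subset_slab (k : LocalModel) : k.region ⊆ slab := fun x hx => by
  rw [mem_region_iff] at hx; exact ⟨hx.1, hx.2.1⟩

theorem isClosed_region (k : LocalModel) : IsClosed k.region := by
  have h : ∀ i : Fin 3, Continuous fun x : R3 => x i := fun i => by fun_prop
  have h0 : IsClosed slab := (isClosed_le continuous_const (h 2)).inter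
    (isClosed_le (h 2) continuous_const)
  have hA : IsOpen slitA := (isOpen_lt (h 0) continuous_const).inter
    ((isOpen_lt continuous_const (h 2)).inter (isOpen_lt (h 2) continuous_const))
  have hB : IsOpen slitB := (isOpen_lt (h 1) continuous_const).inter
    ((isOpen_lt continuous_const (h 2)).inter (isOpen_lt (h 2) continuous_const))
  have h1 : IsClosed {x : R3 | 0 ≤ x 1} := isClosed_le continuous_const (h 1)
  cases k
  · exact h0
  · exact h0.sdiff hA
  · exact (h0.sdiff hA).sdiff hB
  · exact h0.inter h1
  · exact (h0.sdiff hA).inter h1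

theorem center_mem_region (k : LocalModel) {x : R3} (h0 : x 0 = 0) (h1 : x 1 = 0)
    (h2 : 0 ≤ x 2) (h3 : x 2 ≤ 5) : x ∈ k.region := by
  rw [mem_region_iff]; simp [h0, h1, h2, h3]

/-- The vertical segments of the local models are not reduced to a point. -/
theorem exists_vertical_segment (k : LocalModel) {x : R3} (hx : x ∈ k.region) :
    ∃ σ : ℝ, (σ = 1 ∨ σ = -1) ∧ ∀ t ∈ Icc (0 : ℝ) (1 / 2), atHeight x (x 2 + σ * t) ∈ k.region := by
  rw [mem_region_iff] at hx
  obtain ⟨h1, h2, h3, h4, h5⟩ := hx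
  -- The floors and ceilings of the slits are at integer heights. Each unit interval of heights is
  -- cut at its midpoint, and the segment of length `1 / 2` is directed so as to remain in the
  -- closed unit interval that contains `x 2`.
  by_cases hA : x 2 ≤ 1 / 2
  · refine ⟨1, Or.inl rfl, fun t ht => ?_⟩
    have := ht.1; have := ht.2
    rw [mem_region_iff]; simp; grind
  by_cases hB : x 2 ≤ 1
  · refine ⟨-1, Or.inr rfl, fun t ht => ?_⟩
    have := ht.1; have := ht.2
    rw [mem_region_iff]; simp; grind
  by_cases hC : x 2 < 2
  · rcases le_total (x 2) (3 / 2) with h | h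
    · refine ⟨1, Or.inl rfl, fun t ht => ?_⟩
      have := ht.1; have := ht.2
      rw [mem_region_iff]; simp; grind
    · refine ⟨-1, Or.inr rfl, fun t ht => ?_⟩
      have := ht.1; have := ht.2
      rw [mem_region_iff]; simp; grind
  by_cases hD : x 2 ≤ 5 / 2
  · refine ⟨1, Or.inl rfl, fun t ht => ?_⟩
    have := ht.1; have := ht.2
    rw [mem_region_iff]; simp; grind
  by_cases hE : x 2 ≤ 3
  · refine ⟨-1, Or.inr rfl, fun t ht => ?_⟩
    have := ht.1; have := ht.2
    rw [mem_region_iff]; simp; grind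
  by_cases hF : x 2 ≤ 7 / 2
  · refine ⟨1, Or.inl rfl, fun t ht => ?_⟩
    have := ht.1; have := ht.2
    rw [mem_region_iff]; simp; grind
  by_cases hG : x 2 < 4
  · refine ⟨-1, Or.inr rfl, fun t ht => ?_⟩
    have := ht.1; have := ht.2
    rw [mem_region_iff]; simp; grind
  by_cases hH : x 2 ≤ 9 / 2
  · refine ⟨1, Or.inl rfl, fun t ht => ?_⟩
    have := ht.1; have := ht.2
    rw [mem_region_iff]; simp; grind
  · refine ⟨-1, Or.inr rfl, fun t ht => ?_⟩
    have := ht.1; have := ht.2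
    rw [mem_region_iff]; simp; grind

end Region

/-! ### Model charts, and invariance of the vertical direction. -/

section ModelChart

variable {V : Type*} [TopologicalSpace V] [ChartedSpace R3 V]
  {B : Type*} [TopologicalSpace B] {N : BranchedNbhd V B} {k k' : LocalModel}
  {e e' : OpenPartialHomeomorph V R3} {b b' : B} {ξ : PlaneField V}

namespace IsModelChart

variable {B : Type*} {b : B} {M : Set V} {π : M → B}

theorem symm_mem_iff (h : IsModelChart M π k e b) {x : R3} (hx : x ∈ modelBox) :
    e.symm x ∈ M ↔ x ∈ k.region := by
  rw [← h.target_eq] at hx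
  rw [h.mem_iff _ (e.map_target hx), e.right_inv hx]

theorem map_mem_modelBox (h : IsModelChart M π k e b) {p : V} (hp : p ∈ e.source) :
    e p ∈ modelBox := h.target_eq ▸ e.map_source hp

theorem symm_mem_source (h : IsModelChart M π k e b) {x : R3} (hx : x ∈ modelBox) :
    e.symm x ∈ e.source := e.map_target (h.target_eq ▸ hx)

theorem right_inv (h : IsModelChart M π k e b) {x : R3} (hx : x ∈ modelBox) :
    e (e.symm x) = x := e.right_inv (h.target_eq ▸ hx)

/-- The fiber over the center of the chart. -/
theorem proj_eq_iff (h : IsModelChart M π k e b) (p : M) :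
    π p = b ↔ (p : V) ∈ e.source ∧ e p 0 = 0 ∧ e p 1 = 0 := by
  have h0 : centerPt 0 ∈ modelBox := by simp [mem_modelBox]
  have hM : e.symm (centerPt 0) ∈ M :=
    (h.symm_mem_iff h0).2 (center_mem_region k rfl rfl le_rfl (by simp))
  let p₀ : M := ⟨e.symm (centerPt 0), hM⟩
  have hp₀ : (p₀ : V) ∈ e.source := h.symm_mem_source h0
  have he : e p₀ = centerPt 0 := h.right_inv h0
  rw [← h.center p₀ hp₀ he, eq_comm, h.fiber_iff p₀ p hp₀, he, sameVertical_iff]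
  refine and_congr_right fun hp => ⟨fun h1 => ⟨h1.1.symm, h1.2.1.symm⟩,
    fun h1 => ⟨h1.1.symm, h1.2.symm, fun t ht => ?_⟩⟩
  have h2 := region_subset_slab k ((h.mem_iff p hp).1 p.2)
  rw [centerPt_two, uIcc_of_le h2.1] at ht
  exact center_mem_region k rfl rfl ht.1 (ht.2.trans h2.2)

end IsModelChart

/-- Two charts have parallel vertical directions along the neighborhood. -/
theorem jac_vertical (h : N.IsChart k e b) (h' : N.IsChart k' e' b') {p : V} (hpN : p ∈ N.carrier)
    (hp : p ∈ e.source) (hp' : p ∈ e'.source) :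
    ∃ c : ℝ, c ≠ 0 ∧ jac e e' (e p) (stdVec 2) = c • stdVec 2 := by
  set x := e p with hx
  have hxb : x ∈ modelBox := h.map_mem_modelBox hp
  have hxR : x ∈ k.region := (h.mem_iff p hp).1 hpN
  have hsx : e.symm x = p := e.left_inv hp
  obtain ⟨σ, hσ, hseg⟩ := exists_vertical_segment k hxR
  have hT := contDiffAt_transition h.smooth h'.smooth (e.map_source hp) (by rwa [e.left_inv hp])
  have hd : HasFDerivAt (fun y => e' (e.symm y)) (jac e e' x) (x + (0 : ℝ) • stdVec 2) := by
    rw [zero_smul, add_zero]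
    exact (hT.differentiableAt (by simp)).hasFDerivAt
  have hline : HasDerivAt (fun t : ℝ => x + t • stdVec 2) (stdVec 2) (0 : ℝ) := by
    simpa using ((hasDerivAt_id (0 : ℝ)).smul_const (stdVec 2)).const_add x
  have hg : HasDerivAt (fun t : ℝ => e' (e.symm (x + t • stdVec 2))) (jac e e' x (stdVec 2)) 0 :=
    HasFDerivAt.comp_hasDerivAt (f := fun t : ℝ => x + t • stdVec 2) (0 : ℝ) hd hline
  -- The transition map sends fibers to fibers, hence a vertical segment issued from `x` to a
  -- vertical segment.
  have hfib : ∀ t ∈ Icc (0 : ℝ) (1 / 2), e' (e.symm (x + (σ * t) • stdVec 2)) 0 = e' p 0 ∧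
      e' (e.symm (x + (σ * t) • stdVec 2)) 1 = e' p 1 := by
    intro t ht
    have h1 : x + (σ * t) • stdVec 2 = atHeight x (x 2 + σ * t) := by
      rw [atHeight_eq_add, add_sub_cancel_left]
    have h2 := hseg t ht
    have h3 := region_subset_slab k h2
    have h4 : atHeight x (x 2 + σ * t) ∈ modelBox :=
      atHeight_mem_modelBox hxb (by linarith [h3.1, atHeight_two x (x 2 + σ * t)])
        (by linarith [h3.2, atHeight_two x (x 2 + σ * t)])
    rw [h1]
    set y := atHeight x (x 2 + σ * t) with hy
    have h5 : e.symm y ∈ N.carrier := (h.symm_mem_iff h4).2 h2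
    have h6 : N.proj ⟨p, hpN⟩ = N.proj ⟨e.symm y, h5⟩ := by
      rw [h.fiber_iff _ _ hp]
      refine ⟨h.symm_mem_source h4, ?_⟩
      change SameVertical _ (e p) (e (e.symm y))
      rw [h.right_inv h4, sameVertical_iff]
      refine ⟨rfl, rfl, fun s hs => ?_⟩
      rw [← hx] at hs
      rw [← hx]
      change s ∈ uIcc (x 2) (x 2 + σ * t) at hs
      have ht0 := ht.1
      rcases hσ with rfl | rfl
      · rw [uIcc_of_le (by linarith)] at hs
        have := hseg (s - x 2) ⟨by linarith [hs.1], by linarith [hs.2, ht.2]⟩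
        simpa using this
      · rw [uIcc_of_ge (by linarith)] at hs
        have := hseg (x 2 - s) ⟨by linarith [hs.2], by linarith [hs.1, ht.2]⟩
        simpa using this
    obtain ⟨-, h7⟩ := (h'.fiber_iff ⟨p, hpN⟩ ⟨e.symm y, h5⟩ hp').1 h6
    exact ⟨h7.1.symm, h7.2.1.symm⟩
  have hσ0 : σ ≠ 0 := by rcases hσ with rfl | rfl <;> norm_num
  have hg2 : HasDerivAt (fun t : ℝ => e' (e.symm (x + (σ * t) • stdVec 2)))
      (σ • jac e e' x (stdVec 2)) 0 := by
    have h1 : HasDerivAt (fun t : ℝ => σ * t) σ 0 := by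
      simpa using (hasDerivAt_id (0 : ℝ)).const_mul σ
    have h2 : HasDerivAt (fun t : ℝ => e' (e.symm (x + t • stdVec 2))) (jac e e' x (stdVec 2))
        (σ * 0) := by rwa [mul_zero]
    exact HasDerivAt.scomp (0 : ℝ) h2 h1
  -- The fiber may exist only on the side `σ` of `p`, but the one-sided derivative already
  -- determines the derivative.
  have hzero : ∀ i : Fin 3, (∀ t ∈ Icc (0 : ℝ) (1 / 2),
      e' (e.symm (x + (σ * t) • stdVec 2)) i = e' p i) → jac e e' x (stdVec 2) i = 0 := by
    intro i hi
    have h1 : HasDerivAt (fun t : ℝ => e' (e.symm (x + (σ * t) • stdVec 2)) i)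
        ((σ • jac e e' x (stdVec 2)) i) 0 :=
      ((EuclideanSpace.proj i : R3 →L[ℝ] ℝ).hasFDerivAt).comp_hasDerivAt (0 : ℝ) hg2
    have h2 : HasDerivWithinAt (fun t : ℝ => e' (e.symm (x + (σ * t) • stdVec 2)) i) 0
        (Icc 0 (1 / 2)) 0 :=
      (hasDerivWithinAt_const (0 : ℝ) (Icc (0 : ℝ) (1 / 2)) (e' p i)).congr hi
        (hi 0 (by norm_num))
    have h3 := (uniqueDiffOn_Icc (by norm_num : (0 : ℝ) < 1 / 2) 0 (by norm_num)).eq_deriv _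
      h1.hasDerivWithinAt h2
    have h4 : σ * jac e e' x (stdVec 2) i = 0 := by simpa using h3
    exact (mul_eq_zero.1 h4).resolve_left hσ0
  have h0 := hzero 0 fun t ht => (hfib t ht).1
  have h1 := hzero 1 fun t ht => (hfib t ht).2
  refine ⟨jac e e' x (stdVec 2) 2, fun h2 => ?_, ?_⟩
  · have h3 : jac e e' x (stdVec 2) = 0 := R3_ext h0 h1 h2
    have h4 := DFunLike.congr_fun (jac_comp_jac h.smooth h'.smooth (e.map_source hp)
      (by rwa [e.left_inv hp])) (stdVec 2)
    rw [ContinuousLinearMap.comp_apply, ← hx, h3, map_zero] at h4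
    have h6 := congrArg (fun z : R3 => z 2) h4
    simp [stdVec] at h6
  · apply R3_ext
    · rw [h0]; simp [stdVec]
    · rw [h1]; simp [stdVec]
    · simp [stdVec]

theorem SpansAt.change (he : e ∈ IsManifold.maximalAtlas (𝓡 3) ∞ V)
    (he' : e' ∈ IsManifold.maximalAtlas (𝓡 3) ∞ V) {p : V} (hp : p ∈ e.source)
    (hp' : p ∈ e'.source) {v v' : R3} (h : SpansAt e ξ (e p) v) (h' : SpansAt e' ξ (e' p) v') :
    ∃ c : ℝ, 0 < c ∧ ∀ u, inner ℝ v u = c * inner ℝ v' (jac e e' (e p) u) := by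
  unfold SpansAt at h h'
  rw [e.left_inv hp] at h
  rw [e'.left_inv hp', pullCovector_change he he' hp hp'] at h'
  obtain ⟨c, hc, h1⟩ := h'.exists_pos h
  rw [← pullCovector_smul] at h1
  have h2 := pullCovector_injective he hp h1
  exact ⟨c, hc, fun u => by simpa using DFunLike.congr_fun h2 u⟩

/-- Along `N` the transition maps preserve the vertical line, by `jac_vertical`, so tangency of `ξ`
to it can be tested in any model chart. -/
theorem rep_two_eq_zero_iff (h : N.IsChart k e b) (h' : N.IsChart k' e' b') {p : V}
    (hpN : p ∈ N.carrier) (hp : p ∈ e.source) (hp' : p ∈ e'.source) :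
    rep e ξ (e p) 2 = 0 ↔ rep e' ξ (e' p) 2 = 0 := by
  obtain ⟨c, hc, h1⟩ := SpansAt.change h.smooth h'.smooth hp hp'
    (spansAt_rep (ξ := ξ) h.smooth (e.map_source hp))
    (spansAt_rep (ξ := ξ) h'.smooth (e'.map_source hp'))
  obtain ⟨d, hd, h2⟩ := jac_vertical h h' hpN hp hp'
  have h3 := h1 (stdVec 2)
  rw [h2, inner_smul_right, inner_stdVec, inner_stdVec] at h3
  rw [h3]
  simp [hc.ne', hd]

/-- At points of the set `U`, the vertical direction of the charts is tangent to `ξ`. -/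
def BranchedNbhd.LegendrianOn (N : BranchedNbhd V B) (ξ : PlaneField V) (U : Set V) : Prop :=
  ∀ p ∈ N.carrier, p ∈ U → ∀ k e b, N.IsChart k e b → p ∈ e.source → rep e ξ (e p) 2 = 0

/-- The definition tests only central fibers, but every point of `N` is on the central fiber of some
model chart, and the choice of the chart does not matter by `rep_two_eq_zero_iff`. -/
theorem fibersLegendrian_iff : N.FibersLegendrian ξ ↔ N.LegendrianOn ξ univ := by
  have key : ∀ (b : B) (k : LocalModel) (e : OpenPartialHomeomorph V R3), N.IsChart k e b →
      ∀ t ∈ Icc (0 : ℝ) 5, ((∀ u : TangentSpace (𝓡 3) (e.symm (centerPt t)),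
      chartDeriv e (e.symm (centerPt t)) u = stdVec 2 →
        u ∈ planeOf (ξ (e.symm (centerPt t)))) ↔ rep e ξ (centerPt t) 2 = 0) := by
    intro b k e h t ht
    have hb : centerPt t ∈ modelBox := by
      simp only [mem_modelBox, centerPt_zero, centerPt_one, centerPt_two, abs_zero]
      exact ⟨one_pos, one_pos, by linarith [ht.1], by linarith [ht.2]⟩
    have ht' : centerPt t ∈ e.target := h.target_eq ▸ hb
    have hs := spansAt_rep (ξ := ξ) h.smooth ht'
    constructor
    · intro h1
      obtain ⟨u, hu⟩ := (chartDeriv_bijective h.smooth (e.map_target ht')).2 (stdVec 2)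
      have := (hs.mem_planeOf_iff u).1 (h1 u hu)
      rwa [hu, inner_stdVec] at this
    · intro h1 u hu
      rw [hs.mem_planeOf_iff, hu, inner_stdVec, h1]
  constructor
  · intro h p hpN _ k e b he hp
    obtain ⟨k', e', he'⟩ := N.exists_chart (N.proj ⟨p, hpN⟩)
    obtain ⟨hp', h0, h1⟩ := (he'.proj_eq_iff ⟨p, hpN⟩).1 rfl
    have hR := region_subset_slab k' ((he'.mem_iff p hp').1 hpN)
    rw [rep_two_eq_zero_iff he he' hpN hp hp']
    have h2 := (key _ k' e' he' (e' p 2) hR).1 (h _ k' e' he' _ hR)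
    have h3 : centerPt (e' p 2) = e' p := R3_ext h0.symm h1.symm rfl
    rwa [h3] at h2
  · intro h b k e he t ht
    refine (key b k e he t ht).2 ?_
    have hb : centerPt t ∈ modelBox := by
      simp only [mem_modelBox, centerPt_zero, centerPt_one, centerPt_two, abs_zero]
      exact ⟨one_pos, one_pos, by linarith [ht.1], by linarith [ht.2]⟩
    have h1 := h (e.symm (centerPt t))
      ((he.symm_mem_iff hb).2 (center_mem_region k rfl rfl ht.1 ht.2)) trivial k e b he
      (he.symm_mem_source hb)
    rwa [he.right_inv hb] at h1

end ModelChart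

end

noncomputable section

/-! ### Diffeomorphisms that preserve the product structure of the models. -/

section VertDiffeo

/-- A diffeomorphism of `ℝ³` that is the product of a diffeomorphism of the horizontal plane and of
an increasing diffeomorphism of the vertical line. -/
structure VertDiffeo where
  toFun : R3 → R3
  invFun : R3 → R3
  height : ℝ ≃o ℝ
  left_inv : Function.LeftInverse invFun toFun
  right_inv : Function.RightInverse invFun toFun
  smooth : ContDiff ℝ ∞ toFun
  smooth_inv : ContDiff ℝ ∞ invFun
  map_atHeight : ∀ x t, toFun (atHeight x t) = atHeight (toFun x) (height t)

namespace VertDiffeo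

variable (G : VertDiffeo)

/-- The underlying homeomorphism. -/
def homeo : R3 ≃ₜ R3 where
  toFun := G.toFun
  invFun := G.invFun
  left_inv := G.left_inv
  right_inv := G.right_inv
  continuous_toFun := G.smooth.continuous
  continuous_invFun := G.smooth_inv.continuous

theorem map_two (x : R3) : G.toFun x 2 = G.height (x 2) := by
  conv_lhs => rw [← atHeight_self x, G.map_atHeight]
  rfl

theorem inv_atHeight (y : R3) (s : ℝ) :
    G.invFun (atHeight y s) = atHeight (G.invFun y) (G.height.symm s) := by
  apply G.left_inv.injective
  rw [G.right_inv, G.map_atHeight, G.right_inv, OrderIso.apply_symm_apply]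

theorem image_uIcc (a b t : ℝ) :
    G.height t ∈ uIcc (G.height a) (G.height b) ↔ t ∈ uIcc a b := by
  simp only [mem_uIcc, G.height.le_iff_le]

/-- Rescaling of the coordinates (translated by `u`), with prescribed action on heights. -/
def diag (α β : ℝ) (hα : α ≠ 0) (hβ : β ≠ 0) (u : R3) (h : ℝ ≃o ℝ) (h1 : ContDiff ℝ ∞ h)
    (h2 : ContDiff ℝ ∞ h.symm) : VertDiffeo where
  toFun x := !₂[α * (x 0 - u 0), β * (x 1 - u 1), h (x 2)]
  invFun y := !₂[u 0 + y 0 / α, u 1 + y 1 / β, h.symm (y 2)]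
  height := h
  left_inv x := by apply R3_ext <;> simp [hα, hβ]
  right_inv y := by apply R3_ext <;> simp <;> field_simp
  smooth := by
    rw [contDiff_euclidean]
    intro i
    fin_cases i
    · simp; fun_prop
    · simp; fun_prop
    · exact h1.comp (by fun_prop : ContDiff ℝ ∞ fun x : R3 => x 2)
  smooth_inv := by
    rw [contDiff_euclidean]
    intro i
    fin_cases i
    · simp; fun_prop
    · simp; fun_prop
    · exact h2.comp (by fun_prop : ContDiff ℝ ∞ fun x : R3 => x 2)
  map_atHeight x t := by apply R3_ext <;> simp

/-- Rescaling of the coordinates (translated by `u`) followed by the exchange of the horizontal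
coordinates, with prescribed action on heights. -/
def swap (α β : ℝ) (hα : α ≠ 0) (hβ : β ≠ 0) (u : R3) (h : ℝ ≃o ℝ) (h1 : ContDiff ℝ ∞ h)
    (h2 : ContDiff ℝ ∞ h.symm) : VertDiffeo where
  toFun x := !₂[β * (x 1 - u 1), α * (x 0 - u 0), h (x 2)]
  invFun y := !₂[u 0 + y 1 / α, u 1 + y 0 / β, h.symm (y 2)]
  height := h
  left_inv x := by apply R3_ext <;> simp [hα, hβ]
  right_inv y := by apply R3_ext <;> simp <;> field_simp
  smooth := by
    rw [contDiff_euclidean]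
    intro i
    fin_cases i
    · simp; fun_prop
    · simp; fun_prop
    · exact h1.comp (by fun_prop : ContDiff ℝ ∞ fun x : R3 => x 2)
  smooth_inv := by
    rw [contDiff_euclidean]
    intro i
    fin_cases i
    · simp; fun_prop
    · simp; fun_prop
    · exact h2.comp (by fun_prop : ContDiff ℝ ∞ fun x : R3 => x 2)
  map_atHeight x t := by apply R3_ext <;> simp

end VertDiffeo

/-- The increasing affine map that sends `[c, d]` onto `[0, 5]`. -/
def affineHeight (c d : ℝ) (h : c < d) : ℝ ≃o ℝ where
  toFun z := 5 * (z - c) / (d - c)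
  invFun z := c + (d - c) * z / 5
  left_inv z := by have := sub_pos.2 h; field_simp; ring
  right_inv z := by have := sub_pos.2 h; field_simp; ring
  map_rel_iff' := by
    intro a b
    have := sub_pos.2 h
    simp only [Equiv.coe_fn_mk]
    rw [div_le_div_iff_of_pos_right this]
    constructor <;> intro h <;> linarith

theorem contDiff_affineHeight (c d : ℝ) (h : c < d) : ContDiff ℝ ∞ (affineHeight c d h) := by
  change ContDiff ℝ ∞ fun z => 5 * (z - c) / (d - c)
  fun_prop

theorem contDiff_affineHeight_symm (c d : ℝ) (h : c < d) :
    ContDiff ℝ ∞ (affineHeight c d h).symm := by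
  change ContDiff ℝ ∞ fun z => c + (d - c) * z / 5
  fun_prop

end VertDiffeo

/-! ### Smaller model charts inside a model chart. -/

section Subchart

variable {V : Type*} [TopologicalSpace V]

/-- The chart `e` followed by the diffeomorphism `G`, with target restricted to the model box. -/
def subchart (e : OpenPartialHomeomorph V R3) (G : VertDiffeo) : OpenPartialHomeomorph V R3 :=
  (e.transHomeomorph G.homeo).trans (OpenPartialHomeomorph.ofSet modelBox isOpen_modelBox)

variable {e : OpenPartialHomeomorph V R3} {G : VertDiffeo}

theorem subchart_apply (p : V) : subchart e G p = G.toFun (e p) := rfl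

theorem subchart_symm_apply (y : R3) : (subchart e G).symm y = e.symm (G.invFun y) := rfl

theorem mem_subchart_source {p : V} :
    p ∈ (subchart e G).source ↔ p ∈ e.source ∧ G.toFun (e p) ∈ modelBox := by
  rw [subchart, OpenPartialHomeomorph.trans_source]
  rfl

theorem subchart_target (h : ∀ y ∈ modelBox, G.invFun y ∈ e.target) :
    (subchart e G).target = modelBox := by
  ext y
  rw [subchart, OpenPartialHomeomorph.trans_target]
  exact ⟨fun h => h.1, fun hy => ⟨hy, h y hy⟩⟩

variable [ChartedSpace R3 V] [IsManifold (𝓡 3) ∞ V]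

theorem subchart_mem_maximalAtlas (he : e ∈ IsManifold.maximalAtlas (𝓡 3) ∞ V) :
    subchart e G ∈ IsManifold.maximalAtlas (𝓡 3) ∞ V := by
  rw [IsManifold.mem_maximalAtlas_iff_contMDiffOn] at he ⊢
  constructor
  · exact (contMDiff_iff_contDiff.2 G.smooth).comp_contMDiffOn
      (he.1.mono fun p hp => (mem_subchart_source.1 hp).1)
  · refine he.2.comp (contMDiff_iff_contDiff.2 G.smooth_inv).contMDiffOn fun y hy => ?_
    rw [subchart, OpenPartialHomeomorph.trans_target] at hy
    exact hy.2

/-- This produces all the auxiliary charts: disks around flat points, half disks at the boundary,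
branch arcs near a double point. The point `p₀` only has to be over the center; its height is free.
-/
theorem IsModelChart.subchart {B : Type*} {M : Set V} {π : M → B} {k k' : LocalModel} {b : B}
    (h : IsModelChart M π k e b) (hbox : ∀ y ∈ modelBox, G.invFun y ∈ modelBox)
    (hreg : ∀ y ∈ modelBox, G.invFun y ∈ k.region ↔ y ∈ k'.region) (p₀ : M)
    (hp₀ : (p₀ : V) ∈ e.source) (hc0 : G.toFun (e p₀) 0 = 0) (hc1 : G.toFun (e p₀) 1 = 0)
    (hc2 : -1 < G.toFun (e p₀) 2) (hc3 : G.toFun (e p₀) 2 < 6) :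
    IsModelChart M π k' (_root_.subchart e G) (π p₀) := by
  have hreg' : ∀ x, G.toFun x ∈ modelBox → (x ∈ k.region ↔ G.toFun x ∈ k'.region) := by
    intro x hx
    rw [← hreg _ hx, G.left_inv]
  have hmem : ∀ p ∈ (_root_.subchart e G).source, p ∈ M ↔ G.toFun (e p) ∈ k'.region := by
    intro p hp
    rw [mem_subchart_source] at hp
    rw [h.mem_iff p hp.1, hreg' _ hp.2]
  have hfib : ∀ p q : M, (p : V) ∈ (_root_.subchart e G).source → (π p = π q ↔
      (q : V) ∈ (_root_.subchart e G).source ∧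
        SameVertical k'.region (G.toFun (e p)) (G.toFun (e q))) := by
    intro p q hp
    have hpR := (hmem p hp).1 p.2
    rw [mem_subchart_source] at hp ⊢
    obtain ⟨hp, hpb⟩ := hp
    rw [h.fiber_iff p q hp, and_assoc]
    refine and_congr_right fun hq => ?_
    rw [sameVertical_iff, sameVertical_iff]
    constructor
    · rintro ⟨h0, h1, h2⟩
      have hq' : e q = atHeight (e p) (e q 2) := R3_ext h0.symm h1.symm rfl
      have hGq : G.toFun (e q) = atHeight (G.toFun (e p)) (G.height (e q 2)) := by
        rw [hq', G.map_atHeight]; rfl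
      have hslab := region_subset_slab k' hpR
      rw [slab, mem_ofPred_eq, G.map_two] at hslab
      have hin : ∀ t ∈ uIcc (G.height (e p 2)) (G.height (e q 2)), -1 < t → t < 6 →
          atHeight (G.toFun (e p)) t ∈ k'.region := by
        intro t ht ht1 ht2
        have h3 := h2 (G.height.symm t) (by
          rw [← G.image_uIcc, OrderIso.apply_symm_apply]; exact ht)
        have h4 : G.toFun (atHeight (e p) (G.height.symm t)) = atHeight (G.toFun (e p)) t := by
          rw [G.map_atHeight, OrderIso.apply_symm_apply]
        rw [hreg' _ (by rw [h4]; exact atHeight_mem_modelBox hpb ht1 ht2), h4] at h3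
        exact h3
      -- A fiber of the large chart cannot leave the small box through its top: it would pass at
      -- height `11 / 2`, which is in the box but above the slab. The bottom is treated with the
      -- height `-1 / 2`.
      have hup : G.height (e q 2) < 6 := by
        by_contra hcon
        have := (region_subset_slab k' (hin (11 / 2) (by
          rw [uIcc_of_le (by linarith)]; constructor <;> linarith) (by norm_num)
          (by norm_num))).2
        norm_num [atHeight_two] at this
      have hlow : -1 < G.height (e q 2) := by
        by_contra hcon
        have := (region_subset_slab k' (hin (-1 / 2) (by
          rw [uIcc_of_ge (by linarith)]; constructor <;> linarith) (by norm_num)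
          (by norm_num))).1
        norm_num [atHeight_two] at this
      refine ⟨?_, ?_, ?_, ?_⟩
      · rw [hGq]; exact atHeight_mem_modelBox hpb hlow hup
      · rw [hGq]; rfl
      · rw [hGq]; rfl
      · intro t ht
        rw [G.map_two, G.map_two] at ht
        have h5 := (ordConnected_Ioo (a := (-1 : ℝ)) (b := 6)).uIcc_subset
          (x := G.height (e p 2)) (y := G.height (e q 2)) ⟨by linarith, by linarith⟩
          ⟨hlow, hup⟩ ht
        exact hin t ht h5.1 h5.2
    · rintro ⟨hqb, h0, h1, h2⟩
      have hGq : G.toFun (e q) = atHeight (G.toFun (e p)) (G.toFun (e q) 2) :=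
        R3_ext h0.symm h1.symm rfl
      have hq' : e q = atHeight (e p) (G.height.symm (G.toFun (e q) 2)) := by
        conv_lhs => rw [← G.left_inv (e q), hGq, G.inv_atHeight, G.left_inv]
      refine ⟨?_, ?_, ?_⟩
      · rw [hq']; rfl
      · rw [hq']; rfl
      · intro t ht
        have h3 := h2 (G.height t) (by
          rw [G.map_two, G.map_two, G.image_uIcc]; exact ht)
        have h5 := (ordConnected_Ioo (a := (-1 : ℝ)) (b := 6)).uIcc_subset
          (x := G.toFun (e p) 2) (y := G.toFun (e q) 2) ⟨hpb.2.2.1, hpb.2.2.2⟩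
          ⟨hqb.2.2.1, hqb.2.2.2⟩ (by
            rw [G.map_two, G.map_two, G.image_uIcc]; exact ht : G.height t ∈ _)
        rw [← G.map_atHeight, ← hreg' _ (by
          rw [G.map_atHeight]; exact atHeight_mem_modelBox hpb h5.1 h5.2)] at h3
        exact h3
  have hp₀b : G.toFun (e p₀) ∈ modelBox :=
    ⟨by rw [hc0]; simp, by rw [hc1]; simp, hc2, hc3⟩
  have hp₀s : (p₀ : V) ∈ (_root_.subchart e G).source := mem_subchart_source.2 ⟨hp₀, hp₀b⟩
  refine ⟨subchart_mem_maximalAtlas h.smooth,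
    subchart_target fun y hy => h.target_eq ▸ hbox y hy, hmem, hfib, ?_⟩
  intro p hp hpc
  rw [subchart_apply] at hpc
  rw [hfib p p₀ hp, hpc, sameVertical_iff]
  refine ⟨hp₀s, hc0.symm, hc1.symm, fun t ht => ?_⟩
  have h1 := region_subset_slab k' ((hmem p₀ hp₀s).1 p₀.2)
  rw [centerPt_two, uIcc_of_le h1.1] at ht
  exact center_mem_region k' rfl rfl ht.1 (ht.2.trans h1.2)

omit [IsManifold (𝓡 3) ∞ V] in
theorem pullCovector_subchart (he : e ∈ IsManifold.maximalAtlas (𝓡 3) ∞ V) {p : V}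
    (hp : p ∈ e.source) (β : R3 →L[ℝ] ℝ) :
    pullCovector (subchart e G) p β = pullCovector e p (β.comp (fderiv ℝ G.toFun (e p))) := by
  have h1 : MDifferentiableAt (𝓡 3) (𝓡 3) e p :=
    (contMDiffAt_of_mem_maximalAtlas he hp).mdifferentiableAt (by simp)
  have h2 : MDifferentiableAt (𝓡 3) (𝓡 3) G.toFun (e p) :=
    (contMDiff_iff_contDiff.2 G.smooth).mdifferentiableAt (by simp)
  have h3 := mfderiv_comp p h2 h1
  unfold pullCovector chartDeriv
  change ContinuousLinearMap.comp β (mfderiv (𝓡 3) (𝓡 3) (G.toFun ∘ e) p) = _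
  rw [h3, mfderiv_eq_fderiv]
  rfl

theorem ChartSign.subchart {o : OrientedAtlas V} {ε σ : ℝ}
    (he : e ∈ IsManifold.maximalAtlas (𝓡 3) ∞ V) (h : ChartSign o e ε)
    (hσ : ∀ x, 0 < σ * (fderiv ℝ G.toFun x).det) : ChartSign o (subchart e G) (ε * σ) := by
  intro f hf y hy hyf
  have hy2 : y ∈ modelBox ∧ G.invFun y ∈ e.target := by
    rw [_root_.subchart, OpenPartialHomeomorph.trans_target] at hy
    exact hy
  rw [subchart_symm_apply] at hyf
  have h1 := h f hf (G.invFun y) hy2.2 hyf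
  have hs : (_root_.subchart e G).symm y ∈ e.source := e.map_target hy2.2
  rw [jac_comp (subchart_mem_maximalAtlas he) he (o.smooth hf) hy hs hyf, det_comp_R3,
    subchart_symm_apply, e.right_inv hy2.2]
  have h2 : jac (_root_.subchart e G) e y = fderiv ℝ G.invFun y := by
    unfold jac
    apply Filter.EventuallyEq.fderiv_eq
    have : ∀ᶠ z in 𝓝 y, G.invFun z ∈ e.target :=
      G.smooth_inv.continuous.continuousAt.eventually (e.open_target.mem_nhds hy2.2)
    filter_upwards [this] with z hz
    rw [subchart_symm_apply, e.right_inv hz]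
  have h3 : (fderiv ℝ G.toFun (G.invFun y)).comp (fderiv ℝ G.invFun y) =
      ContinuousLinearMap.id ℝ R3 := by
    rw [← fderiv_comp _ ((G.smooth.differentiable (by simp)) _)
      ((G.smooth_inv.differentiable (by simp)) _)]
    have : G.toFun ∘ G.invFun = id := funext G.right_inv
    rw [this, fderiv_id]
  have h4 := congrArg ContinuousLinearMap.det h3
  rw [det_comp_R3] at h4
  have h5 : (ContinuousLinearMap.id ℝ R3).det = 1 := by simp [ContinuousLinearMap.det]
  rw [h5] at h4
  rw [h2]
  have h6 := hσ (G.invFun y)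
  set a := (fderiv ℝ G.toFun (G.invFun y)).det
  set b := (fderiv ℝ G.invFun y).det
  have h7 : 0 < σ * b := by
    have hb : b ≠ 0 := by rintro h; rw [h, mul_zero] at h4; exact zero_ne_one h4
    have h8 : 0 < b ^ 2 := by positivity
    have : σ * a * b ^ 2 = σ * b * (a * b) := by ring
    rw [h4, mul_one] at this
    rw [← this]; positivity
  have := mul_pos h1 h7
  linarith [this]

end Subchart

/-! ### Twisting numbers computed in rescaled charts. -/

section Twisting

variable {V : Type*} [TopologicalSpace V] [ChartedSpace R3 V]
  {e : OpenPartialHomeomorph V R3} {ξ : PlaneField V}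

theorem innerSL_cos_sin (a b : ℝ) : innerSL ℝ (!₂[a, b, 0] : R3) =
    a • (EuclideanSpace.proj 0 : R3 →L[ℝ] ℝ) + b • (EuclideanSpace.proj 1 : R3 →L[ℝ] ℝ) := by
  ext u
  simp [PiLp.inner_apply, Fin.sum_univ_three]
  ring

theorem norm_cos_sin {σ : ℝ} (hσ : σ = 1 ∨ σ = -1) (θ : ℝ) :
    ‖(!₂[σ * Real.cos θ, Real.sin θ, 0] : R3)‖ = 1 := by
  have hσ2 : σ ^ 2 = 1 := by rcases hσ with rfl | rfl <;> norm_num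
  rw [EuclideanSpace.norm_eq, Real.sqrt_eq_one]
  simp [Fin.sum_univ_three, mul_pow, hσ2]

theorem spansAt_iff_rep_eq (he : e ∈ IsManifold.maximalAtlas (𝓡 3) ∞ V) {x v : R3}
    (hx : x ∈ e.target) (hv : ‖v‖ = 1) : SpansAt e ξ x v ↔ rep e ξ x = v :=
  ⟨fun h => h.rep_eq_of_norm he hx hv, fun h => h ▸ spansAt_rep he hx⟩

/-- In the chart `e`, the function `θ` is an angle of `ξ` along the vertical segment between the
heights `c` and `d` through `x`. -/
def IsAngle (e : OpenPartialHomeomorph V R3) (ξ : PlaneField V) (σ : ℝ) (x : R3) (c d : ℝ)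
    (θ : ℝ → ℝ) : Prop :=
  ContinuousOn θ (Icc c d) ∧ ∀ z ∈ Icc c d,
    rep e ξ (atHeight x z) = !₂[σ * Real.cos (θ z), Real.sin (θ z), 0]

theorem hasTwisting_iff (he : e ∈ IsManifold.maximalAtlas (𝓡 3) ∞ V)
    (hc : ∀ t ∈ Icc (0 : ℝ) 5, centerPt t ∈ e.target) {τ : ℝ} : HasTwisting e ξ τ ↔
      ∃ θ, IsAngle e ξ 1 (centerPt 0) 0 5 θ ∧ τ = (θ 5 - θ 0) / (2 * Real.pi) := by
  unfold HasTwisting IsAngle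
  refine exists_congr fun θ => ?_
  rw [and_assoc]
  refine and_congr_right fun _ => and_congr_left fun _ => forall₂_congr fun t ht => ?_
  have h1 : atHeight (centerPt 0) t = centerPt t := rfl
  rw [h1, ← spansAt_iff_rep_eq he (hc t ht) (norm_cos_sin (Or.inl rfl) _), SpansAt,
    innerSL_cos_sin, one_mul]

/-- The rescaling that maps the vertical segment through `x` between the heights `c` and `d` to
the central segment; it reverses the orientation if `σ = -1`. -/
def boxMap (σ r : ℝ) (hσ : σ ≠ 0) (hr : 0 < r) (x : R3) (c d : ℝ) (h : c < d) : VertDiffeo :=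
  VertDiffeo.diag (σ / r) (1 / r) (div_ne_zero hσ hr.ne') (one_div_pos.2 hr).ne' x
    (affineHeight c d h) (contDiff_affineHeight c d h) (contDiff_affineHeight_symm c d h)

variable {σ r : ℝ} {hσ : σ ≠ 0} {hr : 0 < r} {x : R3} {c d : ℝ} {h : c < d}

theorem boxMap_apply (y : R3) : (boxMap σ r hσ hr x c d h).toFun y =
    !₂[σ / r * (y 0 - x 0), 1 / r * (y 1 - x 1), 5 * (y 2 - c) / (d - c)] := rfl

theorem boxMap_inv_apply (y : R3) : (boxMap σ r hσ hr x c d h).invFun y =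
    !₂[x 0 + y 0 / (σ / r), x 1 + y 1 / (1 / r), c + (d - c) * y 2 / 5] := rfl

theorem fderiv_boxMap (y u : R3) : fderiv ℝ (boxMap σ r hσ hr x c d h).toFun y u =
    !₂[σ / r * u 0, 1 / r * u 1, 5 * u 2 / (d - c)] := by
  have h1 := ((boxMap σ r hσ hr x c d h).smooth.differentiable (by simp)) y
  have h2 : ∀ i (f : R3 → ℝ) (f' : ℝ), (∀ z, (boxMap σ r hσ hr x c d h).toFun z i = f z) →
      HasDerivAt (fun t : ℝ => f (y + t • u)) f' 0 →
      fderiv ℝ (boxMap σ r hσ hr x c d h).toFun y u i = f' := by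
    intro i f f' hf hd
    have h3 : HasDerivAt (fun t : ℝ => y + t • u) u (0 : ℝ) := by
      simpa using ((hasDerivAt_id (0 : ℝ)).smul_const u).const_add y
    have h4 : HasFDerivAt (fun z => (boxMap σ r hσ hr x c d h).toFun z i)
        ((EuclideanSpace.proj i : R3 →L[ℝ] ℝ).comp
          (fderiv ℝ (boxMap σ r hσ hr x c d h).toFun y)) (y + (0 : ℝ) • u) := by
      rw [zero_smul, add_zero]
      exact ((EuclideanSpace.proj i : R3 →L[ℝ] ℝ).hasFDerivAt).comp y h1.hasFDerivAt
    have h5 := HasFDerivAt.comp_hasDerivAt (f := fun t : ℝ => y + t • u) (0 : ℝ) h4 h3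
    have h6 : (fun z => (boxMap σ r hσ hr x c d h).toFun z i) = f := funext hf
    rw [h6] at h5
    exact h5.unique hd
  have hlin : ∀ a b l : ℝ, HasDerivAt (fun t : ℝ => a * (b + t * l)) (a * l) 0 := fun a b l => by
    simpa using (((hasDerivAt_id (0 : ℝ)).mul_const l).const_add b).const_mul a
  apply R3_ext
  · refine h2 0 (fun z => σ / r * (z 0 - x 0)) _ (fun z => rfl) ?_
    convert hlin (σ / r) (y 0 - x 0) (u 0) using 1
    · ext t
      simp only [PiLp.add_apply, PiLp.smul_apply, smul_eq_mul]
      ring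
    · rfl
  · refine h2 1 (fun z => 1 / r * (z 1 - x 1)) _ (fun z => rfl) ?_
    convert hlin (1 / r) (y 1 - x 1) (u 1) using 1
    · ext t
      simp only [PiLp.add_apply, PiLp.smul_apply, smul_eq_mul]
      ring
    · rfl
  · refine h2 2 (fun z => 5 * (z 2 - c) / (d - c)) _ (fun z => rfl) ?_
    convert hlin (5 / (d - c)) (y 2 - c) (u 2) using 1
    · ext t; simp; ring
    · simp; ring

theorem det_fderiv_boxMap (y : R3) : (fderiv ℝ (boxMap σ r hσ hr x c d h).toFun y).det =
    σ / r * (1 / r) * (5 / (d - c)) := by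
  rw [ContinuousLinearMap.det,
    ← LinearMap.det_toMatrix (EuclideanSpace.basisFun (Fin 3) ℝ).toBasis, Matrix.det_fin_three]
  simp [LinearMap.toMatrix_apply, fderiv_boxMap]

/-- The two horizontal coordinates are scaled by the same factor up to the sign `σ`, so angles are
unchanged except for the reflection recorded by `σ`. Hence the twisting in the small chart is an
angle variation read in `e`. -/
theorem hasTwisting_subchart_iff (he : e ∈ IsManifold.maximalAtlas (𝓡 3) ∞ V)
    [IsManifold (𝓡 3) ∞ V] (hσ' : σ = 1 ∨ σ = -1)
    (hbox : ∀ y ∈ modelBox, (boxMap σ r hσ hr x c d h).invFun y ∈ e.target) {τ : ℝ} :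
    HasTwisting (subchart e (boxMap σ r hσ hr x c d h)) ξ τ ↔
      ∃ θ, IsAngle e ξ σ x c d θ ∧ τ = (θ d - θ c) / (2 * Real.pi) := by
  set G := boxMap σ r hσ hr x c d h with hG
  have hdc := sub_pos.2 h
  have hcb : ∀ t ∈ Icc (0 : ℝ) 5, centerPt t ∈ modelBox := by
    intro t ht
    simp only [mem_modelBox, centerPt_zero, centerPt_one, centerPt_two, abs_zero]
    exact ⟨one_pos, one_pos, by linarith [ht.1], by linarith [ht.2]⟩
  have hinv : ∀ t, G.invFun (centerPt t) = atHeight x (c + (d - c) * t / 5) := by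
    intro t
    rw [hG, boxMap_inv_apply]
    apply R3_ext <;> simp
  have hes : subchart e G ∈ IsManifold.maximalAtlas (𝓡 3) ∞ V := subchart_mem_maximalAtlas he
  have key : ∀ t ∈ Icc (0 : ℝ) 5, ∀ φ : ℝ,
      rep (subchart e G) ξ (centerPt t) = !₂[1 * Real.cos φ, Real.sin φ, 0] ↔
      rep e ξ (atHeight x (c + (d - c) * t / 5)) = !₂[σ * Real.cos φ, Real.sin φ, 0] := by
    intro t ht φ
    have ht' : atHeight x (c + (d - c) * t / 5) ∈ e.target := hinv t ▸ hbox _ (hcb t ht)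
    rw [← spansAt_iff_rep_eq hes (by rw [subchart_target hbox]; exact hcb t ht)
      (norm_cos_sin (Or.inl rfl) _), ← spansAt_iff_rep_eq he ht' (norm_cos_sin hσ' _)]
    have hf : ContinuousLinearMap.comp (innerSL ℝ (!₂[1 * Real.cos φ, Real.sin φ, 0] : R3))
        (fderiv ℝ G.toFun (e (e.symm (atHeight x (c + (d - c) * t / 5))))) =
        innerSL ℝ ((1 / r) • (!₂[σ * Real.cos φ, Real.sin φ, 0] : R3)) := by
      ext u
      rw [ContinuousLinearMap.comp_apply, hG, fderiv_boxMap]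
      simp [PiLp.inner_apply, Fin.sum_univ_three]
      ring
    have hS : SpansAt (subchart e G) ξ (centerPt t) !₂[1 * Real.cos φ, Real.sin φ, 0] ↔
        SpansAt e ξ (atHeight x (c + (d - c) * t / 5))
          ((1 / r) • (!₂[σ * Real.cos φ, Real.sin φ, 0] : R3)) := by
      unfold SpansAt
      rw [subchart_symm_apply, hinv, pullCovector_subchart he (e.map_target ht'), hf]
    rw [hS]
    constructor
    · intro h1
      have h2 := h1.smul hr
      rwa [smul_smul, mul_one_div_cancel hr.ne', one_smul] at h2
    · intro h1
      exact h1.smul (one_div_pos.2 hr)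
  rw [hasTwisting_iff hes (fun t ht => by rw [subchart_target hbox]; exact hcb t ht)]
  constructor
  · rintro ⟨θ, ⟨hc1, hc2⟩, rfl⟩
    refine ⟨fun z => θ (5 * (z - c) / (d - c)), ⟨?_, ?_⟩, ?_⟩
    · refine hc1.comp (by fun_prop) fun z hz => ?_
      constructor
      · have := hz.1; apply div_nonneg <;> linarith
      · rw [div_le_iff₀ hdc]; linarith [hz.2]
    · intro z hz
      have hz' : 5 * (z - c) / (d - c) ∈ Icc (0 : ℝ) 5 := by
        constructor
        · have := hz.1; apply div_nonneg <;> linarith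
        · rw [div_le_iff₀ hdc]; linarith [hz.2]
      have h1 := (key _ hz' _).1 (hc2 _ hz')
      have h2 : c + (d - c) * (5 * (z - c) / (d - c)) / 5 = z := by field_simp; ring
      rwa [h2] at h1
    · have h1 : 5 * (d - c) / (d - c) = 5 := by field_simp
      simp [h1]
  · rintro ⟨θ, ⟨hc1, hc2⟩, rfl⟩
    refine ⟨fun t => θ (c + (d - c) * t / 5), ⟨?_, ?_⟩, ?_⟩
    · refine hc1.comp (by fun_prop) fun t ht => ?_
      constructor
      · have := ht.1; have : 0 ≤ (d - c) * t / 5 := by positivity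
        linarith
      · nlinarith [ht.2]
    · intro t ht
      have ht' : c + (d - c) * t / 5 ∈ Icc c d := by
        constructor
        · have := ht.1; have : 0 ≤ (d - c) * t / 5 := by positivity
          linarith
        · nlinarith [ht.2]
      exact (key t ht _).2 (hc2 _ ht')
    · simp

end Twisting

end

noncomputable section

/-! ### Rotating complex numbers and their angles. -/

section Rotation

/-- The solution of `A' = -i q A`. -/
theorem eq_mul_exp_of_hasDerivAt {A : ℝ → ℂ} {q : ℝ → ℝ} {U : Set ℝ} {c d : ℝ} (hU : IsOpen U)
    (hcd : Icc c d ⊆ U) (hq : ContinuousOn q U)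
    (hA : ∀ z ∈ Icc c d, HasDerivAt A (-Complex.I * q z * A z) z) {z : ℝ} (hz : z ∈ Icc c d) :
    A z = A c * Complex.exp (-Complex.I * ((∫ t in c..z, q t : ℝ) : ℂ)) := by
  set Q : ℝ → ℝ := fun z => ∫ t in c..z, q t with hQ
  have hQd : ∀ z ∈ Icc c d, HasDerivAt Q (q z) z := by
    intro z hz
    apply intervalIntegral.integral_hasDerivAt_right
    · apply ContinuousOn.intervalIntegrable
      rw [uIcc_of_le hz.1]
      exact hq.mono ((Icc_subset_Icc le_rfl hz.2).trans hcd)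
    · exact hq.stronglyMeasurableAtFilter hU z (hcd hz)
    · exact hq.continuousAt (hU.mem_nhds (hcd hz))
  have hd : ∀ z ∈ Icc c d, HasDerivAt (fun z => A z * Complex.exp (Complex.I * (Q z : ℂ))) 0 z := by
    intro z hz
    have h1 : HasDerivAt (fun z => Complex.exp (Complex.I * (Q z : ℂ)))
        (Complex.exp (Complex.I * (Q z : ℂ)) * (Complex.I * (q z : ℂ))) z :=
      ((hQd z hz).ofReal_comp.const_mul Complex.I).cexp
    have h2 := (hA z hz).mul h1
    have h3 : -Complex.I * q z * A z * Complex.exp (Complex.I * (Q z : ℂ)) +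
        A z * (Complex.exp (Complex.I * (Q z : ℂ)) * (Complex.I * (q z : ℂ))) = 0 := by ring
    rw [h3] at h2
    exact h2
  have hconst := constant_of_has_deriv_right_zero
    (fun z hz => (hd z hz).continuousAt.continuousWithinAt)
    (fun z hz => (hd z (Ico_subset_Icc_self hz)).hasDerivWithinAt) z hz
  have hQc : Q c = 0 := by simp [hQ]
  rw [hQc] at hconst
  simp only [Complex.ofReal_zero, mul_zero, Complex.exp_zero, mul_one] at hconst
  rw [← hconst, mul_assoc, ← Complex.exp_add]
  simp [hQ]

theorem exists_int_of_exp_eq {a b : ℝ}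
    (h : Complex.exp (Complex.I * a) = Complex.exp (Complex.I * b)) :
    ∃ n : ℤ, a = b + 2 * Real.pi * n := by
  obtain ⟨n, hn⟩ := Complex.exp_eq_exp_iff_exists_int.1 h
  refine ⟨n, ?_⟩
  have h1 : Complex.I * (a : ℂ) = Complex.I * ((b + 2 * Real.pi * n : ℝ) : ℂ) := by
    rw [hn]; push_cast; ring
  exact_mod_cast mul_left_cancel₀ Complex.I_ne_zero h1

/-- Two continuous angles that are always equal modulo `2π` differ by a constant. -/
theorem sub_eq_sub_of_exp_eq {f g : ℝ → ℝ} {c d : ℝ} (hcd : c ≤ d) (hf : ContinuousOn f (Icc c d))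
    (hg : ContinuousOn g (Icc c d)) {u : ℂ}
    (h : ∀ z ∈ Icc c d, Complex.exp (Complex.I * f z) = u * Complex.exp (Complex.I * g z)) :
    f d - f c = g d - g c := by
  have h1 : ∀ z ∈ Icc c d, ∃ n : ℤ, f z - g z = (f c - g c) + 2 * Real.pi * n := by
    intro z hz
    apply exists_int_of_exp_eq
    have hc := h c ⟨le_rfl, hcd⟩
    have hz := h z hz
    push_cast
    rw [mul_sub, mul_sub, Complex.exp_sub, Complex.exp_sub, hc, hz,
      mul_div_cancel_right₀ _ (Complex.exp_ne_zero _), mul_div_cancel_right₀ _ (Complex.exp_ne_zero _)]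
  have hpi := Real.pi_pos
  have h2 : ContinuousOn (fun z => ((f z - g z) - (f c - g c)) / (2 * Real.pi)) (Icc c d) := by
    fun_prop
  have h3 := isPreconnected_Icc.constant_of_mapsTo (T := range ((↑) : ℤ → ℝ)) (S := Icc c d)
    (f := fun z => ((f z - g z) - (f c - g c)) / (2 * Real.pi))
    Int.isClosedEmbedding_coe_real.isInducing.isDiscrete_range h2 (fun z hz => by
      obtain ⟨n, hn⟩ := h1 z hz
      refine ⟨n, ?_⟩
      simp only [hn]
      field_simp
      ring) (x := c) (y := d) ⟨le_rfl, hcd⟩ ⟨hcd, le_rfl⟩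
  simp only [sub_self, zero_div] at h3
  have := (div_eq_zero_iff.1 h3.symm).resolve_right (by positivity)
  linarith

end Rotation

/-! ### Contact fields with Legendrian verticals are fields that rotate at positive rate. -/

section LocalField

/-- The rate at which the field `v` rotates along the vertical direction. -/
def rate (ε : ℝ) (v : R3 → R3) (x : R3) : ℝ :=
  ε * (v x 1 * fderiv ℝ v x (stdVec 2) 0 - v x 0 * fderiv ℝ v x (stdVec 2) 1)

/-- The horizontal part of `v`, as a complex number. -/
def horiz (ε : ℝ) (v : R3) : ℂ := ⟨v 0, ε * v 1⟩

/-- An open set of the model box that contains the complement of the region `k` and is a union of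
vertical segments of the region. -/
structure IsSaturated (k : LocalModel) (Ω : Set R3) : Prop where
  isOpen : IsOpen Ω
  subset : Ω ⊆ modelBox
  diff_subset : modelBox \ k.region ⊆ Ω
  mem : ∀ x ∈ Ω, ∀ t, (∀ s ∈ uIcc (x 2) t, atHeight x s ∈ k.region) → atHeight x t ∈ Ω

/-- A smooth field of unit vectors that defines a contact structure on `Ω`, with sign `ε`, to which
the vertical segments of the region are tangent. -/
structure IsLocalField (k : LocalModel) (ε : ℝ) (Ω : Set R3) (v : R3 → R3) : Prop where
  sat : IsSaturated k Ω
  sign : ε = 1 ∨ ε = -1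
  smooth : ∀ x ∈ Ω, ContDiffAt ℝ ∞ v x
  norm_eq : ∀ x ∈ Ω, ‖v x‖ = 1
  pos : ∀ x ∈ Ω, 0 < ε * helicity v x
  vert : ∀ x ∈ Ω, x ∈ k.region → v x 2 = 0

/-- Slits and missing halves lie on the negative side of the coordinate planes. Thus from any point
of a region one can always move in the directions of increasing `x 0` and `x 1`, in particular off
the coordinate planes. -/
theorem region_mono (k : LocalModel) {x y : R3} (hx : x ∈ k.region) (h0 : x 0 ≤ y 0)
    (h1 : x 1 ≤ y 1) (h2 : x 2 = y 2) : y ∈ k.region := by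
  rw [mem_region_iff] at hx ⊢
  rw [← h2]
  refine ⟨hx.1, hx.2.1, fun hk h => hx.2.2.1 hk (h0.trans_lt h),
    fun hk h => hx.2.2.2.1 hk (h1.trans_lt h), fun hk => (hx.2.2.2.2 hk).trans h1⟩

theorem continuous_atHeight (x : R3) : Continuous (atHeight x) := by
  have : atHeight x = fun t => x + (t - x 2) • stdVec 2 := funext (atHeight_eq_add x)
  rw [this]
  fun_prop

theorem hasDerivAt_atHeight (x : R3) (t : ℝ) : HasDerivAt (atHeight x) (stdVec 2) t := by
  have : atHeight x = fun t => x + (t - x 2) • stdVec 2 := funext (atHeight_eq_add x)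
  rw [this]
  simpa using (((hasDerivAt_id t).sub_const (x 2)).smul_const (stdVec 2)).const_add x

theorem horiz_exp_eq (ε θ : ℝ) :
    horiz ε !₂[ε * Real.cos θ, Real.sin θ, 0] = ε * Complex.exp (Complex.I * θ) := by
  rw [mul_comm Complex.I, Complex.exp_mul_I, ← Complex.ofReal_cos, ← Complex.ofReal_sin]
  apply Complex.ext
  · simp only [horiz, Complex.add_re, Complex.ofReal_re, Complex.I_re, Complex.mul_re,
      Complex.I_im, Complex.ofReal_im]
    change ε * _ = _; ring
  · simp only [horiz, Complex.add_im, Complex.ofReal_re, Complex.mul_im, Complex.I_re,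
      Complex.I_im, Complex.ofReal_im]
    change ε * Real.sin θ = _; ring

/-- The half line in the positive direction stays in the region, where the vertical component
vanishes; at points of the frontier the one-sided derivative is enough. -/
theorem IsSaturated.fderiv_horizontal {k : LocalModel} {Ω : Set R3} {v : R3 → R3}
    (h : IsSaturated k Ω) {x : R3} (hv : ContDiffAt ℝ ∞ v x)
    (hvert : ∀ y ∈ Ω, y ∈ k.region → v y 2 = 0) (hx : x ∈ Ω) (hxR : x ∈ k.region)
    {i : Fin 3} (hi : i = 0 ∨ i = 1) : fderiv ℝ v x (stdVec i) 2 = 0 := by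
  have hd : HasFDerivAt v (fderiv ℝ v x) (x + (0 : ℝ) • stdVec i) := by
    rw [zero_smul, add_zero]
    exact ((hv).differentiableAt (by simp)).hasFDerivAt
  have hline : HasDerivAt (fun t : ℝ => x + t • stdVec i) (stdVec i) (0 : ℝ) := by
    simpa using ((hasDerivAt_id (0 : ℝ)).smul_const (stdVec i)).const_add x
  have h1 := HasFDerivAt.comp_hasDerivAt (f := fun t : ℝ => x + t • stdVec i) (0 : ℝ) hd hline
  have h2 : HasDerivAt (fun t : ℝ => v (x + t • stdVec i) 2) (fderiv ℝ v x (stdVec i) 2) 0 :=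
    ((EuclideanSpace.proj 2 : R3 →L[ℝ] ℝ).hasFDerivAt).comp_hasDerivAt (0 : ℝ) h1
  have h3 : ∀ᶠ t in 𝓝 (0 : ℝ), x + t • stdVec i ∈ Ω := by
    apply hline.continuousAt.eventually
    simpa using h.isOpen.mem_nhds hx
  have h4 : HasDerivWithinAt (fun t : ℝ => v (x + t • stdVec i) 2) 0 (Ici 0) 0 := by
    refine (hasDerivWithinAt_const (0 : ℝ) (Ici (0 : ℝ)) (0 : ℝ)).congr_of_eventuallyEq ?_
      (by simpa using hvert x hx hxR)
    filter_upwards [nhdsWithin_le_nhds h3, self_mem_nhdsWithin] with t ht ht0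
    apply hvert _ ht
    have ht0' : (0 : ℝ) ≤ t := ht0
    apply region_mono k hxR <;> rcases hi with rfl | rfl <;> simp [stdVec, ht0']
  exact (uniqueDiffOn_Ici (0 : ℝ) 0 (by simp)).eq_deriv _ h2.hasDerivWithinAt h4

/-- In `v · curl v` only the vertical derivatives of the horizontal components survive. Over the
region, being contact therefore means rotating at positive rate along the fibers. -/
theorem IsSaturated.helicity_eq_rate {k : LocalModel} {ε : ℝ} {Ω : Set R3} {v : R3 → R3}
    (h : IsSaturated k Ω) {x : R3} (hv : ContDiffAt ℝ ∞ v x)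
    (hvert : ∀ y ∈ Ω, y ∈ k.region → v y 2 = 0) (hx : x ∈ Ω) (hxR : x ∈ k.region) : ε * helicity v x = rate ε v x := by
  rw [helicity_eq ((hv).differentiableAt (by simp)),
    h.fderiv_horizontal hv hvert hx hxR (Or.inl rfl), h.fderiv_horizontal hv hvert hx hxR (Or.inr rfl),
    hvert x hx hxR, rate]
  ring

namespace IsLocalField

variable {k : LocalModel} {ε : ℝ} {Ω : Set R3} {v : R3 → R3}

theorem eps_sq (h : IsLocalField k ε Ω v) : ε * ε = 1 := by
  rcases h.sign with h | h <;> rw [h] <;> norm_num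

theorem helicity_eq_rate (h : IsLocalField k ε Ω v) {x : R3} (hx : x ∈ Ω)
    (hxR : x ∈ k.region) : ε * helicity v x = rate ε v x :=
  h.sat.helicity_eq_rate (h.smooth x hx) h.vert hx hxR

theorem rate_pos (h : IsLocalField k ε Ω v) {x : R3} (hx : x ∈ Ω) (hxR : x ∈ k.region) :
    0 < rate ε v x := h.helicity_eq_rate hx hxR ▸ h.pos x hx

theorem contDiffAt_rate (h : IsLocalField k ε Ω v) {x : R3} (hx : x ∈ Ω) :
    ContDiffAt ℝ ∞ (rate ε v) x := by
  have h1 := h.smooth x hx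
  have h2 : ContDiffAt ℝ ∞ (fun y => fderiv ℝ v y (stdVec 2)) x :=
    (h1.fderiv_right (m := ∞) (by simp)).clm_apply contDiffAt_const
  have h3 : ∀ i, ContDiffAt ℝ ∞ (fun y => v y i) x := fun i => contDiffAt_euclidean.1 h1 i
  have h4 : ∀ i, ContDiffAt ℝ ∞ (fun y => fderiv ℝ v y (stdVec 2) i) x :=
    fun i => contDiffAt_euclidean.1 h2 i
  exact contDiffAt_const.mul (((h3 1).mul (h4 0)).sub ((h3 0).mul (h4 1)))

theorem inner_fderiv (h : IsLocalField k ε Ω v) {x : R3} (hx : x ∈ Ω) (u : R3) :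
    inner ℝ (v x) (fderiv ℝ v x u) = 0 := by
  have hd := ((h.smooth x hx).differentiableAt (by simp)).hasFDerivAt
  have h1 := hd.inner ℝ hd
  have h2 : (fun y => inner ℝ (v y) (v y)) =ᶠ[𝓝 x] fun _ => (1 : ℝ) := by
    filter_upwards [h.sat.isOpen.mem_nhds hx] with y hy
    rw [real_inner_self_eq_norm_sq, h.norm_eq y hy, one_pow]
  have h3 := h1.unique ((hasFDerivAt_const (1 : ℝ) x).congr_of_eventuallyEq h2)
  have h4 := DFunLike.congr_fun h3 u
  simp [fderivInnerCLM_apply] at h4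
  rw [real_inner_comm (v x)] at h4
  linarith

theorem norm_horiz (h : IsLocalField k ε Ω v) {x : R3} (hx : x ∈ Ω) (hxR : x ∈ k.region) :
    v x 0 ^ 2 + v x 1 ^ 2 = 1 := by
  have h1 := h.norm_eq x hx
  rw [EuclideanSpace.norm_eq, Real.sqrt_eq_one] at h1
  simpa [Fin.sum_univ_three, h.vert x hx hxR] using h1

/-- A unit horizontal vector moves orthogonally to itself, so its derivative is a real multiple of
`i` times it, and the multiple is `-rate`. The sign `ε` in `horiz` makes the sense of rotation the
same in positive and negative charts. -/
theorem hasDerivAt_horiz (h : IsLocalField k ε Ω v) {x : R3} {t : ℝ} (hx : atHeight x t ∈ Ω)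
    (hxR : atHeight x t ∈ k.region) :
    HasDerivAt (fun z => horiz ε (v (atHeight x z)))
      (-Complex.I * rate ε v (atHeight x t) * horiz ε (v (atHeight x t))) t := by
  set y := atHeight x t with hy
  have hd := ((h.smooth y hx).differentiableAt (by simp)).hasFDerivAt
  have h1 : HasDerivAt (fun z => v (atHeight x z)) (fderiv ℝ v y (stdVec 2)) t :=
    HasFDerivAt.comp_hasDerivAt t hd (hasDerivAt_atHeight x t)
  have h2 : ∀ i, HasDerivAt (fun z => v (atHeight x z) i) (fderiv ℝ v y (stdVec 2) i) t :=
    fun i => ((EuclideanSpace.proj i : R3 →L[ℝ] ℝ).hasFDerivAt).comp_hasDerivAt t h1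
  have h3 : HasDerivAt (fun z => ((v (atHeight x z) 0 : ℝ) : ℂ) +
      ((ε * v (atHeight x z) 1 : ℝ) : ℂ) * Complex.I)
      (((fderiv ℝ v y (stdVec 2) 0 : ℝ) : ℂ) +
        ((ε * fderiv ℝ v y (stdVec 2) 1 : ℝ) : ℂ) * Complex.I) t :=
    (h2 0).ofReal_comp.add (((h2 1).const_mul ε).ofReal_comp.mul_const Complex.I)
  have h4 : (fun z => horiz ε (v (atHeight x z))) = fun z => ((v (atHeight x z) 0 : ℝ) : ℂ) +
      ((ε * v (atHeight x z) 1 : ℝ) : ℂ) * Complex.I := by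
    funext z
    apply Complex.ext <;> simp [horiz]
  rw [h4]
  convert h3 using 1
  have h5 := h.inner_fderiv hx (stdVec 2)
  have h6 := h.norm_horiz hx hxR
  have h7 := h.vert y hx hxR
  have h8 := h.eps_sq
  set a := v y 0
  set b := v y 1
  set a' := fderiv ℝ v y (stdVec 2) 0 with ha'
  set b' := fderiv ℝ v y (stdVec 2) 1 with hb'
  have h9 : a * a' + b * b' = 0 := by
    simp only [PiLp.inner_apply, Fin.sum_univ_three, RCLike.inner_apply, conj_trivial] at h5
    change a' * a + b' * b + fderiv ℝ v y (stdVec 2) 2 * v y 2 = 0 at h5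
    rw [h7] at h5
    linarith
  have hr : rate ε v y = ε * (b * a' - a * b') := rfl
  apply Complex.ext
  · simp [horiz, hr]
    change _ * (ε * b) = a'
    linear_combination (b * (b * a' - a * b')) * h8 + a' * h6 - a * h9
  · simp [horiz, hr]
    change -(ε * (b * a' - a * b') * a) = ε * b'
    linear_combination (ε * b') * h6 - ε * b * h9

theorem horiz_eq_exp (h : IsLocalField k ε Ω v) {x : R3} {c d : ℝ}
    (hΩ : ∀ z ∈ Icc c d, atHeight x z ∈ Ω) (hR : ∀ z ∈ Icc c d, atHeight x z ∈ k.region)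
    {z : ℝ} (hz : z ∈ Icc c d) :
    horiz ε (v (atHeight x z)) = horiz ε (v (atHeight x c)) *
      Complex.exp (-Complex.I * ((∫ t in c..z, rate ε v (atHeight x t) : ℝ) : ℂ)) := by
  refine eq_mul_exp_of_hasDerivAt (A := fun z => horiz ε (v (atHeight x z)))
    (q := fun t => rate ε v (atHeight x t)) (U := atHeight x ⁻¹' Ω)
    (h.sat.isOpen.preimage (continuous_atHeight x)) (fun z hz => hΩ z hz) ?_
    (fun z hz => h.hasDerivAt_horiz (hΩ z hz) (hR z hz)) hz
  intro t ht
  exact ((h.contDiffAt_rate ht).continuousAt.comp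
    (continuous_atHeight x).continuousAt).continuousWithinAt

/-- The twisting along a vertical segment is thus determined by the integral of the rate, which
turns equality of weights into equality of integrals. -/
theorem angle_sub (h : IsLocalField k ε Ω v) {x : R3} {c d : ℝ} (hcd : c ≤ d)
    (hΩ : ∀ z ∈ Icc c d, atHeight x z ∈ Ω) (hR : ∀ z ∈ Icc c d, atHeight x z ∈ k.region)
    {θ : ℝ → ℝ} (hθ : ContinuousOn θ (Icc c d))
    (hv : ∀ z ∈ Icc c d, v (atHeight x z) = !₂[ε * Real.cos (θ z), Real.sin (θ z), 0]) :
    θ d - θ c = -∫ t in c..d, rate ε v (atHeight x t) := by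
  have hε : (ε : ℂ) ≠ 0 := by rcases h.sign with h | h <;> rw [h] <;> norm_num
  have hQ : ContinuousOn (fun z => -∫ t in c..z, rate ε v (atHeight x t)) (Icc c d) := by
    apply ContinuousOn.neg
    have := intervalIntegral.continuousOn_primitive_interval'
      (f := fun t => rate ε v (atHeight x t)) (μ := MeasureTheory.volume) (a := c) (b₁ := c)
      (b₂ := d) ?_ left_mem_uIcc
    · rwa [uIcc_of_le hcd] at this
    · apply ContinuousOn.intervalIntegrable
      rw [uIcc_of_le hcd]
      exact fun t ht => ((h.contDiffAt_rate (hΩ t ht)).continuousAt.comp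
        (continuous_atHeight x).continuousAt).continuousWithinAt
  have := sub_eq_sub_of_exp_eq hcd hθ hQ (u := Complex.exp (Complex.I * θ c))
    (fun z hz => by
      have h1 := h.horiz_eq_exp hΩ hR hz
      rw [hv z hz, hv c ⟨le_rfl, hcd⟩, horiz_exp_eq, horiz_exp_eq, mul_assoc] at h1
      have h2 := mul_left_cancel₀ hε h1
      rw [h2]
      push_cast
      ring_nf)
  rw [this]
  simp

theorem exists_angle (h : IsLocalField k ε Ω v) {x : R3} {c d : ℝ} (hcd : c ≤ d)
    (hΩ : ∀ z ∈ Icc c d, atHeight x z ∈ Ω) (hR : ∀ z ∈ Icc c d, atHeight x z ∈ k.region) :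
    ∃ θ : ℝ → ℝ, ContinuousOn θ (Icc c d) ∧
      (∀ z ∈ Icc c d, v (atHeight x z) = !₂[ε * Real.cos (θ z), Real.sin (θ z), 0]) := by
  have hε2 := h.eps_sq
  have hc : c ∈ Icc c d := ⟨le_rfl, hcd⟩
  set A := horiz ε (v (atHeight x c)) with hA
  have hn : ‖(ε : ℂ) * A‖ = 1 := by
    have h1 := h.norm_horiz (hΩ c hc) (hR c hc)
    rw [Complex.norm_def, Real.sqrt_eq_one, Complex.normSq_apply]
    simp [hA, horiz]
    linear_combination h1 + (v (atHeight x c) 0 ^ 2 + v (atHeight x c) 1 ^ 2 * (ε * ε + 1)) * hε2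
  have harg : (ε : ℂ) * A = Complex.exp (Complex.I * Complex.arg (ε * A)) := by
    have := Complex.norm_mul_exp_arg_mul_I ((ε : ℂ) * A)
    rw [hn] at this
    rw [mul_comm Complex.I]
    simpa using this.symm
  refine ⟨fun z => Complex.arg (ε * A) - ∫ t in c..z, rate ε v (atHeight x t), ?_, ?_⟩
  · apply continuousOn_const.sub
    have := intervalIntegral.continuousOn_primitive_interval'
      (f := fun t => rate ε v (atHeight x t)) (μ := MeasureTheory.volume) (a := c) (b₁ := c)
      (b₂ := d) ?_ left_mem_uIcc
    · rwa [uIcc_of_le hcd] at this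
    · apply ContinuousOn.intervalIntegrable
      rw [uIcc_of_le hcd]
      exact fun t ht => ((h.contDiffAt_rate (hΩ t ht)).continuousAt.comp
        (continuous_atHeight x).continuousAt).continuousWithinAt
  · intro z hz
    have h1 := h.horiz_eq_exp hΩ hR hz
    have h2 : (ε : ℂ) * horiz ε (v (atHeight x z)) = Complex.exp (Complex.I *
        ((Complex.arg (ε * A) - ∫ t in c..z, rate ε v (atHeight x t) : ℝ) : ℂ)) := by
      rw [h1, ← hA, ← mul_assoc, harg, ← Complex.exp_add]
      push_cast
      congr 1
      rw [← harg]
      ring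
    set φ := Complex.arg (ε * A) - ∫ t in c..z, rate ε v (atHeight x t) with hφ
    have h3 : horiz ε (v (atHeight x z)) = horiz ε !₂[ε * Real.cos φ, Real.sin φ, 0] := by
      rw [horiz_exp_eq, ← h2, ← mul_assoc]
      have : (ε : ℂ) * ε = 1 := by exact_mod_cast hε2
      rw [this, one_mul]
    have hε0 : ε ≠ 0 := by rintro h0; rw [h0] at hε2; norm_num at hε2
    have h4 := Complex.ext_iff.1 h3
    simp only [horiz] at h4
    apply R3_ext
    · exact h4.1
    · exact mul_left_cancel₀ hε0 h4.2
    · exact h.vert _ (hΩ z hz) (hR z hz)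

end IsLocalField

end LocalField

end

noncomputable section

/-! ### The end points of the fibers in the models. -/

section Segments

open scoped Classical in
/-- The lower end of the vertical segment of the region through `x`. -/
def segBot (k : LocalModel) (x : R3) : ℝ :=
  if k = .double ∧ x 1 < 0 ∧ 4 ≤ x 2 then 4
  else if (k = .branch ∨ k = .double ∨ k = .bdryBranch) ∧ x 0 < 0 ∧ 2 ≤ x 2 then 2 else 0

open scoped Classical in
/-- The upper end of the vertical segment of the region through `x`. -/
def segTop (k : LocalModel) (x : R3) : ℝ :=
  if (k = .branch ∨ k = .double ∨ k = .bdryBranch) ∧ x 0 < 0 ∧ x 2 ≤ 1 then 1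
  else if k = .double ∧ x 1 < 0 ∧ x 2 ≤ 3 then 3 else 5

variable {k : LocalModel} {x : R3}

theorem segBot_le (hx : x ∈ k.region) : segBot k x ≤ x 2 := by
  rw [mem_region_iff] at hx; unfold segBot; split_ifs <;> grind

theorem le_segTop (hx : x ∈ k.region) : x 2 ≤ segTop k x := by
  rw [mem_region_iff] at hx; unfold segTop; split_ifs <;> grind

theorem segBot_nonneg : 0 ≤ segBot k x := by unfold segBot; split_ifs <;> norm_num

theorem segTop_le : segTop k x ≤ 5 := by unfold segTop; split_ifs <;> norm_num

theorem segBot_lt_segTop (hx : x ∈ k.region) : segBot k x + 1 ≤ segTop k x := by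
  rw [mem_region_iff] at hx; unfold segBot segTop; split_ifs <;> grind

theorem mem_region_of_mem_seg (hx : x ∈ k.region) {t : ℝ}
    (ht : t ∈ Icc (segBot k x) (segTop k x)) : atHeight x t ∈ k.region := by
  obtain ⟨h1, h2⟩ := ht
  rw [mem_region_iff] at hx ⊢
  simp only [atHeight_zero, atHeight_one, atHeight_two]
  unfold segBot at h1; unfold segTop at h2
  split_ifs at h1 h2 <;> grind

/-- The slits have height one, so half a unit beyond the end of a fiber no other sheet has been
reached. -/
theorem notMem_region_below {t : ℝ} (h1 : segBot k x - 1 / 2 ≤ t)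
    (h2 : t < segBot k x) : atHeight x t ∉ k.region := by
  rw [mem_region_iff]
  simp only [atHeight_zero, atHeight_one, atHeight_two]
  unfold segBot at h1 h2
  split_ifs at h1 h2 <;> grind

theorem notMem_region_above {t : ℝ} (h1 : segTop k x < t)
    (h2 : t ≤ segTop k x + 1 / 2) : atHeight x t ∉ k.region := by
  rw [mem_region_iff]
  simp only [atHeight_zero, atHeight_one, atHeight_two]
  unfold segTop at h1 h2
  split_ifs at h1 h2 <;> grind

theorem segBot_atHeight (hx : x ∈ k.region) {t : ℝ}
    (ht : t ∈ Icc (segBot k x) (segTop k x)) : segBot k (atHeight x t) = segBot k x := by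
  obtain ⟨h1, h2⟩ := ht
  rw [mem_region_iff] at hx
  unfold segBot at h1 ⊢; unfold segTop at h2
  simp only [atHeight_zero, atHeight_one, atHeight_two]
  split_ifs at h1 h2 ⊢ <;> grind

theorem segBot_congr {x y : R3} (h0 : x 0 < 0 ↔ y 0 < 0) (h1 : x 1 < 0 ↔ y 1 < 0)
    (h2 : x 2 = y 2) : segBot k x = segBot k y := by
  unfold segBot; split_ifs <;> grind

theorem segTop_congr {x y : R3} (h0 : x 0 < 0 ↔ y 0 < 0) (h1 : x 1 < 0 ↔ y 1 < 0)
    (h2 : x 2 = y 2) : segTop k x = segTop k y := by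
  unfold segTop; split_ifs <;> grind

/-- A saturated set contains whole fibers, and also the margins of length `1 / 2` at both ends,
which lie in the box outside the region. -/
theorem IsSaturated.atHeight_mem {Ω : Set R3} (h : IsSaturated k Ω) (hx : x ∈ Ω)
    (hxR : x ∈ k.region) {t : ℝ}
    (ht : t ∈ Icc (segBot k x - 1 / 2) (segTop k x + 1 / 2)) : atHeight x t ∈ Ω := by
  have hb := segBot_nonneg (k := k) (x := x)
  have hT := segTop_le (k := k) (x := x)
  have hbox : atHeight x t ∈ modelBox :=
    atHeight_mem_modelBox (h.subset hx) (by linarith [ht.1]) (by linarith [ht.2])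
  by_cases h1 : t < segBot k x
  · exact h.diff_subset ⟨hbox, notMem_region_below ht.1 h1⟩
  by_cases h2 : segTop k x < t
  · exact h.diff_subset ⟨hbox, notMem_region_above h2 ht.2⟩
  · refine h.mem x hx t fun s hs => mem_region_of_mem_seg hxR ?_
    exact ordConnected_Icc.uIcc_subset ⟨segBot_le hxR, le_segTop hxR⟩
      ⟨not_lt.1 h1, not_lt.1 h2⟩ hs

end Segments

/-! ### Smooth dependence of vertical primitives. -/

section Primitive

/-- A function that is smooth on a neighborhood of a compact set agrees near this set with a smooth
function with compact support. -/
theorem exists_contDiff_eventuallyEq {f : R3 → ℝ} {K Ω : Set R3} (hK : IsCompact K)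
    (hΩ : IsOpen Ω) (hKΩ : K ⊆ Ω) (hf : ∀ x ∈ Ω, ContDiffAt ℝ ∞ f x) :
    ∃ g : R3 → ℝ, ContDiff ℝ ∞ g ∧ HasCompactSupport g ∧ ∃ U, IsOpen U ∧ K ⊆ U ∧ U ⊆ Ω ∧
      ∀ x ∈ U, g x = f x := by
  obtain ⟨L, hL, hKL, hLΩ⟩ := exists_compact_between hK hΩ hKΩ
  obtain ⟨L', hL', hLL', hLΩ'⟩ := exists_compact_between hL hΩ hLΩ
  obtain ⟨χ, h0, h1, -⟩ := exists_contMDiffMap_zero_one_of_isClosed (n := (⊤ : ℕ∞)) 𝓘(ℝ, R3)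
    (s := (interior L')ᶜ) (t := L) isOpen_interior.isClosed_compl hL.isClosed
    (disjoint_compl_left_iff_subset.2 hLL')
  have hχ : ContDiff ℝ ∞ χ := contMDiff_iff_contDiff.1 χ.contMDiff
  have hsupp : tsupport χ ⊆ L' := by
    apply closure_minimal _ hL'.isClosed
    intro x hx
    by_contra hx'
    exact hx (h0 fun h => hx' (interior_subset h))
  refine ⟨fun x => χ x * f x, ?_, ?_, interior L, isOpen_interior, hKL,
    interior_subset.trans hLΩ, ?_⟩
  · rw [contDiff_iff_contDiffAt]
    intro x
    by_cases hx : x ∈ Ω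
    · exact hχ.contDiffAt.mul (hf x hx)
    · have h2 : (fun x => χ x * f x) =ᶠ[𝓝 x] fun _ => 0 := by
        have : x ∉ tsupport χ := fun h => hx (hLΩ' (hsupp h))
        filter_upwards [notMem_tsupport_iff_eventuallyEq.1 this] with y hy
        simp [hy]
      exact contDiffAt_const.congr_of_eventuallyEq h2
  · exact HasCompactSupport.of_support_subset_isCompact hL' fun x hx => hsupp
      (subset_tsupport _ (left_ne_zero_of_mul hx))
  · intro x hx
    have : χ x = 1 := h1 (interior_subset hx)
    simp [this]

open MeasureTheory in
-- The integral is a difference of two integrals from `-∞`. Each is the convolution, on the vertical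
-- line, of `g` with the indicator function of a half line; smoothness in the parameter and in the
-- end point follows from that of convolutions with parameters.
theorem contDiff_primitive {g : R3 → ℝ} (hg : ContDiff ℝ ∞ g) (hs : HasCompactSupport g) (c : ℝ) :
    ContDiff ℝ ∞ fun x : R3 => ∫ t in c..x 2, g (atHeight x t) := by
  have hsmooth : ContDiff ℝ ∞ fun q : R3 × ℝ => atHeight q.1 q.2 := by
    rw [contDiff_euclidean]
    intro i
    fin_cases i
    · change ContDiff ℝ ∞ fun q : R3 × ℝ => q.1 0
      fun_prop
    · change ContDiff ℝ ∞ fun q : R3 × ℝ => q.1 1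
      fun_prop
    · change ContDiff ℝ ∞ fun q : R3 × ℝ => q.2
      fun_prop
  set S : Set ℝ := (fun x : R3 => x 2) '' tsupport g with hS
  have hScomp : IsCompact S := hs.isCompact.image (by fun_prop)
  have hzero : ∀ x t, t ∉ S → g (atHeight x t) = 0 := by
    intro x t ht
    by_contra h
    exact ht ⟨atHeight x t, subset_tsupport _ h, rfl⟩
  set P : R3 × ℝ → ℝ := fun q => ∫ t in Iic q.2, g (atHeight q.1 t) with hP
  have hPs : ContDiff ℝ ∞ P := by
    have h1 := contDiffOn_convolution_right_with_param (𝕜 := ℝ) (n := ⊤) (μ := volume)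
      (f := indicator (Ici (0 : ℝ)) (fun _ => (1 : ℝ))) (ContinuousLinearMap.mul ℝ ℝ)
      (g := fun (x : R3) (t : ℝ) => g (atHeight x t)) (s := univ) (k := S) isOpen_univ hScomp
      (fun p x _ hx => hzero p x hx)
      ((locallyIntegrable_const (1 : ℝ)).indicator measurableSet_Ici)
      (hg.comp hsmooth).contDiffOn
    rw [univ_prod_univ, contDiffOn_univ] at h1
    convert h1 using 1
    funext q
    simp only [hP, convolution, ContinuousLinearMap.mul_apply']
    rw [← integral_sub_left_eq_self _ volume q.2, ← integral_indicator measurableSet_Iic]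
    congr 1
    funext t
    by_cases ht : t ≤ q.2
    · simp [indicator, ht]
    · simp [indicator, ht]
  have hint : ∀ x : R3, Integrable (fun t => g (atHeight x t)) := by
    intro x
    apply Continuous.integrable_of_hasCompactSupport
    · exact hg.continuous.comp (continuous_atHeight x)
    · exact HasCompactSupport.of_support_subset_isCompact hScomp fun t ht => by
        by_contra h
        exact ht (hzero x t h)
  have heq : (fun x : R3 => ∫ t in c..x 2, g (atHeight x t)) = fun x => P (x, x 2) - P (x, c) := by
    funext x
    rw [hP]
    simp only
    rw [intervalIntegral.integral_Iic_sub_Iic (hint x).integrableOn (hint x).integrableOn]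
  rw [heq]
  exact (hPs.comp (by fun_prop)).sub (hPs.comp (by fun_prop))

end Primitive

/-! ### The angle between two fields with the same total rotation. -/

section Difference

open scoped Classical in
/-- The difference between the angles of the fields `v` and `v'`, computed from the lower end of the
vertical segments of the region. -/
def angleDiff (k : LocalModel) (ε : ℝ) (Ω : Set R3) (v v' : R3 → R3) (x : R3) : ℝ :=
  if x ∈ k.region ∧ x ∈ Ω then
    ∫ t in segBot k x..x 2, (rate ε v (atHeight x t) - rate ε v' (atHeight x t)) else 0

/-- Two local fields that agree off the region and have the same total rotation along the vertical
segments of the region. -/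
structure IsFieldPair (k : LocalModel) (ε : ℝ) (Ω : Set R3) (v v' : R3 → R3) : Prop where
  left : IsLocalField k ε Ω v
  right : IsLocalField k ε modelBox v'
  eq_off : ∀ x ∈ modelBox, x ∉ k.region → v x = v' x
  balanced : ∀ x ∈ Ω, x ∈ k.region → x 0 ≠ 0 → x 1 ≠ 0 →
    ∫ t in segBot k x..segTop k x, (rate ε v (atHeight x t) - rate ε v' (atHeight x t)) = 0

namespace IsFieldPair

variable {k : LocalModel} {ε : ℝ} {Ω : Set R3} {v v' : R3 → R3}

theorem smooth_sub (h : IsFieldPair k ε Ω v v') {x : R3} (hx : x ∈ Ω) :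
    ContDiffAt ℝ ∞ (fun y => rate ε v y - rate ε v' y) x :=
  (h.left.contDiffAt_rate hx).sub (h.right.contDiffAt_rate (h.left.sat.subset hx))

theorem eventually_eq_off (h : IsFieldPair k ε Ω v v') {x : R3} (hx : x ∈ modelBox)
    (hxR : x ∉ k.region) : v =ᶠ[𝓝 x] v' := by
  filter_upwards [isOpen_modelBox.mem_nhds hx, (isClosed_region k).isOpen_compl.mem_nhds hxR]
    with y hy hyR using h.eq_off y hy hyR

theorem rate_eq_off (h : IsFieldPair k ε Ω v v') {x : R3} (hx : x ∈ modelBox)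
    (hxR : x ∉ k.region) : rate ε v x - rate ε v' x = 0 := by
  have h1 := h.eventually_eq_off hx hxR
  unfold rate
  rw [h1.fderiv_eq, h1.eq_of_nhds, sub_self]

theorem eventually_tube {U : Set R3} (hU : IsOpen U) {x : R3} {a b : ℝ}
    (hx : ∀ t ∈ Icc a b, atHeight x t ∈ U) : ∀ᶠ y in 𝓝 x, ∀ t ∈ Icc a b, atHeight y t ∈ U := by
  have hc : Continuous fun q : R3 × ℝ => atHeight q.1 q.2 := by
    have : (fun q : R3 × ℝ => atHeight q.1 q.2) =
        fun q => q.1 + (q.2 - q.1 2) • stdVec 2 := funext fun q => atHeight_eq_add _ _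
    rw [this]
    fun_prop
  refine isCompact_Icc.eventually_forall_of_forall_eventually fun t ht => ?_
  exact hc.continuousAt.eventually (hU.mem_nhds (hx t ht))

/-- The hypothesis only concerns fibers off the coordinate planes. The others are limits of such
fibers with the same ends, and the integral is continuous. -/
theorem balanced_all (h : IsFieldPair k ε Ω v v') {x : R3} (hx : x ∈ Ω) (hxR : x ∈ k.region) :
    ∫ t in segBot k x..segTop k x, (rate ε v (atHeight x t) - rate ε v' (atHeight x t)) = 0 := by
  have hbt : segBot k x ≤ segTop k x := by linarith [segBot_lt_segTop hxR]
  set K : Set R3 := atHeight x '' Icc (segBot k x) (segTop k x) with hK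
  have hKc : IsCompact K := isCompact_Icc.image (continuous_atHeight x)
  have hKΩ : K ⊆ Ω := by
    rintro _ ⟨t, ht, rfl⟩
    exact h.left.sat.atHeight_mem hx hxR ⟨by linarith [ht.1], by linarith [ht.2]⟩
  obtain ⟨g, hg, hgs, U, hU, hKU, hUΩ, hgU⟩ := exists_contDiff_eventuallyEq hKc h.left.sat.isOpen
    hKΩ (fun y hy => h.smooth_sub hy)
  -- Moving in this direction stays in the region by `region_mono`. For a small positive
  -- displacement no coordinate changes from negative to nonnegative, so `segBot` and `segTop` are
  -- unchanged, and no coordinate is zero any more.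
  set w : R3 := !₂[1, 1, 0] with hw
  have htube := eventually_tube hU (x := x) (fun t ht => hKU ⟨t, ht, rfl⟩)
  have hcont : Continuous fun δ : ℝ => ∫ t in segBot k x..segTop k x,
      g (atHeight (x + δ • w) t) := by
    apply intervalIntegral.continuous_parametric_intervalIntegral_of_continuous'
    apply hg.continuous.comp
    have : (fun q : ℝ × ℝ => atHeight (x + q.1 • w) q.2) =
        fun q => (x + q.1 • w) + (q.2 - (x + q.1 • w) 2) • stdVec 2 :=
      funext fun q => atHeight_eq_add _ _
    change Continuous fun q : ℝ × ℝ => atHeight (x + q.1 • w) q.2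
    rw [this]
    fun_prop
  have hline : ContinuousAt (fun δ : ℝ => x + δ • w) 0 := by fun_prop
  have hx0 : x + (0 : ℝ) • w = x := by simp
  have hsmall : ∀ s : ℝ, ∀ᶠ δ in 𝓝[>] (0 : ℝ), (s < 0 ↔ s + δ < 0) ∧ s + δ ≠ 0 := by
    intro s
    rcases lt_or_ge s 0 with hs | hs
    · filter_upwards [Ioo_mem_nhdsGT (neg_pos.2 hs)] with δ hδ
      exact ⟨⟨fun _ => by linarith [hδ.2], fun _ => hs⟩, by linarith [hδ.2] |> ne_of_lt⟩
    · filter_upwards [self_mem_nhdsWithin] with δ hδ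
      have hδ' : 0 < δ := hδ
      exact ⟨⟨fun h => by linarith, fun h => by linarith⟩, (by linarith : 0 < s + δ).ne'⟩
  have hzero : ∀ᶠ δ in 𝓝[>] (0 : ℝ), ∫ t in segBot k x..segTop k x,
      g (atHeight (x + δ • w) t) = 0 := by
    rw [← hx0] at htube
    filter_upwards [nhdsWithin_le_nhds (hline.eventually htube), hsmall (x 0), hsmall (x 1),
      self_mem_nhdsWithin] with δ h1 h2 h3 h4
    have hδ : (0 : ℝ) < δ := h4
    rw [hx0] at h1
    have e0 : (x + δ • w) 0 = x 0 + δ := by simp [hw]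
    have e1 : (x + δ • w) 1 = x 1 + δ := by simp [hw]
    have e2 : (x + δ • w) 2 = x 2 := by simp [hw]
    have hyR : x + δ • w ∈ k.region :=
      region_mono k hxR (by rw [e0]; linarith) (by rw [e1]; linarith) e2.symm
    have hyΩ : x + δ • w ∈ Ω := by
      have := hUΩ (h1 (x 2) ⟨segBot_le hxR, le_segTop hxR⟩)
      rwa [← e2, atHeight_self] at this
    have hb := h.balanced _ hyΩ hyR (by rw [e0]; exact h2.2) (by rw [e1]; exact h3.2)
    rw [← segBot_congr (x := x) (by rw [e0]; exact h2.1) (by rw [e1]; exact h3.1) e2.symm,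
      ← segTop_congr (x := x) (by rw [e0]; exact h2.1) (by rw [e1]; exact h3.1) e2.symm] at hb
    rw [← hb]
    apply intervalIntegral.integral_congr
    intro t ht
    rw [uIcc_of_le hbt] at ht
    exact hgU _ (h1 t ht)
  have hlim : ∫ t in segBot k x..segTop k x, g (atHeight (x + (0 : ℝ) • w) t) = 0 :=
    tendsto_nhds_unique (hcont.continuousAt.tendsto.mono_left nhdsWithin_le_nhds)
      (tendsto_const_nhds.congr' (by filter_upwards [hzero] with δ hδ using hδ.symm))
  rw [hx0] at hlim
  rw [← hlim]
  apply intervalIntegral.integral_congr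
  intro t ht
  rw [uIcc_of_le hbt] at ht
  exact (hgU _ (hKU ⟨t, ht, rfl⟩)).symm

theorem angleDiff_of_mem {x : R3} (hx : x ∈ Ω) (hxR : x ∈ k.region) : angleDiff k ε Ω v v' x =
    ∫ t in segBot k x..x 2, (rate ε v (atHeight x t) - rate ε v' (atHeight x t)) := by
  rw [angleDiff, if_pos ⟨hxR, hx⟩]

theorem angleDiff_off {x : R3} (hxR : x ∉ k.region) : angleDiff k ε Ω v v' x = 0 := by
  rw [angleDiff, if_neg fun h => hxR h.1]

theorem angleDiff_atHeight (hs : IsSaturated k Ω) {x : R3} (hx : x ∈ Ω) (hxR : x ∈ k.region)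
    {t : ℝ} (ht : t ∈ Icc (segBot k x) (segTop k x)) : angleDiff k ε Ω v v' (atHeight x t) =
    ∫ s in segBot k x..t, (rate ε v (atHeight x s) - rate ε v' (atHeight x s)) := by
  rw [angleDiff_of_mem (hs.atHeight_mem hx hxR ⟨by linarith [ht.1], by linarith [ht.2]⟩)
    (mem_region_of_mem_seg hxR ht), segBot_atHeight hxR ht]
  rfl

/-- The angle difference is a primitive, along vertical lines, of the difference of the rates. -/
theorem integral_eq_angleDiff (h : IsFieldPair k ε Ω v v') {y : R3} {c d : ℝ} {g : ℝ → ℝ}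
    (hg : Continuous g) (hbox : ∀ t ∈ Icc c d, atHeight y t ∈ Ω)
    (hgv : ∀ t ∈ Icc c d, g t = rate ε v (atHeight y t) - rate ε v' (atHeight y t))
    (hc : atHeight y c ∉ k.region) {z : ℝ} (hz : z ∈ Icc c d) :
    ∫ t in c..z, g t = angleDiff k ε Ω v v' (atHeight y z) := by
  have hs := h.left.sat
  have hg0 : ∀ t ∈ Icc c d, atHeight y t ∉ k.region → g t = 0 := fun t ht htR => by
    rw [hgv t ht, h.rate_eq_off (hs.subset (hbox t ht)) htR]
  have hii : ∀ a b, IntervalIntegrable g MeasureTheory.volume a b :=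
    fun a b => hg.intervalIntegrable a b
  -- The aim is to show that `H` is locally constant; it vanishes at `c`.
  set H : ℝ → ℝ := fun z => (∫ t in c..z, g t) - angleDiff k ε Ω v v' (atHeight y z) with hH
  have hdiff : ∀ a b, H b - H a = (∫ t in a..b, g t) -
      (angleDiff k ε Ω v v' (atHeight y b) - angleDiff k ε Ω v v' (atHeight y a)) := by
    intro a b
    simp only [hH]
    rw [← intervalIntegral.integral_add_adjacent_intervals (hii c a) (hii a b)]
    ring
  have hzeroint : ∀ a b, (∀ t ∈ Ioo (min a b) (max a b), g t = 0) → ∫ t in a..b, g t = 0 := by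
    intro a b hab
    rcases eq_or_ne a b with rfl | hne
    · simp
    have hcl : closure (Ioo (min a b) (max a b)) = Icc (min a b) (max a b) :=
      closure_Ioo (by simpa using hne)
    have h2 := closure_minimal (s := Ioo (min a b) (max a b)) (fun t ht => hab t ht)
      (isClosed_eq hg continuous_const)
    rw [hcl] at h2
    rw [intervalIntegral.integral_congr (g := fun _ => 0) fun t ht => h2 ht]
    simp
  -- Inside a fiber this is additivity of the integral. Beyond the top end `angleDiff` drops to zero
  -- by definition, and the balance condition says that it was already zero there; at the bottom end
  -- it starts from zero. In the gaps the integrand vanishes.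
  have hseg : ∀ x : ℝ, x ∈ Icc c d → atHeight y x ∈ k.region → ∀ b ∈ Icc c d,
      segBot k (atHeight y x) - 1 / 2 < b → b < segTop k (atHeight y x) + 1 / 2 → H b = H x := by
    intro x hx hxR b hb hb1 hb2
    have hxΩ := hbox x hx
    set p := atHeight y x with hp
    have hpx : p 2 = x := rfl
    have hp1 := segBot_le hxR
    have hp2 := le_segTop hxR
    rw [hpx] at hp1 hp2
    set f : ℝ → ℝ := fun t => rate ε v (atHeight p t) - rate ε v' (atHeight p t) with hf
    have hD : ∀ t ∈ Icc (segBot k p) (segTop k p), angleDiff k ε Ω v v' (atHeight y t) =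
        ∫ s in segBot k p..t, f s := fun t ht => angleDiff_atHeight hs hxΩ hxR ht
    have hfc : ContinuousOn f (Icc (segBot k p) (segTop k p)) := fun t ht =>
      ((h.smooth_sub (hs.atHeight_mem hxΩ hxR ⟨by linarith [ht.1], by linarith [ht.2]⟩)).continuousAt.comp
        (continuous_atHeight p).continuousAt).continuousWithinAt
    have hfi : ∀ a ∈ Icc (segBot k p) (segTop k p), ∀ b ∈ Icc (segBot k p) (segTop k p),
        IntervalIntegrable f MeasureTheory.volume a b := fun a ha b hb =>
      (hfc.mono (ordConnected_Icc.uIcc_subset ha hb)).intervalIntegrable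
    have hbot : segBot k p ∈ Icc (segBot k p) (segTop k p) := ⟨le_rfl, hp1.trans hp2⟩
    have htop : segTop k p ∈ Icc (segBot k p) (segTop k p) := ⟨hp1.trans hp2, le_rfl⟩
    have hin : ∀ b ∈ Icc c d, b ∈ Icc (segBot k p) (segTop k p) → H b = H x := by
      intro b hb hbs
      have h1 := hdiff x b
      rw [hD b hbs, hp, hD x ⟨hp1, hp2⟩] at h1
      have h2 := intervalIntegral.integral_add_adjacent_intervals (hfi _ hbot x ⟨hp1, hp2⟩)
        (hfi x ⟨hp1, hp2⟩ b hbs)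
      have h3 : ∫ t in x..b, g t = ∫ t in x..b, f t :=
        intervalIntegral.integral_congr fun t ht => hgv t (ordConnected_Icc.uIcc_subset hx hb ht)
      linarith
    by_cases hbt : segTop k p < b
    · have htcd : segTop k p ∈ Icc c d := ⟨hx.1.trans hp2, hbt.le.trans hb.2⟩
      rw [← hin _ htcd htop, ← sub_eq_zero, hdiff, hD _ htop]
      have h1 : atHeight y b ∉ k.region := notMem_region_above (x := p) hbt hb2.le
      have h2 : ∫ s in segBot k p..segTop k p, f s = 0 := h.balanced_all hxΩ hxR
      rw [angleDiff_off h1, h2, sub_zero, sub_zero]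
      apply hzeroint
      intro t ht
      rw [min_eq_left hbt.le, max_eq_right hbt.le] at ht
      exact hg0 t ⟨htcd.1.trans ht.1.le, ht.2.le.trans hb.2⟩
        (notMem_region_above (x := p) ht.1 (by linarith [ht.2]))
    by_cases hbb : b < segBot k p
    · have hbcd : segBot k p ∈ Icc c d := ⟨hb.1.trans hbb.le, hp1.trans hx.2⟩
      rw [← hin _ hbcd hbot, ← sub_eq_zero, hdiff, hD _ hbot]
      have h1 : atHeight y b ∉ k.region := notMem_region_below (x := p) hb1.le hbb
      rw [angleDiff_off h1, intervalIntegral.integral_same, sub_zero, sub_zero]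
      apply hzeroint
      intro t ht
      rw [min_eq_right hbb.le, max_eq_left hbb.le] at ht
      exact hg0 t ⟨hb.1.trans ht.1.le, ht.2.le.trans hbcd.2⟩
        (notMem_region_below (x := p) (by linarith [ht.1]) ht.2)
    exact hin b hb ⟨not_lt.1 hbb, not_lt.1 hbt⟩
  have hloc : ∀ x ∈ Icc c d, ∀ᶠ b in 𝓝 x, b ∈ Icc c d → H b = H x := by
    intro x hx
    by_cases hxR : atHeight y x ∈ k.region
    · have h1 := segBot_le hxR
      have h2 := le_segTop hxR
      rw [atHeight_two] at h1 h2
      filter_upwards [Ioo_mem_nhds (by linarith : segBot k (atHeight y x) - 1 / 2 < x)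
        (by linarith : x < segTop k (atHeight y x) + 1 / 2)] with b hb hbc
      exact hseg x hx hxR b hbc hb.1 hb.2
    · have h1 : ∀ᶠ b in 𝓝 x, atHeight y b ∉ k.region :=
        (continuous_atHeight y).continuousAt.eventually
          ((isClosed_region k).isOpen_compl.mem_nhds hxR)
      obtain ⟨r, hr, hb⟩ := Metric.eventually_nhds_iff_ball.1 h1
      filter_upwards [Metric.ball_mem_nhds x hr] with b hbr hbc
      rw [← sub_eq_zero, hdiff, angleDiff_off hxR, angleDiff_off (hb b hbr), sub_zero, sub_zero]
      apply hzeroint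
      intro t ht
      have ht' : t ∈ uIcc x b := Ioo_subset_Icc_self ht
      refine hg0 t (ordConnected_Icc.uIcc_subset hx hbc ht') (hb t ?_)
      exact (convex_ball x r).ordConnected.uIcc_subset (Metric.mem_ball_self hr) hbr ht'
  have hconst := constant_of_has_deriv_right_zero (f := H) (a := c) (b := d)
    (fun x hx => by
      refine tendsto_const_nhds.congr' ?_
      filter_upwards [nhdsWithin_le_nhds (hloc x hx), self_mem_nhdsWithin] with b h1 h2
      exact (h1 h2).symm)
    (fun x hx => by
      refine (hasDerivWithinAt_const x (Ici x) (H x)).congr_of_eventuallyEq ?_ rfl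
      filter_upwards [nhdsWithin_le_nhds (hloc x (Ico_subset_Icc_self hx)),
        Icc_mem_nhdsGE_of_mem hx] with b h1 h2 using h1 h2) z hz
  have hHc : H c = 0 := by simp [hH, angleDiff_off hc]
  rw [hHc] at hconst
  exact sub_eq_zero.1 hconst

/-- When the vertical line through `x` meets several sheets after a small displacement, the lower
end `segBot` jumps. Integrating instead from a fixed height `c` just below the fiber of `x` gives
the same value on all neighboring lines, because each sheet met on the way contributes zero. This is
why `angleDiff` is smooth across the branch locus and at the ends of the fibers. -/
theorem angleDiff_eventuallyEq (h : IsFieldPair k ε Ω v v') {x : R3} (hx : x ∈ Ω)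
    (hxR : x ∈ k.region) : ∃ (g : R3 → ℝ) (c : ℝ), ContDiff ℝ ∞ g ∧ HasCompactSupport g ∧
      g x = rate ε v x - rate ε v' x ∧
      angleDiff k ε Ω v v' =ᶠ[𝓝 x] fun y => ∫ t in c..y 2, g (atHeight y t) := by
  set c := segBot k x - 1 / 2 with hc
  set d := segTop k x + 1 / 2 with hd
  have hb := segBot_le hxR
  have ht := le_segTop hxR
  set K : Set R3 := atHeight x '' Icc c d with hK
  have hKc : IsCompact K := isCompact_Icc.image (continuous_atHeight x)
  have hKΩ : K ⊆ Ω := by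
    rintro _ ⟨t, ht, rfl⟩
    exact h.left.sat.atHeight_mem hx hxR ht
  obtain ⟨g, hg, hgs, U, hU, hKU, hUΩ, hgU⟩ := exists_contDiff_eventuallyEq hKc h.left.sat.isOpen
    hKΩ (fun y hy => h.smooth_sub hy)
  have hx2 : x 2 ∈ Icc c d := ⟨by linarith, by linarith⟩
  refine ⟨g, c, hg, hgs, ?_, ?_⟩
  · apply hgU
    exact hKU ⟨x 2, hx2, atHeight_self x⟩
  have htube := eventually_tube hU (x := x) (fun t ht => hKU ⟨t, ht, rfl⟩)
  have hcR : ∀ᶠ y in 𝓝 x, atHeight y c ∉ k.region := by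
    have h1 : ∀ t ∈ Icc c c, atHeight x t ∈ k.regionᶜ := fun t ht => by
      rw [Icc_self, mem_singleton_iff] at ht
      subst ht
      exact notMem_region_below le_rfl (by linarith)
    filter_upwards [eventually_tube (isClosed_region k).isOpen_compl h1] with y hy
    exact hy c ⟨le_rfl, le_rfl⟩
  have hy2 : ∀ᶠ y : R3 in 𝓝 x, y 2 ∈ Icc c d := by
    have h1 : Continuous fun y : R3 => y 2 := by fun_prop
    exact h1.continuousAt.eventually
      (Icc_mem_nhds (by linarith : c < x 2) (by linarith : x 2 < d))
  filter_upwards [htube, hcR, hy2] with y h1 h2 h3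
  have := h.integral_eq_angleDiff (y := y) (c := c) (d := d) (g := fun t => g (atHeight y t))
    (hg.continuous.comp (continuous_atHeight y)) (fun t ht => hUΩ (h1 t ht))
    (fun t ht => hgU _ (h1 t ht)) h2 h3
  rw [atHeight_self] at this
  exact this.symm

theorem contDiffAt_angleDiff (h : IsFieldPair k ε Ω v v') {x : R3}
    (hx' : x ∈ k.region → x ∈ Ω) : ContDiffAt ℝ ∞ (angleDiff k ε Ω v v') x := by
  by_cases hxR : x ∈ k.region
  · obtain ⟨g, c, hg, hgs, -, heq⟩ := h.angleDiff_eventuallyEq (hx' hxR) hxR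
    exact (contDiff_primitive hg hgs c).contDiffAt.congr_of_eventuallyEq heq
  · have : angleDiff k ε Ω v v' =ᶠ[𝓝 x] fun _ => 0 := by
      filter_upwards [(isClosed_region k).isOpen_compl.mem_nhds hxR] with y hy
      exact angleDiff_off hy
    exact contDiffAt_const.congr_of_eventuallyEq this

theorem fderiv_angleDiff (h : IsFieldPair k ε Ω v v') {x : R3} (hx : x ∈ Ω)
    (hxR : x ∈ k.region) :
    fderiv ℝ (angleDiff k ε Ω v v') x (stdVec 2) = rate ε v x - rate ε v' x := by
  obtain ⟨g, c, hg, hgs, hgx, heq⟩ := h.angleDiff_eventuallyEq hx hxR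
  rw [heq.fderiv_eq, ← hgx]
  have h1 := ((contDiff_primitive hg hgs c).differentiable (by simp) (atHeight x (x 2))).hasFDerivAt
  have h2 := HasFDerivAt.comp_hasDerivAt (x 2) h1 (hasDerivAt_atHeight x (x 2))
  rw [atHeight_self] at h2
  have hgc : Continuous fun t => g (atHeight x t) := hg.continuous.comp (continuous_atHeight x)
  have h3 : HasDerivAt (fun z => ∫ t in c..z, g (atHeight x t)) (g (atHeight x (x 2))) (x 2) :=
    intervalIntegral.integral_hasDerivAt_right (hgc.intervalIntegrable _ _)
      (hgc.stronglyMeasurableAtFilter _ _) hgc.continuousAt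
  rw [atHeight_self] at h3
  exact h2.unique h3

/-- The field `v'` is obtained from `v` by a rotation of angle `angleDiff`. -/
theorem horiz_eq_mul_exp (h : IsFieldPair k ε Ω v v') {x : R3} (hx : x ∈ Ω)
    (hxR : x ∈ k.region) : horiz ε (v' x) =
      horiz ε (v x) * Complex.exp (Complex.I * angleDiff k ε Ω v v' x) := by
  have hs := h.left.sat
  have hb := segBot_le hxR
  have ht := le_segTop hxR
  have hΩ : ∀ z ∈ Icc (segBot k x) (x 2), atHeight x z ∈ Ω := fun z hz =>
    hs.atHeight_mem hx hxR ⟨by linarith [hz.1], by linarith [hz.2]⟩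
  have hR : ∀ z ∈ Icc (segBot k x) (x 2), atHeight x z ∈ k.region := fun z hz =>
    mem_region_of_mem_seg hxR ⟨hz.1, hz.2.trans ht⟩
  have h1 := h.left.horiz_eq_exp hΩ hR ⟨hb, le_rfl⟩
  have h2 := h.right.horiz_eq_exp (fun z hz => hs.subset (hΩ z hz)) hR ⟨hb, le_rfl⟩
  -- The two fields agree just below the fiber, hence at its bottom end by continuity; from there
  -- they rotate at their respective rates.
  have hbot : v (atHeight x (segBot k x)) = v' (atHeight x (segBot k x)) := by
    have hm := hΩ _ ⟨le_rfl, hb⟩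
    have hc1 : ContinuousAt (fun t => v (atHeight x t)) (segBot k x) :=
      (h.left.smooth _ hm).continuousAt.comp (continuous_atHeight x).continuousAt
    have hc2 : ContinuousAt (fun t => v' (atHeight x t)) (segBot k x) :=
      (h.right.smooth _ (hs.subset hm)).continuousAt.comp (continuous_atHeight x).continuousAt
    refine tendsto_nhds_unique (hc1.tendsto.mono_left nhdsWithin_le_nhds)
      ((hc2.tendsto.mono_left (nhdsWithin_le_nhds (s := Iio (segBot k x)))).congr' ?_)
    filter_upwards [Ioo_mem_nhdsLT (by linarith : segBot k x - 1 / 2 < segBot k x)] with t ht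
    refine (h.eq_off _ (hs.subset (hs.atHeight_mem hx hxR ⟨ht.1.le, ?_⟩))
      (notMem_region_below ht.1.le ht.2)).symm
    linarith [ht.2]
  rw [atHeight_self] at h1 h2
  rw [h1, h2, hbot, mul_assoc, ← Complex.exp_add, angleDiff_of_mem hx hxR,
    intervalIntegral.integral_sub]
  · push_cast
    ring_nf
  · apply ContinuousOn.intervalIntegrable
    rw [uIcc_of_le hb]
    exact fun t ht => ((h.left.contDiffAt_rate (hΩ t ht)).continuousAt.comp
      (continuous_atHeight x).continuousAt).continuousWithinAt
  · apply ContinuousOn.intervalIntegrable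
    rw [uIcc_of_le hb]
    exact fun t ht => ((h.right.contDiffAt_rate (hs.subset (hΩ t ht))).continuousAt.comp
      (continuous_atHeight x).continuousAt).continuousWithinAt

end IsFieldPair

end Difference

end

noncomputable section

/-! ### Rotation of the horizontal part of a field. -/

section Rotated

/-- The field `v`, with its horizontal part rotated by the angle `φ`. -/
def rotField (ε : ℝ) (φ : R3 → ℝ) (v : R3 → R3) (x : R3) : R3 :=
  !₂[v x 0 * Real.cos (φ x) - ε * v x 1 * Real.sin (φ x),
    ε * v x 0 * Real.sin (φ x) + v x 1 * Real.cos (φ x), v x 2]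

variable {k : LocalModel} {ε : ℝ} {Ω : Set R3} {φ : R3 → ℝ} {v v' : R3 → R3} {x : R3}

theorem exp_I_mul_eq (a : ℝ) : Complex.exp (Complex.I * a) = ⟨Real.cos a, Real.sin a⟩ := by
  rw [mul_comm, Complex.exp_mul_I, ← Complex.ofReal_cos, ← Complex.ofReal_sin]
  apply Complex.ext <;> simp only [Complex.add_re, Complex.add_im, Complex.mul_re, Complex.mul_im,
    Complex.ofReal_re, Complex.ofReal_im, Complex.I_re, Complex.I_im] <;> ring

theorem rotField_of_exp_eq_one (h : Complex.exp (Complex.I * φ x) = 1) :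
    rotField ε φ v x = v x := by
  rw [exp_I_mul_eq] at h
  have h1 : Real.cos (φ x) = 1 := congrArg Complex.re h
  have h2 : Real.sin (φ x) = 0 := congrArg Complex.im h
  apply R3_ext
  · change v x 0 * Real.cos (φ x) - ε * v x 1 * Real.sin (φ x) = _
    rw [h1, h2]; ring
  · change ε * v x 0 * Real.sin (φ x) + v x 1 * Real.cos (φ x) = _
    rw [h1, h2]; ring
  · rfl

theorem rotField_of_eq_zero (h : φ x = 0) : rotField ε φ v x = v x :=
  rotField_of_exp_eq_one (by simp [h])

theorem horiz_rotField (hε : ε * ε = 1) : horiz ε (rotField ε φ v x) =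
    horiz ε (v x) * Complex.exp (Complex.I * φ x) := by
  rw [exp_I_mul_eq]
  apply Complex.ext
  · simp only [horiz, Complex.mul_re]
    rfl
  · simp only [horiz, Complex.mul_im]
    change ε * (ε * v x 0 * Real.sin (φ x) + v x 1 * Real.cos (φ x)) = _
    linear_combination v x 0 * Real.sin (φ x) * hε

theorem horiz_injective (hε : ε * ε = 1) {a b : R3} (h : horiz ε a = horiz ε b)
    (h2 : a 2 = b 2) : a = b := by
  have h4 := Complex.ext_iff.1 h
  have hε0 : ε ≠ 0 := by rintro h0; rw [h0] at hε; norm_num at hε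
  exact R3_ext h4.1 (mul_left_cancel₀ hε0 h4.2) h2

theorem norm_rotField (hε : ε * ε = 1) : ‖rotField ε φ v x‖ = ‖v x‖ := by
  rw [EuclideanSpace.norm_eq, EuclideanSpace.norm_eq]
  congr 1
  simp only [Fin.sum_univ_three, Real.norm_eq_abs, sq_abs]
  change (v x 0 * Real.cos (φ x) - ε * v x 1 * Real.sin (φ x)) ^ 2 +
    (ε * v x 0 * Real.sin (φ x) + v x 1 * Real.cos (φ x)) ^ 2 + v x 2 ^ 2 = _
  linear_combination (v x 0 ^ 2 + v x 1 ^ 2) * Real.sin_sq_add_cos_sq (φ x) +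
    (v x 0 ^ 2 + v x 1 ^ 2) * Real.sin (φ x) ^ 2 * hε

theorem contDiffAt_rotField (hv : ContDiffAt ℝ ∞ v x) (hφ : ContDiffAt ℝ ∞ φ x) :
    ContDiffAt ℝ ∞ (rotField ε φ v) x := by
  have h3 : ∀ i, ContDiffAt ℝ ∞ (fun y => v y i) x := fun i => contDiffAt_euclidean.1 hv i
  rw [contDiffAt_euclidean]
  intro i
  fin_cases i
  · exact ((h3 0).mul hφ.cos).sub ((contDiffAt_const.mul (h3 1)).mul hφ.sin)
  · exact ((contDiffAt_const.mul (h3 0)).mul hφ.sin).add ((h3 1).mul hφ.cos)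
  · exact h3 2

/-- The horizontal part is multiplied by `exp (iφ)`, while `rate` counts rotation in the opposite
sense; hence the minus sign. -/
theorem rate_rotField (hε : ε * ε = 1) (hv : ContDiffAt ℝ ∞ v x) (hφ : ContDiffAt ℝ ∞ φ x) :
    rate ε (rotField ε φ v) x =
      rate ε v x - (v x 0 ^ 2 + v x 1 ^ 2) * fderiv ℝ φ x (stdVec 2) := by
  have hd := ((contDiffAt_rotField (ε := ε) hv hφ).differentiableAt (by simp)).hasFDerivAt
  have hv' := (hv.differentiableAt (by simp)).hasFDerivAt
  have hφ' := (hφ.differentiableAt (by simp)).hasFDerivAt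
  rw [← atHeight_self x] at hd hv' hφ'
  have hl := hasDerivAt_atHeight x (x 2)
  have h1 : HasDerivAt (fun t => rotField ε φ v (atHeight x t))
      (fderiv ℝ (rotField ε φ v) (atHeight x (x 2)) (stdVec 2)) (x 2) :=
    HasFDerivAt.comp_hasDerivAt (x 2) hd hl
  have h2 : HasDerivAt (fun t => v (atHeight x t))
      (fderiv ℝ v (atHeight x (x 2)) (stdVec 2)) (x 2) := HasFDerivAt.comp_hasDerivAt _ hv' hl
  have h3 : HasDerivAt (fun t => φ (atHeight x t))
      (fderiv ℝ φ (atHeight x (x 2)) (stdVec 2)) (x 2) := HasFDerivAt.comp_hasDerivAt _ hφ' hl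
  rw [atHeight_self] at h1 h2 h3
  have h1' : ∀ i, HasDerivAt (fun t => rotField ε φ v (atHeight x t) i)
      (fderiv ℝ (rotField ε φ v) x (stdVec 2) i) (x 2) :=
    fun i => ((EuclideanSpace.proj i : R3 →L[ℝ] ℝ).hasFDerivAt).comp_hasDerivAt _ h1
  have h2' : ∀ i, HasDerivAt (fun t => v (atHeight x t) i)
      (fderiv ℝ v x (stdVec 2) i) (x 2) :=
    fun i => ((EuclideanSpace.proj i : R3 →L[ℝ] ℝ).hasFDerivAt).comp_hasDerivAt _ h2
  have e0 := (h1' 0).unique (((h2' 0).mul h3.cos).sub (((h2' 1).const_mul ε).mul h3.sin))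
  have e1 := (h1' 1).unique ((((h2' 0).const_mul ε).mul h3.sin).add ((h2' 1).mul h3.cos))
  simp only [atHeight_self] at e0 e1
  unfold rate
  rw [e0, e1]
  change ε * ((ε * v x 0 * Real.sin (φ x) + v x 1 * Real.cos (φ x)) * _ -
    (v x 0 * Real.cos (φ x) - ε * v x 1 * Real.sin (φ x)) * _) = _
  set S := Real.sin (φ x)
  set C := Real.cos (φ x)
  have hSC : S ^ 2 + C ^ 2 = 1 := Real.sin_sq_add_cos_sq (φ x)
  set a := v x 0
  set b := v x 1
  set a' := fderiv ℝ v x (stdVec 2) 0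
  set b' := fderiv ℝ v x (stdVec 2) 1
  set p := fderiv ℝ φ x (stdVec 2)
  linear_combination (ε * (b * a' - a * b') - (a ^ 2 + b ^ 2) * p * (ε * ε)) * hSC +
    (ε * (b * a' - a * b') * S ^ 2 - (a ^ 2 + b ^ 2) * p) * hε

/-- Off the region the angle need only be a multiple of `2π`, not zero. This is what lets a rotation
add full turns to the fibers while leaving the complement unchanged. -/
theorem IsLocalField.rotField (h : IsLocalField k ε Ω v) (hφ : ∀ x ∈ Ω, ContDiffAt ℝ ∞ φ x)
    (hoff : ∀ x ∈ Ω, x ∉ k.region → Complex.exp (Complex.I * φ x) = 1)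
    (hpos : ∀ x ∈ Ω, x ∈ k.region → fderiv ℝ φ x (stdVec 2) < rate ε v x) :
    IsLocalField k ε Ω (rotField ε φ v) where
  sat := h.sat
  sign := h.sign
  smooth x hx := contDiffAt_rotField (h.smooth x hx) (hφ x hx)
  norm_eq x hx := by rw [norm_rotField h.eps_sq, h.norm_eq x hx]
  vert x hx hxR := h.vert x hx hxR
  pos x hx := by
    by_cases hxR : x ∈ k.region
    · rw [h.sat.helicity_eq_rate (contDiffAt_rotField (h.smooth x hx) (hφ x hx))
        (fun y hy hyR => h.vert y hy hyR) hx hxR, rate_rotField h.eps_sq (h.smooth x hx) (hφ x hx),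
        h.norm_horiz hx hxR, one_mul]
      linarith [hpos x hx hxR]
    · have : _root_.rotField ε φ v =ᶠ[𝓝 x] v := by
        filter_upwards [h.sat.isOpen.mem_nhds hx, (isClosed_region k).isOpen_compl.mem_nhds hxR]
          with y hy hyR using rotField_of_exp_eq_one (hoff y hy hyR)
      rw [helicity_congr this]
      exact h.pos x hx

end Rotated

/-! ### Interpolation between two fields. -/

section Interpolation

/-- A cutoff function of the horizontal coordinates. -/
structure IsHorizontalCutoff (ρ : R3 → ℝ) : Prop where
  smooth : ContDiff ℝ ∞ ρ
  nonneg : ∀ x, 0 ≤ ρ x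
  le_one : ∀ x, ρ x ≤ 1
  atHeight : ∀ x t, ρ (atHeight x t) = ρ x
  eq_one : ∀ x, |x 0| ≤ 1 / 2 → |x 1| ≤ 1 / 2 → ρ x = 1
  eq_zero : ∀ x, 3 / 4 ≤ |x 0| ∨ 3 / 4 ≤ |x 1| → ρ x = 0

theorem exists_horizontalCutoff : ∃ ρ, IsHorizontalCutoff ρ := by
  set f : ContDiffBump (0 : ℝ) := ⟨1 / 2, 3 / 4, by norm_num, by norm_num⟩ with hf
  have hz : ∀ t : ℝ, 3 / 4 ≤ |t| → f t = 0 := fun t ht =>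
    f.zero_of_le_dist (by simpa [Real.dist_eq, hf] using ht)
  have ho : ∀ t : ℝ, |t| ≤ 1 / 2 → f t = 1 := fun t ht =>
    f.one_of_mem_closedBall (by simpa [Real.dist_eq, hf] using ht)
  refine ⟨fun x => f (x 0) * f (x 1), ?_, fun x => mul_nonneg f.nonneg f.nonneg,
    fun x => mul_le_one₀ f.le_one f.nonneg f.le_one, fun x t => rfl, fun x h0 h1 => ?_,
    fun x h => ?_⟩
  · exact (f.contDiff.comp (by fun_prop)).mul (f.contDiff.comp (by fun_prop))
  · rw [ho _ h0, ho _ h1, one_mul]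
  · rcases h with h | h <;> simp [hz _ h]

theorem IsHorizontalCutoff.fderiv_vertical {ρ : R3 → ℝ} (hρ : IsHorizontalCutoff ρ) (x : R3) :
    fderiv ℝ ρ x (stdVec 2) = 0 := by
  have h1 := (hρ.smooth.differentiable (by simp) (_root_.atHeight x (x 2))).hasFDerivAt
  have h2 := HasFDerivAt.comp_hasDerivAt (x 2) h1 (hasDerivAt_atHeight x (x 2))
  rw [atHeight_self] at h2
  refine h2.unique ?_
  have : (ρ ∘ _root_.atHeight x) = fun _ => ρ x := funext fun t => hρ.atHeight x t
  rw [this]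
  exact hasDerivAt_const _ _

namespace IsFieldPair

variable {k : LocalModel} {ε : ℝ} {Ω : Set R3} {v v' : R3 → R3} {ρ : R3 → ℝ}

/-- Since `ρ` is constant on vertical lines, the new rate is `(1 - ρ) * rate ε v + ρ * rate ε v'`,
which is positive. The horizontal derivatives of `ρ` play no role. -/
theorem isLocalField_rotField (h : IsFieldPair k ε Ω v v') (hρ : IsHorizontalCutoff ρ) :
    IsLocalField k ε Ω (rotField ε (fun x => ρ x * angleDiff k ε Ω v v' x) v) := by
  refine h.left.rotField (fun x hx => hρ.smooth.contDiffAt.mul (h.contDiffAt_angleDiff fun _ => hx))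
    (fun x hx hxR => by simp [angleDiff_off hxR]) fun x hx hxR => ?_
  rw [fderiv_fun_mul (hρ.smooth.differentiable (by simp) x)
    ((h.contDiffAt_angleDiff fun _ => hx).differentiableAt (by simp))]
  simp only [add_apply, smul_apply, hρ.fderiv_vertical, h.fderiv_angleDiff hx hxR, smul_eq_mul]
  have h1 := h.left.rate_pos hx hxR
  have h2 := h.right.rate_pos (h.left.sat.subset hx) hxR
  have h3 := hρ.nonneg x
  have h4 := hρ.le_one x
  rcases h3.eq_or_lt with h5 | h5
  · rw [← h5]; linarith
  · nlinarith

theorem rotField_eq (h : IsFieldPair k ε Ω v v') {x : R3} (hx : x ∈ Ω) (hρ : ρ x = 1) :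
    rotField ε (fun x => ρ x * angleDiff k ε Ω v v' x) v x = v' x := by
  by_cases hxR : x ∈ k.region
  · apply horiz_injective h.left.eps_sq
    · rw [horiz_rotField h.left.eps_sq, hρ, one_mul, h.horiz_eq_mul_exp hx hxR]
    · change v x 2 = _
      rw [h.left.vert x hx hxR, h.right.vert x (h.left.sat.subset hx) hxR]
  · rw [rotField_of_eq_zero (by simp [angleDiff_off hxR])]
    exact h.eq_off x (h.left.sat.subset hx) hxR

end IsFieldPair

end Interpolation

end

noncomputable section

/-! ### Global inverse functions. -/

section Inverse

/-- In finite dimension injective differentials are invertible; the inverse function theorem makes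
the bijection open, with smooth inverse. -/
theorem exists_contDiff_inverse {E : Type*} [NormedAddCommGroup E] [NormedSpace ℝ E]
    [FiniteDimensional ℝ E] {f : E → E} (hf : ContDiff ℝ ∞ f) (hb : Function.Bijective f)
    (hd : ∀ x u, fderiv ℝ f x u = 0 → u = 0) :
    ∃ g, ContDiff ℝ ∞ g ∧ Function.LeftInverse g f ∧ Function.RightInverse g f := by
  have : CompleteSpace E := FiniteDimensional.complete ℝ E
  have hinj : ∀ x, Function.Injective (fderiv ℝ f x).toLinearMap := fun x =>
    (injective_iff_map_eq_zero _).2 (hd x)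
  set D : E → E ≃L[ℝ] E := fun x =>
    (LinearEquiv.ofInjectiveEndo _ (hinj x)).toContinuousLinearEquiv with hD
  have hDf : ∀ x, HasStrictFDerivAt f (D x : E →L[ℝ] E) x := by
    intro x
    have : (D x : E →L[ℝ] E) = fderiv ℝ f x := by ext u; rfl
    rw [this]
    exact hf.contDiffAt.hasStrictFDerivAt (by simp)
  have hopen : IsOpenMap f := isOpenMap_of_hasStrictFDerivAt_equiv hDf
  set h : E ≃ₜ E := (Equiv.ofBijective f hb).toHomeomorphOfContinuousOpen hf.continuous hopen
  exact ⟨h.symm, h.contDiff_symm (fun x => (hDf x).hasFDerivAt) hf, h.symm_apply_apply,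
    h.apply_symm_apply⟩

theorem contDiff_atHeight : ContDiff ℝ ∞ fun q : R3 × ℝ => atHeight q.1 q.2 := by
  have : (fun q : R3 × ℝ => atHeight q.1 q.2) =
      fun q => q.1 + (q.2 - q.1 2) • stdVec 2 := funext fun q => atHeight_eq_add _ _
  rw [this]
  fun_prop

theorem contDiff_R3_coord (i : Fin 3) : ContDiff ℝ ∞ fun x : R3 => x i := by fun_prop

/-- A smooth family of functions, increasing from `-∞` to `∞` on each vertical line, can be solved
smoothly for the height. -/
theorem exists_vertical_inverse {H : ℝ × R3 → ℝ} (hH : ContDiff ℝ ∞ H)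
    (hpos : ∀ s x, 0 < fderiv ℝ H (s, x) (0, stdVec 2))
    (hsurj : ∀ s x, Function.Surjective fun z => H (s, atHeight x z)) :
    (∀ s x, StrictMono fun z => H (s, atHeight x z)) ∧ ∃ J : ℝ × R3 → ℝ, ContDiff ℝ ∞ J ∧
      (∀ s x, H (s, atHeight x (J (s, x))) = x 2) ∧ ∀ s x, J (s, atHeight x (H (s, x))) = x 2 := by
  have hder : ∀ s x z, HasDerivAt (fun z => H (s, atHeight x z))
      (fderiv ℝ H (s, atHeight x z) (0, stdVec 2)) z := fun s x z => by
    have h1 := (hH.differentiable (by simp) (s, atHeight x z)).hasFDerivAt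
    have h2 : HasDerivAt (fun z => (s, atHeight x z)) ((0 : ℝ), stdVec 2) z :=
      (hasDerivAt_const z s).prodMk (hasDerivAt_atHeight x z)
    exact h1.comp_hasDerivAt z h2
  have hmono : ∀ s x, StrictMono fun z => H (s, atHeight x z) := fun s x =>
    strictMono_of_hasDerivAt_pos (fun z => hder s x z) fun z => hpos s _
  refine ⟨hmono, ?_⟩
  -- `F` replaces the height by `H` and keeps the other variables. Its differential is triangular,
  -- with the positive vertical derivative of `H` on the diagonal, and the solution `J` is the
  -- height of its inverse.
  set F : ℝ × R3 → ℝ × R3 := fun q => (q.1, atHeight q.2 (H q)) with hF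
  have hFs : ContDiff ℝ ∞ F := contDiff_fst.prodMk (contDiff_atHeight.comp (contDiff_snd.prodMk hH))
  have hbij : Function.Bijective F := by
    constructor
    · rintro ⟨s, x⟩ ⟨s', x'⟩ h
      obtain ⟨rfl, h2⟩ := Prod.ext_iff.1 h
      have e0 : x 0 = x' 0 := by simpa [hF] using congrArg (fun y : R3 => y 0) h2
      have e1 : x 1 = x' 1 := by simpa [hF] using congrArg (fun y : R3 => y 1) h2
      have e2 : H (s, x) = H (s, x') := by simpa [hF] using congrArg (fun y : R3 => y 2) h2
      have e3 : x' = atHeight x (x' 2) := R3_ext e0.symm e1.symm rfl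
      rw [e3] at e2
      nth_rewrite 1 [← atHeight_self x] at e2
      have := (hmono s x).injective e2
      rw [e3, ← this, atHeight_self]
    · rintro ⟨s, y⟩
      obtain ⟨z, hz⟩ := hsurj s y (y 2)
      refine ⟨(s, atHeight y z), ?_⟩
      simp only at hz
      simp [hF, hz]
  have hd : ∀ q u, fderiv ℝ F q u = 0 → u = 0 := by
    rintro ⟨s, x⟩ ⟨a, u⟩ h
    have h1 := (hFs.differentiable (by simp) (s, x)).hasFDerivAt
    have hs := (hasFDerivAt_fst (𝕜 := ℝ) (p := F (s, x))).comp (s, x) h1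
    have ha : a = 0 := by
      have := hs.unique (hasFDerivAt_fst (𝕜 := ℝ) (p := (s, x)))
      have := DFunLike.congr_fun this (a, u)
      simpa [h] using this.symm
    subst ha
    have h2 := (hasFDerivAt_snd (𝕜 := ℝ) (p := F (s, x))).comp (s, x) h1
    have h3 : ∀ i, HasFDerivAt (fun q => (F q).2 i)
        ((EuclideanSpace.proj i : R3 →L[ℝ] ℝ).comp ((ContinuousLinearMap.snd ℝ ℝ R3).comp
          (fderiv ℝ F (s, x)))) (s, x) := fun i =>
      ((EuclideanSpace.proj i : R3 →L[ℝ] ℝ).hasFDerivAt).comp (s, x) h2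
    have hc : ∀ i, HasFDerivAt (fun q : ℝ × R3 => q.2 i)
        ((EuclideanSpace.proj i : R3 →L[ℝ] ℝ).comp (ContinuousLinearMap.snd ℝ ℝ R3)) (s, x) :=
      fun i => ((EuclideanSpace.proj i : R3 →L[ℝ] ℝ).hasFDerivAt).comp (s, x) hasFDerivAt_snd
    have e0 : u 0 = 0 := by
      have := DFunLike.congr_fun ((hc 0).unique (h3 0)) (0, u)
      simpa [h] using this
    have e1 : u 1 = 0 := by
      have := DFunLike.congr_fun ((hc 1).unique (h3 1)) (0, u)
      simpa [h] using this
    have eu : u = u 2 • stdVec 2 := by apply R3_ext <;> simp [stdVec, e0, e1]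
    have e2 : fderiv ℝ H (s, x) (0, u) = 0 := by
      have h4 := (hH.differentiable (by simp) (s, x)).hasFDerivAt
      have := DFunLike.congr_fun (h4.unique (h3 2)) (0, u)
      simpa [h] using this
    have e3 : ((0 : ℝ), u) = u 2 • ((0 : ℝ), stdVec 2) := by
      rw [Prod.smul_mk, smul_zero, ← eu]
    rw [e3, map_smul, smul_eq_mul] at e2
    have := (mul_eq_zero.1 e2).resolve_right (hpos s x).ne'
    rw [this, zero_smul] at eu
    rw [eu]
    rfl
  obtain ⟨g, hg, hgl, hgr⟩ := exists_contDiff_inverse hFs hbij hd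
  refine ⟨fun q => (g q).2 2, (contDiff_R3_coord 2).comp (contDiff_snd.comp hg), fun s x => ?_,
    fun s x => ?_⟩
  · have h1 := hgr (s, x)
    obtain ⟨h2, h3⟩ := Prod.ext_iff.1 h1
    simp only [hF] at h2 h3
    have e0 : (g (s, x)).2 0 = x 0 := by simpa using congrArg (fun y : R3 => y 0) h3
    have e1 : (g (s, x)).2 1 = x 1 := by simpa using congrArg (fun y : R3 => y 1) h3
    have e2 : H (g (s, x)) = x 2 := by simpa using congrArg (fun y : R3 => y 2) h3
    have e3 : g (s, x) = (s, atHeight x ((g (s, x)).2 2)) :=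
      Prod.ext h2 (R3_ext e0 e1 rfl)
    rw [← e3, e2]
  · have := hgl (s, x)
    simp only [hF] at this
    simp only [this]

end Inverse

/-! ### The vertical isotopy that realizes an interpolation. -/

section ModelIsotopy

/-- A smooth isotopy of `ℝ³` supported in `K`, with its inverse. -/
structure IsModelIsotopy (K : Set R3) (φ ψ : ℝ → R3 → R3) : Prop where
  smooth : ContDiff ℝ ∞ fun q : ℝ × R3 => φ q.1 q.2
  smooth_inv : ContDiff ℝ ∞ fun q : ℝ × R3 => ψ q.1 q.2
  left_inv : ∀ s x, ψ s (φ s x) = x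
  right_inv : ∀ s x, φ s (ψ s x) = x
  zero : ∀ x, φ 0 x = x
  off : ∀ s x, x ∉ K → φ s x = x

theorem IsModelIsotopy.inv_off {K : Set R3} {φ ψ : ℝ → R3 → R3} (h : IsModelIsotopy K φ ψ)
    (s : ℝ) {x : R3} (hx : x ∉ K) : ψ s x = x := by
  conv_lhs => rw [← h.off s x hx]
  exact h.left_inv s x

theorem IsModelIsotopy.map_mem {K : Set R3} {φ ψ : ℝ → R3 → R3} (h : IsModelIsotopy K φ ψ)
    (s : ℝ) {x : R3} (hx : x ∈ K) : φ s x ∈ K := by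
  by_contra h'
  have h1 := h.inv_off s h'
  rw [h.left_inv] at h1
  rw [← h1] at h'
  exact h' hx

theorem IsModelIsotopy.inv_mem {K : Set R3} {φ ψ : ℝ → R3 → R3} (h : IsModelIsotopy K φ ψ)
    (s : ℝ) {x : R3} (hx : x ∈ K) : ψ s x ∈ K := by
  by_contra h'
  have h1 := h.off s _ h'
  rw [h.right_inv] at h1
  rw [← h1] at h'
  exact h' hx

/-- The part of the region where the horizontal cutoff functions may be nonzero. -/
def LocalModel.core (k : LocalModel) : Set R3 := {x ∈ k.region | |x 0| ≤ 3 / 4 ∧ |x 1| ≤ 3 / 4}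

theorem core_subset_modelBox (k : LocalModel) : k.core ⊆ modelBox := by
  rintro x ⟨h, h0, h1⟩
  have h2 := region_subset_slab k h
  exact ⟨by linarith, by linarith, by linarith [h2.1], by linarith [h2.2]⟩

theorem isCompact_core (k : LocalModel) : IsCompact k.core := by
  refine Metric.isCompact_of_isClosed_isBounded ?_ ?_
  · have h1 : ∀ i, IsClosed {x : R3 | |x i| ≤ 3 / 4} := fun i =>
      isClosed_le (contDiff_R3_coord i).continuous.abs continuous_const
    exact (isClosed_region k).inter ((h1 0).inter (h1 1))
  · refine (Metric.isBounded_closedBall (x := (0 : R3)) (r := 7)).subset ?_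
    rintro x ⟨h, h0, h1⟩
    have h2 := region_subset_slab k h
    rw [mem_closedBall_zero_iff, EuclideanSpace.norm_eq, Real.sqrt_le_left (by norm_num)]
    simp only [Fin.sum_univ_three, Real.norm_eq_abs, sq_abs]
    have := abs_le.1 h0
    have := abs_le.1 h1
    nlinarith [h2.1, h2.2]

variable {k : LocalModel} {ε : ℝ} {v v' : R3 → R3} {ρ : R3 → ℝ}

theorem IsFieldPair.mul_angleDiff_off {Ω : Set R3} (hρ : IsHorizontalCutoff ρ) {x : R3}
    (hx : x ∉ k.core) : ρ x * angleDiff k ε Ω v v' x = 0 := by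
  by_cases hxR : x ∈ k.region
  · have : ¬ (|x 0| ≤ 3 / 4 ∧ |x 1| ≤ 3 / 4) := fun h => hx ⟨hxR, h⟩
    rw [hρ.eq_zero x (by grind), zero_mul]
  · rw [angleDiff_off hxR, mul_zero]

theorem IsFieldPair.contDiff_mul_angleDiff (h : IsFieldPair k ε modelBox v v')
    (hρ : IsHorizontalCutoff ρ) :
    ContDiff ℝ ∞ fun x => ρ x * angleDiff k ε modelBox v v' x := by
  rw [contDiff_iff_contDiffAt]
  intro x
  by_cases hx : x ∈ modelBox
  · exact hρ.smooth.contDiffAt.mul (h.contDiffAt_angleDiff fun _ => hx)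
  · have h1 : x ∈ k.coreᶜ := fun h => hx (core_subset_modelBox k h)
    have : (fun x => ρ x * angleDiff k ε modelBox v v' x) =ᶠ[𝓝 x] fun _ => 0 := by
      filter_upwards [(isCompact_core k).isClosed.isOpen_compl.mem_nhds h1] with y hy
      exact mul_angleDiff_off hρ hy
    exact contDiffAt_const.congr_of_eventuallyEq this

theorem hasDerivAt_along {f : R3 → ℝ} (hf : ContDiff ℝ ∞ f) (x : R3) (z : ℝ) :
    HasDerivAt (fun z => f (atHeight x z)) (fderiv ℝ f (atHeight x z) (stdVec 2)) z :=
  (hf.differentiable (by simp) (atHeight x z)).hasFDerivAt.comp_hasDerivAt z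
    (hasDerivAt_atHeight x z)

open MeasureTheory in
/-- A smooth function that is positive on a compact set is, on this set, the vertical derivative of
a smooth function that is increasing on vertical lines, and close to the height. -/
theorem exists_height_function {q : R3 → ℝ} {K Ω : Set R3} (hK : IsCompact K) (hΩ : IsOpen Ω)
    (hKΩ : K ⊆ Ω) (hq : ∀ x ∈ Ω, ContDiffAt ℝ ∞ q x) (hpos : ∀ x ∈ K, 0 < q x) :
    ∃ T : R3 → ℝ, ContDiff ℝ ∞ T ∧ (∀ x, 0 < fderiv ℝ T x (stdVec 2)) ∧
      (∀ x ∈ K, fderiv ℝ T x (stdVec 2) = q x) ∧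
      ∀ x, ∃ C, ∀ z, |T (atHeight x z) - z| ≤ C := by
  have hΩ' : IsOpen {x ∈ Ω | 0 < q x} := by
    have hc : ContinuousOn q Ω := fun x hx => (hq x hx).continuousAt.continuousWithinAt
    exact hc.isOpen_inter_preimage hΩ isOpen_Ioi
  -- The logarithm of `q` is extended with compact support, so that the exponential of the extension
  -- is positive everywhere and equals `1` outside a compact set; its vertical primitive is then
  -- increasing and at bounded distance from the height on each line.
  obtain ⟨g, hg, hgs, U, hU, hKU, hUΩ, hgU⟩ := exists_contDiff_eventuallyEq (f := fun x =>
    Real.log (q x)) hK hΩ' (fun x hx => ⟨hKΩ hx, hpos x hx⟩)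
    (fun x hx => (hq x hx.1).log hx.2.ne')
  set f : R3 → ℝ := fun x => Real.exp (g x) - 1 with hf
  have hfs : ContDiff ℝ ∞ f := hg.exp.sub contDiff_const
  have hfc : HasCompactSupport f := hgs.comp_left (g := fun y => Real.exp y - 1) (by simp)
  set T : R3 → ℝ := fun x => x 2 + ∫ t in (0 : ℝ)..x 2, f (atHeight x t) with hT
  have hTs : ContDiff ℝ ∞ T := (contDiff_R3_coord 2).add (contDiff_primitive hfs hfc 0)
  have hcx : ∀ x, Continuous fun t => f (atHeight x t) := fun x =>
    hfs.continuous.comp (continuous_atHeight x)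
  have hder : ∀ x, fderiv ℝ T x (stdVec 2) = Real.exp (g x) := by
    intro x
    have h1 := hasDerivAt_along hTs x (x 2)
    rw [atHeight_self] at h1
    have h2 : HasDerivAt (fun z => z + ∫ t in (0 : ℝ)..z, f (atHeight x t))
        (1 + f (atHeight x (x 2))) (x 2) :=
      (hasDerivAt_id (x 2)).add (intervalIntegral.integral_hasDerivAt_right
        ((hcx x).intervalIntegrable _ _) ((hcx x).stronglyMeasurableAtFilter _ _)
        (hcx x).continuousAt)
    rw [h1.unique h2, atHeight_self]
    simp [hf]
  refine ⟨T, hTs, fun x => by rw [hder]; exact Real.exp_pos _, fun x hx => ?_, fun x => ?_⟩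
  · rw [hder, hgU x (hKU hx), Real.exp_log (hpos x hx)]
  · have hint : Integrable fun t => f (atHeight x t) := by
      apply (hcx x).integrable_of_hasCompactSupport
      have hcl : IsCompact ((fun y : R3 => y 2) '' tsupport f) :=
        hfc.image (contDiff_R3_coord 2).continuous
      refine HasCompactSupport.of_support_subset_isCompact hcl fun t ht => ?_
      exact ⟨atHeight x t, subset_tsupport _ ht, rfl⟩
    refine ⟨∫ t, ‖f (atHeight x t)‖, fun z => ?_⟩
    simp only [hT, atHeight_two, atHeight_atHeight, add_sub_cancel_left]
    rw [← Real.norm_eq_abs]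
    exact (intervalIntegral.norm_integral_le_integral_norm_uIoc).trans
      (setIntegral_le_integral hint.norm (Filter.Eventually.of_forall fun t => norm_nonneg _))

theorem smoothTransition_mem (s : ℝ) :
    0 ≤ Real.smoothTransition s ∧ Real.smoothTransition s ≤ 1 :=
  ⟨Real.smoothTransition.nonneg s, Real.smoothTransition.le_one s⟩

/-- Along a fiber in the core, `-T` is an angle of `v` up to a constant, where `T` is a primitive of
the rate, and `-(T - E)` is an angle of the field rotated by `E`. Hence the rotated field at `y`
equals `v` at `x` when `T y - E y = T x`. The isotopy slides `x` vertically to the solution `y` of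
this equation with `E` replaced by a multiple of `E` increasing from zero. -/
theorem IsFieldPair.exists_isotopy (h : IsFieldPair k ε modelBox v v')
    (hρ : IsHorizontalCutoff ρ) : ∃ φ ψ, IsModelIsotopy k.core φ ψ ∧
      (∀ s x, φ s x 0 = x 0 ∧ φ s x 1 = x 1) ∧
      ∀ x ∈ k.core,
        rotField ε (fun x => ρ x * angleDiff k ε modelBox v v' x) v (φ 1 x) = v x := by
  have hsub := core_subset_modelBox k
  set E : R3 → ℝ := fun x => ρ x * angleDiff k ε modelBox v v' x with hE
  have hEs : ContDiff ℝ ∞ E := h.contDiff_mul_angleDiff hρ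
  have hEoff : ∀ x ∉ k.core, E x = 0 := fun x hx => mul_angleDiff_off hρ hx
  have hEbd : ∃ C, ∀ x, |E x| ≤ C := by
    obtain ⟨C, hC⟩ := hEs.continuous.bounded_above_of_compact_support
      (HasCompactSupport.of_support_subset_isCompact (isCompact_core k) fun x hx => by
        by_contra h'
        exact hx (hEoff x h'))
    exact ⟨C, hC⟩
  have hEd : ∀ x ∈ k.core, fderiv ℝ E x (stdVec 2) = ρ x * (rate ε v x - rate ε v' x) := by
    intro x hx
    rw [hE, fderiv_fun_mul (hρ.smooth.differentiable (by simp) x)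
      ((h.contDiffAt_angleDiff fun _ => hsub hx).differentiableAt (by simp))]
    simp [hρ.fderiv_vertical, h.fderiv_angleDiff (hsub hx) hx.1]
  have hEd' : ∀ x ∉ k.core, fderiv ℝ E x (stdVec 2) = 0 := by
    intro x hx
    have : E =ᶠ[𝓝 x] fun _ => 0 := by
      filter_upwards [(isCompact_core k).isClosed.isOpen_compl.mem_nhds hx] with y hy
        using hEoff y hy
    rw [this.fderiv_eq]
    simp
  obtain ⟨T, hT, hTpos, hTq, hTb⟩ := exists_height_function (q := rate ε v) (isCompact_core k)
    isOpen_modelBox hsub (fun x hx => h.left.contDiffAt_rate hx)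
    (fun x hx => h.left.rate_pos (hsub hx) hx.1)
  -- `Real.smoothTransition` keeps the coefficient of `E` in `[0, 1]` for all real times, so the
  -- vertical derivative stays a convex combination of the two rates on the core.
  set H : ℝ × R3 → ℝ := fun q => T q.2 - Real.smoothTransition q.1 * E q.2 with hH
  have hHs : ContDiff ℝ ∞ H := (hT.comp contDiff_snd).sub
    ((Real.smoothTransition.contDiff.comp contDiff_fst).mul (hEs.comp contDiff_snd))
  have hHd : ∀ s x, fderiv ℝ H (s, x) (0, stdVec 2) =
      fderiv ℝ T x (stdVec 2) - Real.smoothTransition s * fderiv ℝ E x (stdVec 2) := by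
    intro s x
    have h1 := (hHs.differentiable (by simp) (s, atHeight x (x 2))).hasFDerivAt.comp_hasDerivAt
      (x 2) ((hasDerivAt_const (x 2) s).prodMk (hasDerivAt_atHeight x (x 2)))
    have h2 := (hasDerivAt_along hT x (x 2)).sub
      ((hasDerivAt_along hEs x (x 2)).const_mul (Real.smoothTransition s))
    have := h1.unique h2
    rwa [atHeight_self] at this
  have hHpos : ∀ s x, 0 < fderiv ℝ H (s, x) (0, stdVec 2) := by
    intro s x
    rw [hHd]
    by_cases hx : x ∈ k.core
    · rw [hTq x hx, hEd x hx]
      have h1 := h.left.rate_pos (hsub hx) hx.1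
      have h2 := h.right.rate_pos (hsub hx) hx.1
      have h3 : 0 ≤ Real.smoothTransition s * ρ x :=
        mul_nonneg (smoothTransition_mem s).1 (hρ.nonneg x)
      have h4 : Real.smoothTransition s * ρ x ≤ 1 :=
        mul_le_one₀ (smoothTransition_mem s).2 (hρ.nonneg x) (hρ.le_one x)
      rcases h3.eq_or_lt with h5 | h5
      · rw [← mul_assoc, ← h5]; linarith
      · nlinarith
    · rw [hEd' x hx, mul_zero, sub_zero]
      exact hTpos x
  have hHsurj : ∀ s x, Function.Surjective fun z => H (s, atHeight x z) := by
    intro s x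
    obtain ⟨C, hC⟩ := hTb x
    obtain ⟨C', hC'⟩ := hEbd
    have hb : ∀ z, |H (s, atHeight x z) - z| ≤ C + C' := by
      intro z
      have h1 : |Real.smoothTransition s * E (atHeight x z)| ≤ C' := by
        rw [abs_mul, abs_of_nonneg (smoothTransition_mem s).1]
        exact (mul_le_of_le_one_left (abs_nonneg _) (smoothTransition_mem s).2).trans (hC' _)
      have h2 := abs_le.1 (hC z)
      have h3 := abs_le.1 h1
      simp only [hH]
      rw [abs_le]
      constructor <;> linarith
    apply Continuous.surjective
    · have := continuous_atHeight x
      exact hHs.continuous.comp (by fun_prop)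
    · refine Filter.tendsto_atTop_mono (f := fun z => z - (C + C')) (fun z => ?_)
        (Filter.tendsto_atTop_add_const_right _ _ Filter.tendsto_id)
      linarith [(abs_le.1 (hb z)).1]
    · refine Filter.tendsto_atBot_mono (f := fun z => z + (C + C')) (fun z => ?_)
        (Filter.tendsto_atBot_add_const_right _ _ Filter.tendsto_id)
      linarith [(abs_le.1 (hb z)).2]
  obtain ⟨hmono, J, hJ, hHJ, hJH⟩ := exists_vertical_inverse hHs hHpos hHsurj
  set φ : ℝ → R3 → R3 := fun s x => atHeight x (J (s, atHeight x (H (0, x)))) with hφ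
  set ψ : ℝ → R3 → R3 := fun s x => atHeight x (J (0, atHeight x (H (s, x)))) with hψ
  have hHφ : ∀ s x, H (s, φ s x) = H (0, x) := fun s x => hHJ s (atHeight x (H (0, x)))
  have hH0 : ∀ x, H (0, x) = T x := fun x => by simp [hH]
  have hHoff : ∀ s, ∀ x ∉ k.core, H (s, x) = H (0, x) := fun s x hx => by simp [hH, hEoff x hx]
  have hφs : ∀ (f : ℝ × R3 → ℝ), ContDiff ℝ ∞ f → ∀ (a : ℝ × R3 → ℝ), ContDiff ℝ ∞ a →
      ContDiff ℝ ∞ fun q : ℝ × R3 => atHeight q.2 (J (a q, atHeight q.2 (f q))) :=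
    fun f hf a ha => contDiff_atHeight.comp (contDiff_snd.prodMk (hJ.comp (ha.prodMk
      (contDiff_atHeight.comp (contDiff_snd.prodMk hf)))))
  have hiso : IsModelIsotopy k.core φ ψ :=
    { smooth := hφs _ (hHs.comp (contDiff_const.prodMk contDiff_snd)) _ contDiff_fst
      smooth_inv := hφs _ hHs _ contDiff_const
      left_inv := fun s x => by
        have h1 : ψ s (φ s x) = atHeight x (J (0, atHeight x (H (s, φ s x)))) := rfl
        rw [h1, hHφ, hJH, atHeight_self]
      right_inv := fun s x => by
        have h1 : φ s (ψ s x) = atHeight x (J (s, atHeight x (H (0, ψ s x)))) := rfl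
        have h2 : H (0, ψ s x) = H (s, x) := hHJ 0 (atHeight x (H (s, x)))
        rw [h1, h2, hJH, atHeight_self]
      zero := fun x => by
        simp only [hφ]
        rw [hJH, atHeight_self]
      off := fun s x hx => by
        simp only [hφ]
        rw [← hHoff s x hx, hJH, atHeight_self] }
  refine ⟨φ, ψ, hiso, fun s x => ⟨rfl, rfl⟩, fun x hx => ?_⟩
  set y := φ 1 x with hy
  have hyc : y ∈ k.core := hiso.map_mem 1 hx
  have hyx : ∀ z, atHeight y z = atHeight x z := fun z => rfl
  -- Off the core `H` does not depend on time. A point off the core on the path from `x` to `y`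
  -- would give contradictory inequalities, by strict monotonicity of `H` in the height at the times
  -- `0` and `1`.
  have hseg : ∀ z ∈ uIcc (x 2) (y 2), atHeight x z ∈ k.core := by
    intro z hz
    by_contra hzc
    have h1 : H (1, atHeight x z) = H (0, atHeight x z) := hHoff 1 _ hzc
    have h2 : H (1, atHeight x (y 2)) = H (0, atHeight x (x 2)) := by
      rw [← hyx, atHeight_self, atHeight_self]
      exact hHφ 1 x
    have hne1 : z ≠ x 2 := by rintro rfl; rw [atHeight_self] at hzc; exact hzc hx
    have hne2 : z ≠ y 2 := by rintro rfl; rw [← hyx, atHeight_self] at hzc; exact hzc hyc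
    rcases le_total (x 2) (y 2) with hxy | hxy
    · rw [uIcc_of_le hxy] at hz
      have h3 := hmono 0 x (lt_of_le_of_ne hz.1 hne1.symm)
      have h4 := hmono 1 x (lt_of_le_of_ne hz.2 hne2)
      simp only at h3 h4
      linarith
    · rw [uIcc_of_ge hxy] at hz
      have h3 := hmono 0 x (lt_of_le_of_ne hz.2 hne1)
      have h4 := hmono 1 x (lt_of_le_of_ne hz.1 hne2.symm)
      simp only at h3 h4
      linarith
  have hTE : T y - T x = E y := by
    have := hHφ 1 x
    rw [hH0] at this
    simp only [hH, Real.smoothTransition.one, one_mul] at this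
    linarith
  have hcontr : ContinuousOn (fun z => rate ε v (atHeight x z)) (uIcc (x 2) (y 2)) := fun z hz =>
    ((h.left.contDiffAt_rate (hsub (hseg z hz))).continuousAt.comp
      (continuous_atHeight x).continuousAt).continuousWithinAt
  have hint : ∫ z in x 2..y 2, rate ε v (atHeight x z) = E y := by
    rw [← hTE]
    have h1 := intervalIntegral.integral_eq_sub_of_hasDerivAt
      (f := fun z => T (atHeight x z)) (f' := fun z => rate ε v (atHeight x z))
      (a := x 2) (b := y 2) (fun z hz => by
        have := hasDerivAt_along hT x z
        rwa [hTq _ (hseg z hz)] at this) hcontr.intervalIntegrable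
    rw [h1, atHeight_self, ← hyx, atHeight_self]
  have hexp : horiz ε (v y) = horiz ε (v x) * Complex.exp (-Complex.I * E y) := by
    rcases le_total (x 2) (y 2) with hxy | hxy
    · rw [uIcc_of_le hxy] at hseg
      have := h.left.horiz_eq_exp (x := x) (fun z hz => hsub (hseg z hz))
        (fun z hz => (hseg z hz).1) ⟨hxy, le_rfl⟩
      rwa [← hyx (y 2), atHeight_self, atHeight_self, hint] at this
    · rw [uIcc_of_ge hxy] at hseg
      have := h.left.horiz_eq_exp (x := x) (fun z hz => hsub (hseg z hz))
        (fun z hz => (hseg z hz).1) ⟨hxy, le_rfl⟩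
      rw [← hyx (y 2), atHeight_self, atHeight_self, intervalIntegral.integral_symm, hint] at this
      rw [this, mul_assoc, ← Complex.exp_add]
      simp
  apply horiz_injective h.left.eps_sq
  · rw [horiz_rotField h.left.eps_sq, hexp, mul_assoc, ← Complex.exp_add]
    simp
  · change v y 2 = v x 2
    rw [h.left.vert y (hsub hyc) hyc.1, h.left.vert x (hsub hx) hx.1]

end ModelIsotopy

end

noncomputable section

/-! ### From isotopies of the model to isotopies of the manifold. -/

section Isotopy

variable {V : Type*} [TopologicalSpace V] [ChartedSpace R3 V]
  {e : OpenPartialHomeomorph V R3} {ξ ξ' ξ'' : PlaneField V} {A : Set V}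

theorem spansAt_map_iff {p : V} (hp : p ∈ e.source) {v : R3} :
    SpansAt e ξ (e p) v ↔ Spans (pullCovector e p (innerSL ℝ v)) (ξ p) := by
  unfold SpansAt
  rw [e.left_inv hp]

theorem IsotopicRel.refl : IsotopicRel A ξ ξ := by
  refine ⟨fun _ p => p, contMDiff_snd.contMDiffOn,
    fun s _ => ⟨Diffeomorph.refl (𝓡 3) V ∞, fun p => rfl⟩, fun p => rfl, fun s _ p _ => rfl, ?_⟩
  intro p β hβ
  have : mfderiv (𝓡 3) (𝓡 3) (fun p : V => p) p = ContinuousLinearMap.id ℝ _ := mfderiv_id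
  rw [this]
  exact hβ

theorem IsotopicRel.trans (h : IsotopicRel A ξ ξ') (h' : IsotopicRel A ξ' ξ'') :
    IsotopicRel A ξ ξ'' := by
  obtain ⟨Φ, h1, h2, h3, h4, h5⟩ := h
  obtain ⟨Ψ, g1, g2, g3, g4, g5⟩ := h'
  refine ⟨fun s p => Ψ s (Φ s p), ?_, ?_, ?_, ?_, ?_⟩
  · exact g1.comp (contMDiff_fst.contMDiffOn.prodMk h1) fun z hz => ⟨hz.1, mem_univ _⟩
  · intro s hs
    obtain ⟨φ, hφ⟩ := h2 s hs
    obtain ⟨ψ, hψ⟩ := g2 s hs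
    exact ⟨φ.trans ψ, fun p => by simp [← hφ, ← hψ]⟩
  · intro p
    simp only [h3, g3]
  · intro s hs p hp
    simp only [h4 s hs p hp, g4 s hs p hp]
  · intro p β hβ
    obtain ⟨φ, hφ⟩ := h2 1 (by simp)
    obtain ⟨ψ, hψ⟩ := g2 1 (by simp)
    have e1 : Φ 1 = φ := funext fun p => (hφ p).symm
    have e2 : Ψ 1 = ψ := funext fun p => (hψ p).symm
    have d1 : MDifferentiableAt (𝓡 3) (𝓡 3) (Φ 1) p := by
      rw [e1]; exact φ.contMDiff.mdifferentiable (by simp) p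
    have d2 : MDifferentiableAt (𝓡 3) (𝓡 3) (Ψ 1) (Φ 1 p) := by
      rw [e2]; exact ψ.contMDiff.mdifferentiable (by simp) _
    have hc : mfderiv (𝓡 3) (𝓡 3) (fun p => Ψ 1 (Φ 1 p)) p =
        (mfderiv (𝓡 3) (𝓡 3) (Ψ 1) (Φ 1 p)).comp (mfderiv (𝓡 3) (𝓡 3) (Φ 1) p) :=
      mfderiv_comp p d2 d1
    rw [hc]
    exact h5 p _ (g5 (Φ 1 p) β hβ)

/-- A map of which the chart `e` is a local expression pulls back `ξ'` to `ξ`. -/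
theorem spans_comp_mfderiv [IsManifold (𝓡 3) ∞ V]
    (he : e ∈ IsManifold.maximalAtlas (𝓡 3) ∞ V) {f : V → V} {F : R3 → R3} {p : V}
    (hf : MDifferentiableAt (𝓡 3) (𝓡 3) f p) (hp : p ∈ e.source) (hfp : f p ∈ e.source)
    (hF : DifferentiableAt ℝ F (e p)) (hfF : (fun q => e (f q)) =ᶠ[𝓝 p] fun q => F (e q))
    {v v' : R3} (hv : Spans (pullCovector e p (innerSL ℝ v)) (ξ p))
    (hv' : Spans (pullCovector e (f p) (innerSL ℝ v')) (ξ' (f p)))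
    (hvv : ∀ u, inner ℝ v' (fderiv ℝ F (e p) u) = inner ℝ v u)
    {β : Covector (f p)} (hβ : Spans β (ξ' (f p))) :
    Spans (p := p) (β.comp (mfderiv (𝓡 3) (𝓡 3) f p)) (ξ p) := by
  obtain ⟨c, hc, rfl⟩ := Spans.exists_pos hv' hβ
  have h1 : mfderiv (𝓡 3) (𝓡 3) (fun q => e (f q)) p =
      (chartDeriv e (f p)).comp (mfderiv (𝓡 3) (𝓡 3) f p) :=
    mfderiv_comp p ((contMDiffAt_of_mem_maximalAtlas he hfp).mdifferentiableAt (by simp)) hf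
  have h2 : mfderiv (𝓡 3) (𝓡 3) (fun q => F (e q)) p =
      (mfderiv (𝓡 3) (𝓡 3) F (e p)).comp (chartDeriv e p) :=
    mfderiv_comp p hF.mdifferentiableAt
      ((contMDiffAt_of_mem_maximalAtlas he hp).mdifferentiableAt (by simp))
  rw [hfF.mfderiv_eq, h2, mfderiv_eq_fderiv] at h1
  have h3 : (c • pullCovector e (f p) (innerSL ℝ v')).comp (mfderiv (𝓡 3) (𝓡 3) f p) =
      c • pullCovector e p (innerSL ℝ v) := by
    ext u
    have h4 := DFunLike.congr_fun h1 u
    change c * inner ℝ v' (chartDeriv e (f p) (mfderiv (𝓡 3) (𝓡 3) f p u)) =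
      c * inner ℝ v (chartDeriv e p u)
    rw [← hvv]
    congr 2
    exact h4.symm
  rw [h3]
  exact hv.smul hc

open scoped Classical in
/-- The map of `V` given by `φ` in the chart `e`, and by the identity elsewhere. -/
def transport (e : OpenPartialHomeomorph V R3) (φ : R3 → R3) (p : V) : V :=
  if p ∈ e.source then e.symm (φ (e p)) else p

theorem transport_of_mem {φ : R3 → R3} {p : V} (hp : p ∈ e.source) :
    transport e φ p = e.symm (φ (e p)) := if_pos hp

theorem transport_of_eq {φ : R3 → R3} {p : V} (hp : p ∈ e.source → φ (e p) = e p) :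
    transport e φ p = p := by
  by_cases h : p ∈ e.source
  · rw [transport_of_mem h, hp h, e.left_inv h]
  · exact if_neg h

/-- The only question is at the frontier of the chart. The image of the compact `K` is closed
because `V` is Hausdorff, and off this image the map is the identity. -/
theorem contMDiff_transport [T2Space V] [IsManifold (𝓡 3) ∞ V]
    (he : e ∈ IsManifold.maximalAtlas (𝓡 3) ∞ V) {K : Set R3} (hK : IsCompact K)
    (hKe : K ⊆ e.target) {φ : ℝ → R3 → R3} (hφ : ContDiff ℝ ∞ fun q : ℝ × R3 => φ q.1 q.2)
    (hoff : ∀ s x, x ∉ K → φ s x = x) (hmaps : ∀ s, ∀ x ∈ K, φ s x ∈ K) :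
    ContMDiff (𝓘(ℝ, ℝ).prod (𝓡 3)) (𝓡 3) ∞ fun z : ℝ × V => transport e (φ z.1) z.2 := by
  have hmt : ∀ s, ∀ x ∈ e.target, φ s x ∈ e.target := fun s x hx => by
    by_cases h : x ∈ K
    · exact hKe (hmaps s x h)
    · rwa [hoff s x h]
  rintro ⟨s, p⟩
  by_cases hp : p ∈ e.source
  · have h1 : ContMDiffAt (𝓘(ℝ, ℝ).prod (𝓡 3)) (𝓡 3) ∞ (fun z : ℝ × V => e z.2) (s, p) :=
      ContMDiffAt.comp (s, p) (g := e) (f := Prod.snd) (I' := 𝓡 3)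
        (contMDiffAt_of_mem_maximalAtlas he hp) contMDiffAt_snd
    have h2 : ContMDiffAt (𝓘(ℝ, ℝ).prod (𝓡 3)) 𝓘(ℝ, ℝ × R3) ∞
        (fun z : ℝ × V => (z.1, e z.2)) (s, p) := contMDiffAt_fst.prodMk_space h1
    have h3 : ContMDiffAt (𝓘(ℝ, ℝ).prod (𝓡 3)) (𝓡 3) ∞ (fun z : ℝ × V => φ z.1 (e z.2)) (s, p) :=
      ContMDiffAt.comp (s, p) (g := fun q : ℝ × R3 => φ q.1 q.2) (I' := 𝓘(ℝ, ℝ × R3))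
        hφ.contMDiff.contMDiffAt h2
    have h4 : ContMDiffAt (𝓘(ℝ, ℝ).prod (𝓡 3)) (𝓡 3) ∞
        (fun z : ℝ × V => e.symm (φ z.1 (e z.2))) (s, p) :=
      ContMDiffAt.comp (s, p) (g := e.symm) (I' := 𝓡 3)
        (contMDiffAt_symm_of_mem_maximalAtlas he (hmt s _ (e.map_source hp))) h3
    refine h4.congr_of_eventuallyEq ?_
    filter_upwards [continuousAt_snd.eventually (e.open_source.mem_nhds hp)] with z hz
    exact transport_of_mem hz
  · have hKV : IsClosed (e.symm '' K) :=
      (hK.image_of_continuousOn (e.continuousOn_symm.mono hKe)).isClosed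
    have hpK : p ∈ (e.symm '' K)ᶜ := by
      rintro ⟨x, hx, rfl⟩
      exact hp (e.map_target (hKe hx))
    refine contMDiffAt_snd.congr_of_eventuallyEq ?_
    filter_upwards [continuousAt_snd.eventually (hKV.isOpen_compl.mem_nhds hpK)] with z hz
    apply transport_of_eq
    intro hzs
    apply hoff
    exact fun h => hz ⟨e z.2, h, e.left_inv hzs⟩

theorem IsModelIsotopy.isotopicRel [T2Space V] [IsManifold (𝓡 3) ∞ V]
    (he : e ∈ IsManifold.maximalAtlas (𝓡 3) ∞ V) {K : Set R3} (hK : IsCompact K)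
    (hKe : K ⊆ e.target) {φ ψ : ℝ → R3 → R3} (h : IsModelIsotopy K φ ψ)
    (hA : ∀ p ∈ A, p ∈ e.source → e p ∉ K)
    (hoff : ∀ p, (p ∈ e.source → e p ∉ K) → ξ' p = ξ p)
    (hon : ∀ x ∈ K, ∃ v v', SpansAt e ξ x v ∧ SpansAt e ξ' (φ 1 x) v' ∧
      ∀ u, inner ℝ v' (fderiv ℝ (φ 1) x u) = inner ℝ v u) : IsotopicRel A ξ ξ' := by
  have hs := contMDiff_transport he hK hKe h.smooth h.off fun s x hx => h.map_mem s hx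
  have hs' := contMDiff_transport he hK hKe h.smooth_inv (fun s x hx => h.inv_off s hx)
    fun s x hx => h.inv_mem s hx
  have hmt : ∀ s, ∀ x ∈ e.target, φ s x ∈ e.target := fun s x hx => by
    by_cases hx' : x ∈ K
    · exact hKe (h.map_mem s hx')
    · rwa [h.off s x hx']
  have hmt' : ∀ s, ∀ x ∈ e.target, ψ s x ∈ e.target := fun s x hx => by
    by_cases hx' : x ∈ K
    · exact hKe (h.inv_mem s hx')
    · rwa [h.inv_off s hx']
  have hslice : ∀ s : ℝ, ContMDiff (𝓡 3) (𝓘(ℝ, ℝ).prod (𝓡 3)) ∞ fun p : V => (s, p) :=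
    fun s => (contMDiff_const (I' := 𝓘(ℝ, ℝ)) (c := s)).prodMk contMDiff_id
  have hsm : ∀ s, ContMDiff (𝓡 3) (𝓡 3) ∞ (transport e (φ s)) := fun s => hs.comp (hslice s)
  have hsm' : ∀ s, ContMDiff (𝓡 3) (𝓡 3) ∞ (transport e (ψ s)) := fun s => hs'.comp (hslice s)
  refine ⟨fun s p => transport e (φ s) p, hs.contMDiffOn, fun s _ => ?_, fun p => ?_,
    fun s _ p hp => ?_, fun p β hβ => ?_⟩
  · refine ⟨⟨⟨transport e (φ s), transport e (ψ s), fun p => ?_, fun p => ?_⟩, hsm s, hsm' s⟩,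
      fun p => rfl⟩
    · by_cases hp : p ∈ e.source
      · have h1 := hmt s _ (e.map_source hp)
        rw [transport_of_mem hp, transport_of_mem (e.map_target h1), e.right_inv h1, h.left_inv,
          e.left_inv hp]
      · rw [transport_of_eq (φ := φ s) fun h => absurd h hp,
          transport_of_eq fun h => absurd h hp]
    · by_cases hp : p ∈ e.source
      · have h1 := hmt' s _ (e.map_source hp)
        rw [transport_of_mem hp, transport_of_mem (e.map_target h1), e.right_inv h1, h.right_inv,
          e.left_inv hp]
      · rw [transport_of_eq (φ := ψ s) fun h => absurd h hp,
          transport_of_eq fun h => absurd h hp]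
  · exact transport_of_eq fun _ => h.zero _
  · exact transport_of_eq fun hp' => h.off s _ (hA p hp hp')
  · by_cases hpK : p ∈ e.source ∧ e p ∈ K
    · obtain ⟨hp, hpK⟩ := hpK
      obtain ⟨v, v', hv, hv', hvv⟩ := hon _ hpK
      have ht := hmt 1 _ (e.map_source hp)
      have hfp : transport e (φ 1) p ∈ e.source := by
        rw [transport_of_mem hp]; exact e.map_target ht
      have hef : e (transport e (φ 1) p) = φ 1 (e p) := by
        rw [transport_of_mem hp, e.right_inv ht]
      refine spans_comp_mfderiv he ((hsm 1).mdifferentiable (by simp) p) hp hfp (F := φ 1) ?_ ?_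
        ((spansAt_map_iff hp).1 hv) ?_ hvv hβ
      · exact ((h.smooth.comp (contDiff_const.prodMk contDiff_id)).differentiable (by simp)) (e p)
      · filter_upwards [e.open_source.mem_nhds hp] with q hq
        rw [transport_of_mem hq, e.right_inv (hmt 1 _ (e.map_source hq))]
      · rw [← hef] at hv'
        exact (spansAt_map_iff hfp).1 hv'
    · have hpK' : p ∈ e.source → e p ∉ K := fun h1 h2 => hpK ⟨h1, h2⟩
      have hKV : IsClosed (e.symm '' K) :=
        (hK.image_of_continuousOn (e.continuousOn_symm.mono hKe)).isClosed
      have hpV : p ∈ (e.symm '' K)ᶜ := by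
        rintro ⟨x, hx, rfl⟩
        exact hpK ⟨e.map_target (hKe hx), by rwa [e.right_inv (hKe hx)]⟩
      have hid : transport e (φ 1) =ᶠ[𝓝 p] id := by
        filter_upwards [hKV.isOpen_compl.mem_nhds hpV] with q hq
        exact transport_of_eq fun hqs => h.off 1 _ fun hqK => hq ⟨e q, hqK, e.left_inv hqs⟩
      have hp1 : transport e (φ 1) p = p := hid.eq_of_nhds
      -- The differential goes to the tangent space at the image of `p`, which equals `p` only
      -- propositionally; the statement is generalized over the image point in order to substitute.
      have hgen : ∀ (q : V) (hq : q = p) (L : TangentSpace (𝓡 3) p →L[ℝ] TangentSpace (𝓡 3) q)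
          (hL : HEq L (ContinuousLinearMap.id ℝ (TangentSpace (𝓡 3) p))) (β : Covector q),
          Spans β (ξ' q) → Spans (p := p) (β.comp L) (ξ p) := by
        rintro q rfl L hL β hβ
        rw [eq_of_heq hL, ← hoff q hpK']
        exact hβ
      refine hgen _ hp1 _ ?_ β hβ
      have h1 := hid.mfderiv_eq (I := 𝓡 3) (I' := 𝓡 3)
      exact heq_of_eq (h1.trans mfderiv_id)

end Isotopy

end

noncomputable section

/-! ### Angles under real linear maps of the plane. -/

section Lift

/-- The angle of the image of `A exp (i E)` by the linear map `z ↦ p z + q z̄`, relative to the angle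
of the image of `A`. -/
theorem exists_lift_rot {a b : ℝ} {p q A : ℝ → ℂ} {E θ r : ℝ → ℝ}
    (hp : ContinuousOn p (Icc a b)) (hq : ContinuousOn q (Icc a b)) (hA : ContinuousOn A (Icc a b))
    (hE : ContinuousOn E (Icc a b)) (hA0 : ∀ z ∈ Icc a b, A z ≠ 0)
    (hpq : ∀ z ∈ Icc a b, ‖q z‖ < ‖p z‖) (hr : ∀ z ∈ Icc a b, 0 < r z)
    (h : ∀ z ∈ Icc a b, p z * A z + q z * starRingEnd ℂ (A z) =
      r z * Complex.exp (Complex.I * θ z)) :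
    ∃ δ : ℝ → ℝ, ContinuousOn δ (Icc a b) ∧
      (∀ z ∈ Icc a b, ∃ r' : ℝ, 0 < r' ∧ p z * (A z * Complex.exp (Complex.I * E z)) +
        q z * starRingEnd ℂ (A z * Complex.exp (Complex.I * E z)) =
          r' * Complex.exp (Complex.I * (θ z + δ z : ℝ))) ∧
      ∀ z ∈ Icc a b, Complex.exp (Complex.I * E z) = 1 → δ z = E z := by
  -- The image of `A exp (iE)` is `p A exp (iE) (1 + κ exp (-2iE))`. As `‖κ‖ < 1`, the last factor
  -- stays in the right half plane, where the argument is continuous. So the angle increases by `E`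
  -- plus a difference of two arguments, and these cancel when `exp (iE) = 1`.
  set κ : ℝ → ℂ := fun z => q z * starRingEnd ℂ (A z) / (p z * A z) with hκ
  have hp0 : ∀ z ∈ Icc a b, p z ≠ 0 := fun z hz => norm_pos_iff.1 ((norm_nonneg _).trans_lt (hpq z hz))
  have hκ1 : ∀ z ∈ Icc a b, ‖κ z‖ < 1 := by
    intro z hz
    have h1 := norm_pos_iff.2 (hA0 z hz)
    rw [hκ]
    simp only [norm_div, norm_mul, RCLike.norm_conj]
    rw [mul_div_mul_right _ _ h1.ne', div_lt_one (norm_pos_iff.2 (hp0 z hz))]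
    exact hpq z hz
  have hκc : ContinuousOn κ (Icc a b) :=
    (hq.mul (Complex.continuous_conj.comp_continuousOn hA)).div (hp.mul hA)
      fun z hz => mul_ne_zero (hp0 z hz) (hA0 z hz)
  have hslit : ∀ w : ℂ, ‖w‖ < 1 → 1 + w ∈ Complex.slitPlane := fun w hw => by
    left
    have := (abs_le.1 (Complex.abs_re_le_norm w)).1
    simp only [Complex.add_re, Complex.one_re]
    linarith
  set e : ℝ → ℂ := fun z => Complex.exp (-(2 * Complex.I * E z)) with he
  have hec : ContinuousOn e (Icc a b) :=
    Complex.continuous_exp.comp_continuousOn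
      ((continuousOn_const.mul (Complex.continuous_ofReal.comp_continuousOn hE)).neg)
  have hen : ∀ z, ‖e z‖ = 1 := fun z => by
    rw [he]
    simp only [Complex.norm_exp]
    simp
  have hκe : ∀ z ∈ Icc a b, ‖κ z * e z‖ < 1 := fun z hz => by
    rw [norm_mul, hen, mul_one]; exact hκ1 z hz
  refine ⟨fun z => E z + (1 + κ z * e z).arg - (1 + κ z).arg, ?_, fun z hz => ?_, fun z hz h1 => ?_⟩
  · refine (hE.add fun z hz => ?_).sub fun z hz => ?_
    · exact ContinuousAt.comp_continuousWithinAt (f := fun z => 1 + κ z * e z)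
        (Complex.continuousAt_arg (hslit _ (hκe z hz)))
        ((continuousOn_const.add (hκc.mul hec)) z hz)
    · exact ContinuousAt.comp_continuousWithinAt (f := fun z => 1 + κ z)
        (Complex.continuousAt_arg (hslit _ (hκ1 z hz)))
        ((continuousOn_const.add hκc) z hz)
  · have hn : ∀ w : ℂ, ‖w‖ < 1 → 0 < ‖1 + w‖ := fun w hw =>
      norm_pos_iff.2 (Complex.slitPlane_ne_zero (hslit w hw))
    have h1 := hn _ (hκ1 z hz)
    have h2 := hn _ (hκe z hz)
    refine ⟨r z * ‖1 + κ z * e z‖ / ‖1 + κ z‖, div_pos (mul_pos (hr z hz) h2) h1, ?_⟩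
    have hpolar : ∀ w : ℂ, w = ‖w‖ * Complex.exp (Complex.I * w.arg) := fun w => by
      rw [mul_comm Complex.I, Complex.norm_mul_exp_arg_mul_I]
    have hp0z := hp0 z hz
    have hA0z := hA0 z hz
    have e1 : p z * A z * (1 + κ z) = r z * Complex.exp (Complex.I * θ z) := by
      rw [← h z hz, hκ]
      field_simp
    have e2 : starRingEnd ℂ (Complex.exp (Complex.I * E z)) =
        Complex.exp (Complex.I * E z) * e z := by
      rw [he, ← Complex.exp_conj, ← Complex.exp_add]
      congr 1
      simp
      ring
    have e3 : p z * (A z * Complex.exp (Complex.I * E z)) +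
        q z * starRingEnd ℂ (A z * Complex.exp (Complex.I * E z)) =
        p z * A z * Complex.exp (Complex.I * E z) * (1 + κ z * e z) := by
      rw [map_mul, e2, hκ]
      field_simp
    rw [e3]
    have h10 : (1 + κ z) ≠ 0 := Complex.slitPlane_ne_zero (hslit _ (hκ1 z hz))
    apply mul_right_cancel₀ h10
    have e4 : p z * A z * Complex.exp (Complex.I * E z) * (1 + κ z * e z) * (1 + κ z) =
        r z * Complex.exp (Complex.I * θ z) * Complex.exp (Complex.I * E z) * (1 + κ z * e z) := by
      rw [← e1]; ring
    rw [e4]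
    have key : ∀ (X Y : ℂ) (R₁ R₂ α₁ α₂ : ℝ), R₁ ≠ 0 → X = R₁ * Complex.exp (Complex.I * α₁) →
        Y = R₂ * Complex.exp (Complex.I * α₂) →
        r z * Complex.exp (Complex.I * θ z) * Complex.exp (Complex.I * E z) * Y =
          (r z * R₂ / R₁ : ℝ) * Complex.exp (Complex.I * (θ z + (E z + α₂ - α₁) : ℝ)) * X := by
      rintro X Y R₁ R₂ α₁ α₂ hR rfl rfl
      have hR' : (R₁ : ℂ) ≠ 0 := by exact_mod_cast hR
      have hexp : Complex.exp (Complex.I * (θ z + (E z + α₂ - α₁) : ℝ)) *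
          Complex.exp (Complex.I * α₁) = Complex.exp (Complex.I * θ z) *
            Complex.exp (Complex.I * E z) * Complex.exp (Complex.I * α₂) := by
        rw [← Complex.exp_add, ← Complex.exp_add, ← Complex.exp_add]
        push_cast
        ring_nf
      have hc : (r z * R₂ / R₁ : ℂ) * R₁ = r z * R₂ := div_mul_cancel₀ _ hR'
      push_cast at hexp ⊢
      linear_combination -(r z * R₂ : ℂ) * hexp - Complex.exp (Complex.I *
        (θ z + (E z + α₂ - α₁))) * Complex.exp (Complex.I * α₁) * hc
    exact key _ _ _ _ _ _ h1.ne' (hpolar _) (hpolar _)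
  · have : e z = 1 := by
      have h3 : e z = (Complex.exp (Complex.I * E z) * Complex.exp (Complex.I * E z))⁻¹ := by
        rw [he, ← Complex.exp_add, ← Complex.exp_neg]
        congr 1
        ring
      rw [h3, h1]
      simp
    simp [this]

end Lift

/-! ### One fiber seen in two model charts. -/

section FiberParam

/-- A segment in the region that went beyond an end of the fiber would cross the margin of length `1
/ 2`, which contains no point of the region. -/
theorem mem_seg_iff {k : LocalModel} {x y : R3} (hx : x ∈ k.region) :
    SameVertical k.region x y ↔ y = atHeight x (y 2) ∧ y 2 ∈ Icc (segBot k x) (segTop k x) := by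
  rw [sameVertical_iff]
  have h1 := segBot_le hx
  have h2 := le_segTop hx
  constructor
  · rintro ⟨h0, h1', h⟩
    refine ⟨R3_ext h0.symm h1'.symm rfl, ?_, ?_⟩
    · by_contra! hlt
      set t := max (y 2) (segBot k x - 1 / 2)
      have ht : t < segBot k x := max_lt hlt (by linarith)
      refine notMem_region_below (le_max_right _ _) ht (h t ?_)
      rw [uIcc_of_ge (by linarith)]
      exact ⟨le_max_left _ _, by linarith⟩
    · by_contra! hlt
      set t := min (y 2) (segTop k x + 1 / 2)
      have ht : segTop k x < t := lt_min hlt (by linarith)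
      refine notMem_region_above ht (min_le_right _ _) (h t ?_)
      rw [uIcc_of_le (by linarith)]
      exact ⟨by linarith, min_le_left _ _⟩
  · rintro ⟨h, h3⟩
    refine ⟨by rw [h]; rfl, by rw [h]; rfl, fun t ht => mem_region_of_mem_seg hx ?_⟩
    exact ordConnected_Icc.uIcc_subset ⟨h1, h2⟩ h3 ht

variable {V : Type*} [TopologicalSpace V] [ChartedSpace R3 V]
  {B : Type*} [TopologicalSpace B] {N : BranchedNbhd V B} {k k' : LocalModel}
  {e f : OpenPartialHomeomorph V R3} {b c : B}

theorem centerPt_mem_modelBox {t : ℝ} (ht : t ∈ Icc (0 : ℝ) 5) : centerPt t ∈ modelBox := by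
  simp only [mem_modelBox, centerPt_zero, centerPt_one, centerPt_two, abs_zero]
  exact ⟨one_pos, one_pos, by linarith [ht.1], by linarith [ht.2]⟩

theorem IsModelChart.symm_center_mem (hf : N.IsChart k' f b) {t : ℝ} (ht : t ∈ Icc (0 : ℝ) 5) :
    f.symm (centerPt t) ∈ N.carrier :=
  (IsModelChart.symm_mem_iff hf (centerPt_mem_modelBox ht)).2
    (center_mem_region k' rfl rfl ht.1 ht.2)

/-- The central fiber of a model chart, seen in another model chart. -/
theorem exists_fiber_param (hf : N.IsChart k' f b) (he : N.IsChart k e c) {p₀ : N.carrier}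
    (hp₀ : (p₀ : V) ∈ e.source) (hb : N.proj p₀ = b) :
    ∃ h : ℝ → ℝ, ContinuousOn h (Icc 0 5) ∧
      (∀ z ∈ Icc (0 : ℝ) 5, f.symm (centerPt z) ∈ e.source ∧
        e (f.symm (centerPt z)) = atHeight (e p₀) (h z) ∧
        h z ∈ Icc (segBot k (e p₀)) (segTop k (e p₀))) ∧
      (((∀ z ∈ Icc (0 : ℝ) 5, ∃ c : ℝ, 0 < c ∧
          jac f e (centerPt z) (stdVec 2) = c • stdVec 2) ∧
          h 0 = segBot k (e p₀) ∧ h 5 = segTop k (e p₀)) ∨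
        ((∀ z ∈ Icc (0 : ℝ) 5, ∃ c : ℝ, c < 0 ∧
          jac f e (centerPt z) (stdVec 2) = c • stdVec 2) ∧
          h 0 = segTop k (e p₀) ∧ h 5 = segBot k (e p₀))) := by
  have hxR : e p₀ ∈ k.region := (he.mem_iff _ hp₀).1 p₀.2
  set x := e p₀ with hx
  have hmem : ∀ z ∈ Icc (0 : ℝ) 5, f.symm (centerPt z) ∈ e.source ∧
      SameVertical k.region x (e (f.symm (centerPt z))) := by
    intro z hz
    have hN := IsModelChart.symm_center_mem hf hz
    have hs := IsModelChart.symm_mem_source hf (centerPt_mem_modelBox hz)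
    have h1 : N.proj ⟨_, hN⟩ = b := (IsModelChart.proj_eq_iff hf ⟨_, hN⟩).2 ⟨hs, by
      simp only
      rw [IsModelChart.right_inv hf (centerPt_mem_modelBox hz)]
      exact ⟨rfl, rfl⟩⟩
    exact (he.fiber_iff p₀ ⟨_, hN⟩ hp₀).1 (hb.trans h1.symm)
  set h : ℝ → ℝ := fun z => e (f.symm (centerPt z)) 2 with hh
  have hft : ∀ z ∈ Icc (0 : ℝ) 5, centerPt z ∈ f.target := fun z hz => by
    rw [hf.target_eq]; exact centerPt_mem_modelBox hz
  have hder : ∀ z ∈ Icc (0 : ℝ) 5, HasDerivAt h (jac f e (centerPt z) (stdVec 2) 2) z := by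
    intro z hz
    have h1 := ((contDiffAt_transition hf.smooth he.smooth (hft z hz) (hmem z hz).1).differentiableAt
      (by simp)).hasFDerivAt
    have h2 := HasFDerivAt.comp_hasDerivAt (f := fun z => atHeight (centerPt 0) z) z h1
      (hasDerivAt_atHeight (centerPt 0) z)
    exact ((EuclideanSpace.proj 2 : R3 →L[ℝ] ℝ).hasFDerivAt).comp_hasDerivAt z h2
  have hjc : ContinuousOn (fun z => jac f e (centerPt z) (stdVec 2) 2) (Icc 0 5) := by
    intro z hz
    have h1 := (contDiffAt_transition hf.smooth he.smooth (hft z hz) (hmem z hz).1).fderiv_right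
      (m := ∞) (by simp)
    have h2 : ContinuousAt (fun z => jac f e (centerPt z)) z :=
      ContinuousAt.comp (f := centerPt) h1.continuousAt (continuous_atHeight (centerPt 0)).continuousAt
    have h3 : ContinuousAt (fun z => jac f e (centerPt z) (stdVec 2)) z :=
      h2.clm_apply continuousAt_const
    exact ((EuclideanSpace.proj 2 : R3 →L[ℝ] ℝ).continuous.continuousAt.comp h3).continuousWithinAt
  have hjv : ∀ z ∈ Icc (0 : ℝ) 5, ∃ c : ℝ, c ≠ 0 ∧ jac f e (centerPt z) (stdVec 2) = c • stdVec 2 := by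
    intro z hz
    have h1 := _root_.jac_vertical hf he (IsModelChart.symm_center_mem hf hz)
      (IsModelChart.symm_mem_source hf (centerPt_mem_modelBox hz)) (hmem z hz).1
    rwa [IsModelChart.right_inv hf (centerPt_mem_modelBox hz)] at h1
  have hjv2 : ∀ z ∈ Icc (0 : ℝ) 5, jac f e (centerPt z) (stdVec 2) =
      jac f e (centerPt z) (stdVec 2) 2 • stdVec 2 := by
    intro z hz
    obtain ⟨c, hc, h1⟩ := hjv z hz
    rw [h1]
    simp [stdVec]
  have hne : ∀ z ∈ Icc (0 : ℝ) 5, jac f e (centerPt z) (stdVec 2) 2 ≠ 0 := by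
    intro z hz h0
    obtain ⟨c, hc, h1⟩ := hjv z hz
    rw [h1] at h0
    simp [stdVec, hc] at h0
  have hhc : ContinuousOn h (Icc 0 5) := fun z hz => (hder z hz).continuousAt.continuousWithinAt
  have hseg : ∀ z ∈ Icc (0 : ℝ) 5, e (f.symm (centerPt z)) = atHeight x (h z) ∧
      h z ∈ Icc (segBot k x) (segTop k x) := fun z hz => (mem_seg_iff hxR).1 (hmem z hz).2
  have hsurj : ∀ t ∈ Icc (segBot k x) (segTop k x), ∃ z ∈ Icc (0 : ℝ) 5, h z = t := by
    intro t ht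
    have hR := mem_region_of_mem_seg hxR ht
    have hbox : atHeight x t ∈ modelBox := atHeight_mem_modelBox (he.map_mem_modelBox hp₀)
      (by linarith [ht.1, segBot_nonneg (k := k) (x := x)])
      (by linarith [ht.2, segTop_le (k := k) (x := x)])
    have hN := (IsModelChart.symm_mem_iff he hbox).2 hR
    have hs := IsModelChart.symm_mem_source he hbox
    have h1 : N.proj p₀ = N.proj ⟨_, hN⟩ := by
      refine (he.fiber_iff p₀ ⟨_, hN⟩ hp₀).2 ⟨hs, ?_⟩
      simp only
      rw [IsModelChart.right_inv he hbox]
      exact (mem_seg_iff hxR).2 ⟨rfl, ht⟩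
    obtain ⟨h2, h3, h4⟩ := (IsModelChart.proj_eq_iff hf ⟨_, hN⟩).1 (h1.symm.trans hb)
    simp only at h2 h3 h4
    have h5 := region_subset_slab k' ((hf.mem_iff _ h2).1 hN)
    refine ⟨_, h5, ?_⟩
    simp only [hh]
    rw [centerPt_eq_atHeight h3 h4, atHeight_self, f.left_inv h2,
      IsModelChart.right_inv he hbox]
    rfl
  have hz0 : (0 : ℝ) ∈ Icc (0 : ℝ) 5 := by norm_num
  have hz5 : (5 : ℝ) ∈ Icc (0 : ℝ) 5 := by norm_num
  have hbt : segBot k x ≤ segTop k x := (segBot_le hxR).trans (le_segTop hxR)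
  obtain ⟨z1, hz1, hz1'⟩ := hsurj _ ⟨le_rfl, hbt⟩
  obtain ⟨z2, hz2, hz2'⟩ := hsurj _ ⟨hbt, le_rfl⟩
  refine ⟨h, hhc, fun z hz => ⟨(hmem z hz).1, hseg z hz⟩, ?_⟩
  -- The derivative of the height is continuous and never zero, so the fiber is traversed
  -- monotonically; surjectivity then identifies its ends, in the same or in the opposite order.
  have hsign : (∀ z ∈ Icc (0 : ℝ) 5, 0 < jac f e (centerPt z) (stdVec 2) 2) ∨
      ∀ z ∈ Icc (0 : ℝ) 5, jac f e (centerPt z) (stdVec 2) 2 < 0 := by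
    by_contra! hcon
    obtain ⟨⟨u, hu, hu'⟩, w, hw, hw'⟩ := hcon
    obtain ⟨y, hy, hy0⟩ := isPreconnected_Icc.intermediate_value hu hw hjc ⟨hu', hw'⟩
    exact hne y hy hy0
  rcases hsign with hpos | hneg
  · left
    have hm : StrictMonoOn h (Icc 0 5) := strictMonoOn_of_deriv_pos (convex_Icc 0 5) hhc
      fun z hz => by
        rw [(hder z (interior_subset hz)).deriv]; exact hpos z (interior_subset hz)
    refine ⟨fun z hz => ⟨_, hpos z hz, hjv2 z hz⟩, ?_, ?_⟩
    · have := hm.monotoneOn hz0 hz1 hz1.1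
      exact le_antisymm (hz1' ▸ this) (hseg 0 hz0).2.1
    · have := hm.monotoneOn hz2 hz5 hz2.2
      exact le_antisymm (hseg 5 hz5).2.2 (hz2' ▸ this)
  · right
    have hm : StrictAntiOn h (Icc 0 5) := strictAntiOn_of_deriv_neg (convex_Icc 0 5) hhc
      fun z hz => by
        rw [(hder z (interior_subset hz)).deriv]; exact hneg z (interior_subset hz)
    refine ⟨fun z hz => ⟨_, hneg z hz, hjv2 z hz⟩, ?_, ?_⟩
    · have := hm.antitoneOn hz0 hz2 hz2.1
      exact le_antisymm (hseg 0 hz0).2.2 (hz2' ▸ this)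
    · have := hm.antitoneOn hz1 hz5 hz1.2
      exact le_antisymm (hz1' ▸ this) (hseg 5 hz5).2.1

end FiberParam

end

noncomputable section

/-! ### Independence of the chart of the change of twisting. -/

section Twisting

theorem det_of_vertical {J : R3 →L[ℝ] R3} {c : ℝ} (h : J (stdVec 2) = c • stdVec 2) :
    J.det = c * (J (stdVec 0) 0 * J (stdVec 1) 1 - J (stdVec 1) 0 * J (stdVec 0) 1) := by
  have h0 : J (stdVec 2) 0 = 0 := by rw [h]; simp [stdVec]
  have h1 : J (stdVec 2) 1 = 0 := by rw [h]; simp [stdVec]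
  have h2 : J (stdVec 2) 2 = c := by rw [h]; simp [stdVec]
  rw [ContinuousLinearMap.det,
    ← LinearMap.det_toMatrix (EuclideanSpace.basisFun (Fin 3) ℝ).toBasis, Matrix.det_fin_three]
  unfold stdVec at h0 h1 h2 ⊢
  simp [LinearMap.toMatrix_apply, h0, h1, h2]
  ring

/-- This puts a real linear map of the horizontal plane in the form `z ↦ p z + q z̄` required by
`exists_lift_rot`. -/
theorem horiz_linear {ε : ℝ} (hε : ε * ε = 1) (m n : ℂ) (v : R3) :
    v 0 * m + v 1 * n = (m - Complex.I * ε * n) / 2 * horiz ε v +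
      (m + Complex.I * ε * n) / 2 * starRingEnd ℂ (horiz ε v) := by
  have h1 : horiz ε v = v 0 + Complex.I * ε * v 1 := by
    apply Complex.ext <;> simp [horiz]
  have h2 : starRingEnd ℂ (horiz ε v) = v 0 - Complex.I * ε * v 1 := by
    rw [h1]; apply Complex.ext <;> simp
  have h3 : (ε : ℂ) * ε = 1 := by exact_mod_cast hε
  rw [h2, h1]
  linear_combination (-(v 1 : ℂ) * n) * h3 + (ε * ε * n * v 1 : ℂ) * Complex.I_sq

/-- The right side is `ε` times the determinant of the real linear map. Its sign decides which of
the two coefficients dominates, that is, whether the map preserves the sense of rotation. -/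
theorem normSq_sub_normSq (ε : ℝ) (m n : ℂ) :
    ‖(m - Complex.I * ε * n) / 2‖ ^ 2 - ‖(m + Complex.I * ε * n) / 2‖ ^ 2 =
      ε * (m.re * n.im - m.im * n.re) := by
  rw [← Complex.normSq_eq_norm_sq, ← Complex.normSq_eq_norm_sq, Complex.normSq_apply,
    Complex.normSq_apply]
  simp
  ring

variable {V : Type*} [TopologicalSpace V] [ChartedSpace R3 V]
  {B : Type*} [TopologicalSpace B] {N : BranchedNbhd V B} {k k' : LocalModel}
  {e f : OpenPartialHomeomorph V R3} {b c : B} {o : OrientedAtlas V} {ξ ξ' : PlaneField V}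

/-- The effect on the twisting of a rotation, in a model chart, along a fiber. -/
theorem hasTwisting_rot (hf : N.IsChart k' f b) (hfp : o.IsPositive f) (he : N.IsChart k e c)
    {ε : ℝ} (hε : ε * ε = 1) (hs : ChartSign o e ε) {p₀ : N.carrier} (hp₀ : (p₀ : V) ∈ e.source)
    (hb : N.proj p₀ = b) {φ : R3 → ℝ}
    (hleg : ∀ t ∈ Icc (segBot k (e p₀)) (segTop k (e p₀)), rep e ξ (atHeight (e p₀) t) 2 = 0)
    (hcont : ContinuousOn (fun t => rep e ξ (atHeight (e p₀) t))
      (Icc (segBot k (e p₀)) (segTop k (e p₀))))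
    (hφ : ContinuousOn (fun t => φ (atHeight (e p₀) t))
      (Icc (segBot k (e p₀)) (segTop k (e p₀))))
    (hrot : ∀ t ∈ Icc (segBot k (e p₀)) (segTop k (e p₀)),
      rep e ξ' (atHeight (e p₀) t) = rotField ε φ (rep e ξ) (atHeight (e p₀) t))
    (hbot : Complex.exp (Complex.I * φ (atHeight (e p₀) (segBot k (e p₀)))) = 1)
    (htop : Complex.exp (Complex.I * φ (atHeight (e p₀) (segTop k (e p₀)))) = 1) {τ : ℝ}
    (hτ : HasTwisting f ξ τ) :
    HasTwisting f ξ' (τ + (φ (atHeight (e p₀) (segTop k (e p₀))) -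
      φ (atHeight (e p₀) (segBot k (e p₀)))) / (2 * Real.pi)) := by
  obtain ⟨h, hc, hh, hsign⟩ := exists_fiber_param hf he hp₀ hb
  set x := e p₀ with hx
  set bot := segBot k x
  set top := segTop k x
  have hft : ∀ z ∈ Icc (0 : ℝ) 5, centerPt z ∈ f.target := fun z hz => by
    rw [hf.target_eq]; exact centerPt_mem_modelBox hz
  rw [hasTwisting_iff hf.smooth hft] at hτ ⊢
  obtain ⟨θ, ⟨hθ, hθv⟩, rfl⟩ := hτ
  have hhI : MapsTo h (Icc 0 5) (Icc bot top) := fun z hz => (hh z hz).2.2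
  set J : ℝ → R3 →L[ℝ] R3 := fun z => jac f e (centerPt z) with hJ
  set m : ℝ → ℂ := fun z => ⟨J z (stdVec 0) 0, J z (stdVec 1) 0⟩ with hm
  set n : ℝ → ℂ := fun z => ⟨J z (stdVec 0) 1, J z (stdVec 1) 1⟩ with hn
  have hJc : ∀ u i, ContinuousOn (fun z => J z u i) (Icc 0 5) := by
    intro u i z hz
    have h1 := (contDiffAt_transition hf.smooth he.smooth (hft z hz) (hh z hz).1).fderiv_right
      (m := ∞) (by simp)
    have h2 : ContinuousAt (fun z => jac f e (centerPt z)) z :=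
      ContinuousAt.comp (f := centerPt) h1.continuousAt (continuous_atHeight (centerPt 0)).continuousAt
    have h3 : ContinuousAt (fun z => jac f e (centerPt z) u) z := h2.clm_apply continuousAt_const
    exact ((EuclideanSpace.proj i : R3 →L[ℝ] ℝ).continuous.continuousAt.comp h3).continuousWithinAt
  have hmk : ∀ a b : ℝ → ℝ, ContinuousOn a (Icc 0 5) → ContinuousOn b (Icc 0 5) →
      ContinuousOn (fun z => (⟨a z, b z⟩ : ℂ)) (Icc 0 5) := by
    intro a b ha hb
    have : (fun z => (⟨a z, b z⟩ : ℂ)) = fun z => (a z : ℂ) + b z * Complex.I := by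
      funext z; apply Complex.ext <;> simp
    rw [this]
    exact (Complex.continuous_ofReal.comp_continuousOn ha).add
      ((Complex.continuous_ofReal.comp_continuousOn hb).mul continuousOn_const)
  have hmc : ContinuousOn m (Icc 0 5) := hmk _ _ (hJc _ _) (hJc _ _)
  have hnc : ContinuousOn n (Icc 0 5) := hmk _ _ (hJc _ _) (hJc _ _)
  set p : ℝ → ℂ := fun z => (m z - Complex.I * ε * n z) / 2 with hp
  set q : ℝ → ℂ := fun z => (m z + Complex.I * ε * n z) / 2 with hq
  have hpc : ContinuousOn p (Icc 0 5) :=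
    (hmc.sub (continuousOn_const.mul hnc)).div_const 2
  have hqc : ContinuousOn q (Icc 0 5) :=
    (hmc.add (continuousOn_const.mul hnc)).div_const 2
  -- For a covector without vertical component, the change of charts only involves the first two
  -- rows and columns of the Jacobian matrix, and is linear in the horizontal part up to a positive
  -- factor.
  have hchange : ∀ η : PlaneField V, ∀ z ∈ Icc (0 : ℝ) 5, rep e η (atHeight x (h z)) 2 = 0 →
      ∃ r : ℝ, 0 < r ∧ (horiz 1 (rep f η (centerPt z)) : ℂ) =
        r * (p z * horiz ε (rep e η (atHeight x (h z))) +
          q z * starRingEnd ℂ (horiz ε (rep e η (atHeight x (h z))))) ∧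
        rep f η (centerPt z) 2 = 0 := by
    intro η z hz h2
    set P := f.symm (centerPt z) with hP
    have hPf : P ∈ f.source := f.map_target (hft z hz)
    have hfP : f P = centerPt z := f.right_inv (hft z hz)
    obtain ⟨hPe, heP, -⟩ := hh z hz
    obtain ⟨r, hr, h3⟩ := SpansAt.change hf.smooth he.smooth hPf hPe
      (spansAt_rep (ξ := η) hf.smooth (f.map_source hPf))
      (spansAt_rep (ξ := η) he.smooth (e.map_source hPe))
    rw [hfP, heP] at h3
    refine ⟨r, hr, ?_, ?_⟩
    · rw [← horiz_linear hε]
      have h30 := h3 (stdVec 0)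
      have h31 := h3 (stdVec 1)
      rw [inner_stdVec] at h30 h31
      simp only [PiLp.inner_apply, Fin.sum_univ_three, RCLike.inner_apply, conj_trivial] at h30 h31
      rw [h2] at h30 h31
      apply Complex.ext
      · simp [horiz, hm, hn]
        rw [h30]; ring
      · simp [horiz, hm, hn]
        rw [h31]; ring
    · have h4 := rep_two_eq_zero_iff (ξ := η) hf he (IsModelChart.symm_center_mem hf hz) hPf hPe
      rw [heP, ← hP, hfP] at h4
      exact h4.2 h2
  have hleg' : ∀ t ∈ Icc bot top, rep e ξ' (atHeight x t) 2 = 0 := fun t ht => by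
    rw [hrot t ht]; exact hleg t ht
  set A : ℝ → ℂ := fun z => horiz ε (rep e ξ (atHeight x (h z))) with hA
  set E : ℝ → ℝ := fun z => φ (atHeight x (h z)) with hE
  have hAE : ∀ z ∈ Icc (0 : ℝ) 5, horiz ε (rep e ξ' (atHeight x (h z))) =
      A z * Complex.exp (Complex.I * E z) := fun z hz => by
    rw [hrot _ (hhI hz), horiz_rotField hε]
  have hvc : ContinuousOn (fun z => rep e ξ (atHeight x (h z))) (Icc 0 5) := hcont.comp hc hhI
  have hvci : ∀ i, ContinuousOn (fun z => rep e ξ (atHeight x (h z)) i) (Icc 0 5) := fun i =>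
    (EuclideanSpace.proj i : R3 →L[ℝ] ℝ).continuous.comp_continuousOn hvc
  have hAc : ContinuousOn A (Icc 0 5) := hmk _ _ (hvci 0) (continuousOn_const.mul (hvci 1))
  have hEc : ContinuousOn E (Icc 0 5) := hφ.comp hc hhI
  have hhor : ∀ z ∈ Icc (0 : ℝ) 5, horiz 1 (rep f ξ (centerPt z)) =
      Complex.exp (Complex.I * θ z) := fun z hz => by
    have : rep f ξ (centerPt z) = _ := hθv z hz
    rw [this, horiz_exp_eq]
    simp
  have hlin : ∀ z ∈ Icc (0 : ℝ) 5, ∃ r : ℝ, 0 < r ∧ p z * A z + q z * starRingEnd ℂ (A z) =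
      r * Complex.exp (Complex.I * θ z) := by
    intro z hz
    obtain ⟨r, hr, h1, -⟩ := hchange ξ z hz (hleg _ (hhI hz))
    rw [hhor z hz] at h1
    refine ⟨r⁻¹, inv_pos.2 hr, ?_⟩
    rw [h1, ← mul_assoc]
    have : (r : ℂ) ≠ 0 := by exact_mod_cast hr.ne'
    push_cast
    rw [inv_mul_cancel₀ this, one_mul]
  choose! r hr hrlin using hlin
  have hA0 : ∀ z ∈ Icc (0 : ℝ) 5, A z ≠ 0 := by
    intro z hz h0
    have h1 := hrlin z hz
    rw [h0] at h1
    have h2 : (r z : ℂ) ≠ 0 := by exact_mod_cast (hr z hz).ne'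
    simp [h2] at h1
  have hfinish : ∀ δ : ℝ → ℝ, ContinuousOn δ (Icc 0 5) → (∀ z ∈ Icc (0 : ℝ) 5, ∃ r' : ℝ, 0 < r' ∧
      p z * (A z * Complex.exp (Complex.I * E z)) +
        q z * starRingEnd ℂ (A z * Complex.exp (Complex.I * E z)) =
          r' * Complex.exp (Complex.I * (θ z + δ z : ℝ))) →
      IsAngle f ξ' 1 (centerPt 0) 0 5 fun z => θ z + δ z := by
    intro δ hδ hl
    refine ⟨hθ.add hδ, fun z hz => ?_⟩
    change rep f ξ' (centerPt z) = _
    obtain ⟨r', hr', h1⟩ := hl z hz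
    obtain ⟨s, hs, h2, h3⟩ := hchange ξ' z hz (hleg' _ (hhI hz))
    rw [hAE z hz, h1, ← mul_assoc, ← Complex.ofReal_mul] at h2
    have h4 : s * r' = 1 := by
      have h5 := norm_rep (ξ := ξ') hf.smooth (hft z hz)
      rw [EuclideanSpace.norm_eq, Real.sqrt_eq_one] at h5
      simp only [Fin.sum_univ_three, Real.norm_eq_abs, sq_abs, h3] at h5
      have h6 := congrArg (fun w : ℂ => ‖w‖ ^ 2) h2
      simp only [norm_mul, Complex.norm_real, Complex.norm_exp_I_mul_ofReal, mul_one] at h6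
      rw [← Complex.normSq_eq_norm_sq, Complex.normSq_apply] at h6
      simp only [horiz, one_mul, Real.norm_eq_abs, abs_of_pos hs, abs_of_pos hr'] at h6
      have h7 : (s * r') ^ 2 = 1 := by rw [← h6]; linarith
      exact (pow_eq_one_iff_of_nonneg (mul_pos hs hr').le two_ne_zero).1 h7
    rw [h4, Complex.ofReal_one, one_mul] at h2
    apply horiz_injective (ε := 1) (by norm_num)
    · rw [h2, horiz_exp_eq]; simp
    · exact h3
  -- The determinant of the transition is `d` times the horizontal determinant, and its sign is
  -- prescribed by `ε`. So the horizontal map, in terms of `horiz`, preserves rotations exactly when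
  -- the direction of the fiber is preserved.
  have hnorm : ∀ z ∈ Icc (0 : ℝ) 5, ∀ d : ℝ, jac f e (centerPt z) (stdVec 2) = d • stdVec 2 →
      0 < d * (‖p z‖ ^ 2 - ‖q z‖ ^ 2) := by
    intro z hz d hd
    have h1 := ChartSign.jac_pos hf.smooth he.smooth (chartSign_one_iff.2 hfp) hs (hft z hz)
      (hh z hz).1
    rw [det_of_vertical hd] at h1
    rw [hp, hq]
    simp only
    rw [normSq_sub_normSq]
    convert h1 using 1
    simp only [hm, hn, hJ]
    ring
  have hlt : ∀ a b : ℝ, 0 ≤ a → 0 ≤ b → 0 < a ^ 2 - b ^ 2 → b < a := fun a b ha hb hab => by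
    nlinarith
  have hE1 : ∀ z, h z = bot ∨ h z = top → Complex.exp (Complex.I * E z) = 1 := by
    rintro z (hz | hz) <;> simp only [hE, hz] <;> assumption
  have hz0 : (0 : ℝ) ∈ Icc (0 : ℝ) 5 := by norm_num
  have hz5 : (5 : ℝ) ∈ Icc (0 : ℝ) 5 := by norm_num
  rcases hsign with ⟨hd, h0, h5⟩ | ⟨hd, h0, h5⟩
  · obtain ⟨δ, hδ, hl, hδE⟩ := exists_lift_rot hpc hqc hAc hEc hA0 (fun z hz => by
      obtain ⟨d, hd, hdv⟩ := hd z hz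
      exact hlt _ _ (norm_nonneg _) (norm_nonneg _)
        (pos_of_mul_pos_right (hnorm z hz d hdv) hd.le)) hr hrlin
    refine ⟨_, hfinish δ hδ hl, ?_⟩
    rw [hδE 0 hz0 (hE1 0 (Or.inl h0)), hδE 5 hz5 (hE1 5 (Or.inr h5))]
    simp only [hE, h0, h5]
    ring
  -- If the fiber is reversed, the antilinear coefficient dominates: the lemma is applied to the
  -- conjugate of `A` and to `-E`. The change of sign of the angle and the exchange of the ends
  -- compensate each other.
  · have hconj : ∀ z, starRingEnd ℂ (A z * Complex.exp (Complex.I * E z)) =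
        starRingEnd ℂ (A z) * Complex.exp (Complex.I * (-E z : ℝ)) := fun z => by
      rw [map_mul, ← Complex.exp_conj]
      simp
    obtain ⟨δ, hδ, hl, hδE⟩ := exists_lift_rot (p := q) (q := p) (A := fun z => starRingEnd ℂ (A z))
      (E := fun z => -E z) (θ := θ) (r := r) hqc hpc
      (Complex.continuous_conj.comp_continuousOn hAc) hEc.neg
      (fun z hz => by simpa using hA0 z hz) (fun z hz => by
        obtain ⟨d, hd, hdv⟩ := hd z hz
        refine hlt _ _ (norm_nonneg _) (norm_nonneg _) ?_
        have := hnorm z hz d hdv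
        nlinarith) hr (fun z hz => by
          rw [← hrlin z hz, Complex.conj_conj]; ring)
    have hneg : ∀ z, Complex.exp (Complex.I * E z) = 1 →
        Complex.exp (Complex.I * (-E z : ℝ)) = 1 := fun z hz => by
      rw [Complex.ofReal_neg, mul_neg, Complex.exp_neg, hz, inv_one]
    refine ⟨_, hfinish δ hδ (fun z hz => ?_), ?_⟩
    · obtain ⟨r', hr', h1⟩ := hl z hz
      refine ⟨r', hr', ?_⟩
      rw [← h1, ← hconj, Complex.conj_conj]
      ring
    · rw [hδE 0 hz0 (hneg _ (hE1 0 (Or.inr h0))), hδE 5 hz5 (hneg _ (hE1 5 (Or.inl h5)))]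
      simp only [hE, h0, h5]
      ring

end Twisting

end

noncomputable section

/-! ### Points near which the model is a product. -/

section Flat

/-- Near the point `x` of the region, the region is a product. -/
def FlatAt (k : LocalModel) (x : R3) : Prop :=
  (k = .branch ∨ k = .double ∨ k = .bdryBranch → x 0 < 0 ∨ 0 < x 0 ∨ (k = .double ∧ x 1 < 0 ∧ 4 ≤ x 2)) ∧
  (k = .double → x 1 < 0 ∨ 0 < x 1 ∨ (x 0 < 0 ∧ x 2 ≤ 1)) ∧
  (k = .bdryDisk ∨ k = .bdryBranch → 0 < x 1)

theorem flatAt_of_ne {k : LocalModel} {x : R3} (hx : x ∈ k.region) (h0 : x 0 ≠ 0)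
    (h1 : x 1 ≠ 0) : FlatAt k x := by
  rw [mem_region_iff] at hx
  exact ⟨fun _ => (lt_or_gt_of_ne h0).imp_right Or.inl, fun _ => (lt_or_gt_of_ne h1).imp_right Or.inl,
    fun hk => lt_of_le_of_ne (hx.2.2.2.2 hk) h1.symm⟩

-- The margin `(segTop k x - segBot k x) / 5` becomes one unit when the fiber is rescaled to `[0,
-- 5]`, as the box of heights `(-1, 6)` requires. It is at most `1`, the height of the slits, so the
-- adjacent sheets are not reached.
set_option maxHeartbeats 400000 in
theorem region_iff_of_flatAt {k : LocalModel} {x z : R3} (hx : x ∈ k.region) (hf : FlatAt k x)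
    (a1 : x 0 < 0 → z 0 < 0) (a2 : 0 < x 0 → 0 < z 0) (b1 : x 1 < 0 → z 1 < 0)
    (b2 : 0 < x 1 → 0 < z 1) (hz2 : segBot k x - (segTop k x - segBot k x) / 5 < z 2)
    (hz2' : z 2 < segTop k x + (segTop k x - segBot k x) / 5) :
    z ∈ k.region ↔ segBot k x ≤ z 2 ∧ z 2 ≤ segTop k x := by
  obtain ⟨f1, f2, f3⟩ := hf
  rw [mem_region_iff] at hx ⊢
  unfold segBot segTop at *
  generalize x 0 = x0 at *
  generalize x 1 = x1 at *
  generalize x 2 = x2 at *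
  generalize z 0 = z0 at *
  generalize z 1 = z1 at *
  generalize z 2 = z2 at *
  cases k <;> simp only [reduceCtorEq, false_and, true_and, or_false, false_or, or_true, true_or,
    or_self, if_false, false_implies, true_implies, and_true, if_true] at * <;>
    (try split_ifs at *) <;> grind

theorem exists_flat_radius {k : LocalModel} {x : R3} (hxb : x ∈ modelBox) (hx : x ∈ k.region)
    (hf : FlatAt k x) : ∃ r : ℝ, 0 < r ∧ |x 0| + r ≤ 1 ∧ |x 1| + r ≤ 1 ∧
      ∀ z : R3, |z 0 - x 0| < r → |z 1 - x 1| < r →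
        segBot k x - (segTop k x - segBot k x) / 5 < z 2 →
        z 2 < segTop k x + (segTop k x - segBot k x) / 5 →
        (z ∈ k.region ↔ segBot k x ≤ z 2 ∧ z 2 ≤ segTop k x) := by
  obtain ⟨r, hr, h0, h1, h2, h3⟩ : ∃ r : ℝ, 0 < r ∧ |x 0| + r ≤ 1 ∧ |x 1| + r ≤ 1 ∧
      (x 0 ≠ 0 → r ≤ |x 0|) ∧ (x 1 ≠ 0 → r ≤ |x 1|) := by
    have hs : ∀ s : ℝ, |s| < 1 → ∃ r : ℝ, 0 < r ∧ |s| + r ≤ 1 ∧ (s ≠ 0 → r ≤ |s|) := by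
      intro s hs
      by_cases h : s = 0
      · exact ⟨1, one_pos, by simp [h], fun h' => absurd h h'⟩
      · exact ⟨min (1 - |s|) |s|, lt_min (by linarith) (abs_pos.2 h),
          by linarith [min_le_left (1 - |s|) |s|], fun _ => min_le_right _ _⟩
    obtain ⟨r, hr, h1, h2⟩ := hs _ hxb.1
    obtain ⟨r', hr', h1', h2'⟩ := hs _ hxb.2.1
    have ha := min_le_left r r'
    have hb := min_le_right r r'
    exact ⟨min r r', lt_min hr hr', by linarith, by linarith, fun h => ha.trans (h2 h),
      fun h => hb.trans (h2' h)⟩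
  refine ⟨r, hr, h0, h1, fun z hz0 hz1 hz2 hz2' => ?_⟩
  have hsign : ∀ s t : ℝ, (s ≠ 0 → r ≤ |s|) → |t - s| < r → (s < 0 → t < 0) ∧ (0 < s → 0 < t) := by
    intro s t h h'
    have h3 := abs_lt.1 h'
    constructor
    · intro hs
      have := h hs.ne
      rw [abs_of_neg hs] at this
      linarith
    · intro hs
      have := h hs.ne'
      rw [abs_of_pos hs] at this
      linarith
  obtain ⟨a1, a2⟩ := hsign _ _ h2 hz0
  obtain ⟨b1, b2⟩ := hsign _ _ h3 hz1
  exact region_iff_of_flatAt hx hf a1 a2 b1 b2 hz2 hz2'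

end Flat

/-! ### Partial solutions on saturated domains, and their expression in charts. -/

section Solution

variable {V : Type*} [TopologicalSpace V] [ChartedSpace R3 V] [IsManifold (𝓡 3) ∞ V]
  {B : Type*} [TopologicalSpace B] {N : BranchedNbhd V B} {k k' : LocalModel}
  {e f : OpenPartialHomeomorph V R3} {b c : B} {o : OrientedAtlas V} {ξ ξ' ξ₀ ζ : PlaneField V}
  {w : N.Regular → ℤ} {S S' : Set V}

/-- A point near which the model is a product has a positive disk chart, and the twisting can be
computed in the given chart. -/
theorem exists_disk_chart (he : N.IsChart k e c) {ε : ℝ} (hε : ε = 1 ∨ ε = -1)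
    (hs : ChartSign o e ε) {p₀ : N.carrier} (hp₀ : (p₀ : V) ∈ e.source)
    (hf : FlatAt k (e p₀)) : ∃ f, N.IsChart .disk f (N.proj p₀) ∧ o.IsPositive f ∧
      ∀ ξ τ, HasTwisting f ξ τ ↔ ∃ θ, IsAngle e ξ ε (e p₀) (segBot k (e p₀)) (segTop k (e p₀)) θ ∧
        τ = (θ (segTop k (e p₀)) - θ (segBot k (e p₀))) / (2 * Real.pi) := by
  have hxb := he.map_mem_modelBox hp₀
  have hxR := (he.mem_iff _ hp₀).1 p₀.2
  obtain ⟨r, hr, hr0, hr1, hreg⟩ := exists_flat_radius hxb hxR hf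
  set x := e p₀ with hx
  have hbt := segBot_lt_segTop hxR
  have hb := segBot_nonneg (k := k) (x := x)
  have ht := segTop_le (k := k) (x := x)
  have hb2 := segBot_le hxR
  have ht2 := le_segTop hxR
  set bot := segBot k x
  set top := segTop k x
  have hlt : bot < top := by linarith
  have hε0 : ε ≠ 0 := by rcases hε with rfl | rfl <;> norm_num
  have hε2 : ε * ε = 1 := by rcases hε with rfl | rfl <;> norm_num
  have hεa : |ε| = 1 := by rcases hε with rfl | rfl <;> norm_num
  -- The factor `ε` reflects the first coordinate when `e` is negative, so that the disk chart is
  -- positive.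
  set G := boxMap ε r hε0 hr x bot top hlt with hG
  have hinv : ∀ y ∈ modelBox, |G.invFun y 0 - x 0| < r ∧ |G.invFun y 1 - x 1| < r ∧
      bot - (top - bot) / 5 < G.invFun y 2 ∧ G.invFun y 2 < top + (top - bot) / 5 ∧
      G.invFun y 2 = bot + (top - bot) * y 2 / 5 := by
    intro y hy
    rw [hG, boxMap_inv_apply]
    obtain ⟨h0, h1, h2, h3⟩ := hy
    have hd : 0 < top - bot := sub_pos.2 hlt
    refine ⟨?_, ?_, ?_, ?_, rfl⟩
    · change |x 0 + y 0 / (ε / r) - x 0| < r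
      rw [add_sub_cancel_left, abs_div, abs_div, hεa, abs_of_pos hr, div_div_eq_mul_div, div_one]
      nlinarith
    · change |x 1 + y 1 / (1 / r) - x 1| < r
      rw [add_sub_cancel_left, abs_div, abs_div, abs_one, abs_of_pos hr, div_div_eq_mul_div,
        div_one]
      nlinarith
    · change _ < bot + (top - bot) * y 2 / 5
      nlinarith
    · change bot + (top - bot) * y 2 / 5 < _
      nlinarith
  have hbox : ∀ y ∈ modelBox, G.invFun y ∈ modelBox := by
    intro y hy
    obtain ⟨h0, h1, h2, h3, -⟩ := hinv y hy
    refine ⟨?_, ?_, by linarith, by linarith⟩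
    · have := abs_sub_abs_le_abs_sub (G.invFun y 0) (x 0)
      linarith
    · have := abs_sub_abs_le_abs_sub (G.invFun y 1) (x 1)
      linarith
  have hGx : G.toFun x = !₂[ε / r * (x 0 - x 0), 1 / r * (x 1 - x 1), 5 * (x 2 - bot) / (top - bot)] :=
    boxMap_apply x
  have h2 : G.toFun x 2 = 5 * (x 2 - bot) / (top - bot) := by rw [hGx]; rfl
  have hd : 0 < top - bot := sub_pos.2 hlt
  refine ⟨subchart e G, ?_, ?_, ?_⟩
  · refine he.subchart hbox ?_ p₀ hp₀ ?_ ?_ ?_ ?_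
    · intro y hy
      obtain ⟨h0, h1, h2, h3, h4⟩ := hinv y hy
      rw [hreg _ h0 h1 h2 h3, h4]
      change _ ↔ 0 ≤ y 2 ∧ y 2 ≤ 5
      constructor
      · rintro ⟨h5, h6⟩
        constructor <;> nlinarith
      · rintro ⟨h5, h6⟩
        constructor <;> nlinarith
    · rw [← hx, hGx]; simp
    · rw [← hx, hGx]; simp
    · rw [← hx, h2]
      have : 0 ≤ 5 * (x 2 - bot) / (top - bot) := div_nonneg (by linarith) hd.le
      linarith
    · rw [← hx, h2, div_lt_iff₀ hd]
      linarith
  · rw [← chartSign_one_iff, ← hε2]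
    refine ChartSign.subchart he.smooth hs fun y => ?_
    rw [hG, det_fderiv_boxMap]
    have : ε * (ε / r * (1 / r) * (5 / (top - bot))) = 5 / (r * r * (top - bot)) * (ε * ε) := by
      field_simp
    rw [this, hε2, mul_one]
    positivity
  · intro ξ τ
    exact hasTwisting_subchart_iff he.smooth hε fun y hy => by
      rw [he.target_eq]; exact hbox y hy

theorem notMem_branchLocus_of_disk (h : N.IsChart .disk f b) : b ∉ N.branchLocus :=
  fun h' => h' ⟨f, Or.inl h⟩

theorem HasTwisting.unique (hf : f ∈ IsManifold.maximalAtlas (𝓡 3) ∞ V)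
    (hft : ∀ t ∈ Icc (0 : ℝ) 5, centerPt t ∈ f.target) {τ τ' : ℝ}
    (h : HasTwisting f ξ τ) (h' : HasTwisting f ξ τ') : τ = τ' := by
  rw [hasTwisting_iff hf hft] at h h'
  obtain ⟨θ, ⟨h1, h2⟩, rfl⟩ := h
  obtain ⟨θ', ⟨h1', h2'⟩, rfl⟩ := h'
  rw [sub_eq_sub_of_exp_eq (by norm_num) h1 h1' (u := 1) fun z hz => ?_]
  rw [one_mul, ← one_mul (Complex.exp (Complex.I * θ z)), ← one_mul (Complex.exp (Complex.I * θ' z)),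
    ← Complex.ofReal_one, ← horiz_exp_eq, ← horiz_exp_eq, ← h2 z hz, ← h2' z hz]

theorem IsModelChart.center_mem_target (hf : N.IsChart k f b) {t : ℝ} (ht : t ∈ Icc (0 : ℝ) 5) :
    centerPt t ∈ f.target := by
  rw [hf.target_eq]; exact centerPt_mem_modelBox ht

theorem IsModelChart.proj_symm_center (hf : N.IsChart k f b) {t : ℝ} (ht : t ∈ Icc (0 : ℝ) 5) :
    N.proj ⟨f.symm (centerPt t), IsModelChart.symm_center_mem hf ht⟩ = b := by
  refine (IsModelChart.proj_eq_iff hf _).2 ⟨hf.symm_mem_source (centerPt_mem_modelBox ht), ?_⟩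
  simp only
  rw [IsModelChart.right_inv hf (centerPt_mem_modelBox ht)]
  exact ⟨rfl, rfl⟩

theorem HasTwisting.congr_fiber (hf : N.IsChart k f b)
    (h : ∀ q : N.carrier, N.proj q = b → ξ q = ξ' q) {τ : ℝ} (hτ : HasTwisting f ξ τ) :
    HasTwisting f ξ' τ := by
  obtain ⟨θ, h1, h2, h3⟩ := hτ
  refine ⟨θ, h1, fun t ht => ?_, h3⟩
  have := h ⟨_, IsModelChart.symm_center_mem hf ht⟩ (IsModelChart.proj_symm_center hf ht)
  simp only at this
  rw [← this]
  exact h2 t ht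

/-- An open set that contains the complement of the neighborhood and is a union of fibers. -/
structure BranchedNbhd.IsDomain (N : BranchedNbhd V B) (S : Set V) : Prop where
  isOpen : IsOpen S
  compl_subset : N.carrierᶜ ⊆ S
  mem : ∀ p q : N.carrier, N.proj p = N.proj q → (p : V) ∈ S → (q : V) ∈ S

/-- On the domain `S`, `ξ` is a contact structure generated by the branched surface, with weight
`w`. -/
structure BranchedNbhd.IsSolution (N : BranchedNbhd V B) (o : OrientedAtlas V) (ζ ξ₀ : PlaneField V)
    (w : N.Regular → ℤ) (S : Set V) (ξ : PlaneField V) : Prop where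
  dom : N.IsDomain S
  contact : ∀ p ∈ S, ContactAt o ξ p
  agree : ∀ p, p ∉ N.carrier → ξ p = ζ p
  legendrian : N.LegendrianOn ξ S
  -- Only disk charts are tested. Over boundary points the structure is forced by `ζ`, see
  -- `eq_of_bdryDisk`, and half disk charts are dealt with at the end.
  weight : ∀ p : N.carrier, (p : V) ∈ S → ∀ (hb : N.proj p ∉ N.branchLocus)
    (f : OpenPartialHomeomorph V R3), N.IsChart .disk f (N.proj p) → o.IsPositive f →
    ∃ τ₀ τ : ℝ, HasTwisting f ξ₀ τ₀ ∧ HasTwisting f ξ τ ∧ (w ⟨N.proj p, hb⟩ : ℝ) = τ₀ - τ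

theorem BranchedNbhd.IsDomain.isSaturated (h : N.IsDomain S) (he : N.IsChart k e c) :
    IsSaturated k (e.target ∩ e.symm ⁻¹' S) where
  isOpen := e.isOpen_inter_preimage_symm h.isOpen
  subset x hx := he.target_eq ▸ hx.1
  diff_subset x hx := ⟨he.target_eq ▸ hx.1, h.compl_subset fun hN =>
    hx.2 ((he.symm_mem_iff hx.1).1 hN)⟩
  mem x hx t ht := by
    have hxb : x ∈ modelBox := he.target_eq ▸ hx.1
    have hxR : x ∈ k.region := by simpa using ht (x 2) left_mem_uIcc
    have htR := ht t right_mem_uIcc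
    have hts := region_subset_slab k htR
    have htb : atHeight x t ∈ modelBox := atHeight_mem_modelBox hxb
      (by linarith [hts.1, atHeight_two x t]) (by linarith [hts.2, atHeight_two x t])
    refine ⟨he.target_eq ▸ htb, ?_⟩
    refine h.mem ⟨_, (he.symm_mem_iff hxb).2 hxR⟩ ⟨_, (he.symm_mem_iff htb).2 htR⟩ ?_ hx.2
    refine (he.fiber_iff _ _ (he.symm_mem_source hxb)).2 ⟨he.symm_mem_source htb, ?_⟩
    simp only
    rw [he.right_inv hxb, he.right_inv htb, sameVertical_iff]
    exact ⟨rfl, rfl, ht⟩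

/-- The dictionary between contact structures with Legendrian fibers and rotating fields in a model
chart. -/
theorem isLocalField_rep (hd : N.IsDomain S) (hc : ∀ p ∈ S, ContactAt o ξ p)
    (hl : N.LegendrianOn ξ S) (he : N.IsChart k e c) {ε : ℝ} (hε : ε = 1 ∨ ε = -1)
    (hs : ChartSign o e ε) : IsLocalField k ε (e.target ∩ e.symm ⁻¹' S) (rep e ξ) := by
  have hcs : ∀ x ∈ e.target ∩ e.symm ⁻¹' S, ContDiffAt ℝ ∞ (rep e ξ) x ∧
      0 < ε * helicity (rep e ξ) x := by
    rintro x ⟨hx, hxS⟩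
    have := ((contactAt_iff hε he.smooth hs (e.map_target hx)).1 (hc _ hxS)).self_of_nhds
    rwa [e.right_inv hx] at this
  refine ⟨hd.isSaturated he, hε, fun x hx => (hcs x hx).1, fun x hx => norm_rep he.smooth hx.1,
    fun x hx => (hcs x hx).2, fun x hx hxR => ?_⟩
  have := hl (e.symm x) ((he.symm_mem_iff (he.target_eq ▸ hx.1)).2 hxR) hx.2 k e c he
    (e.map_target hx.1)
  rwa [e.right_inv hx.1] at this

namespace BranchedNbhd.IsSolution

theorem isLocalField (h : N.IsSolution o ζ ξ₀ w S ξ) (he : N.IsChart k e c) {ε : ℝ}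
    (hε : ε = 1 ∨ ε = -1) (hs : ChartSign o e ε) :
    IsLocalField k ε (e.target ∩ e.symm ⁻¹' S) (rep e ξ) :=
  isLocalField_rep h.dom h.contact h.legendrian he hε hs

theorem inter_eq_modelBox (he : N.IsChart k e c) (hS : e.source ⊆ S) :
    e.target ∩ e.symm ⁻¹' S = modelBox := by
  rw [he.target_eq, inter_eq_left]
  exact fun x hx => hS (he.symm_mem_source hx)

/-- Two solutions for the same `w` have the same twisting in a disk chart, since twisting numbers
with respect to a given chart are unique. Off the coordinate planes such a chart exists, and there
`angle_sub` converts the equality into the balance condition. -/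
theorem isFieldPair (h : N.IsSolution o ζ ξ₀ w S ξ) (h' : N.IsSolution o ζ ξ₀ w S' ξ')
    (he : N.IsChart k e c) (hS' : e.source ⊆ S') {ε : ℝ} (hε : ε = 1 ∨ ε = -1)
    (hs : ChartSign o e ε) :
    IsFieldPair k ε (e.target ∩ e.symm ⁻¹' S) (rep e ξ) (rep e ξ') := by
  have hl := h.isLocalField he hε hs
  have hr := h'.isLocalField he hε hs
  have hr' := hr
  rw [inter_eq_modelBox he hS'] at hr
  refine ⟨hl, hr, fun x hx hxR => ?_, fun x hx hxR h0 h1 => ?_⟩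
  · have hN : e.symm x ∉ N.carrier := fun hN => hxR ((he.symm_mem_iff hx).1 hN)
    rw [rep_eq_iff he.smooth (he.target_eq ▸ hx), h.agree _ hN, h'.agree _ hN]
  · have hxb : x ∈ modelBox := he.target_eq ▸ hx.1
    set p₀ : N.carrier := ⟨e.symm x, (he.symm_mem_iff hxb).2 hxR⟩ with hp₀
    have hps : (p₀ : V) ∈ e.source := he.symm_mem_source hxb
    have hex : e p₀ = x := he.right_inv hxb
    obtain ⟨f, hf, hfp, hft⟩ := exists_disk_chart he hε hs hps
      (by rw [hex]; exact flatAt_of_ne hxR h0 h1)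
    rw [hex] at hft
    obtain ⟨τ₀, τ, t1, t2, t3⟩ := h.weight p₀ hx.2 (notMem_branchLocus_of_disk hf) f hf hfp
    obtain ⟨τ₀', τ', t1', t2', t3'⟩ := h'.weight p₀ (hS' hps) (notMem_branchLocus_of_disk hf) f hf
      hfp
    have h00 := HasTwisting.unique hf.smooth (fun t ht => IsModelChart.center_mem_target hf ht) t1 t1'
    have hττ : τ = τ' := by linarith
    obtain ⟨θ, ⟨a1, a2⟩, a3⟩ := (hft ξ τ).1 t2
    obtain ⟨θ', ⟨b1, b2⟩, b3⟩ := (hft ξ' τ').1 t2'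
    have hbt : segBot k x ≤ segTop k x := (segBot_le hxR).trans (le_segTop hxR)
    have hΩ : ∀ z ∈ Icc (segBot k x) (segTop k x), atHeight x z ∈ e.target ∩ e.symm ⁻¹' S :=
      fun z hz => hl.sat.atHeight_mem hx hxR ⟨by linarith [hz.1], by linarith [hz.2]⟩
    have hRs : ∀ z ∈ Icc (segBot k x) (segTop k x), atHeight x z ∈ k.region := fun z hz =>
      mem_region_of_mem_seg hxR hz
    have c1 := hl.angle_sub hbt hΩ hRs a1 a2
    have c2 := hr.angle_sub hbt (fun z hz => hl.sat.subset (hΩ z hz)) hRs b1 b2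
    rw [intervalIntegral.integral_sub]
    · have hpi := Real.pi_pos
      rw [hττ, b3, div_left_inj' (by positivity)] at a3
      linarith
    · apply ContinuousOn.intervalIntegrable
      rw [uIcc_of_le hbt]
      exact fun t ht => ((hl.contDiffAt_rate (hΩ t ht)).continuousAt.comp
        (continuous_atHeight x).continuousAt).continuousWithinAt
    · apply ContinuousOn.intervalIntegrable
      rw [uIcc_of_le hbt]
      exact fun t ht => ((hr.contDiffAt_rate (hl.sat.subset (hΩ t ht))).continuousAt.comp
        (continuous_atHeight x).continuousAt).continuousWithinAt

end BranchedNbhd.IsSolution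

end Solution

end

noncomputable section

/-! ### Replacing a solution by another one over the column of a chart. -/

section Interpolate

/-- The rates involve only derivatives along the fiber, so agreement on a single fiber is enough.
This protects the fibers where two structures already coincide. -/
theorem IsFieldPair.angleDiff_eq_zero {k : LocalModel} {ε : ℝ} {Ω : Set R3} {v v' : R3 → R3}
    (h : IsFieldPair k ε Ω v v') {x : R3} (hx : x ∈ Ω) (hxR : x ∈ k.region)
    (heq : ∀ t ∈ Icc (segBot k x) (segTop k x), v (atHeight x t) = v' (atHeight x t)) :
    angleDiff k ε Ω v v' x = 0 := by
  have hs := h.left.sat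
  have hb := segBot_le hxR
  have ht := le_segTop hxR
  rw [IsFieldPair.angleDiff_of_mem hx hxR]
  have hrate : ∀ t ∈ Ioo (segBot k x) (segTop k x),
      rate ε v (atHeight x t) = rate ε v' (atHeight x t) := by
    intro t htI
    have hm := hs.atHeight_mem hx hxR (t := t) ⟨by linarith [htI.1], by linarith [htI.2]⟩
    have h1 := ((h.left.smooth _ hm).differentiableAt (by simp)).hasFDerivAt.comp_hasDerivAt t
      (hasDerivAt_atHeight x t)
    have h2 := ((h.right.smooth _ (hs.subset hm)).differentiableAt (by simp)).hasFDerivAt.comp_hasDerivAt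
      t (hasDerivAt_atHeight x t)
    have h3 : (v ∘ atHeight x) =ᶠ[𝓝 t] (v' ∘ atHeight x) := by
      filter_upwards [Ioo_mem_nhds htI.1 htI.2] with s hsI
      exact heq s (Ioo_subset_Icc_self hsI)
    have h4 := h1.unique (h2.congr_of_eventuallyEq h3)
    unfold rate
    rw [h4, heq t (Ioo_subset_Icc_self htI)]
  rw [intervalIntegral.integral_of_le hb, MeasureTheory.integral_Ioc_eq_integral_Ioo]
  rw [MeasureTheory.setIntegral_congr_fun (g := fun _ => 0) measurableSet_Ioo]
  · simp
  · intro t htI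
    simp only
    rw [hrate t ⟨htI.1, htI.2.trans_le ht⟩, sub_self]

variable {V : Type*} [TopologicalSpace V] [ChartedSpace R3 V] [IsManifold (𝓡 3) ∞ V]
  {B : Type*} [TopologicalSpace B] {N : BranchedNbhd V B} {k k' : LocalModel}
  {e f : OpenPartialHomeomorph V R3} {b c : B} {o : OrientedAtlas V} {ξ ξ' ξ₀ ζ : PlaneField V}
  {w : N.Regular → ℤ} {S S' : Set V}

open scoped Classical in
/-- The plane field `ξ`, rotated by the angle `φ` in the chart `e` along the fibers (and replaced by
`ξ'` where `ξ` is not defined). -/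
def rotPlane (N : BranchedNbhd V B) (e : OpenPartialHomeomorph V R3) (S : Set V) (ε : ℝ)
    (ρ φ : R3 → ℝ) (ξ ξ' : PlaneField V) : PlaneField V := fun p =>
  if p ∈ e.source ∧ p ∈ N.carrier ∧ ρ (e p) ≠ 0 then
    if p ∈ S then rayAt e p (ξ p) (rotField ε φ (rep e ξ) (e p)) else ξ' p
  else ξ p

/-- The central part of a chart. -/
def column (e : OpenPartialHomeomorph V R3) : Set V :=
  {p ∈ e.source | |e p 0| < 1 / 2 ∧ |e p 1| < 1 / 2}

theorem isOpen_column (e : OpenPartialHomeomorph V R3) : IsOpen (column e) := by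
  have h1 : IsOpen {x : R3 | |x 0| < 1 / 2 ∧ |x 1| < 1 / 2} :=
    (isOpen_lt (contDiff_R3_coord 0).continuous.abs continuous_const).inter
      (isOpen_lt (contDiff_R3_coord 1).continuous.abs continuous_const)
  exact e.isOpen_inter_preimage h1

theorem column_saturated (he : N.IsChart k e c) {p q : N.carrier} (hpq : N.proj p = N.proj q)
    (hp : (p : V) ∈ column e) : (q : V) ∈ column e := by
  obtain ⟨hq, h0, h1, -⟩ := (he.fiber_iff p q hp.1).1 hpq
  exact ⟨hq, by rw [← h0]; exact hp.2.1, by rw [← h1]; exact hp.2.2⟩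

/-- The engine of both halves of the theorem: `ξ` is rotated in the chart by `ρ * angleDiff`.
Existence uses the extension of the domain by the column. Uniqueness uses the isotopy, and the last
clause, which keeps agreements obtained in previous charts. -/
theorem exists_interpolation [T2Space V] (h : N.IsSolution o ζ ξ₀ w S ξ)
    (h' : N.IsSolution o ζ ξ₀ w S' ξ') (he : N.IsChart k e c) (hS' : e.source ⊆ S') :
    ∃ ξ'' : PlaneField V, N.IsSolution o ζ ξ₀ w (S ∪ column e) ξ'' ∧
      (S = univ → IsotopicRel N.carrierᶜ ξ ξ'') ∧ (∀ p ∈ column e, ξ'' p = ξ' p) ∧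
      ∀ p : N.carrier, (∀ q : N.carrier, N.proj q = N.proj p → ξ q = ξ' q) → ξ'' p = ξ' p := by
  obtain ⟨ε, hε, hs⟩ := exists_chartSign o he.smooth
    (by rw [he.target_eq]; exact convex_modelBox.isPreconnected)
  have hε2 : ε * ε = 1 := by rcases hε with rfl | rfl <;> norm_num
  obtain ⟨ρ, hρ⟩ := exists_horizontalCutoff
  have hpair := h.isFieldPair h' he hS' hε hs
  set Ω := e.target ∩ e.symm ⁻¹' S with hΩ
  set φ : R3 → ℝ := fun x => ρ x * angleDiff k ε Ω (rep e ξ) (rep e ξ') x with hφ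
  have hnew : IsLocalField k ε Ω (rotField ε φ (rep e ξ)) := hpair.isLocalField_rotField hρ
  set η := rotPlane N e S ε ρ φ ξ ξ' with hη
  have hmemΩ : ∀ p ∈ e.source, p ∈ S → e p ∈ Ω := fun p hp hpS =>
    ⟨e.map_source hp, by rw [mem_preimage, e.left_inv hp]; exact hpS⟩
  have hφ0 : ∀ p ∈ e.source, ¬ (p ∈ N.carrier ∧ ρ (e p) ≠ 0) → φ (e p) = 0 := by
    intro p hp hn
    by_cases hpN : p ∈ N.carrier
    · have : ρ (e p) = 0 := by
        by_contra h0; exact hn ⟨hpN, h0⟩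
      simp [hφ, this]
    · have : e p ∉ k.region := fun hR => hpN ((he.mem_iff p hp).2 hR)
      simp [hφ, IsFieldPair.angleDiff_off this]
  have hrep : ∀ p ∈ e.source, p ∈ S → rep e η (e p) = rotField ε φ (rep e ξ) (e p) := by
    intro p hp hpS
    by_cases hc : p ∈ N.carrier ∧ ρ (e p) ≠ 0
    · have h1 : η p = rayAt e p (ξ p) (rotField ε φ (rep e ξ) (e p)) := by
        rw [hη, rotPlane, if_pos ⟨hp, hc⟩, if_pos hpS]
      have h2 := hnew.norm_eq _ (hmemΩ p hp hpS)
      have h3 : rotField ε φ (rep e ξ) (e p) ≠ 0 := fun h0 => by rw [h0] at h2; simp at h2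
      refine SpansAt.rep_eq_of_norm he.smooth (e.map_source hp) ((spansAt_map_iff hp).2 ?_) h2
      rw [h1]
      exact spans_rayAt he.smooth hp _ h3
    · rw [rotField_of_eq_zero (hφ0 p hp hc), rep_eq_iff he.smooth (e.map_source hp), e.left_inv hp]
      rw [hη, rotPlane, if_neg fun h => hc h.2]
  have hagree : ∀ p, p ∉ N.carrier → η p = ξ p := fun p hp => by
    rw [hη, rotPlane, if_neg fun h => hp h.2.1]
  have hone : ∀ p ∈ e.source, ρ (e p) = 1 → η p = ξ' p := by
    intro p hp hρ1
    by_cases hpN : p ∈ N.carrier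
    · by_cases hpS : p ∈ S
      · have h1 := hrep p hp hpS
        rw [hpair.rotField_eq (hmemΩ p hp hpS) hρ1, rep_eq_iff he.smooth (e.map_source hp),
          e.left_inv hp] at h1
        exact h1
      · rw [hη, rotPlane, if_pos ⟨hp, hpN, by rw [hρ1]; exact one_ne_zero⟩, if_neg hpS]
    · rw [hagree p hpN, h.agree p hpN, h'.agree p hpN]
  have hcol : ∀ p ∈ column e, η p = ξ' p := fun p hp =>
    hone p hp.1 (hρ.eq_one _ hp.2.1.le hp.2.2.le)
  have hoff : ∀ p, (p ∈ e.source → e p ∉ k.core) → η p = ξ p := by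
    intro p hp
    rw [hη, rotPlane, if_neg]
    rintro ⟨hps, hpN, hρ0⟩
    refine hp hps ⟨(he.mem_iff p hps).1 hpN, ?_⟩
    by_contra hcon
    exact hρ0 (hρ.eq_zero _ (by grind))
  have hdom : N.IsDomain (S ∪ column e) :=
    ⟨h.dom.isOpen.union (isOpen_column e), h.dom.compl_subset.trans subset_union_left,
      fun p q hpq hp => hp.imp (h.dom.mem p q hpq) (column_saturated he hpq)⟩
  have hoffs : ∀ p ∉ e.source, ∀ᶠ q in 𝓝 p, ξ q = η q := by
    intro p hp
    have hKt : k.core ⊆ e.target := he.target_eq ▸ core_subset_modelBox k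
    have hK : IsClosed (e.symm '' k.core) :=
      ((isCompact_core k).image_of_continuousOn (e.continuousOn_symm.mono hKt)).isClosed
    have hpK : p ∈ (e.symm '' k.core)ᶜ := by
      rintro ⟨x, hx, rfl⟩
      exact hp (e.map_target (hKt hx))
    filter_upwards [hK.isOpen_compl.mem_nhds hpK] with q hq
    exact (hoff q fun hqs hqK => hq ⟨e q, hqK, e.left_inv hqs⟩).symm
  have hcolS' : column e ⊆ S' := fun p hp => hS' hp.1
  refine ⟨η, ⟨hdom, ?_, ?_, ?_, ?_⟩, ?_, hcol, ?_⟩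
  · intro p hp
    by_cases hpc : p ∈ column e
    · refine (h'.contact p (hcolS' hpc)).congr ?_
      filter_upwards [(isOpen_column e).mem_nhds hpc] with q hq using (hcol q hq).symm
    have hpS : p ∈ S := hp.resolve_right hpc
    by_cases hps : p ∈ e.source
    · rw [contactAt_iff hε he.smooth hs hps]
      have h1 : ∀ x ∈ Ω, rep e η x = rotField ε φ (rep e ξ) x := fun x hx => by
        have := hrep (e.symm x) (e.map_target hx.1) hx.2
        rwa [e.right_inv hx.1] at this
      filter_upwards [hnew.sat.isOpen.mem_nhds (hmemΩ p hps hpS)] with x hx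
      have h2 : rep e η =ᶠ[𝓝 x] rotField ε φ (rep e ξ) := by
        filter_upwards [hnew.sat.isOpen.mem_nhds hx] with y hy using h1 y hy
      rw [helicity_congr h2]
      exact ⟨(hnew.smooth x hx).congr_of_eventuallyEq h2, hnew.pos x hx⟩
    · exact (h.contact p hpS).congr (hoffs p hps)
  · intro p hp
    rw [hagree p hp, h.agree p hp]
  · intro p hpN hp k₁ e₁ b₁ he₁ hp₁
    by_cases hps : p ∈ e.source
    · rw [rep_two_eq_zero_iff he₁ he hpN hp₁ hps]
      by_cases hpS : p ∈ S
      · rw [hrep p hps hpS]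
        exact hnew.vert _ (hmemΩ p hps hpS) ((he.mem_iff p hps).1 hpN)
      · have hpc := hp.resolve_left hpS
        have h1 : rep e η (e p) = rep e ξ' (e p) := by
          rw [rep_eq_iff he.smooth (e.map_source hps), e.left_inv hps, hcol p hpc]
        rw [h1]
        exact h'.legendrian p hpN (hS' hps) k e c he hps
    · have hpS : p ∈ S := hp.resolve_right fun h => hps h.1
      have h1 : rep e₁ η (e₁ p) = rep e₁ ξ (e₁ p) := by
        rw [rep_eq_iff he₁.smooth (e₁.map_source hp₁), e₁.left_inv hp₁]
        exact hoff p fun h => absurd h hps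
      rw [h1]
      exact h.legendrian p hpN hpS k₁ e₁ b₁ he₁ hp₁
  · intro p hp hb f hf hfp
    by_cases hpS : (p : V) ∈ S
    · obtain ⟨τ₀, τ, t1, t2, t3⟩ := h.weight p hpS hb f hf hfp
      refine ⟨τ₀, τ, t1, ?_, t3⟩
      by_cases hps : (p : V) ∈ e.source
      · have hpR : e p ∈ k.region := (he.mem_iff _ hps).1 p.2
        have hpΩ := hmemΩ p hps hpS
        have hbt : segBot k (e p) ≤ segTop k (e p) := (segBot_le hpR).trans (le_segTop hpR)
        have hmem : ∀ t ∈ Icc (segBot k (e p)) (segTop k (e p)), atHeight (e p) t ∈ Ω :=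
          fun t ht => hpair.left.sat.atHeight_mem hpΩ hpR ⟨by linarith [ht.1], by linarith [ht.2]⟩
        -- The rotation angle vanishes at both ends of the fiber, so the twisting, and hence the
        -- weight, does not change.
        have hbot : φ (atHeight (e p) (segBot k (e p))) = 0 := by
          simp only [hφ]
          rw [IsFieldPair.angleDiff_atHeight hpair.left.sat hpΩ hpR ⟨le_rfl, hbt⟩]
          simp
        have htop : φ (atHeight (e p) (segTop k (e p))) = 0 := by
          simp only [hφ]
          rw [IsFieldPair.angleDiff_atHeight hpair.left.sat hpΩ hpR ⟨hbt, le_rfl⟩,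
            hpair.balanced_all hpΩ hpR, mul_zero]
        have := hasTwisting_rot (φ := φ) (ξ' := η) hf hfp he hε2 hs hps rfl
          (fun t ht => hpair.left.vert _ (hmem t ht) (mem_region_of_mem_seg hpR ht))
          (fun t ht => ((hpair.left.smooth _ (hmem t ht)).continuousAt.comp
            (continuous_atHeight (e p)).continuousAt).continuousWithinAt)
          (fun t ht => (((hρ.smooth.contDiffAt.mul (hpair.contDiffAt_angleDiff
            fun _ => hmem t ht)).continuousAt (x := atHeight (e p) t)).comp
            (continuous_atHeight (e p)).continuousAt).continuousWithinAt)
          (fun t ht => by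
            have h1 := hrep (e.symm (atHeight (e p) t)) (e.map_target (hmem t ht).1) (hmem t ht).2
            rwa [e.right_inv (hmem t ht).1] at h1) (by rw [hbot]; simp) (by rw [htop]; simp) t2
        rwa [hbot, htop, sub_zero, zero_div, add_zero] at this
      · refine HasTwisting.congr_fiber hf (fun q hq => (hoff q fun hqs => ?_).symm) t2
        exact absurd ((he.fiber_iff q p hqs).1 hq).1 hps
    · have hpc : (p : V) ∈ column e := hp.resolve_left hpS
      obtain ⟨τ₀, τ, t1, t2, t3⟩ := h'.weight p (hcolS' hpc) hb f hf hfp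
      exact ⟨τ₀, τ, t1, HasTwisting.congr_fiber hf
        (fun q hq => (hcol q (column_saturated he hq.symm hpc)).symm) t2, t3⟩
  · rintro rfl
    have hΩbox : Ω = modelBox := by rw [hΩ, preimage_univ, inter_univ, he.target_eq]
    rw [hΩbox] at hpair
    obtain ⟨Φ, Ψ, hiso, hhor, hmap⟩ := hpair.exists_isotopy hρ
    have hKt : k.core ⊆ e.target := he.target_eq ▸ core_subset_modelBox k
    refine hiso.isotopicRel he.smooth (isCompact_core k) hKt
      (fun p hp hps hpK => hp ((he.mem_iff p hps).2 hpK.1)) hoff fun x hx => ?_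
    have hxt := hKt hx
    have hyt := hKt (hiso.map_mem 1 hx)
    refine ⟨rep e ξ x, rep e η (Φ 1 x), spansAt_rep he.smooth hxt, spansAt_rep he.smooth hyt,
      fun u => ?_⟩
    -- The same covector defines the two plane fields at `x` and at its image. It has no vertical
    -- component, and the isotopy preserves the horizontal coordinates, so it is its own pullback.
    have h1 : rep e η (Φ 1 x) = rep e ξ x := by
      have h2 := hrep (e.symm (Φ 1 x)) (e.map_target hyt) (mem_univ _)
      rw [e.right_inv hyt] at h2
      rw [h2, ← hmap x hx, hφ, hΩbox]
    have hv : rep e ξ x 2 = 0 := hpair.left.vert x (he.target_eq ▸ hxt) hx.1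
    have hd := ((hiso.smooth.comp (contDiff_const (c := (1 : ℝ)).prodMk contDiff_id)).differentiable
      (by simp) x).hasFDerivAt
    have hd' : HasFDerivAt (Φ 1) (fderiv ℝ (Φ 1) x) x := hd.differentiableAt.hasFDerivAt
    have hcoord : ∀ i : Fin 3, (∀ y, Φ 1 y i = y i) → fderiv ℝ (Φ 1) x u i = u i := by
      intro i hi
      have a1 := ((EuclideanSpace.proj i : R3 →L[ℝ] ℝ).hasFDerivAt).comp x hd'
      have a2 : HasFDerivAt (fun y : R3 => y i) (EuclideanSpace.proj i : R3 →L[ℝ] ℝ) x :=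
        (EuclideanSpace.proj i : R3 →L[ℝ] ℝ).hasFDerivAt
      have a3 : (fun y : R3 => y i) = (EuclideanSpace.proj i : R3 →L[ℝ] ℝ) ∘ Φ 1 :=
        funext fun y => (hi y).symm
      rw [a3] at a2
      exact DFunLike.congr_fun (a1.unique a2) u
    rw [h1]
    simp only [PiLp.inner_apply, Fin.sum_univ_three, RCLike.inner_apply, conj_trivial, hv]
    rw [hcoord 0 fun y => (hhor 1 y).1, hcoord 1 fun y => (hhor 1 y).2]
    ring
  · intro p hp
    by_cases hps : (p : V) ∈ e.source
    · by_cases hpS : (p : V) ∈ S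
      · have hpR : e p ∈ k.region := (he.mem_iff _ hps).1 p.2
        have hpΩ := hmemΩ p hps hpS
        have hD : angleDiff k ε Ω (rep e ξ) (rep e ξ') (e p) = 0 := by
          refine hpair.angleDiff_eq_zero hpΩ hpR fun t ht => ?_
          have hm := hpair.left.sat.atHeight_mem hpΩ hpR (t := t)
            ⟨by linarith [ht.1], by linarith [ht.2]⟩
          rw [rep_eq_iff he.smooth hm.1]
          have hN : e.symm (atHeight (e p) t) ∈ N.carrier :=
            (he.symm_mem_iff (he.target_eq ▸ hm.1)).2 (mem_region_of_mem_seg hpR ht)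
          refine hp ⟨_, hN⟩ (((he.fiber_iff p ⟨_, hN⟩ hps).2 ⟨e.map_target hm.1, ?_⟩).symm)
          simp only
          rw [e.right_inv hm.1]
          exact (mem_seg_iff hpR).2 ⟨rfl, ht⟩
        have h1 := hrep p hps hpS
        rw [rotField_of_eq_zero (by simp [hφ, hD]), rep_eq_iff he.smooth (e.map_source hps),
          e.left_inv hps] at h1
        rw [h1]
        exact hp p rfl
      · rw [hη, rotPlane]
        split_ifs
        · rfl
        · exact hp p rfl
    · rw [hoff p fun h => absurd h hps]
      exact hp p rfl

end Interpolate

end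

noncomputable section

/-! ### Passage from one chart to the whole neighborhood. -/

section Global

variable {V : Type*} [TopologicalSpace V] [ChartedSpace R3 V] [IsManifold (𝓡 3) ∞ V]
  {B : Type*} [TopologicalSpace B] {N : BranchedNbhd V B} {k k' : LocalModel}
  {e f : OpenPartialHomeomorph V R3} {b c : B} {o : OrientedAtlas V} {ξ ξ' ξ₀ ζ : PlaneField V}
  {w : N.Regular → ℤ} {S S' : Set V}

theorem mem_column (he : N.IsChart k e c) {p : N.carrier} (hp : N.proj p = c) :
    (p : V) ∈ column e := by
  obtain ⟨h, h0, h1⟩ := (IsModelChart.proj_eq_iff he p).1 hp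
  exact ⟨h, by rw [h0]; norm_num, by rw [h1]; norm_num⟩

theorem exists_finite_columns [CompactSpace V] (N : BranchedNbhd V B) :
    ∃ l : List (OpenPartialHomeomorph V R3), (∀ e ∈ l, ∃ k c, N.IsChart k e c) ∧
      ∀ p ∈ N.carrier, ∃ e ∈ l, p ∈ column e := by
  choose k e he using N.exists_chart
  obtain ⟨t, ht⟩ := N.isClosed.isCompact.elim_finite_subcover (fun b => column (e b))
    (fun b => isOpen_column _) fun p hp => mem_iUnion.2 ⟨N.proj ⟨p, hp⟩, mem_column (he _) rfl⟩
  refine ⟨(t.toList).map e, ?_, fun p hp => ?_⟩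
  · intro e' he'
    obtain ⟨b, -, rfl⟩ := List.mem_map.1 he'
    exact ⟨_, _, he b⟩
  · obtain ⟨b, hb, hpb⟩ := mem_iUnion₂.1 (ht hp)
    exact ⟨e b, List.mem_map.2 ⟨b, Finset.mem_toList.2 hb, rfl⟩, hpb⟩

theorem BranchedNbhd.Generates.isSolution (h : N.Generates o ζ ξ) (hw : N.HasWeight o ξ₀ ξ w) :
    N.IsSolution o ζ ξ₀ w univ ξ where
  dom := ⟨isOpen_univ, subset_univ _, fun _ _ _ _ => mem_univ _⟩
  contact := isContactOn_iff.1 h.contact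
  agree := h.agree
  legendrian := fibersLegendrian_iff.1 h.legendrian
  weight _ _ hb f hf hfp := hw ⟨_, hb⟩ f (Or.inl hf) hfp

/-- Induction over finitely many columns covering `N`: after each interpolation the current
structure is still a solution, isotopic to `ξ`, and equal to `ξ'` over all the columns treated so
far. -/
theorem BranchedNbhd.IsSolution.isotopicRel [T2Space V] [CompactSpace V]
    (h : N.IsSolution o ζ ξ₀ w univ ξ) (h' : N.IsSolution o ζ ξ₀ w univ ξ') :
    IsotopicRel N.carrierᶜ ξ ξ' := by
  obtain ⟨l, hl, hcov⟩ := exists_finite_columns N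
  have key : ∀ l : List (OpenPartialHomeomorph V R3), (∀ e ∈ l, ∃ k c, N.IsChart k e c) →
      ∃ ξ₁, N.IsSolution o ζ ξ₀ w univ ξ₁ ∧ IsotopicRel N.carrierᶜ ξ ξ₁ ∧
        ∀ e ∈ l, ∀ p ∈ column e, ξ₁ p = ξ' p := by
    intro l
    induction l with
    | nil => exact fun _ => ⟨ξ, h, IsotopicRel.refl, by simp⟩
    | cons e l ih =>
      intro hl
      obtain ⟨ξ₁, h1, h2, h3⟩ := ih fun e' he' => hl e' (List.mem_cons_of_mem _ he')
      obtain ⟨k, c, he⟩ := hl e List.mem_cons_self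
      obtain ⟨ξ₂, g1, g2, g3, g4⟩ := exists_interpolation h1 h' he (subset_univ _)
      rw [univ_union] at g1
      refine ⟨ξ₂, g1, h2.trans (g2 rfl), ?_⟩
      intro e' he' p hp
      rcases List.mem_cons.1 he' with rfl | he''
      · exact g3 p hp
      · by_cases hpN : p ∈ N.carrier
        · obtain ⟨k', c', hc'⟩ := hl e' he'
          -- Columns are unions of fibers near `N`, so the previous agreement holds on the whole
          -- fiber of `p`, as the last clause of the interpolation requires.
          exact g4 ⟨p, hpN⟩ fun q hq => h3 e' he'' q (column_saturated hc' hq.symm hp)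
        · rw [g1.agree p hpN, h'.agree p hpN]
  obtain ⟨ξ₁, h1, h2, h3⟩ := key l hl
  have : ξ₁ = ξ' := by
    funext p
    by_cases hpN : p ∈ N.carrier
    · obtain ⟨e, he, hp⟩ := hcov p hpN
      exact h3 e he p hp
    · rw [h1.agree p hpN, h'.agree p hpN]
  rwa [this] at h2

/-- The domain starts as the complement of `N`, where `ξ₀` itself is a solution, and grows by one
column at each interpolation with a local solution. -/
theorem exists_isSolution_univ [T2Space V] [CompactSpace V]
    (h0 : N.IsSolution o ζ ξ₀ w N.carrierᶜ ξ₀)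
    (hloc : ∀ k e c, N.IsChart k e c → ∃ ξ, N.IsSolution o ζ ξ₀ w (e.source ∪ N.carrierᶜ) ξ) :
    ∃ ξ, N.IsSolution o ζ ξ₀ w univ ξ := by
  obtain ⟨l, hl, hcov⟩ := exists_finite_columns N
  have key : ∀ l : List (OpenPartialHomeomorph V R3), (∀ e ∈ l, ∃ k c, N.IsChart k e c) →
      ∃ S ξ, N.IsSolution o ζ ξ₀ w S ξ ∧ ∀ e ∈ l, column e ⊆ S := by
    intro l
    induction l with
    | nil => exact fun _ => ⟨_, _, h0, by simp⟩
    | cons e l ih =>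
      intro hl
      obtain ⟨S, ξ₁, h1, h2⟩ := ih fun e' he' => hl e' (List.mem_cons_of_mem _ he')
      obtain ⟨k, c, he⟩ := hl e List.mem_cons_self
      obtain ⟨ξ', h'⟩ := hloc k e c he
      obtain ⟨ξ₂, g1, -⟩ := exists_interpolation h1 h' he subset_union_left
      refine ⟨_, ξ₂, g1, fun e' he' => ?_⟩
      rcases List.mem_cons.1 he' with rfl | he''
      · exact subset_union_right
      · exact (h2 e' he'').trans subset_union_left
  obtain ⟨S, ξ, h1, h2⟩ := key l hl
  have : S = univ := by
    refine eq_univ_of_forall fun p => ?_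
    by_cases hpN : p ∈ N.carrier
    · obtain ⟨e, he, hp⟩ := hcov p hpN
      exact h2 e he hp
    · exact h1.dom.compl_subset hpN
  exact ⟨ξ, this ▸ h1⟩

end Global

end

noncomputable section

/-! ### Solutions over a single chart. -/

section Local

variable {V : Type*} [TopologicalSpace V] [ChartedSpace R3 V] [IsManifold (𝓡 3) ∞ V]
  {B : Type*} [TopologicalSpace B] {N : BranchedNbhd V B} {k k' : LocalModel}
  {e f : OpenPartialHomeomorph V R3} {b c : B} {o : OrientedAtlas V} {ξ ξ' ξ₀ ζ : PlaneField V}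
  {w : N.Regular → ℤ} {S S' : Set V}

theorem BranchedNbhd.Generates.isLocalField (h : N.Generates o ζ ξ) (he : N.IsChart k e c) {ε : ℝ}
    (hε : ε = 1 ∨ ε = -1) (hs : ChartSign o e ε) : IsLocalField k ε modelBox (rep e ξ) := by
  have := isLocalField_rep (S := univ) ⟨isOpen_univ, subset_univ _, fun _ _ _ _ => mem_univ _⟩
    (isContactOn_iff.1 h.contact) (fibersLegendrian_iff.1 h.legendrian) he hε hs
  rwa [preimage_univ, inter_univ, he.target_eq] at this

theorem BranchedNbhd.Generates.exists_hasTwisting (h : N.Generates o ζ ξ) (hf : N.IsChart k f b)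
    (hfp : o.IsPositive f) : ∃ τ, HasTwisting f ξ τ := by
  have hl := h.isLocalField hf (Or.inl rfl) (chartSign_one_iff.2 hfp)
  obtain ⟨θ, h1, h2⟩ := hl.exists_angle (x := centerPt 0) (c := 0) (d := 5) (by norm_num)
    (fun z hz => centerPt_mem_modelBox hz) (fun z hz => center_mem_region k rfl rfl hz.1 hz.2)
  exact ⟨_, (hasTwisting_iff hf.smooth fun t ht => IsModelChart.center_mem_target hf ht).2
    ⟨θ, ⟨h1, h2⟩, rfl⟩⟩

theorem isSolution_compl (h : N.Generates o ζ ξ₀) :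
    N.IsSolution o ζ ξ₀ w N.carrierᶜ ξ₀ where
  dom := ⟨N.isClosed.isOpen_compl, subset_rfl, fun p _ _ hp => absurd p.2 hp⟩
  contact _ _ := h.contact _ (mem_univ _)
  agree := h.agree
  legendrian p hp hp' := absurd hp hp'
  weight p hp := absurd p.2 hp

theorem exp_eq_one_of_int {g : ℝ} (h : ∃ n : ℤ, g = n) :
    Complex.exp (Complex.I * ((-(2 * Real.pi) * g : ℝ) : ℂ)) = 1 := by
  obtain ⟨n, rfl⟩ := h
  rw [Complex.exp_eq_one_iff]
  refine ⟨-n, ?_⟩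
  push_cast
  ring

/-- Rotating `ξ₀` by `-2π g` increases the rate by `2π` times the derivative of `g`, which is
nonnegative, so the contact condition persists. Integrality off the region makes the rotation
trivial there. On a fiber the twisting decreases by the increase of `g`, which is the weight to be
realized. -/
theorem exists_local_solution (h : N.Generates o ζ ξ₀) (he : N.IsChart k e c) {g : ℝ → ℝ}
    (hg : ContDiff ℝ ∞ g) (hmono : Monotone g)
    (hint : ∀ x ∈ modelBox, x ∉ k.region → ∃ n : ℤ, g (x 2) = n)
    (hend : ∀ x, (∃ n : ℤ, g (segBot k x) = n) ∧ ∃ n : ℤ, g (segTop k x) = n)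
    (hw : ∀ p : N.carrier, (p : V) ∈ e.source → ∀ hb : N.proj p ∉ N.branchLocus,
      (w ⟨N.proj p, hb⟩ : ℝ) = g (segTop k (e p)) - g (segBot k (e p))) :
    ∃ ξ, N.IsSolution o ζ ξ₀ w (e.source ∪ N.carrierᶜ) ξ := by
  classical
  obtain ⟨ε, hε, hs⟩ := exists_chartSign o he.smooth
    (by rw [he.target_eq]; exact convex_modelBox.isPreconnected)
  have hε2 : ε * ε = 1 := by rcases hε with rfl | rfl <;> norm_num
  have hl := h.isLocalField he hε hs
  set φ : R3 → ℝ := fun x => -(2 * Real.pi) * g (x 2) with hφ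
  have hφs : ContDiff ℝ ∞ φ := contDiff_const.mul (hg.comp (contDiff_R3_coord 2))
  have hoff : ∀ x ∈ modelBox, x ∉ k.region → Complex.exp (Complex.I * φ x) = 1 := fun x hx hxR =>
    exp_eq_one_of_int (hint x hx hxR)
  have hnew : IsLocalField k ε modelBox (rotField ε φ (rep e ξ₀)) := by
    refine hl.rotField (fun x _ => hφs.contDiffAt) hoff fun x hx hxR => ?_
    refine lt_of_le_of_lt ?_ (hl.rate_pos hx hxR)
    have h1 := (hφs.differentiable (by simp) (atHeight x (x 2))).hasFDerivAt.comp_hasDerivAt (x 2)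
      (hasDerivAt_atHeight x (x 2))
    rw [atHeight_self] at h1
    rw [← h1.deriv]
    have h2 : (φ ∘ atHeight x) = fun t => -(2 * Real.pi) * g t := rfl
    rw [h2]
    have hanti : Antitone fun t => -(2 * Real.pi) * g t := fun s t hst =>
      mul_le_mul_of_nonpos_left (hmono hst) (by linarith [Real.pi_pos])
    exact hanti.deriv_nonpos
  set η : PlaneField V := fun p =>
    if p ∈ e.source then rayAt e p (ξ₀ p) (rotField ε φ (rep e ξ₀) (e p)) else ξ₀ p with hη
  have hbox : ∀ p ∈ e.source, e p ∈ modelBox := fun p hp => he.map_mem_modelBox hp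
  have hrep : ∀ p ∈ e.source, rep e η (e p) = rotField ε φ (rep e ξ₀) (e p) := by
    intro p hp
    have h1 : η p = rayAt e p (ξ₀ p) (rotField ε φ (rep e ξ₀) (e p)) := if_pos hp
    have h2 := hnew.norm_eq _ (hbox p hp)
    have h3 : rotField ε φ (rep e ξ₀) (e p) ≠ 0 := fun h0 => by rw [h0] at h2; simp at h2
    refine SpansAt.rep_eq_of_norm he.smooth (e.map_source hp) ((spansAt_map_iff hp).2 ?_) h2
    rw [h1]
    exact spans_rayAt he.smooth hp _ h3
  have hagree : ∀ p, p ∉ N.carrier → η p = ξ₀ p := by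
    intro p hpN
    by_cases hp : p ∈ e.source
    · have h1 := hrep p hp
      rw [rotField_of_exp_eq_one (hoff _ (hbox p hp) fun hR => hpN ((he.mem_iff p hp).2 hR)),
        rep_eq_iff he.smooth (e.map_source hp), e.left_inv hp] at h1
      exact h1
    · exact if_neg hp
  refine ⟨η, ⟨⟨e.open_source.union N.isClosed.isOpen_compl, subset_union_right, ?_⟩, ?_, ?_, ?_, ?_⟩⟩
  · intro p q hpq hp
    exact Or.inl ((he.fiber_iff p q (hp.resolve_right fun h => h p.2)).1 hpq).1
  · intro p hp
    by_cases hps : p ∈ e.source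
    · rw [contactAt_iff hε he.smooth hs hps]
      have h1 : ∀ x ∈ modelBox, rep e η x = rotField ε φ (rep e ξ₀) x := fun x hx => by
        have := hrep (e.symm x) (he.symm_mem_source hx)
        rwa [he.right_inv hx] at this
      filter_upwards [isOpen_modelBox.mem_nhds (hbox p hps)] with x hx
      have h2 : rep e η =ᶠ[𝓝 x] rotField ε φ (rep e ξ₀) := by
        filter_upwards [isOpen_modelBox.mem_nhds hx] with y hy using h1 y hy
      rw [helicity_congr h2]
      exact ⟨(hnew.smooth x hx).congr_of_eventuallyEq h2, hnew.pos x hx⟩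
    · refine ContactAt.congr (h.contact p (mem_univ p)) ?_
      filter_upwards [N.isClosed.isOpen_compl.mem_nhds (hp.resolve_left hps)] with q hq
      exact (hagree q hq).symm
  · intro p hp
    rw [hagree p hp, h.agree p hp]
  · intro p hpN hp k₁ e₁ b₁ he₁ hp₁
    have hps : p ∈ e.source := hp.resolve_right fun h => h hpN
    rw [rep_two_eq_zero_iff he₁ he hpN hp₁ hps, hrep p hps]
    exact hnew.vert _ (hbox p hps) ((he.mem_iff p hps).1 hpN)
  · intro p hp hb f hf hfp
    have hps : (p : V) ∈ e.source := hp.resolve_right fun h => h p.2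
    have hpR : e p ∈ k.region := (he.mem_iff _ hps).1 p.2
    have hmem : ∀ t ∈ Icc (segBot k (e p)) (segTop k (e p)), atHeight (e p) t ∈ modelBox :=
      fun t ht => hl.sat.atHeight_mem (hbox p hps) hpR ⟨by linarith [ht.1], by linarith [ht.2]⟩
    obtain ⟨τ₀, t1⟩ := h.exists_hasTwisting hf hfp
    refine ⟨τ₀, _, t1, hasTwisting_rot (φ := φ) (ξ' := η) hf hfp he hε2 hs hps rfl
      (fun t ht => hl.vert _ (hmem t ht) (mem_region_of_mem_seg hpR ht))
      (fun t ht => ((hl.smooth _ (hmem t ht)).continuousAt.comp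
        (continuous_atHeight (e p)).continuousAt).continuousWithinAt)
      (hφs.continuous.comp (continuous_atHeight (e p))).continuousOn
      (fun t ht => ?_) (exp_eq_one_of_int (hend _).1) (exp_eq_one_of_int (hend _).2) t1, ?_⟩
    · have h1 := hrep _ (he.symm_mem_source (hmem t ht))
      rwa [he.right_inv (hmem t ht)] at h1
    · rw [hw p hps hb]
      simp only [hφ, atHeight_two]
      have := Real.pi_pos
      field_simp
      ring

end Local

end

noncomputable section

/-! ### Weights as functions on the sheets of a chart. -/

section Sheets

variable {V : Type*} [TopologicalSpace V] [ChartedSpace R3 V] [IsManifold (𝓡 3) ∞ V]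
  {B : Type*} [TopologicalSpace B] {N : BranchedNbhd V B} {k k' : LocalModel}
  {e f : OpenPartialHomeomorph V R3} {b c : B} {o : OrientedAtlas V} {ξ ξ' ξ₀ ζ : PlaneField V}
  {w : N.Regular → ℤ} {S S' : Set V} {x y : R3}

/-- The point with coordinates `x` in the chart `e` projects to a regular point of the branched
surface. -/
def RegularAt (N : BranchedNbhd V B) (e : OpenPartialHomeomorph V R3) (x : R3) : Prop :=
  ∃ h : e.symm x ∈ N.carrier, N.proj ⟨e.symm x, h⟩ ∉ N.branchLocus

open scoped Classical in
/-- The weight of the sheet through the point with coordinates `x` in the chart `e`. -/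
def chartWeight (w : N.Regular → ℤ) (e : OpenPartialHomeomorph V R3) (x : R3) : ℤ :=
  if h : RegularAt N e x then w ⟨N.proj ⟨e.symm x, h.1⟩, h.2⟩ else 0

theorem chartWeight_nonneg (hw : ∀ b, 0 ≤ w b) : 0 ≤ chartWeight w e x := by
  unfold chartWeight
  split_ifs
  · exact hw _
  · exact le_rfl

theorem chartWeight_map {p : N.carrier} (hp : (p : V) ∈ e.source)
    (hb : N.proj p ∉ N.branchLocus) : chartWeight w e (e p) = w ⟨N.proj p, hb⟩ := by
  have h1 : ∀ q : N.carrier, q = p → ∀ hq : N.proj q ∉ N.branchLocus,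
      w ⟨N.proj q, hq⟩ = w ⟨N.proj p, hb⟩ := by
    rintro q rfl hq; rfl
  have h2 : e.symm (e p) ∈ N.carrier := by rw [e.left_inv hp]; exact p.2
  have h3 : (⟨e.symm (e p), h2⟩ : N.carrier) = p := Subtype.ext (e.left_inv hp)
  have h4 : RegularAt N e (e p) := ⟨h2, by rw [h3]; exact hb⟩
  rw [chartWeight, dif_pos h4]
  exact h1 _ h3 h4.2

theorem chartWeight_eq_of_convex (hw : IsLocallyConstant w) {C : Set R3} (hC : Convex ℝ C)
    (hCe : C ⊆ e.target) (hreg : ∀ z ∈ C, RegularAt N e z) (hx : x ∈ C) (hy : y ∈ C) :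
    chartWeight w e x = chartWeight w e y := by
  have : PreconnectedSpace C := Subtype.preconnectedSpace hC.isPreconnected
  set F : C → N.Regular := fun z => ⟨N.proj ⟨e.symm z, (hreg z z.2).1⟩, (hreg z z.2).2⟩ with hF
  have hFc : Continuous F := by
    refine Continuous.subtype_mk (N.isQuotientMap.continuous.comp (Continuous.subtype_mk ?_ _)) _
    exact (e.continuousOn_symm.mono hCe).domRestrict
  have h1 : ∀ z : C, chartWeight w e z = w (F z) := fun z => dif_pos (hreg z z.2)
  rw [h1 ⟨x, hx⟩, h1 ⟨y, hy⟩]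
  exact (hw.comp_continuous hFc).apply_eq_of_preconnectedSpace _ _

theorem FlatAt.regularAt (o : OrientedAtlas V) (he : N.IsChart k e c) (hx : x ∈ modelBox)
    (hxR : x ∈ k.region) (hf : FlatAt k x) : RegularAt N e x := by
  obtain ⟨ε, hε, hs⟩ := exists_chartSign o he.smooth
    (by rw [he.target_eq]; exact convex_modelBox.isPreconnected)
  have hN := (he.symm_mem_iff hx).2 hxR
  obtain ⟨f, hf, -⟩ := exists_disk_chart (p₀ := ⟨_, hN⟩) he hε hs (he.symm_mem_source hx)
    (by rw [he.right_inv hx]; exact hf)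
  exact ⟨hN, notMem_branchLocus_of_disk hf⟩

/-- Every regular point can be moved off the coordinate planes inside its sheet. -/
theorem exists_generic (o : OrientedAtlas V) (hw : IsLocallyConstant w) (he : N.IsChart k e c)
    (hx : x ∈ modelBox) (hxR : x ∈ k.region) (hr : RegularAt N e x) :
    ∃ y ∈ modelBox, y ∈ k.region ∧ y 0 ≠ 0 ∧ y 1 ≠ 0 ∧ chartWeight w e x = chartWeight w e y ∧
      segBot k x = segBot k y ∧ segTop k x = segTop k y := by
  -- A zero coordinate is moved to `1 / 2` and the others are kept. The motion is increasing, so it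
  -- stays in the region, it keeps the ends of the fiber, and immediately leaves the coordinate
  -- planes; only the initial point needs the regularity hypothesis.
  have hmove : ∀ s : ℝ, |s| < 1 → ∃ t : ℝ, |t| < 1 ∧ t ≠ 0 ∧ s ≤ t ∧ (s < 0 ↔ t < 0) ∧
      ∀ r ∈ Ioc (0 : ℝ) 1, s + r * (t - s) ≠ 0 ∧ s ≤ s + r * (t - s) := by
    intro s hs
    by_cases h : s = 0
    · refine ⟨1 / 2, by norm_num [abs_of_pos], by norm_num, by rw [h]; norm_num,
        by rw [h]; norm_num, fun r hr => ?_⟩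
      rw [h]
      have := hr.1
      constructor <;> [skip; skip] <;> nlinarith
    · exact ⟨s, hs, h, le_rfl, Iff.rfl, fun r _ => by simp [h]⟩
  obtain ⟨t₀, a1, a2, a3, a4, a5⟩ := hmove _ hx.1
  obtain ⟨t₁, b1, b2, b3, b4, b5⟩ := hmove _ hx.2.1
  set y : R3 := !₂[t₀, t₁, x 2] with hy
  have hyb : y ∈ modelBox := ⟨a1, b1, hx.2.2⟩
  have hyR : y ∈ k.region := region_mono k hxR a3 b3 rfl
  refine ⟨y, hyb, hyR, a2, b2, ?_, segBot_congr a4 b4 rfl, segTop_congr a4 b4 rfl⟩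
  refine chartWeight_eq_of_convex hw (convex_segment x y) ?_ ?_ (left_mem_segment ℝ x y)
    (right_mem_segment ℝ x y)
  · rw [he.target_eq]
    exact convex_modelBox.segment_subset hx hyb
  · intro z hz
    have hzb := convex_modelBox.segment_subset hx hyb hz
    rw [segment_eq_image'] at hz
    obtain ⟨r, ⟨hr0, hr1⟩, rfl⟩ := hz
    rcases hr0.eq_or_lt with rfl | hr0
    · simpa using hr
    · obtain ⟨a6, a7⟩ := a5 r ⟨hr0, hr1⟩
      obtain ⟨b6, b7⟩ := b5 r ⟨hr0, hr1⟩
      have hR : x + r • (y - x) ∈ k.region := region_mono k hxR a7 b7 (by simp [hy])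
      exact FlatAt.regularAt o he hzb hR (flatAt_of_ne hR a6 b6)

theorem chartWeight_branchEq (hw : N.IsWeight w) (hf : N.IsChart .branch f b)
    {x₁ x₂ x₃ : R3} (h₁ : RegularAt N e x₁) (h₂ : RegularAt N e x₂) (h₃ : RegularAt N e x₃)
    (s₁ : e.symm x₁ ∈ f.source) (s₂ : e.symm x₂ ∈ f.source) (s₃ : e.symm x₃ ∈ f.source)
    (a₁ : f (e.symm x₁) 0 < 0) (b₁ : f (e.symm x₁) 2 ≤ 1) (a₂ : f (e.symm x₂) 0 < 0)
    (b₂ : 2 ≤ f (e.symm x₂) 2) (a₃ : 0 < f (e.symm x₃) 0) :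
    chartWeight w e x₁ + chartWeight w e x₂ = chartWeight w e x₃ := by
  rw [chartWeight, chartWeight, chartWeight, dif_pos h₁, dif_pos h₂, dif_pos h₃]
  exact hw.branchEq b f hf _ _ _ ⟨_, h₁.1⟩ ⟨_, h₂.1⟩ ⟨_, h₃.1⟩ rfl rfl rfl s₁ s₂ s₃ a₁ b₁ a₂ b₂ a₃

theorem chartWeight_branchEq_subchart (hw : N.IsWeight w) (he : N.IsChart k e c) {G : VertDiffeo}
    (hf : N.IsChart .branch (subchart e G) b)
    {x₁ x₂ x₃ : R3} (h₁ : RegularAt N e x₁) (h₂ : RegularAt N e x₂) (h₃ : RegularAt N e x₃)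
    (m₁ : x₁ ∈ modelBox) (m₂ : x₂ ∈ modelBox) (m₃ : x₃ ∈ modelBox)
    (s₁ : G.toFun x₁ ∈ modelBox) (s₂ : G.toFun x₂ ∈ modelBox) (s₃ : G.toFun x₃ ∈ modelBox)
    (a₁ : G.toFun x₁ 0 < 0) (b₁ : G.toFun x₁ 2 ≤ 1) (a₂ : G.toFun x₂ 0 < 0)
    (b₂ : 2 ≤ G.toFun x₂ 2) (a₃ : 0 < G.toFun x₃ 0) :
    chartWeight w e x₁ + chartWeight w e x₂ = chartWeight w e x₃ := by
  have key : ∀ x ∈ modelBox, G.toFun x ∈ modelBox → e.symm x ∈ (subchart e G).source ∧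
      subchart e G (e.symm x) = G.toFun x := by
    intro x hx hG
    have h1 : e (e.symm x) = x := he.right_inv hx
    refine ⟨?_, ?_⟩
    · rw [mem_subchart_source, h1]
      exact ⟨he.symm_mem_source hx, hG⟩
    · rw [subchart_apply, h1]
  obtain ⟨c1, d1⟩ := key _ m₁ s₁
  obtain ⟨c2, d2⟩ := key _ m₂ s₂
  obtain ⟨c3, d3⟩ := key _ m₃ s₃
  refine chartWeight_branchEq hw hf h₁ h₂ h₃ c1 c2 c3 ?_ ?_ ?_ ?_ ?_ <;> simpa only [d1, d2, d3]

theorem region_iff_of_boundary {z : R3} (hk : k = .bdryDisk ∨ (k = .bdryBranch ∧ (x 0 < 0 ∨ 0 < x 0)))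
    (hx : x ∈ k.region) (a1 : x 0 < 0 → z 0 < 0) (a2 : 0 < x 0 → 0 < z 0)
    (hz2 : segBot k x - (segTop k x - segBot k x) / 5 < z 2)
    (hz2' : z 2 < segTop k x + (segTop k x - segBot k x) / 5) :
    z ∈ k.region ↔ (segBot k x ≤ z 2 ∧ z 2 ≤ segTop k x) ∧ 0 ≤ z 1 := by
  rw [mem_region_iff] at hx ⊢
  unfold segBot segTop at *
  generalize x 0 = x0 at *
  generalize x 1 = x1 at *
  generalize x 2 = x2 at *
  generalize z 0 = z0 at *
  generalize z 1 = z1 at *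
  generalize z 2 = z2 at *
  cases k <;> simp only [reduceCtorEq, false_and, true_and, or_false, false_or, or_true, true_or,
    or_self, if_false, false_implies, true_implies, and_true, if_true] at * <;>
    (try split_ifs at *) <;> grind

theorem affine_height_bounds {p q y : ℝ} (h : p < q) (h0 : 0 ≤ p) (h5 : q ≤ 5) (hy : -1 < y)
    (hy' : y < 6) : (-1 < p + (q - p) * y / 5 ∧ p + (q - p) * y / 5 < 6) ∧
      (p - (q - p) / 5 < p + (q - p) * y / 5 ∧ p + (q - p) * y / 5 < q + (q - p) / 5) ∧
      (p ≤ p + (q - p) * y / 5 ∧ p + (q - p) * y / 5 ≤ q ↔ 0 ≤ y ∧ y ≤ 5) := by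
  have hd : 0 < q - p := sub_pos.2 h
  have h1 : 0 < (q - p) * (y + 1) := mul_pos hd (by linarith)
  have h2 : 0 < (q - p) * (6 - y) := mul_pos hd (by linarith)
  refine ⟨⟨by linarith, by linarith⟩, ⟨by linarith, by linarith⟩, ?_⟩
  have h3 : p ≤ p + (q - p) * y / 5 ↔ 0 ≤ y := by
    rw [le_add_iff_nonneg_right, mul_div_assoc, mul_nonneg_iff_of_pos_left hd]
    constructor <;> intro h <;> linarith
  have h4 : p + (q - p) * y / 5 ≤ q ↔ y ≤ 5 := by
    rw [← mul_le_mul_iff_right₀ hd (b := y)]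
    constructor <;> intro h <;> linarith
  rw [h3, h4]

theorem affine_sign_bounds {s r t : ℝ} (hr : 0 < r) (h1 : |s| + r ≤ 1) (h2 : s ≠ 0 → r ≤ |s|)
    (ht : |t| < 1) : |s + t * r| < 1 ∧ (s < 0 → s + t * r < 0) ∧ (0 < s → 0 < s + t * r) := by
  have h3 : |t * r| < r := by
    rw [abs_mul, abs_of_pos hr]
    exact (mul_lt_iff_lt_one_left hr).2 ht
  have h4 := abs_lt.1 h3
  refine ⟨(abs_add_le _ _).trans_lt (by linarith), fun hs => ?_, fun hs => ?_⟩
  · have := h2 hs.ne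
    rw [abs_of_neg hs] at this
    linarith
  · have := h2 hs.ne'
    rw [abs_of_pos hs] at this
    linarith

/-- A boundary point off the branch locus has a half disk chart. -/
theorem exists_bdryDisk_chart (he : N.IsChart k e c)
    (hk : k = .bdryDisk ∨ (k = .bdryBranch ∧ (x 0 < 0 ∨ 0 < x 0))) (hxb : x ∈ modelBox)
    (hxR : x ∈ k.region) (hx1 : x 1 = 0) :
    ∃ (h : e.symm x ∈ N.carrier) (f : _), N.IsChart .bdryDisk f (N.proj ⟨e.symm x, h⟩) := by
  have hN := (he.symm_mem_iff hxb).2 hxR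
  obtain ⟨r, hr, hr0, hr1, hrx⟩ : ∃ r : ℝ, 0 < r ∧ |x 0| + r ≤ 1 ∧ r ≤ 1 ∧
      (x 0 ≠ 0 → r ≤ |x 0|) := by
    by_cases h : x 0 = 0
    · exact ⟨1, one_pos, by simp [h], le_rfl, fun h' => absurd h h'⟩
    · refine ⟨min (1 - |x 0|) |x 0|, lt_min (by linarith [hxb.1]) (abs_pos.2 h),
        by linarith [min_le_left (1 - |x 0|) |x 0|], ?_, fun _ => min_le_right _ _⟩
      exact (min_le_right _ _).trans hxb.1.le
  have hbt := segBot_lt_segTop hxR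
  have hb := segBot_nonneg (k := k) (x := x)
  have ht := segTop_le (k := k) (x := x)
  have hb2 := segBot_le hxR
  have ht2 := le_segTop hxR
  have hreg := fun z => region_iff_of_boundary (z := z) hk hxR
  set bot := segBot k x
  set top := segTop k x
  have hlt : bot < top := by linarith
  have hd : 0 < top - bot := sub_pos.2 hlt
  set G := boxMap 1 r one_ne_zero hr x bot top hlt with hG
  have hinv : ∀ y : R3, G.invFun y 0 = x 0 + y 0 * r ∧ G.invFun y 1 = y 1 * r ∧
      G.invFun y 2 = bot + (top - bot) * y 2 / 5 := by
    intro y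
    rw [hG, boxMap_inv_apply]
    refine ⟨?_, ?_, rfl⟩
    · change x 0 + y 0 / (1 / r) = _
      rw [div_div_eq_mul_div, div_one]
    · change x 1 + y 1 / (1 / r) = _
      rw [div_div_eq_mul_div, div_one, hx1, zero_add]
  have hGx : G.toFun x = !₂[1 / r * (x 0 - x 0), 1 / r * (x 1 - x 1), 5 * (x 2 - bot) / (top - bot)] :=
    boxMap_apply x
  have h2 : G.toFun x 2 = 5 * (x 2 - bot) / (top - bot) := by rw [hGx]; rfl
  have hex : e (e.symm x) = x := he.right_inv hxb
  refine ⟨hN, subchart e G, he.subchart ?_ ?_ ⟨_, hN⟩ (he.symm_mem_source hxb) ?_ ?_ ?_ ?_⟩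
  · rintro y ⟨h0, h1, h2, h3⟩
    obtain ⟨i0, i1, i2⟩ := hinv y
    have h4 := (affine_sign_bounds (s := 0) hr (by simpa using hr1) (fun h => absurd rfl h) h1).1
    rw [zero_add] at h4
    rw [mem_modelBox, i0, i1, i2]
    exact ⟨(affine_sign_bounds hr hr0 hrx h0).1, h4, (affine_height_bounds hlt hb ht h2 h3).1⟩
  · rintro y ⟨h0, h1, h2, h3⟩
    obtain ⟨i0, i1, i2⟩ := hinv y
    obtain ⟨-, h4, h5⟩ := affine_sign_bounds hr hr0 hrx h0
    obtain ⟨-, h6, h7⟩ := affine_height_bounds hlt hb ht h2 h3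
    rw [hreg _ (by rwa [i0]) (by rwa [i0]) (by rw [i2]; exact h6.1) (by rw [i2]; exact h6.2), i1, i2]
    exact and_congr h7 (mul_nonneg_iff_of_pos_right hr)
  · rw [hex, hGx]; simp
  · rw [hex, hGx]; simp
  · rw [hex, h2]
    have : 0 ≤ 5 * (x 2 - bot) / (top - bot) := div_nonneg (by linarith) hd.le
    linarith
  · rw [hex, h2, div_lt_iff₀ hd]
    linarith

theorem regularAt_of_bdryDisk {h : e.symm x ∈ N.carrier}
    (hf : N.IsChart .bdryDisk f (N.proj ⟨e.symm x, h⟩)) : RegularAt N e x :=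
  ⟨h, fun h' => h' ⟨f, Or.inr hf⟩⟩

theorem chartWeight_eq_zero_of_bdryDisk (hw : ∀ b : N.Regular, (b : B) ∈ N.boundary → w b = 0)
    {h : e.symm x ∈ N.carrier} (hf : N.IsChart .bdryDisk f (N.proj ⟨e.symm x, h⟩)) :
    chartWeight w e x = 0 := by
  rw [chartWeight, dif_pos (regularAt_of_bdryDisk hf)]
  exact hw _ ⟨f, Or.inl hf⟩

end Sheets

end

noncomputable section

/-! ### Height functions. -/

section Heights

/-- The cubic fixes `0`, `1`, `2` and sends `3` to `5`. It stretches a fiber `[0, 3]` with slit `(1,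
2)`, as found near a double point, to the standard fiber `[0, 5]` with the same slit. Its derivative
is `(z - 1)^2 + 2 / 3`. -/
theorem exists_cubicHeight : ∃ h : ℝ ≃o ℝ, ContDiff ℝ ∞ h ∧ ContDiff ℝ ∞ h.symm ∧
    ∀ z, h z = z + z * (z - 1) * (z - 2) / 3 := by
  set c : ℝ → ℝ := fun z => z + z * (z - 1) * (z - 2) / 3 with hc
  have hcs : ContDiff ℝ ∞ c := by fun_prop
  have hd : ∀ z, HasDerivAt c ((z - 1) ^ 2 + 2 / 3) z := by
    intro z
    have h1 := (hasDerivAt_id z).add (((((hasDerivAt_id z).mul ((hasDerivAt_id z).sub_const 1)).mul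
      ((hasDerivAt_id z).sub_const 2))).div_const 3)
    refine h1.congr_deriv ?_
    simp
    ring
  have hm : StrictMono c := strictMono_of_hasDerivAt_pos hd fun z => by positivity
  have hsurj : Function.Surjective c := by
    refine hcs.continuous.surjective ?_ ?_
    · refine Filter.tendsto_atTop_mono' _ ?_ Filter.tendsto_id
      filter_upwards [Filter.eventually_ge_atTop 2] with z hz
      have : 0 ≤ z * (z - 1) * (z - 2) := by
        apply mul_nonneg (mul_nonneg _ _) <;> linarith
      simp only [hc, id]
      linarith
    · refine Filter.tendsto_atBot_mono' _ ?_ Filter.tendsto_id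
      filter_upwards [Filter.eventually_le_atBot 0] with z hz
      have : z * (z - 1) * (z - 2) ≤ 0 := by
        apply mul_nonpos_of_nonneg_of_nonpos (mul_nonneg_of_nonpos_of_nonpos _ _) <;> linarith
      simp only [hc, id]
      linarith
  obtain ⟨g, hg, hl, hr⟩ := exists_contDiff_inverse hcs ⟨hm.injective, hsurj⟩ fun z u hu => by
    rw [(hd z).hasFDerivAt.fderiv] at hu
    have : (z - 1) ^ 2 + 2 / 3 ≠ 0 := by positivity
    simpa [this] using hu
  refine ⟨⟨⟨c, g, hl, hr⟩, hm.le_iff_le⟩, hcs, hg, fun z => rfl⟩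

/-- The function that increases by `a`, `b` and `c` on the intervals `[0, 1]`, `[2, 3]` and
`[4, 5]`. -/
def stepSum (a b c : ℤ) (z : ℝ) : ℝ :=
  a * Real.smoothTransition z + b * Real.smoothTransition (z - 2)
    + c * Real.smoothTransition (z - 4)

variable {a b c : ℤ} {z : ℝ}

theorem contDiff_stepSum : ContDiff ℝ ∞ (stepSum a b c) := by
  unfold stepSum
  have h : ∀ t : ℝ, ContDiff ℝ ∞ fun z : ℝ => Real.smoothTransition (z - t) := fun t =>
    Real.smoothTransition.contDiff.comp (contDiff_id.sub contDiff_const)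
  exact ((contDiff_const.mul Real.smoothTransition.contDiff).add (contDiff_const.mul (h 2))).add
    (contDiff_const.mul (h 4))

theorem monotone_stepSum (ha : 0 ≤ a) (hb : 0 ≤ b) (hc : 0 ≤ c) : Monotone (stepSum a b c) := by
  intro s t hst
  unfold stepSum
  have h : ∀ u : ℝ, Real.smoothTransition (s - u) ≤ Real.smoothTransition (t - u) := fun u =>
    Real.smoothTransition.monotone (by linarith)
  have h0 : Real.smoothTransition s ≤ Real.smoothTransition t := Real.smoothTransition.monotone hst
  have ha' : (0 : ℝ) ≤ a := Int.cast_nonneg ha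
  have hb' : (0 : ℝ) ≤ b := Int.cast_nonneg hb
  have hc' : (0 : ℝ) ≤ c := Int.cast_nonneg hc
  gcongr
  · exact h 2
  · exact h 4

theorem stepSum_of_nonpos (h : z ≤ 0) : stepSum a b c z = 0 := by
  unfold stepSum
  rw [Real.smoothTransition.zero_of_nonpos h, Real.smoothTransition.zero_of_nonpos (by linarith),
    Real.smoothTransition.zero_of_nonpos (by linarith)]
  simp

theorem stepSum_of_mem_one_two (h : 1 ≤ z) (h' : z ≤ 2) : stepSum a b c z = a := by
  unfold stepSum
  rw [Real.smoothTransition.one_of_one_le h, Real.smoothTransition.zero_of_nonpos (by linarith),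
    Real.smoothTransition.zero_of_nonpos (by linarith)]
  simp

theorem stepSum_of_mem_three_four (h : 3 ≤ z) (h' : z ≤ 4) : stepSum a b c z = a + b := by
  unfold stepSum
  rw [Real.smoothTransition.one_of_one_le (by linarith),
    Real.smoothTransition.one_of_one_le (by linarith),
    Real.smoothTransition.zero_of_nonpos (by linarith)]
  simp

theorem stepSum_of_five_le (h : 5 ≤ z) : stepSum a b c z = a + b + c := by
  unfold stepSum
  rw [Real.smoothTransition.one_of_one_le (by linarith),
    Real.smoothTransition.one_of_one_le (by linarith),
    Real.smoothTransition.one_of_one_le (by linarith)]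
  simp

theorem stepSum_zero : stepSum 0 0 0 z = 0 := by simp [stepSum]

/-- The plateaus of `stepSum` are at the heights of the slits and outside the slab. In the boundary
models the complement of the region also contains points at all other heights, so there the function
has to be zero. -/
theorem exists_int_stepSum {k : LocalModel} {x : R3} (hx : x ∉ k.region)
    (h : k = .bdryDisk ∨ k = .bdryBranch → a = 0 ∧ b = 0 ∧ c = 0) :
    ∃ n : ℤ, stepSum a b c (x 2) = n := by
  by_cases hk : k = .bdryDisk ∨ k = .bdryBranch
  · obtain ⟨rfl, rfl, rfl⟩ := h hk
    exact ⟨0, by rw [stepSum_zero, Int.cast_zero]⟩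
  · rcases lt_or_ge (x 2) 0 with h0 | h0
    · exact ⟨0, by rw [stepSum_of_nonpos h0.le, Int.cast_zero]⟩
    rcases lt_or_ge 5 (x 2) with h5 | h5
    · exact ⟨a + b + c, by rw [stepSum_of_five_le h5.le]; push_cast; ring⟩
    rw [mem_region_iff] at hx
    have : (1 < x 2 ∧ x 2 < 2) ∨ (3 < x 2 ∧ x 2 < 4) := by
      by_contra hcon
      refine hx ⟨h0, h5, fun _ _ => ?_, fun _ _ => ?_, fun h' => absurd h' hk⟩
      · by_contra! hh; exact hcon (Or.inl hh)
      · by_contra! hh; exact hcon (Or.inr hh)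
    rcases this with h' | h'
    · exact ⟨a, by rw [stepSum_of_mem_one_two h'.1.le h'.2.le]⟩
    · exact ⟨a + b, by rw [stepSum_of_mem_three_four h'.1.le h'.2.le]; push_cast; ring⟩

theorem exists_int_stepSum_ends (k : LocalModel) (x : R3) :
    (∃ n : ℤ, stepSum a b c (segBot k x) = n) ∧ ∃ n : ℤ, stepSum a b c (segTop k x) = n := by
  constructor
  · unfold segBot
    split_ifs
    · exact ⟨a + b, by rw [stepSum_of_mem_three_four (by norm_num) le_rfl]; push_cast; ring⟩
    · exact ⟨a, by rw [stepSum_of_mem_one_two (by norm_num) le_rfl]⟩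
    · exact ⟨0, by rw [stepSum_of_nonpos le_rfl, Int.cast_zero]⟩
  · unfold segTop
    split_ifs
    · exact ⟨a, by rw [stepSum_of_mem_one_two le_rfl (by norm_num)]⟩
    · exact ⟨a + b, by rw [stepSum_of_mem_three_four le_rfl (by norm_num)]; push_cast; ring⟩
    · exact ⟨a + b + c, by rw [stepSum_of_five_le le_rfl]; push_cast; ring⟩

end Heights

/-! ### Branch equations near a double point. -/

section Cells

/-- A box with the given sides. -/
def cell (I J K : Set ℝ) : Set R3 := {x | x 0 ∈ I ∧ x 1 ∈ J ∧ x 2 ∈ K}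

theorem convex_cell {I J K : Set ℝ} (hI : Convex ℝ I) (hJ : Convex ℝ J) (hK : Convex ℝ K) :
    Convex ℝ (cell I J K) :=
  (hI.linear_preimage (EuclideanSpace.proj 0 : R3 →L[ℝ] ℝ).toLinearMap).inter
    ((hJ.linear_preimage (EuclideanSpace.proj 1 : R3 →L[ℝ] ℝ).toLinearMap).inter
      (hK.linear_preimage (EuclideanSpace.proj 2 : R3 →L[ℝ] ℝ).toLinearMap))

variable {V : Type*} [TopologicalSpace V] [ChartedSpace R3 V] [IsManifold (𝓡 3) ∞ V]
  {B : Type*} [TopologicalSpace B] {N : BranchedNbhd V B} {k k' : LocalModel}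
  {e f : OpenPartialHomeomorph V R3} {b c : B} {o : OrientedAtlas V} {ξ ξ' ξ₀ ζ : PlaneField V}
  {w : N.Regular → ℤ} {S S' : Set V} {x y : R3}

theorem chartWeight_eq_of_cell (o : OrientedAtlas V) (hw : IsLocallyConstant w)
    (he : N.IsChart k e c) {I J K : Set ℝ} (hI : Convex ℝ I) (hJ : Convex ℝ J) (hK : Convex ℝ K)
    (hreg : ∀ z ∈ cell I J K, z ∈ modelBox ∧ z ∈ k.region ∧ (FlatAt k z ∨ RegularAt N e z))
    (hx : x ∈ cell I J K) (hy : y ∈ cell I J K) : chartWeight w e x = chartWeight w e y :=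
  chartWeight_eq_of_convex hw (convex_cell hI hJ hK) (fun z hz => he.target_eq ▸ (hreg z hz).1)
    (fun z hz => (hreg z hz).2.2.elim (FlatAt.regularAt o he (hreg z hz).1 (hreg z hz).2.1) id)
    hx hy

/-- A branch chart centered at `(0, -1/2)`, small enough to remain over `x 1 < 0`: below the second
slit the fibers are `[0, 3]` with the first slit, and the cubic rescales them. -/
theorem double_branchEq_low (o : OrientedAtlas V) (hw : N.IsWeight w) (he : N.IsChart .double e c) :
    chartWeight w e !₂[-1 / 4, -1 / 2, 0] + chartWeight w e !₂[-1 / 4, -1 / 2, 2] =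
      chartWeight w e !₂[1 / 4, -1 / 2, 0] := by
  obtain ⟨h, h1, h2, h3⟩ := exists_cubicHeight
  set G := VertDiffeo.diag 2 2 two_ne_zero two_ne_zero !₂[0, -1 / 2, 0] h h1 h2 with hG
  have hreg : ∀ x : R3, x ∈ modelBox → x ∈ LocalModel.double.region → x 0 ≠ 0 → x 1 ≠ 0 →
    RegularAt N e x := fun x hx hxR h0 h1 => FlatAt.regularAt o he hx hxR (flatAt_of_ne hxR h0 h1)
  have hle : ∀ s t, h.symm s ≤ t ↔ s ≤ t + t * (t - 1) * (t - 2) / 3 := fun s t => by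
    rw [OrderIso.symm_apply_le, h3]
  have hle' : ∀ s t, t ≤ h.symm s ↔ t + t * (t - 1) * (t - 2) / 3 ≤ s := fun s t => by
    rw [OrderIso.le_symm_apply, h3]
  have hlt : ∀ s t, h.symm s < t ↔ s < t + t * (t - 1) * (t - 2) / 3 := fun s t => by
    rw [← not_le, hle', not_le]
  have hlt' : ∀ s t, t < h.symm s ↔ t + t * (t - 1) * (t - 2) / 3 < s := fun s t => by
    rw [← not_le, hle, not_le]
  have hinv : ∀ y, G.invFun y = !₂[0 + y 0 / 2, -1 / 2 + y 1 / 2, h.symm (y 2)] := fun y => rfl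
  have hto : ∀ y, G.toFun y = !₂[2 * (y 0 - 0), 2 * (y 1 - -1 / 2), h (y 2)] := fun y => rfl
  have hm : (!₂[0, -1 / 2, 0] : R3) ∈ modelBox := by
    simp [mem_modelBox, abs_lt]; norm_num
  have hN := (he.symm_mem_iff hm).2 (by simp [mem_region_iff])
  have hf : N.IsChart .branch (subchart e G) (N.proj ⟨_, hN⟩) := by
    refine he.subchart ?_ ?_ _ (he.symm_mem_source hm) ?_ ?_ ?_ ?_
    · intro y hy
      rw [hinv]
      simp only [mem_modelBox, abs_lt] at hy ⊢
      simp [hlt, hlt']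
      grind
    · intro y hy
      rw [hinv]
      simp only [mem_modelBox, abs_lt] at hy
      simp [mem_region_iff, hle, hle']
      grind
    · simp only [he.right_inv hm, hto]; simp
    · simp only [he.right_inv hm, hto]; simp
    · simp only [he.right_inv hm, hto]; simp [h3]
    · simp only [he.right_inv hm, hto]; simp [h3]
  refine chartWeight_branchEq_subchart hw he hf (hreg _ ?_ ?_ ?_ ?_) (hreg _ ?_ ?_ ?_ ?_)
    (hreg _ ?_ ?_ ?_ ?_) ?_ ?_ ?_ ?_ ?_ ?_ ?_ ?_ ?_ ?_ ?_ <;>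
  simp [mem_modelBox, mem_region_iff, hto, h3, abs_lt] <;> norm_num

/-- Over `x 0 < 0` and above the first slit the fibers are `[2, 5]` with the second slit. The
horizontal coordinates are exchanged and the heights lowered by `2` before the cubic is applied. -/
theorem double_branchEq_high (o : OrientedAtlas V) (hw : N.IsWeight w) (he : N.IsChart .double e c) :
    chartWeight w e !₂[-1 / 2, -1 / 4, 2] + chartWeight w e !₂[-1 / 2, -1 / 4, 4] =
      chartWeight w e !₂[-1 / 2, 1 / 4, 2] := by
  obtain ⟨h, h1, h2, h3⟩ := exists_cubicHeight
  set G := VertDiffeo.swap 2 2 two_ne_zero two_ne_zero !₂[-1 / 2, 0, 0]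
    ((OrderIso.addRight (-2)).trans h) (h1.comp (contDiff_id.add contDiff_const))
    (h2.add contDiff_const) with hG
  have hreg : ∀ x : R3, x ∈ modelBox → x ∈ LocalModel.double.region → x 0 ≠ 0 → x 1 ≠ 0 →
    RegularAt N e x := fun x hx hxR h0 h1 => FlatAt.regularAt o he hx hxR (flatAt_of_ne hxR h0 h1)
  have hinv : ∀ y, ∃ z, G.invFun y = !₂[-1 / 2 + y 1 / 2, 0 + y 0 / 2, z] ∧
      (∀ t, z ≤ t ↔ y 2 ≤ (t - 2) + (t - 2) * (t - 2 - 1) * (t - 2 - 2) / 3) ∧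
      ∀ t, t ≤ z ↔ (t - 2) + (t - 2) * (t - 2 - 1) * (t - 2 - 2) / 3 ≤ y 2 := fun y =>
    ⟨h.symm (y 2) + - -2, rfl,
      fun t => by rw [← h3, ← OrderIso.symm_apply_le]; constructor <;> intro h <;> linarith,
      fun t => by rw [← h3, ← OrderIso.le_symm_apply]; constructor <;> intro h <;> linarith⟩
  have hto : ∀ y, G.toFun y = !₂[2 * (y 1 - 0), 2 * (y 0 - -1 / 2), h (y 2 + -2)] := fun y => rfl
  have hm : (!₂[-1 / 2, 0, 2] : R3) ∈ modelBox := by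
    simp [mem_modelBox, abs_lt]; norm_num
  have hN := (he.symm_mem_iff hm).2 (by simp [mem_region_iff]; norm_num)
  have hf : N.IsChart .branch (subchart e G) (N.proj ⟨_, hN⟩) := by
    refine he.subchart ?_ ?_ _ (he.symm_mem_source hm) ?_ ?_ ?_ ?_
    · intro y hy
      obtain ⟨z, hz, hle, hle'⟩ := hinv y
      rw [hz]
      simp only [mem_modelBox, abs_lt] at hy ⊢
      simp [← not_le, hle, hle']
      grind
    · intro y hy
      obtain ⟨z, hz, hle, hle'⟩ := hinv y
      rw [hz]
      simp only [mem_modelBox, abs_lt] at hy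
      simp [mem_region_iff, hle, hle']
      grind
    · simp only [he.right_inv hm, hto]; simp
    · simp only [he.right_inv hm, hto]; simp
    · simp only [he.right_inv hm, hto]; simp [h3]
    · simp only [he.right_inv hm, hto]; simp [h3]
  refine chartWeight_branchEq_subchart hw he hf (hreg _ ?_ ?_ ?_ ?_) (hreg _ ?_ ?_ ?_ ?_)
    (hreg _ ?_ ?_ ?_ ?_) ?_ ?_ ?_ ?_ ?_ ?_ ?_ ?_ ?_ ?_ ?_ <;>
  simp [mem_modelBox, mem_region_iff, hto, h3, abs_lt] <;> norm_num

/-- Over `0 < x 1` the second slit is absent and the model is a branch model without any change of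
height. -/
theorem double_branchEq_right (o : OrientedAtlas V) (hw : N.IsWeight w) (he : N.IsChart .double e c) :
    chartWeight w e !₂[-1 / 4, 1 / 2, 0] + chartWeight w e !₂[-1 / 4, 1 / 2, 2] =
      chartWeight w e !₂[1 / 4, 1 / 2, 0] := by
  set G := VertDiffeo.diag 2 2 two_ne_zero two_ne_zero !₂[0, 1 / 2, 0] (OrderIso.refl ℝ) contDiff_id
    contDiff_id with hG
  have hreg : ∀ x : R3, x ∈ modelBox → x ∈ LocalModel.double.region → x 0 ≠ 0 → x 1 ≠ 0 →
    RegularAt N e x := fun x hx hxR h0 h1 => FlatAt.regularAt o he hx hxR (flatAt_of_ne hxR h0 h1)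
  have hinv : ∀ y, G.invFun y = !₂[0 + y 0 / 2, 1 / 2 + y 1 / 2, y 2] := fun y => rfl
  have hto : ∀ y, G.toFun y = !₂[2 * (y 0 - 0), 2 * (y 1 - 1 / 2), y 2] := fun y => rfl
  have hm : (!₂[0, 1 / 2, 0] : R3) ∈ modelBox := by
    simp [mem_modelBox]; norm_num
  have hN := (he.symm_mem_iff hm).2 (by simp [mem_region_iff])
  have hf : N.IsChart .branch (subchart e G) (N.proj ⟨_, hN⟩) := by
    refine he.subchart ?_ ?_ _ (he.symm_mem_source hm) ?_ ?_ ?_ ?_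
    · intro y hy
      rw [hinv]
      simp only [mem_modelBox, abs_lt] at hy ⊢
      simp
      grind
    · intro y hy
      rw [hinv]
      simp only [mem_modelBox, abs_lt] at hy
      simp [mem_region_iff]
      grind
    · simp only [he.right_inv hm, hto]; simp
    · simp only [he.right_inv hm, hto]; simp
    · simp only [he.right_inv hm, hto]; simp
    · simp only [he.right_inv hm, hto]; simp
  refine chartWeight_branchEq_subchart hw he hf (hreg _ ?_ ?_ ?_ ?_) (hreg _ ?_ ?_ ?_ ?_)
    (hreg _ ?_ ?_ ?_ ?_) ?_ ?_ ?_ ?_ ?_ ?_ ?_ ?_ ?_ ?_ ?_ <;>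
  simp [mem_modelBox, mem_region_iff, hto, abs_lt] <;> norm_num

end Cells

end

noncomputable section

/-! ### The weights of all the sheets of each model. -/

section Existence

variable {V : Type*} [TopologicalSpace V] [ChartedSpace R3 V] [IsManifold (𝓡 3) ∞ V]
  {B : Type*} [TopologicalSpace B] {N : BranchedNbhd V B} {k k' : LocalModel}
  {e f : OpenPartialHomeomorph V R3} {b c : B} {o : OrientedAtlas V} {ξ ξ' ξ₀ ζ : PlaneField V}
  {w : N.Regular → ℤ} {S S' : Set V} {x y : R3}

theorem disk_weights (o : OrientedAtlas V) (hw : N.IsWeight w) (he : N.IsChart .disk e c)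
    (hx : x ∈ modelBox) (hxR : x ∈ LocalModel.disk.region) :
    chartWeight w e x = chartWeight w e 0 := by
  simp only [mem_modelBox, abs_lt] at hx
  rw [mem_region_iff] at hxR
  refine chartWeight_eq_of_cell o hw.locConst he (convex_Ioo (-1) 1) (convex_Ioo (-1) 1)
    (convex_Icc 0 5) ?_ ⟨hx.1, hx.2.1, hxR.1, hxR.2.1⟩ ?_
  · rintro z ⟨⟨h0, h0'⟩, ⟨h1, h1'⟩, ⟨h2, h2'⟩⟩
    simp only [mem_modelBox, abs_lt, mem_region_iff, FlatAt]
    grind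
  · simp [cell]

/-- The unique sheet reaches the boundary, where the weight is zero, through regular points. -/
theorem bdryDisk_weights (o : OrientedAtlas V) (hw : N.IsWeight w)
    (hbd : ∀ b : N.Regular, (b : B) ∈ N.boundary → w b = 0) (he : N.IsChart .bdryDisk e c)
    (hx : x ∈ modelBox) (hxR : x ∈ LocalModel.bdryDisk.region) : chartWeight w e x = 0 := by
  have key : ∀ z ∈ modelBox, z ∈ LocalModel.bdryDisk.region → z 1 = 0 →
      RegularAt N e z ∧ chartWeight w e z = 0 := by
    intro z hz hzR h1
    obtain ⟨h, f, hf⟩ := exists_bdryDisk_chart he (Or.inl rfl) hz hzR h1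
    exact ⟨regularAt_of_bdryDisk hf, chartWeight_eq_zero_of_bdryDisk hbd hf⟩
  have h0 : (0 : R3) ∈ modelBox := by simp [mem_modelBox]
  rw [← (key 0 h0 (by simp [mem_region_iff]) rfl).2]
  simp only [mem_modelBox, abs_lt] at hx
  rw [mem_region_iff] at hxR
  refine chartWeight_eq_of_cell o hw.locConst he (convex_Ioo (-1) 1) (convex_Ico 0 1)
    (convex_Icc 0 5) ?_ ⟨hx.1, ⟨hxR.2.2.2.2 (Or.inl rfl), hx.2.1.2⟩, hxR.1, hxR.2.1⟩ ?_
  · rintro z ⟨⟨h0, h0'⟩, ⟨h1, h1'⟩, ⟨h2, h2'⟩⟩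
    have hz : z ∈ modelBox := by simp only [mem_modelBox, abs_lt]; grind
    have hzR : z ∈ LocalModel.bdryDisk.region := by
      simp only [mem_region_iff]; grind
    refine ⟨hz, hzR, ?_⟩
    rcases h1.eq_or_lt with h | h
    · exact Or.inr (key z hz hzR h.symm).1
    · left; simp only [FlatAt]; grind
  · simp [cell]

theorem bdryBranch_weights (o : OrientedAtlas V) (hw : N.IsWeight w)
    (hbd : ∀ b : N.Regular, (b : B) ∈ N.boundary → w b = 0) (he : N.IsChart .bdryBranch e c)
    (hx : x ∈ modelBox) (hxR : x ∈ LocalModel.bdryBranch.region) (hx0 : x 0 ≠ 0) :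
    chartWeight w e x = 0 := by
  have key : ∀ z ∈ modelBox, z ∈ LocalModel.bdryBranch.region → z 1 = 0 → z 0 ≠ 0 →
      RegularAt N e z ∧ chartWeight w e z = 0 := by
    intro z hz hzR h1 h0
    obtain ⟨h, f, hf⟩ := exists_bdryDisk_chart he (Or.inr ⟨rfl, lt_or_gt_of_ne h0⟩) hz hzR h1
    exact ⟨regularAt_of_bdryDisk hf, chartWeight_eq_zero_of_bdryDisk hbd hf⟩
  have key' : ∀ (I K : Set ℝ), Convex ℝ I → Convex ℝ K → (∀ z ∈ cell I (Ico 0 1) K,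
      z ∈ modelBox ∧ z ∈ LocalModel.bdryBranch.region ∧ z 0 ≠ 0) → x ∈ cell I (Ico 0 1) K →
      chartWeight w e x = 0 := by
    intro I K hI hK h hxC
    have h0 : (!₂[x 0, 0, x 2] : R3) ∈ cell I (Ico 0 1) K := ⟨hxC.1, by simp, hxC.2.2⟩
    obtain ⟨m1, m2, m3⟩ := h _ h0
    rw [← (key _ m1 m2 rfl m3).2]
    refine chartWeight_eq_of_cell o hw.locConst he hI (convex_Ico 0 1) hK (fun z hz => ?_) hxC h0
    obtain ⟨n1, n2, n3⟩ := h z hz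
    refine ⟨n1, n2, ?_⟩
    rcases hz.2.1.1.eq_or_lt with h | h
    · exact Or.inr (key z n1 n2 h.symm n3).1
    · exact Or.inl (flatAt_of_ne n2 n3 h.ne')
  simp only [mem_modelBox, abs_lt] at hx
  rw [mem_region_iff] at hxR
  obtain ⟨r1, r2, r3, -, r5⟩ := hxR
  have r5 := r5 (Or.inr rfl)
  have hgood : ∀ z : R3, (-1 < z 0 ∧ z 0 < 1) → (0 ≤ z 1 ∧ z 1 < 1) → (0 ≤ z 2 ∧ z 2 ≤ 5) →
      z 0 ≠ 0 → (z 0 < 0 → z 2 ≤ 1 ∨ 2 ≤ z 2) →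
      z ∈ modelBox ∧ z ∈ LocalModel.bdryBranch.region ∧ z 0 ≠ 0 := by
    intro z h0 h1 h2 h3 h4
    rw [mem_modelBox, abs_lt, abs_lt, mem_region_iff]
    exact ⟨⟨h0, ⟨by linarith, h1.2⟩, by linarith, by linarith⟩,
      ⟨h2.1, h2.2, fun _ => h4, fun h => by simp at h, fun _ => h1.1⟩, h3⟩
  rcases lt_or_gt_of_ne hx0 with h | h
  · rcases r3 (by simp) h with h' | h'
    · exact key' (Ioo (-1) 0) (Icc 0 1) (convex_Ioo _ _) (convex_Icc _ _)
        (fun z ⟨⟨a1, a2⟩, a3, ⟨a4, a5⟩⟩ => hgood z ⟨a1, by linarith⟩ a3 ⟨a4, by linarith⟩ a2.ne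
          fun _ => Or.inl a5) ⟨⟨hx.1.1, h⟩, ⟨r5, hx.2.1.2⟩, r1, h'⟩
    · exact key' (Ioo (-1) 0) (Icc 2 5) (convex_Ioo _ _) (convex_Icc _ _)
        (fun z ⟨⟨a1, a2⟩, a3, ⟨a4, a5⟩⟩ => hgood z ⟨a1, by linarith⟩ a3 ⟨by linarith, a5⟩ a2.ne
          fun _ => Or.inr a4) ⟨⟨hx.1.1, h⟩, ⟨r5, hx.2.1.2⟩, h', r2⟩
  · exact key' (Ioo 0 1) (Icc 0 5) (convex_Ioo _ _) (convex_Icc _ _)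
      (fun z ⟨⟨a1, a2⟩, a3, a4⟩ => hgood z ⟨by linarith, a2⟩ a3 a4 a1.ne'
        fun h => absurd h a1.not_gt) ⟨⟨h, hx.1.2⟩, ⟨r5, hx.2.1.2⟩, r1, r2⟩

theorem branch_weights (o : OrientedAtlas V) (hw : N.IsWeight w) (he : N.IsChart .branch e c)
    (hx : x ∈ modelBox) (hxR : x ∈ LocalModel.branch.region) :
    (x 0 < 0 → x 2 ≤ 1 → chartWeight w e x = chartWeight w e !₂[-1 / 2, 0, 0]) ∧
    (x 0 < 0 → 2 ≤ x 2 → chartWeight w e x = chartWeight w e !₂[-1 / 2, 0, 2]) ∧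
    (0 < x 0 → chartWeight w e x =
      chartWeight w e !₂[-1 / 2, 0, 0] + chartWeight w e !₂[-1 / 2, 0, 2]) := by
  have hgood : ∀ z : R3, (-1 < z 0 ∧ z 0 < 1) → (-1 < z 1 ∧ z 1 < 1) → (0 ≤ z 2 ∧ z 2 ≤ 5) →
      (z 0 < 0 ∨ 0 < z 0) → (z 0 < 0 → z 2 ≤ 1 ∨ 2 ≤ z 2) →
      z ∈ modelBox ∧ z ∈ LocalModel.branch.region ∧ FlatAt .branch z := by
    intro z h0 h1 h2 h3 h4
    simp only [mem_modelBox, abs_lt, mem_region_iff, FlatAt]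
    grind
  have hcell : ∀ I K : Set ℝ, Convex ℝ I → Convex ℝ K → (∀ z ∈ cell I (Ioo (-1) 1) K,
      z ∈ modelBox ∧ z ∈ LocalModel.branch.region ∧ FlatAt .branch z) →
      ∀ y ∈ cell I (Ioo (-1) 1) K, ∀ z ∈ cell I (Ioo (-1) 1) K,
      chartWeight w e y = chartWeight w e z := fun I K hI hK h y hy z hz =>
    chartWeight_eq_of_cell o hw.locConst he hI (convex_Ioo _ _) hK
      (fun z hz => ⟨(h z hz).1, (h z hz).2.1, Or.inl (h z hz).2.2⟩) hy hz
  have c1 := hcell (Ioo (-1) 0) (Icc 0 1) (convex_Ioo _ _) (convex_Icc _ _)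
    fun z ⟨⟨a1, a2⟩, a3, ⟨a4, a5⟩⟩ => hgood z ⟨a1, by linarith⟩ a3 ⟨a4, by linarith⟩ (Or.inl a2)
      fun _ => Or.inl a5
  have c2 := hcell (Ioo (-1) 0) (Icc 2 5) (convex_Ioo _ _) (convex_Icc _ _)
    fun z ⟨⟨a1, a2⟩, a3, ⟨a4, a5⟩⟩ => hgood z ⟨a1, by linarith⟩ a3 ⟨by linarith, a5⟩ (Or.inl a2)
      fun _ => Or.inr a4
  have c3 := hcell (Ioo 0 1) (Icc 0 5) (convex_Ioo _ _) (convex_Icc _ _)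
    fun z ⟨⟨a1, a2⟩, a3, a4⟩ => hgood z ⟨by linarith, a2⟩ a3 a4 (Or.inr a1)
      fun h => absurd h a1.not_gt
  simp only [mem_modelBox, abs_lt] at hx
  rw [mem_region_iff] at hxR
  refine ⟨fun h h' => c1 _ ⟨⟨hx.1.1, h⟩, hx.2.1, hxR.1, h'⟩ _ ?_,
    fun h h' => c2 _ ⟨⟨hx.1.1, h⟩, hx.2.1, h', hxR.2.1⟩ _ ?_, fun h => ?_⟩
  · simp [cell]; norm_num
  · simp [cell]; norm_num
  · rw [c3 x ⟨⟨h, hx.1.2⟩, hx.2.1, hxR.1, hxR.2.1⟩ !₂[1 / 2, 0, 0] (by simp [cell]; norm_num)]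
    have g1 := hgood !₂[-1 / 2, 0, 0] (by simp; norm_num) (by simp) (by simp) (by simp; norm_num)
      (by simp)
    have g2 := hgood !₂[-1 / 2, 0, 2] (by simp; norm_num) (by simp) (by simp; norm_num)
      (by simp; norm_num) (by simp)
    have g3 := hgood !₂[1 / 2, 0, 0] (by simp; norm_num) (by simp) (by simp) (by simp) (by simp)
    refine (chartWeight_branchEq hw he (FlatAt.regularAt o he g1.1 g1.2.1 g1.2.2)
      (FlatAt.regularAt o he g2.1 g2.2.1 g2.2.2) (FlatAt.regularAt o he g3.1 g3.2.1 g3.2.2)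
      (he.symm_mem_source g1.1) (he.symm_mem_source g2.1) (he.symm_mem_source g3.1)
      ?_ ?_ ?_ ?_ ?_).symm
    · rw [he.right_inv g1.1]; simp; norm_num
    · rw [he.right_inv g1.1]; simp
    · rw [he.right_inv g2.1]; simp; norm_num
    · rw [he.right_inv g2.1]; simp
    · rw [he.right_inv g3.1]; simp

/-- Three sheets are primitive: below the first slit, between the slits, above the second slit. The
branch equations express the other weights as sums of consecutive ones, which is what a single step
function of the height can realize. -/
theorem double_weights (o : OrientedAtlas V) (hw : N.IsWeight w) (he : N.IsChart .double e c)
    (hx : x ∈ modelBox) (hxR : x ∈ LocalModel.double.region) :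
    (x 0 < 0 → x 2 ≤ 1 → chartWeight w e x = chartWeight w e !₂[-1 / 4, -1 / 2, 0]) ∧
    (x 1 < 0 → 4 ≤ x 2 → chartWeight w e x = chartWeight w e !₂[-1 / 2, -1 / 4, 4]) ∧
    (x 0 < 0 → x 1 < 0 → 2 ≤ x 2 → x 2 ≤ 3 →
      chartWeight w e x = chartWeight w e !₂[-1 / 4, -1 / 2, 2]) ∧
    (0 < x 0 → x 1 < 0 → x 2 ≤ 3 → chartWeight w e x =
      chartWeight w e !₂[-1 / 4, -1 / 2, 0] + chartWeight w e !₂[-1 / 4, -1 / 2, 2]) ∧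
    (x 0 < 0 → 0 < x 1 → 2 ≤ x 2 → chartWeight w e x =
      chartWeight w e !₂[-1 / 4, -1 / 2, 2] + chartWeight w e !₂[-1 / 2, -1 / 4, 4]) ∧
    (0 < x 0 → 0 < x 1 → chartWeight w e x = chartWeight w e !₂[-1 / 4, -1 / 2, 0] +
      (chartWeight w e !₂[-1 / 4, -1 / 2, 2] + chartWeight w e !₂[-1 / 2, -1 / 4, 4])) := by
  have hgood : ∀ z : R3, (-1 < z 0 ∧ z 0 < 1) → (-1 < z 1 ∧ z 1 < 1) → (0 ≤ z 2 ∧ z 2 ≤ 5) →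
      (z 0 < 0 ∨ 0 < z 0 ∨ (z 1 < 0 ∧ 4 ≤ z 2)) → (z 1 < 0 ∨ 0 < z 1 ∨ (z 0 < 0 ∧ z 2 ≤ 1)) →
      (z 0 < 0 → z 2 ≤ 1 ∨ 2 ≤ z 2) → (z 1 < 0 → z 2 ≤ 3 ∨ 4 ≤ z 2) →
      z ∈ modelBox ∧ z ∈ LocalModel.double.region ∧ FlatAt .double z := by
    intro z h0 h1 h2 h3 h4 h5 h6
    rw [mem_modelBox, abs_lt, abs_lt, mem_region_iff]
    refine ⟨⟨h0, h1, by linarith, by linarith⟩,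
      ⟨h2.1, h2.2, fun _ => h5, fun _ => h6, fun h => by simp at h⟩,
      fun _ => h3.imp_right (Or.imp_right fun h => ⟨rfl, h⟩), fun _ => h4, fun h => by simp at h⟩
  have hcell : ∀ l₀ u₀ l₁ u₁ l₂ u₂ : ℝ, (∀ z ∈ cell (Ioo l₀ u₀) (Ioo l₁ u₁) (Icc l₂ u₂),
      z ∈ modelBox ∧ z ∈ LocalModel.double.region ∧ FlatAt .double z) →
      ∀ y ∈ cell (Ioo l₀ u₀) (Ioo l₁ u₁) (Icc l₂ u₂),
      ∀ z ∈ cell (Ioo l₀ u₀) (Ioo l₁ u₁) (Icc l₂ u₂),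
      chartWeight w e y = chartWeight w e z := fun _ _ _ _ _ _ h y hy z hz =>
    chartWeight_eq_of_cell o hw.locConst he (convex_Ioo _ _) (convex_Ioo _ _) (convex_Icc _ _)
      (fun z hz => ⟨(h z hz).1, (h z hz).2.1, Or.inl (h z hz).2.2⟩) hy hz
  have c1 := hcell (-1) 0 (-1) 1 0 1 fun z ⟨⟨a1, a2⟩, ⟨a3, a4⟩, ⟨a5, a6⟩⟩ =>
    hgood z ⟨a1, by linarith⟩ ⟨a3, a4⟩ ⟨a5, by linarith⟩ (Or.inl a2) (Or.inr (Or.inr ⟨a2, a6⟩))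
      (fun _ => Or.inl a6) (fun _ => Or.inl (by linarith))
  have c2 := hcell (-1) 1 (-1) 0 4 5 fun z ⟨⟨a1, a2⟩, ⟨a3, a4⟩, ⟨a5, a6⟩⟩ =>
    hgood z ⟨a1, a2⟩ ⟨a3, by linarith⟩ ⟨by linarith, a6⟩ (Or.inr (Or.inr ⟨a4, a5⟩)) (Or.inl a4)
      (fun _ => Or.inr (by linarith)) (fun _ => Or.inr a5)
  have c3 := hcell (-1) 0 (-1) 0 2 3 fun z ⟨⟨a1, a2⟩, ⟨a3, a4⟩, ⟨a5, a6⟩⟩ =>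
    hgood z ⟨a1, by linarith⟩ ⟨a3, by linarith⟩ ⟨by linarith, by linarith⟩ (Or.inl a2) (Or.inl a4)
      (fun _ => Or.inr a5) (fun _ => Or.inl a6)
  have c4 := hcell 0 1 (-1) 0 0 3 fun z ⟨⟨a1, a2⟩, ⟨a3, a4⟩, ⟨a5, a6⟩⟩ =>
    hgood z ⟨by linarith, a2⟩ ⟨a3, by linarith⟩ ⟨a5, by linarith⟩ (Or.inr (Or.inl a1)) (Or.inl a4)
      (fun h => absurd h a1.not_gt) (fun _ => Or.inl a6)
  have c5 := hcell (-1) 0 0 1 2 5 fun z ⟨⟨a1, a2⟩, ⟨a3, a4⟩, ⟨a5, a6⟩⟩ =>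
    hgood z ⟨a1, by linarith⟩ ⟨by linarith, a4⟩ ⟨by linarith, a6⟩ (Or.inl a2) (Or.inr (Or.inl a3))
      (fun _ => Or.inr a5) (fun h => absurd h a3.not_gt)
  have c6 := hcell 0 1 0 1 0 5 fun z ⟨⟨a1, a2⟩, ⟨a3, a4⟩, ⟨a5, a6⟩⟩ =>
    hgood z ⟨by linarith, a2⟩ ⟨by linarith, a4⟩ ⟨a5, a6⟩ (Or.inr (Or.inl a1)) (Or.inr (Or.inl a3))
      (fun h => absurd h a1.not_gt) (fun h => absurd h a3.not_gt)
  have b1 := double_branchEq_low o hw he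
  have b2 := double_branchEq_high o hw he
  have b3 := double_branchEq_right o hw he
  -- The sample points of the three branch equations are moved inside their sheets to common base
  -- points before the equations are combined.
  rw [c1 !₂[-1 / 4, 1 / 2, 0] (by simp [cell]; norm_num) !₂[-1 / 4, -1 / 2, 0]
    (by simp [cell]; norm_num), c5 !₂[-1 / 4, 1 / 2, 2] (by simp [cell]; norm_num)
    !₂[-1 / 2, 1 / 4, 2] (by simp [cell]; norm_num), ← b2,
    c3 !₂[-1 / 2, -1 / 4, 2] (by simp [cell]; norm_num) !₂[-1 / 4, -1 / 2, 2]
    (by simp [cell]; norm_num)] at b3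
  rw [c3 !₂[-1 / 2, -1 / 4, 2] (by simp [cell]; norm_num) !₂[-1 / 4, -1 / 2, 2]
    (by simp [cell]; norm_num)] at b2
  rw [b3, b1, b2]
  simp only [mem_modelBox, abs_lt] at hx
  rw [mem_region_iff] at hxR
  refine ⟨fun h h' => c1 _ ⟨⟨hx.1.1, h⟩, hx.2.1, hxR.1, h'⟩ _ ?_,
    fun h h' => c2 _ ⟨hx.1, ⟨hx.2.1.1, h⟩, h', hxR.2.1⟩ _ ?_,
    fun h h' g g' => c3 _ ⟨⟨hx.1.1, h⟩, ⟨hx.2.1.1, h'⟩, g, g'⟩ _ ?_,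
    fun h h' g => c4 _ ⟨⟨h, hx.1.2⟩, ⟨hx.2.1.1, h'⟩, hxR.1, g⟩ _ ?_,
    fun h h' g => c5 _ ⟨⟨hx.1.1, h⟩, ⟨h', hx.2.1.2⟩, g, hxR.2.1⟩ _ ?_,
    fun h h' => c6 _ ⟨⟨h, hx.1.2⟩, ⟨h', hx.2.1.2⟩, hxR.1, hxR.2.1⟩ _ ?_⟩ <;>
  simp [cell] <;> norm_num

end Existence

end

noncomputable section

/-! ### Assembly of existence and uniqueness. -/

section Main

variable {V : Type*} [TopologicalSpace V] [ChartedSpace R3 V] [IsManifold (𝓡 3) ∞ V]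
  {B : Type*} [TopologicalSpace B] {N : BranchedNbhd V B} {k k' : LocalModel}
  {e f : OpenPartialHomeomorph V R3} {b c : B} {o : OrientedAtlas V} {ξ ξ' ξ₀ ζ : PlaneField V}
  {w : N.Regular → ℤ} {S S' : Set V} {x y : R3}

/-- The weights of the sheets of a chart are given by a step function of the height. -/
theorem exists_heights (o : OrientedAtlas V) (hw : N.IsWeight w) (hnonneg : ∀ b, 0 ≤ w b)
    (hbd : ∀ b : N.Regular, (b : B) ∈ N.boundary → w b = 0) (he : N.IsChart k e c) :
    ∃ m₁ m₂ m₃ : ℤ, 0 ≤ m₁ ∧ 0 ≤ m₂ ∧ 0 ≤ m₃ ∧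
      (k = .bdryDisk ∨ k = .bdryBranch → m₁ = 0 ∧ m₂ = 0 ∧ m₃ = 0) ∧
      ∀ x ∈ modelBox, x ∈ k.region → RegularAt N e x → (chartWeight w e x : ℝ) =
        stepSum m₁ m₂ m₃ (segTop k x) - stepSum m₁ m₂ m₃ (segBot k x) := by
  have hn : ∀ x, 0 ≤ chartWeight w e x := fun x => chartWeight_nonneg hnonneg
  -- By `exists_generic` it is enough to check the formula off the coordinate planes, where the
  -- sheets are separated by signs and heights.
  have hgen : ∀ m₁ m₂ m₃ : ℤ, (∀ x ∈ modelBox, x ∈ k.region → x 0 ≠ 0 → x 1 ≠ 0 →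
      (chartWeight w e x : ℝ) =
        stepSum m₁ m₂ m₃ (segTop k x) - stepSum m₁ m₂ m₃ (segBot k x)) →
      ∀ x ∈ modelBox, x ∈ k.region → RegularAt N e x → (chartWeight w e x : ℝ) =
        stepSum m₁ m₂ m₃ (segTop k x) - stepSum m₁ m₂ m₃ (segBot k x) := by
    intro m₁ m₂ m₃ h x hx hxR hr
    obtain ⟨y, hy, hyR, h0, h1, h2, h3, h4⟩ := exists_generic o hw.locConst he hx hxR hr
    rw [h2, h3, h4]
    exact h y hy hyR h0 h1
  have v0 : ∀ m₁ m₂ m₃ : ℤ, stepSum m₁ m₂ m₃ 0 = 0 := fun _ _ _ => stepSum_of_nonpos le_rfl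
  have v1 : ∀ m₁ m₂ m₃ : ℤ, stepSum m₁ m₂ m₃ 1 = m₁ := fun _ _ _ =>
    stepSum_of_mem_one_two le_rfl (by norm_num)
  have v2 : ∀ m₁ m₂ m₃ : ℤ, stepSum m₁ m₂ m₃ 2 = m₁ := fun _ _ _ =>
    stepSum_of_mem_one_two (by norm_num) le_rfl
  have v3 : ∀ m₁ m₂ m₃ : ℤ, stepSum m₁ m₂ m₃ 3 = m₁ + m₂ := fun _ _ _ =>
    stepSum_of_mem_three_four le_rfl (by norm_num)
  have v4 : ∀ m₁ m₂ m₃ : ℤ, stepSum m₁ m₂ m₃ 4 = m₁ + m₂ := fun _ _ _ =>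
    stepSum_of_mem_three_four (by norm_num) le_rfl
  have v5 : ∀ m₁ m₂ m₃ : ℤ, stepSum m₁ m₂ m₃ 5 = m₁ + m₂ + m₃ := fun _ _ _ =>
    stepSum_of_five_le le_rfl
  cases k with
  | disk =>
    refine ⟨chartWeight w e 0, 0, 0, hn _, le_rfl, le_rfl, by simp, hgen _ _ _ ?_⟩
    intro x hx hxR _ _
    rw [disk_weights o hw he hx hxR]
    simp [segTop, segBot, v0, v5]
  | bdryDisk =>
    refine ⟨0, 0, 0, le_rfl, le_rfl, le_rfl, by simp, hgen _ _ _ ?_⟩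
    intro x hx hxR _ _
    rw [bdryDisk_weights o hw hbd he hx hxR]
    simp [stepSum_zero]
  | bdryBranch =>
    refine ⟨0, 0, 0, le_rfl, le_rfl, le_rfl, by simp, hgen _ _ _ ?_⟩
    intro x hx hxR h0 _
    rw [bdryBranch_weights o hw hbd he hx hxR h0]
    simp [stepSum_zero]
  | branch =>
    refine ⟨chartWeight w e !₂[-1 / 2, 0, 0], chartWeight w e !₂[-1 / 2, 0, 2], 0, hn _, hn _, le_rfl,
      by simp, hgen _ _ _ ?_⟩
    intro x hx hxR h0 _
    obtain ⟨a1, a2, a3⟩ := branch_weights o hw he hx hxR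
    rw [mem_region_iff] at hxR
    rcases lt_or_gt_of_ne h0 with h | h
    · rcases hxR.2.2.1 (Or.inl rfl) h with h' | h'
      · have h2 : ¬ 2 ≤ x 2 := by linarith
        rw [a1 h h']
        simp [segTop, segBot, h, h', h2, v0, v1]
      · have h2 : ¬ x 2 ≤ 1 := by linarith
        rw [a2 h h']
        simp [segTop, segBot, h, h', h2, v2, v5]
    · rw [a3 h]
      simp [segTop, segBot, h.not_gt, v0, v5]
  | double =>
    refine ⟨chartWeight w e !₂[-1 / 4, -1 / 2, 0], chartWeight w e !₂[-1 / 4, -1 / 2, 2],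
      chartWeight w e !₂[-1 / 2, -1 / 4, 4], hn _, hn _, hn _, by simp, hgen _ _ _ ?_⟩
    intro x hx hxR h0 h1
    obtain ⟨a1, a2, a3, a4, a5, a6⟩ := double_weights o hw he hx hxR
    rw [mem_region_iff] at hxR
    obtain ⟨-, -, r1, r2, -⟩ := hxR
    have r1 := r1 (Or.inr (Or.inl rfl))
    have r2 := r2 rfl
    rcases lt_or_gt_of_ne h0 with h | h <;> rcases lt_or_gt_of_ne h1 with g | g
    · rcases r1 h with h' | h'
      · have h2 : ¬ 2 ≤ x 2 := by linarith
        have h4 : ¬ 4 ≤ x 2 := by linarith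
        rw [a1 h h']
        simp [segTop, segBot, h, h', h2, h4, v0, v1]
      · have h2 : ¬ x 2 ≤ 1 := by linarith
        rcases r2 g with g' | g'
        · have h4 : ¬ 4 ≤ x 2 := by linarith
          rw [a3 h g h' g']
          simp [segTop, segBot, h, h', h2, g, g', h4, v2, v3]
        · have h4 : ¬ x 2 ≤ 3 := by linarith
          rw [a2 g g']
          simp [segTop, segBot, h2, g, g', h4, v4, v5]
    · rcases r1 h with h' | h'
      · have h2 : ¬ 2 ≤ x 2 := by linarith
        rw [a1 h h']
        simp [segTop, segBot, h, h', h2, g.not_gt, v0, v1]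
      · have h2 : ¬ x 2 ≤ 1 := by linarith
        rw [a5 h g h']
        simp [segTop, segBot, h, h', h2, g.not_gt, v2, v5]
        ring
    · rcases r2 g with g' | g'
      · have h4 : ¬ 4 ≤ x 2 := by linarith
        rw [a4 h g g']
        simp [segTop, segBot, h.not_gt, g, g', h4, v0, v3]
      · have h4 : ¬ x 2 ≤ 3 := by linarith
        rw [a2 g g']
        simp [segTop, segBot, h.not_gt, g, g', h4, v4, v5]
    · rw [a6 h g]
      simp [segTop, segBot, h.not_gt, g.not_gt, v0, v5]
      ring

theorem exists_isSolution [T2Space V] [CompactSpace V] (h : N.Generates o ζ ξ₀) (hw : N.IsWeight w)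
    (hnonneg : ∀ b, 0 ≤ w b) (hbd : ∀ b : N.Regular, (b : B) ∈ N.boundary → w b = 0) :
    ∃ ξ, N.IsSolution o ζ ξ₀ w univ ξ := by
  refine exists_isSolution_univ (isSolution_compl h) fun k e c he => ?_
  obtain ⟨m₁, m₂, m₃, h1, h2, h3, h4, h5⟩ := exists_heights o hw hnonneg hbd he
  refine exists_local_solution h he contDiff_stepSum (monotone_stepSum h1 h2 h3)
    (fun x _ hxR => exists_int_stepSum hxR h4) (exists_int_stepSum_ends k) fun p hp hb => ?_
  rw [← chartWeight_map (w := w) hp hb]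
  refine h5 _ (he.map_mem_modelBox hp) ((he.mem_iff _ hp).1 p.2) ?_
  have h6 : (⟨e.symm (e p), by rw [e.left_inv hp]; exact p.2⟩ : N.carrier) = p :=
    Subtype.ext (e.left_inv hp)
  exact ⟨by rw [e.left_inv hp]; exact p.2, by rw [h6]; exact hb⟩

/-- Fields that agree off the neighborhood agree along the boundary fibers. -/
theorem eq_of_bdryDisk (h : N.Generates o ζ ξ) (h' : N.Generates o ζ ξ') (hf : N.IsChart .bdryDisk f b)
    (hfp : o.IsPositive f) {q : N.carrier} (hq : N.proj q = b) : ξ q = ξ' q := by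
  obtain ⟨hqs, h0, h1⟩ := (IsModelChart.proj_eq_iff hf q).1 hq
  have hl := h.isLocalField hf (Or.inl rfl) (chartSign_one_iff.2 hfp)
  have hl' := h'.isLocalField hf (Or.inl rfl) (chartSign_one_iff.2 hfp)
  have hqb := hf.map_mem_modelBox hqs
  have key : rep f ξ (f q) = rep f ξ' (f q) := by
    -- A boundary point is a limit of points outside `N` with negative `x 1`, where both structures
    -- equal `ζ`; continuity of the representatives concludes.
    set u : ℝ → R3 := fun t => f q - t • stdVec 1 with hu
    have huc : Continuous u := by fun_prop
    have hu0 : u 0 = f q := by simp [hu]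
    have hev : ∀ᶠ t in 𝓝[>] (0 : ℝ), rep f ξ (u t) = rep f ξ' (u t) := by
      have hb : ∀ᶠ t in 𝓝[>] (0 : ℝ), u t ∈ modelBox :=
        (huc.continuousAt.eventually (isOpen_modelBox.mem_nhds (hu0 ▸ hqb))).filter_mono
          nhdsWithin_le_nhds
      filter_upwards [hb, self_mem_nhdsWithin] with t ht ht0
      have hR : u t ∉ LocalModel.bdryDisk.region := by
        rw [mem_region_iff]
        rintro ⟨-, -, -, -, h2⟩
        have h3 := h2 (Or.inl rfl)
        have h4 : u t 1 = f q 1 - t := by simp [hu, stdVec]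
        rw [h4, h1] at h3
        have : (0 : ℝ) < t := ht0
        linarith
      have hN : f.symm (u t) ∉ N.carrier := fun hN => hR ((hf.symm_mem_iff ht).1 hN)
      rw [rep_eq_iff hf.smooth (hf.target_eq ▸ ht), h.agree _ hN, h'.agree _ hN]
    have hc : ∀ {v : R3 → R3}, IsLocalField .bdryDisk 1 modelBox v →
        Filter.Tendsto (fun t => v (u t)) (𝓝[>] 0) (𝓝 (v (f q))) := by
      intro v hv
      have h2 : ContinuousAt v (u 0) := by rw [hu0]; exact (hv.smooth _ hqb).continuousAt
      have h3 : ContinuousAt (fun t => v (u t)) 0 := ContinuousAt.comp h2 huc.continuousAt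
      have h4 := h3.tendsto
      simp only [hu0] at h4
      exact h4.mono_left nhdsWithin_le_nhds
    exact tendsto_nhds_unique (hc hl) ((hc hl').congr' (hev.mono fun _ h => h.symm))
  rwa [rep_eq_iff hf.smooth (f.map_source hqs), f.left_inv hqs] at key

theorem BranchedNbhd.IsSolution.generates (h : N.IsSolution o ζ ξ₀ w univ ξ) :
    N.Generates o ζ ξ where
  contact := isContactOn_iff.2 h.contact
  legendrian := fibersLegendrian_iff.2 h.legendrian
  agree := h.agree

/-- For half disk charts, absent from the definition of a solution, `ξ` and `ξ₀` coincide along the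
boundary fiber, so the twisting numbers are equal; this is consistent because the weight is zero
there. -/
theorem BranchedNbhd.IsSolution.hasWeight (h : N.IsSolution o ζ ξ₀ w univ ξ)
    (h₀ : N.Generates o ζ ξ₀) (hbd : ∀ b : N.Regular, (b : B) ∈ N.boundary → w b = 0) :
    N.HasWeight o ξ₀ ξ w := by
  rintro ⟨b, hb⟩ f (hf | hf) hfp
  · obtain ⟨p, rfl⟩ := N.isQuotientMap.surjective b
    exact h.weight p (mem_univ _) hb f hf hfp
  · obtain ⟨τ, hτ⟩ := h₀.exists_hasTwisting hf hfp
    refine ⟨τ, τ, hτ, HasTwisting.congr_fiber hf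
      (fun q hq => eq_of_bdryDisk h₀ h.generates hf hfp hq) hτ, ?_⟩
    rw [hbd ⟨b, hb⟩ ⟨f, Or.inl hf⟩]
    simp

end Main

end

theorem mainTheorem11 {V : Type*} [TopologicalSpace V] [T2Space V] [CompactSpace V]
    [ChartedSpace R3 V] [IsManifold (𝓡 3) ∞ V] (o : OrientedAtlas V)
    {B : Type*} [TopologicalSpace B] (N : BranchedNbhd V B)
    (ζ ξ₀ : PlaneField V) (hζ : IsContactOn o ζ N.carrierᶜ) (hξ₀ : N.Generates o ζ ξ₀)
    (w : N.Regular → ℤ) (hw : N.IsWeight w) (hnonneg : ∀ b, 0 ≤ w b) :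
    ((∀ b : N.Regular, (b : B) ∈ N.boundary → w b = 0) →
      ∃ ξ : PlaneField V, N.Generates o ζ ξ ∧ N.HasWeight o ξ₀ ξ w) ∧
    (∀ ξ ξ' : PlaneField V, N.Generates o ζ ξ → N.HasWeight o ξ₀ ξ w →
      N.Generates o ζ ξ' → N.HasWeight o ξ₀ ξ' w →
      IsotopicRel N.carrierᶜ ξ ξ') := by
  refine ⟨fun hbd => ?_, fun ξ ξ' h hw' h' hw'' => (h.isSolution hw').isotopicRel (h'.isSolution hw'')⟩
  obtain ⟨ξ, h⟩ := exists_isSolution hξ₀ hw hnonneg hbd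
  exact ⟨ξ, h.generates, h.hasWeight hξ₀ hbd⟩
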